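/- **Theorem (Stable Manifold).** Let $M$ be a compact connected smooth Riemannian manifold (without boundary) with distance $d$ and exponential map $\exp$, and let $f$ be a $C^1$ diffeomorphism of $M$. Let $\Lambda\subset M$ satisfy $f(\Lambda)=\Lambda$ and carry a dominated splitting $T_\Lambda M=E^{cu}\oplus E^{cs}$, that is, a $Df$-invariant splitting for which there is $n\ge 1$ with $\|Df^m(x)v\|>2\|Df^m(x)w\|$ for all $m\ge n$, $x\in\Lambda$ and unit vectors $v\in E^{cu}_x$, $w\in E^{cs}_x$. Let $\mathcal C^{cu},\mathcal C^{cs}$ be continuous fields of open cones over an open neighborhood $U$ of $\overline\Lambda$ such that for $x\in\Lambda$ the cone $\mathcal C^{cu}_x$ contains $E^{cu}_x$ and is transverse to $E^{cs}_x$, the cone $\mathcal C^{cs}_x$ contains $E^{cs}_x$ and is transverse to $E^{cu}_x$, and such that $\overline{Df(x)(\mathcal C^{cu}_x)}\subset\mathcal C^{cu}_{f(x)}$ and $\overline{Df(x)^{-1}(\mathcal C^{cs}_{f(x)})}\subset\mathcal C^{cs}_x$ whenever $x,f(x)\in U$ (cones contain $0$, and "open" refers to nonzero vectors). For a diffeomorphism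 $g$, an invariant set $\Lambda'$ with a dominated splitting $E^{cu}\oplus E^{cs}$, and an integer $\ell\ge1$, let $\mathrm{Bl}^s(\ell,g)$ be the set of $x\in\Lambda'$ with $$\frac1n\sum_{j=0}^{n-1}\log\big\|Dg^\ell(g^{\ell j}x)|E^{cs}\big\|<-1\quad\text{for every } n\ge1,$$ and let $W^s(x)=\{y\in M:\ \limsup_{n\to+\infty}\frac1n\log d(g^ny,g^nx)<0\}$. A *center-stable disk* of radius $r$ around $x$ is an embedded $C^1$ disk $D\subset U$ of the form $D=\{\exp_x(v+\phi(v)):\ v\in E^{cs}_x,\ \|v\|<r\}$, where $\phi$ is a $C^1$ map from the ball of radius $r$ around $0$ in $E^{cs}_x$ to $E^{cu}_x$ with $\phi(0)=0$, such that $T_yD\subset\mathcal C^{cs}_y$ for every $y\in D$ and $T_xD=E^{cs}_x$. Then for every sufficiently small open neighborhood $V\subset U$ of $\overline\Lambda$ and every $\ell\ge1$ there is $r>0$ such that the following hold. 1. For every $x\in\mathrm{Bl}^s(\ell,f)\subset\Lambda$, the set $W^s(x)$ contains a center-stable disk of radius $r$ around $x$. 2. The same $r$ works for all $g$ in a $C^1$-neighborhood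 (depending on $\ell$) of $f$: the maximal $g$-invariant subset of $V$ has a dominated splitting for $g$ contained in the cone fields $\mathcal C^{cu},\mathcal C^{cs}$, and for any such splitting and every $x$ in the corresponding block $\mathrm{Bl}^s(\ell,g)$ inside this maximal invariant subset, the stable set $W^s(x)$ of $x$ under $g$ contains a center-stable disk of radius $r$ around $x$. -/

import Mathlib

open Set Filter Topology Manifold Bundle
open scoped ContDiff ENNReal

noncomputable section

namespace DomPesin

/-! Throughout, `M` is a (boundaryless) manifold modelled on `ℝ^d`, with a Riemannian metric on its
tangent bundle. -/

/-! ### The `C^1` topology -/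

section C1

variable {d : ℕ} {M : Type*} [TopologicalSpace M] [ChartedSpace (EuclideanSpace ℝ (Fin d)) M]
  [IsManifold (𝓡 d) ∞ M]

/-- The tangent map `Tf : TM → TM` of a `C^1` diffeomorphism, as a continuous map. -/
def tangentCMap (f : M ≃ₘ^1⟮𝓡 d, 𝓡 d⟯ M) :
    C(TangentBundle (𝓡 d) M, TangentBundle (𝓡 d) M) :=
  ⟨tangentMap (𝓡 d) (𝓡 d) f, f.contMDiff.continuous_tangentMap le_rfl⟩

/-- The `C^1` topology on `Diff^1(M)`: the topology of uniform convergence on compact subsets of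
`TM` of the tangent maps. -/
abbrev c1Topology : TopologicalSpace (M ≃ₘ^1⟮𝓡 d, 𝓡 d⟯ M) :=
  TopologicalSpace.induced tangentCMap inferInstance

/-- The filter of `C^1`-neighbourhoods of `f` in `Diff^1(M)`. -/
def c1Nhds (f : M ≃ₘ^1⟮𝓡 d, 𝓡 d⟯ M) : Filter (M ≃ₘ^1⟮𝓡 d, 𝓡 d⟯ M) :=
  @nhds _ c1Topology f

/-- The maximal `g`-invariant subset of `V`: the points whose full orbit stays in `V`. -/
def maxInvariant (g : M ≃ₘ^1⟮𝓡 d, 𝓡 d⟯ M) (V : Set M) : Set M :=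
  {x | ∀ n : ℕ, g^[n] x ∈ V ∧ g.symm^[n] x ∈ V}

/-! ### Cone fields -/

/-- `C` is a continuous field of open cones over `U`: each `C x` is invariant under scalars (so it
contains `0`), the set of nonzero vectors in the cones is open in `TM`, and, over `U`, limits of
vectors in the cones lie in the closures of the cones. -/
structure IsConeField (U : Set M) (C : ∀ x : M, Set (TangentSpace (𝓡 d) x)) : Prop where
  zero_mem : ∀ x ∈ U, (0 : TangentSpace (𝓡 d) x) ∈ C x
  smul_mem : ∀ x ∈ U, ∀ (c : ℝ), ∀ v ∈ C x, c • v ∈ C x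
  isOpen : IsOpen {p : TangentBundle (𝓡 d) M | p.proj ∈ U ∧ p.snd ∈ C p.proj ∧ p.snd ≠ 0}
  mem_closure : ∀ p : TangentBundle (𝓡 d) M, p.proj ∈ U →
    p ∈ closure {q : TangentBundle (𝓡 d) M | q.proj ∈ U ∧ q.snd ∈ C q.proj} →
    p.snd ∈ closure (C p.proj)

/-- The cone fields `Ccu`, `Ccs` over `U` are strictly invariant under `f`, respectively under
`f⁻¹`, at all points of `U` that are mapped inside `U`. -/
structure StrictlyInvariant (f : M → M) (U : Set M)
    (Ccu Ccs : ∀ x : M, Set (TangentSpace (𝓡 d) x)) : Prop where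
  cu : ∀ x ∈ U, f x ∈ U → closure (mfderiv (𝓡 d) (𝓡 d) f x '' Ccu x) ⊆ Ccu (f x)
  cs : ∀ x ∈ U, f x ∈ U → closure (mfderiv (𝓡 d) (𝓡 d) f x ⁻¹' Ccs (f x)) ⊆ Ccs x

/-- The splitting `Ecu ⊕ Ecs` over `S` is contained in the cones `Ccu`, `Ccs`. -/
def Subordinate (S : Set M) (Ecu Ecs : ∀ x : M, Submodule ℝ (TangentSpace (𝓡 d) x))
    (Ccu Ccs : ∀ x : M, Set (TangentSpace (𝓡 d) x)) : Prop :=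
  ∀ x ∈ S, (Ecu x : Set (TangentSpace (𝓡 d) x)) ⊆ Ccu x ∧
    (Ecs x : Set (TangentSpace (𝓡 d) x)) ⊆ Ccs x

/-- `Ccu` is transverse to `Ecs` and `Ccs` is transverse to `Ecu` over `S`. -/
def ConesTransverse (S : Set M) (Ecu Ecs : ∀ x : M, Submodule ℝ (TangentSpace (𝓡 d) x))
    (Ccu Ccs : ∀ x : M, Set (TangentSpace (𝓡 d) x)) : Prop :=
  ∀ x ∈ S, (∀ v ∈ Ccu x, v ∈ Ecs x → v = 0) ∧ (∀ v ∈ Ccs x, v ∈ Ecu x → v = 0)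

end C1

section Riemannian

variable {d : ℕ} {M : Type*} [MetricSpace M] [ChartedSpace (EuclideanSpace ℝ (Fin d)) M]
  [IsManifold (𝓡 d) ∞ M] [RiemannianBundle (fun x : M => TangentSpace (𝓡 d) x)]

/-! ### Dominated splittings -/

/-- `Ecu ⊕ Ecs` is a dominated splitting for `f` over the invariant set `S` (with `Ecu`
dominating). -/
structure IsDominatedSplitting (f : M → M) (S : Set M)
    (Ecu Ecs : ∀ x : M, Submodule ℝ (TangentSpace (𝓡 d) x)) : Prop where
  isCompl : ∀ x ∈ S, IsCompl (Ecu x) (Ecs x)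
  map_cu : ∀ x ∈ S, (Ecu x).map (mfderiv (𝓡 d) (𝓡 d) f x).toLinearMap = Ecu (f x)
  map_cs : ∀ x ∈ S, (Ecs x).map (mfderiv (𝓡 d) (𝓡 d) f x).toLinearMap = Ecs (f x)
  dominated : ∃ n : ℕ, 1 ≤ n ∧ ∀ m ≥ n, ∀ x ∈ S, ∀ v ∈ Ecu x, ∀ w ∈ Ecs x, ‖v‖ = 1 → ‖w‖ = 1 →
    2 * ‖mfderiv (𝓡 d) (𝓡 d) f^[m] x w‖ < ‖mfderiv (𝓡 d) (𝓡 d) f^[m] x v‖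

/-! ### Stable sets and stable blocks

Logarithms take values in `[-∞, ∞]`, with `log 0 = -∞`. -/

/-- The Pesin stable set of `x`. -/
def stableSet (f : M → M) (x : M) : Set M :=
  {y | limsup (fun n : ℕ => ENNReal.log (edist (f^[n] y) (f^[n] x)) / (n : EReal)) atTop < 0}

/-- The operator norm of the restriction of `D(f^l)(x)` to `E`. -/
def normRestrict (f : M → M) (l : ℕ) (x : M) (E : Submodule ℝ (TangentSpace (𝓡 d) x)) : ℝ≥0∞ :=
  ‖(mfderiv (𝓡 d) (𝓡 d) f^[l] x).comp E.subtypeL‖ₑ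

/-- The stable Pesin block `Bl^s(l, f)` in the invariant set `S`. -/
def stableBlock (f : M → M) (S : Set M) (Ecs : ∀ x : M, Submodule ℝ (TangentSpace (𝓡 d) x))
    (l : ℕ) : Set M :=
  {x | x ∈ S ∧ ∀ n : ℕ, 1 ≤ n →
    (∑ j ∈ Finset.range n, ENNReal.log (normRestrict f l (f^[l * j] x) (Ecs (f^[l * j] x))))
      / (n : EReal) < -1}

/-! ### Geodesics and the exponential map -/

/-- The Riemannian metric in the chart around `x₀`, at the point `u` of the image of the chart. -/
def chartMetric (x₀ : M) (u a b : EuclideanSpace ℝ (Fin d)) : ℝ :=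
  inner ℝ
    (mfderiv (𝓡 d) (𝓡 d) (extChartAt (𝓡 d) x₀).symm u a :
      TangentSpace (𝓡 d) ((extChartAt (𝓡 d) x₀).symm u))
    (mfderiv (𝓡 d) (𝓡 d) (extChartAt (𝓡 d) x₀).symm u b :
      TangentSpace (𝓡 d) ((extChartAt (𝓡 d) x₀).symm u))

variable (d) in
/-- A geodesic `γ : ℝ → M` of the Riemannian metric: a smooth curve satisfying, in charts, the
geodesic equation, in the form of the Euler-Lagrange equation
`d/dt G(c)(c', w) = (1/2) (∂_w G)(c)(c', c')` of the energy (for all constant vectors `w`). -/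
structure IsGeodesic (γ : ℝ → M) : Prop where
  contMDiff : ContMDiff 𝓘(ℝ, ℝ) (𝓡 d) ∞ γ
  equation : ∀ (x₀ : M) (t : ℝ), γ t ∈ (extChartAt (𝓡 d) x₀).source →
    ∀ w : EuclideanSpace ℝ (Fin d),
      HasDerivAt
        (fun s => chartMetric x₀ (extChartAt (𝓡 d) x₀ (γ s))
          (deriv (fun τ => extChartAt (𝓡 d) x₀ (γ τ)) s) w)
        (1 / 2 * fderiv ℝ
          (fun u => chartMetric x₀ u (deriv (fun τ => extChartAt (𝓡 d) x₀ (γ τ)) t)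
            (deriv (fun τ => extChartAt (𝓡 d) x₀ (γ τ)) t))
          (extChartAt (𝓡 d) x₀ (γ t)) w) t

/-- The geodesic `γ` has initial point `x` and initial velocity `v`. -/
def IsGeodesicFrom (x : M) (v : TangentSpace (𝓡 d) x) (γ : ℝ → M) : Prop :=
  IsGeodesic d γ ∧
    (⟨γ 0, mfderiv 𝓘(ℝ, ℝ) (𝓡 d) γ 0 (1 : ℝ)⟩ : TangentBundle (𝓡 d) M) = ⟨x, v⟩

open Classical in
/-- The exponential map `exp_x : T_x M → M` of a complete Riemannian manifold. -/
def expMap (x : M) (v : TangentSpace (𝓡 d) x) : M :=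
  if h : ∃ γ : ℝ → M, IsGeodesicFrom x v γ then h.choose 1 else x

/-! ### Center-stable disks -/

/-- `D` is a center-stable disk of radius `r` around `x`, with respect to the splitting
`Ecu ⊕ Ecs` at `x` and the cone field `Ccs` over `U`: it is an embedded `C^1` disk, the image under
`exp_x` of the graph of a `C^1` map `φ` from the ball of radius `r` of `Ecs x` to `Ecu x`, it passes
through `x`, its tangent spaces lie in the cones and its tangent space at `x` is `Ecs x`. -/
def IsCenterStableDisk (U : Set M) (Ccs : ∀ x : M, Set (TangentSpace (𝓡 d) x))
    (Ecu Ecs : ∀ x : M, Submodule ℝ (TangentSpace (𝓡 d) x)) (x : M) (r : ℝ) (D : Set M) : Prop :=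
  ∃ (φ : Ecs x → Ecu x) (ψ : Ecs x → M),
    (∀ v, ψ v = expMap x ((v : TangentSpace (𝓡 d) x) + (φ v : TangentSpace (𝓡 d) x))) ∧
    D = ψ '' Metric.ball 0 r ∧
    ContDiffOn ℝ 1 φ (Metric.ball 0 r) ∧ φ 0 = 0 ∧ ψ 0 = x ∧
    ContMDiffOn 𝓘(ℝ, Ecs x) (𝓡 d) 1 ψ (Metric.ball 0 r) ∧
    IsEmbedding ((Metric.ball 0 r).domRestrict ψ) ∧
    (∀ v ∈ Metric.ball (0 : Ecs x) r,
      Function.Injective (mfderiv 𝓘(ℝ, Ecs x) (𝓡 d) ψ v) ∧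
      ψ v ∈ U ∧ Set.range (mfderiv 𝓘(ℝ, Ecs x) (𝓡 d) ψ v) ⊆ Ccs (ψ v)) ∧
    Set.range (fun w : Ecs x =>
        (⟨ψ 0, mfderiv 𝓘(ℝ, Ecs x) (𝓡 d) ψ 0 w⟩ : TangentBundle (𝓡 d) M)) =
      Set.range (fun w : Ecs x => (⟨x, w⟩ : TangentBundle (𝓡 d) M))

end Riemannian

end DomPesin

end

set_option linter.unusedSectionVars false

noncomputable section

namespace DomPesin

/-! ### Calculus in spaces of bounded functions -/

section Calculus

open Metric BoundedContinuousFunction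

variable {T : Type*} [TopologicalSpace T] {B W X Y : Type*}
  [NormedAddCommGroup B] [NormedSpace ℝ B] [NormedAddCommGroup W] [NormedSpace ℝ W]
  [NormedAddCommGroup X] [NormedSpace ℝ X] [NormedAddCommGroup Y] [NormedSpace ℝ Y]

/-! Along the orbit of a block point a power g^N contracts `Ecs` only on average, and `Ecu` need not
expand at all. Once N is so large that domination has set in, however, each step still separates the
two bundles by a factor 19/10. Let b k bound the norm of g^N on `Ecs` at step k, and divide the k-th
coordinates by the weight ∏_{i<k} (4/3) b i. The rescaled maps contract `Ecs` by 3/4 and expand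
`Ecu` by at least (19/10)(3/4) > 4/3, so they form a uniformly hyperbolic sequence. The block
condition is what makes the weights at most 2^{-k}. Hence the rescaled coordinates, taken in a fixed
ball, correspond to points that stay in the ball of the original coordinates on which g^N is
C^1-close to its linear part; uniform continuity of the derivative suffices, and no Hölder condition
enters. Bounded orbits of the rescaled sequence are orbits of g asymptotic to that of x at an
exponential rate (`exists_weighted_stable_graph`).

For a uniformly hyperbolic sequence G_k the stable graph comes from Perron's method
(`exists_stable_graph`). The bounded sequences with z_{k+1} = G_k(z_k) and first component v at time
0 are the solutions of z - F(z) = S v in a space of bounded sequences, where F reads the contracted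
component forwards and the expanded one backwards. F is a C^1 contraction, so the inverse of id - F
gives the graph together with its smoothness, and the linearized equation gives its slope.

The radius depends on g only through an angle constant, a domination time, the margin δ by which
all-time stable vectors are inside the cones, and moduli of continuity. The first three come from
the cones by compactness. Over the closure of Λ, the vectors whose forward orbit stays in `Ccs` are
exactly the limits of `Ecs`, since a component along `Ecu` would outgrow the rest
(`ConeSplitting.mem_limSub_iff`). If g is C^1-close to f and V is a small neighbourhood, a violation
of the angle or domination estimate by vectors that stay in the cones would produce, in the limit, a
violation for f; hence `ConeSplitting.eventually_adapted`. Every invariant splitting inside the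
cones inherits these constants (`Adapted.adaptedSplitting`), and one exists over the maximal
invariant set, as a limit of subspaces taken in the cones far along the orbit and transported back
(`Adapted.exists_isCompl`).

To present the disk as a graph under `expMap`, the geodesic equation is solved in charts and the
exponential map is shown to be C^1 and tangent to the identity (`exists_expMap_chart`). The
coordinates at time 0 are exponential, those at later times are translations in charts. Small radius
and small slope put the tangent spaces of the disk in the cones (`ChartFamily.graph_disk`). -/

theorem continuousAt_clm_of_norm_sub_le {B : Type*} [NormedAddCommGroup B] {f : B → X →L[ℝ] Y}
    {x : B}
    (h : ∀ η > 0, ∃ ε > 0, ∀ y ∈ ball x ε, ‖f y - f x‖ ≤ η) : ContinuousAt f x := by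
  refine Metric.continuousAt_iff'.2 fun η hη => ?_
  obtain ⟨ε, hε, H⟩ := h (η / 2) (by positivity)
  filter_upwards [ball_mem_nhds x hε] with y hy
  rw [dist_eq_norm]
  exact (H y hy).trans_lt (by linarith)

/-- A map into bounded functions whose components are equi-differentiable is differentiable. -/
theorem hasFDerivAt_bcf {F : B → T →ᵇ W} {D : T → B → B →L[ℝ] W} {F' : B →L[ℝ] T →ᵇ W}
    {x : B} {δ : ℝ} (hδ : 0 < δ)
    (hD : ∀ t, ∀ y ∈ ball x δ, HasFDerivAt (fun z => F z t) (D t y) y)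
    (hF' : ∀ h t, F' h t = D t x h)
    (hm : ∀ η > 0, ∃ ε > 0, ∀ t, ∀ y ∈ ball x ε, ‖D t y - D t x‖ ≤ η) :
    HasFDerivAt F F' x := by
  rw [hasFDerivAt_iff_isLittleO_nhds_zero, Asymptotics.isLittleO_iff]
  intro η hη
  obtain ⟨ε, hε, H⟩ := hm η hη
  filter_upwards [ball_mem_nhds (0 : B) (lt_min hε hδ)] with h hh
  have hh' : ‖h‖ < min ε δ := by simpa using hh
  refine (norm_le (by positivity)).2 fun t => ?_
  -- The radius does not depend on t, so the mean value inequality bounds all components at once,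
  -- hence the sup norm.
  have key := (convex_ball x (min ε δ)).norm_image_sub_le_of_norm_hasFDerivWithin_le'
    (f := fun z => F z t) (f' := D t) (φ := D t x) (C := η) (x := x) (y := x + h)
    (fun y hy => (hD t y (ball_subset_ball (min_le_right _ _) hy)).hasFDerivWithinAt)
    (fun y hy => H t y (ball_subset_ball (min_le_left _ _) hy))
    (mem_ball_self (lt_min hε hδ)) (by simpa using hh')
  simpa [hF'] using key

theorem norm_sub_le_bcf {F' F'' : B →L[ℝ] T →ᵇ W} {D D' : T → B →L[ℝ] W} {η : ℝ} (hη : 0 ≤ η)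
    (hF' : ∀ h t, F' h t = D t h) (hF'' : ∀ h t, F'' h t = D' t h)
    (h : ∀ t, ‖D t - D' t‖ ≤ η) : ‖F' - F''‖ ≤ η := by
  refine ContinuousLinearMap.opNorm_le_bound _ hη fun u => (norm_le (by positivity)).2 fun t => ?_
  have : (F' - F'') u t = (D t - D' t) u := by simp [hF', hF'']
  rw [this]
  exact ((D t - D' t).le_opNorm u).trans (by gcongr; exact h t)

/-- The bounded linear map into bounded functions on a discrete space with given components. -/
def bcfLift [DiscreteTopology T] (D : T → B →L[ℝ] W) (C : ℝ) (h : ∀ t u, ‖D t u‖ ≤ C * ‖u‖) :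
    B →L[ℝ] T →ᵇ W :=
  LinearMap.mkContinuousOfExistsBound
    { toFun := fun u => BoundedContinuousFunction.ofNormedAddCommGroup (fun t => D t u)
        continuous_of_discreteTopology (C * ‖u‖) fun t => h t u
      map_add' := fun u v => by ext t; simp
      map_smul' := fun c u => by ext t; simp }
    ⟨max C 0, fun u => (norm_le (by positivity)).2 fun t => (h t u).trans (by gcongr; simp)⟩

@[simp] theorem bcfLift_apply [DiscreteTopology T] (D : T → B →L[ℝ] W) (C : ℝ)
    (h : ∀ t u, ‖D t u‖ ≤ C * ‖u‖) (u : B) (t : T) : bcfLift D C h u t = D t u := rfl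

/-- Quantitative inverse function theorem for perturbations of the identity. -/
theorem exists_inverse_id_sub [CompleteSpace X] {F : X → X} {D : X → X →L[ℝ] X} {x₀ : X}
    {R c : ℝ} (hc0 : 0 ≤ c) (hc1 : c < 1)
    (hD : ∀ z ∈ ball x₀ R, HasFDerivAt F (D z) z) (hDc : ContinuousOn D (ball x₀ R))
    (hb : ∀ z ∈ ball x₀ R, ‖D z‖ ≤ c) :
    ∃ J : X → X, (∀ y ∈ ball (x₀ - F x₀) ((1 - c) * R), J y ∈ ball x₀ R ∧ J y - F (J y) = y) ∧
      (∀ z ∈ ball x₀ R, J (z - F z) = z) ∧ ContDiffOn ℝ 1 J (ball (x₀ - F x₀) ((1 - c) * R)) ∧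
      ∀ y ∈ ball (x₀ - F x₀) ((1 - c) * R), ∀ u,
        fderiv ℝ J y u - D (J y) (fderiv ℝ J y u) = u := by
  lift c to NNReal using hc0
  have hΦ : ApproximatesLinearOn (fun z => z - F z)
      ((ContinuousLinearEquiv.refl ℝ X : X ≃L[ℝ] X) : X →L[ℝ] X) (ball x₀ R) c := by
    intro x hx y hy
    have := (convex_ball x₀ R).norm_image_sub_le_of_norm_hasFDerivWithin_le
      (fun z hz => (hD z hz).hasFDerivWithinAt) hb hx hy
    have e : x - F x - (y - F y) - ((ContinuousLinearEquiv.refl ℝ X : X ≃L[ℝ] X) : X →L[ℝ] X)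
      (x - y) = F y - F x := by simp; abel
    rw [e]
    simpa [norm_sub_rev] using this
  have hcN : Subsingleton X ∨
      c < ‖(((ContinuousLinearEquiv.refl ℝ X).symm : X ≃L[ℝ] X) : X →L[ℝ] X)‖₊⁻¹ := by
    rcases subsingleton_or_nontrivial X with h | h
    · exact Or.inl h
    · right
      have : ‖(((ContinuousLinearEquiv.refl ℝ X).symm : X ≃L[ℝ] X) : X →L[ℝ] X)‖₊ = 1 := by
        ext; simp
      rw [this]; simpa using hc1
  set e := hΦ.toOpenPartialHomeomorph _ _ hcN isOpen_ball with he
  have hes : e.source = ball x₀ R := rfl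
  have hecoe : ∀ z, e z = z - F z := fun z => rfl
  have htarget : ball (x₀ - F x₀) ((1 - c) * R) ⊆ e.target := by
    intro y hy
    have hR : 0 < (1 - (c : ℝ)) * R := pos_of_mem_ball hy
    have hc' : 0 < 1 - (c : ℝ) := by linarith
    -- Surjectivity is available on closed balls only; an intermediate s gives a closed ball of
    -- radius s/(1-c) < R that still reaches y.
    obtain ⟨s, hs1, hs2⟩ := exists_between (mem_ball.1 hy)
    let ri : (((ContinuousLinearEquiv.refl ℝ X : X ≃L[ℝ] X) : X →L[ℝ] X)).NonlinearRightInverse :=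
      ⟨id, 1, fun y => by simp, fun y => rfl⟩
    have h0 : 0 ≤ s / (1 - c) := div_nonneg (dist_nonneg.trans hs1.le) hc'.le
    have hlt : s / (1 - c) < R := by rw [div_lt_iff₀ hc']; linarith
    obtain ⟨z, hz, hzy⟩ := hΦ.surjOn_closedBall_of_nonlinearRightInverse ri h0
      (closedBall_subset_ball hlt) (show y ∈ _ by
        rw [mem_closedBall]
        refine hs1.le.trans (le_of_eq ?_)
        simp only [ri, NNReal.coe_one, inv_one]
        field_simp)
    exact ⟨z, closedBall_subset_ball hlt hz, hzy⟩
  have hsym : ∀ y ∈ e.target, e.symm y ∈ ball x₀ R ∧ e.symm y - F (e.symm y) = y :=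
    fun y hy => ⟨e.map_target hy, e.right_inv hy⟩
  have hderiv : ∀ z ∈ ball x₀ R, HasFDerivAt e (ContinuousLinearMap.id ℝ X - D z) z :=
    fun z hz => (hasFDerivAt_id z).sub (hD z hz)
  have hCD : ContDiffOn ℝ 1 e (ball x₀ R) := by
    have h1 : DifferentiableOn ℝ e (ball x₀ R) :=
      fun z hz => (hderiv z hz).differentiableAt.differentiableWithinAt
    have h2 : ContinuousOn (fderiv ℝ e) (ball x₀ R) :=
      (continuousOn_const.sub hDc).congr fun z hz => (hderiv z hz).fderiv
    exact (contDiffOn_succ_iff_fderiv_of_isOpen (n := 0) isOpen_ball).2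
      ⟨h1, by simp, contDiffOn_zero.2 h2⟩
  have hJ : ∀ y ∈ e.target, ContDiffAt ℝ 1 e.symm y := by
    intro y hy
    have hz := e.map_target hy
    have hu : IsUnit (1 - D (e.symm y)) := by
      apply isUnit_one_sub_of_norm_lt_one
      exact (hb _ hz).trans_lt hc1
    obtain ⟨w, hw⟩ := hu
    refine e.contDiffAt_symm (f₀' := ContinuousLinearEquiv.ofUnit w) hy ?_
      (hCD.contDiffAt (isOpen_ball.mem_nhds hz))
    convert! hderiv _ hz using 1
  refine ⟨e.symm, fun y hy => hsym y (htarget hy), fun z hz => e.left_inv hz,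
    fun y hy => (hJ y (htarget hy)).contDiffWithinAt, fun y hy u => ?_⟩
  have hd := ((hJ y (htarget hy)).differentiableAt one_ne_zero).hasFDerivAt
  have hcomp := (hderiv _ (hsym y (htarget hy)).1).comp y hd
  have hid : HasFDerivAt (e ∘ e.symm) (ContinuousLinearMap.id ℝ X) y :=
    (hasFDerivAt_id y).congr_of_eventuallyEq (by
      filter_upwards [e.open_target.mem_nhds (htarget hy)] with w hw using e.right_inv hw)
  simpa using congrArg (fun L : X →L[ℝ] X => L u) (hcomp.unique hid)

end Calculus

/-! ### A stable manifold theorem for sequences of maps -/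

section HadamardPerron

open Metric BoundedContinuousFunction

variable {X Y : Type*} [NormedAddCommGroup X] [NormedSpace ℝ X]
  [NormedAddCommGroup Y] [NormedSpace ℝ Y]

/-- The components of the operator whose fixed points are the bounded orbits. -/
def orbitComp (G : ℕ → X × Y → X × Y) (d : ℕ → Y ≃L[ℝ] Y) (k : ℕ) (z : ℕ →ᵇ X × Y) : X × Y :=
  (Nat.rec 0 (fun j _ => (G j (z j)).1) k,
    (d k).symm ((z (k + 1)).2 - ((G k (z k)).2 - d k (z k).2)))

/-- The derivatives of the components of the operator whose fixed points are the bounded orbits. -/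
def orbitDeriv (DG : ℕ → X × Y → X × Y →L[ℝ] X × Y) (d : ℕ → Y ≃L[ℝ] Y) (k : ℕ)
    (z : ℕ →ᵇ X × Y) : (ℕ →ᵇ X × Y) →L[ℝ] X × Y :=
  ContinuousLinearMap.prod
    (Nat.rec 0 (fun j _ => (ContinuousLinearMap.fst ℝ X Y).comp ((DG j (z j)).comp
      (evalCLM ℝ j))) k)
    (((d k).symm : Y →L[ℝ] Y).comp ((ContinuousLinearMap.snd ℝ X Y).comp (evalCLM ℝ (k + 1)) -
      ((ContinuousLinearMap.snd ℝ X Y).comp ((DG k (z k)).comp (evalCLM ℝ k)) -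
        ((d k : Y →L[ℝ] Y).comp ((ContinuousLinearMap.snd ℝ X Y).comp (evalCLM ℝ k))))))

theorem orbitDeriv_apply_snd (DG : ℕ → X × Y → X × Y →L[ℝ] X × Y) (d : ℕ → Y ≃L[ℝ] Y) (k : ℕ)
    (z h : ℕ →ᵇ X × Y) : (orbitDeriv DG d k z h).2 =
      (d k).symm ((h (k + 1)).2 - ((DG k (z k) (h k)).2 - d k (h k).2)) := by
  simp [orbitDeriv]

theorem orbitDeriv_apply_fst_zero (DG : ℕ → X × Y → X × Y →L[ℝ] X × Y) (d : ℕ → Y ≃L[ℝ] Y)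
    (z h : ℕ →ᵇ X × Y) : (orbitDeriv DG d 0 z h).1 = 0 := by
  simp [orbitDeriv]

theorem orbitDeriv_apply_fst_succ (DG : ℕ → X × Y → X × Y →L[ℝ] X × Y) (d : ℕ → Y ≃L[ℝ] Y)
    (k : ℕ) (z h : ℕ →ᵇ X × Y) : (orbitDeriv DG d (k + 1) z h).1 = (DG k (z k) (h k)).1 := by
  simp [orbitDeriv]

theorem norm_apply_lt {X Y : Type*} [NormedAddCommGroup X] [NormedAddCommGroup Y] {z : ℕ →ᵇ X × Y} {ρ : ℝ} (hz : z ∈ ball (0 : ℕ →ᵇ X × Y) ρ) (k : ℕ) :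
    ‖z k‖ < ρ := (z.norm_coe_le_norm k).trans_lt (by simpa using hz)

theorem hasFDerivAt_orbitComp {G : ℕ → X × Y → X × Y} {DG : ℕ → X × Y → X × Y →L[ℝ] X × Y}
    (d : ℕ → Y ≃L[ℝ] Y) {ρ : ℝ} (hG : ∀ k z, ‖z‖ < ρ → HasFDerivAt (G k) (DG k z) z) (k : ℕ)
    {z : ℕ →ᵇ X × Y} (hz : z ∈ ball (0 : ℕ →ᵇ X × Y) ρ) :
    HasFDerivAt (orbitComp G d k) (orbitDeriv DG d k z) z := by
  have hev : ∀ j, HasFDerivAt (fun z : ℕ →ᵇ X × Y => z j) (evalCLM ℝ j) z :=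
    fun j => (evalCLM ℝ j : (ℕ →ᵇ X × Y) →L[ℝ] X × Y).hasFDerivAt
  have hGj : ∀ j, HasFDerivAt (fun z : ℕ →ᵇ X × Y => G j (z j)) ((DG j (z j)).comp (evalCLM ℝ j)) z :=
    fun j => (hG j (z j) (norm_apply_lt hz j)).comp z (hev j)
  refine HasFDerivAt.prodMk ?_ ?_
  · cases k with
    | zero => exact hasFDerivAt_const _ _
    | succ j => exact (hGj j).fst
  · exact ((d k).symm : Y →L[ℝ] Y).hasFDerivAt.comp z ((hev (k + 1)).snd.sub
      ((hGj k).snd.sub ((d k : Y →L[ℝ] Y).hasFDerivAt.comp z (hev k).snd)))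

variable [CompleteSpace X] [CompleteSpace Y]

/-- The stable manifold theorem for a sequence of uniformly hyperbolic maps. -/
theorem exists_stable_graph {G : ℕ → X × Y → X × Y} {DG : ℕ → X × Y → X × Y →L[ℝ] X × Y}
    (d : ℕ → Y ≃L[ℝ] Y) {ρ c c₁ c₂ : ℝ} (hρ : 0 < ρ) (hc1 : c < 1) (h1 : 0 ≤ c₁) (h2 : 0 ≤ c₂)
    (h12 : c₁ + c₂ ≤ c) (hG0 : ∀ k, G k 0 = 0)
    (hG : ∀ k z, ‖z‖ < ρ → HasFDerivAt (G k) (DG k z) z)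
    (hm : ∀ η > 0, ∃ δ > 0, ∀ k z z', ‖z‖ < ρ → ‖z'‖ < ρ → ‖z - z'‖ < δ →
      ‖DG k z - DG k z'‖ ≤ η)
    (hs : ∀ k z h, ‖z‖ < ρ → ‖(DG k z h).1‖ ≤ c * ‖h‖)
    (hd : ∀ k y, ‖(d k).symm y‖ ≤ c₁ * ‖y‖)
    (hu : ∀ k z h, ‖z‖ < ρ → ‖(d k).symm ((DG k z h).2 - d k h.2)‖ ≤ c₂ * ‖h‖)
    (h0 : ∀ k h, (DG k 0 h).2 = d k h.2) :
    ∃ (φ : X → Y) (z : X → ℕ → X × Y), φ 0 = 0 ∧ ContDiffOn ℝ 1 φ (ball 0 ((1 - c) * ρ)) ∧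
      fderiv ℝ φ 0 = 0 ∧
      ∀ v ∈ ball (0 : X) ((1 - c) * ρ), z v 0 = (v, φ v) ∧ (∀ k, z v (k + 1) = G k (z v k)) ∧
        (∀ k, ‖z v k‖ < ρ) ∧ ‖fderiv ℝ φ v‖ ≤ c₂ / ((1 - c₁) * (1 - c)) := by
  have hc0 : 0 ≤ c := by linarith
  have hc1' : 0 < 1 - c₁ := by linarith
  have hc' : 0 < 1 - c := by linarith
  -- In the operator the first component at time k is produced from time k-1, while the second is
  -- solved for from time k+1 through the inverse of d k. Both are contracting directions, and no
  -- condition is imposed on the second component at time 0: that component becomes φ.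
  set D := orbitDeriv DG d with hDdef
  have hDle : ∀ z ∈ ball (0 : ℕ →ᵇ X × Y) ρ, ∀ k h, ‖D k z h‖ ≤ c * ‖h‖ := by
    intro z hz k h
    have hk := fun j => norm_apply_lt hz j
    refine norm_prod_le_iff.2 ⟨?_, ?_⟩
    · cases k with
      | zero => rw [orbitDeriv_apply_fst_zero]; simp; positivity
      | succ j =>
        rw [orbitDeriv_apply_fst_succ]
        exact (hs j _ _ (hk j)).trans (by gcongr; exact h.norm_coe_le_norm j)
    · rw [orbitDeriv_apply_snd, map_sub]
      have a1 := hd k (h (k + 1)).2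
      have a2 := hu k (z k) (h k) (hk k)
      have b1 : ‖(h (k + 1)).2‖ ≤ ‖h‖ := (norm_snd_le _).trans (h.norm_coe_le_norm _)
      have b2 := h.norm_coe_le_norm k
      calc _ ≤ _ := norm_sub_le _ _
        _ ≤ c₁ * ‖h‖ + c₂ * ‖h‖ := add_le_add (a1.trans (by gcongr)) (a2.trans (by gcongr))
        _ = (c₁ + c₂) * ‖h‖ := by ring
        _ ≤ c * ‖h‖ := by gcongr
  have hcomp0 : ∀ k, orbitComp G d k 0 = 0 := by
    intro k
    cases k <;> simp [orbitComp, hG0]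
  have hcomple : ∀ z ∈ ball (0 : ℕ →ᵇ X × Y) ρ, ∀ k, ‖orbitComp G d k z‖ ≤ c * ‖z‖ := by
    intro z hz k
    have := (convex_ball (0 : ℕ →ᵇ X × Y) ρ).norm_image_sub_le_of_norm_hasFDerivWithin_le
      (fun y hy => (hasFDerivAt_orbitComp d hG k hy).hasFDerivWithinAt)
      (fun y hy => ContinuousLinearMap.opNorm_le_bound _ hc0 (hDle y hy k))
      (mem_ball_self hρ) hz
    simpa [hcomp0] using this
  classical
  -- Images are known to be bounded sequences only for z in the ball; the value 0 elsewhere is never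
  -- seen.
  let F : (ℕ →ᵇ X × Y) → (ℕ →ᵇ X × Y) := fun z =>
    if h : z ∈ ball (0 : ℕ →ᵇ X × Y) ρ then
      BoundedContinuousFunction.ofNormedAddCommGroup (fun k => orbitComp G d k z)
        continuous_of_discreteTopology (c * ‖z‖) (hcomple z h) else 0
  let D' : (ℕ →ᵇ X × Y) → (ℕ →ᵇ X × Y) →L[ℝ] (ℕ →ᵇ X × Y) := fun z =>
    if h : z ∈ ball (0 : ℕ →ᵇ X × Y) ρ then bcfLift (fun k => D k z) c (hDle z h) else 0
  have hFapp : ∀ z ∈ ball (0 : ℕ →ᵇ X × Y) ρ, ∀ k, F z k = orbitComp G d k z := by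
    intro z hz k; simp only [F, dif_pos hz]; rfl
  have hD'app : ∀ z ∈ ball (0 : ℕ →ᵇ X × Y) ρ, ∀ h k, D' z h k = D k z h := by
    intro z hz h k; simp only [D', dif_pos hz]; rfl
  have hD'le : ∀ z ∈ ball (0 : ℕ →ᵇ X × Y) ρ, ‖D' z‖ ≤ c := by
    intro z hz
    refine ContinuousLinearMap.opNorm_le_bound _ hc0 fun h =>
      (norm_le (by positivity)).2 fun k => ?_
    rw [hD'app z hz]; exact hDle z hz k h
  have hmod : ∀ x ∈ ball (0 : ℕ →ᵇ X × Y) ρ, ∀ η > 0, ∃ ε > 0, ∀ k, ∀ y ∈ ball x ε,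
      y ∈ ball (0 : ℕ →ᵇ X × Y) ρ ∧ ‖D k y - D k x‖ ≤ η := by
    intro x hx η hη
    obtain ⟨δ, hδ, H⟩ := hm η hη
    obtain ⟨ε, hε, hεb⟩ := Metric.isOpen_iff.1 isOpen_ball x hx
    refine ⟨min ε δ, lt_min hε hδ, fun k y hy => ?_⟩
    have hy0 := hεb (ball_subset_ball (min_le_left _ _) hy)
    refine ⟨hy0, ContinuousLinearMap.opNorm_le_bound _ hη.le fun h => ?_⟩
    have hdist : ∀ j, ‖y j - x j‖ < δ := fun j => by
      have := (y - x).norm_coe_le_norm j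
      have h' : ‖y - x‖ < δ := by
        rw [← dist_eq_norm]; exact (mem_ball.1 hy).trans_le (min_le_right _ _)
      exact this.trans_lt h'
    have hop : ∀ j, ‖(DG j (y j) - DG j (x j)) (h j)‖ ≤ η * ‖h‖ := fun j =>
      (ContinuousLinearMap.le_opNorm _ _).trans (mul_le_mul
        (H j _ _ (norm_apply_lt hy0 j) (norm_apply_lt hx j) (hdist j)) (h.norm_coe_le_norm j)
        (norm_nonneg _) hη.le)
    refine norm_prod_le_iff.2 ⟨?_, ?_⟩
    · rw [_root_.sub_apply, Prod.fst_sub]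
      cases k with
      | zero => rw [orbitDeriv_apply_fst_zero, orbitDeriv_apply_fst_zero]; simp; positivity
      | succ j =>
        rw [orbitDeriv_apply_fst_succ, orbitDeriv_apply_fst_succ]
        exact (norm_fst_le _).trans (hop j)
    · rw [_root_.sub_apply, Prod.snd_sub, orbitDeriv_apply_snd,
        orbitDeriv_apply_snd, ← map_sub]
      refine (hd k _).trans ?_
      have e : (h (k + 1)).2 - ((DG k (y k) (h k)).2 - d k (h k).2) -
        ((h (k + 1)).2 - ((DG k (x k) (h k)).2 - d k (h k).2)) =
          -((DG k (y k) - DG k (x k)) (h k)).2 := by simp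
      rw [e, norm_neg]
      calc c₁ * ‖((DG k (y k) - DG k (x k)) (h k)).2‖ ≤ 1 * (η * ‖h‖) :=
            mul_le_mul (by linarith) ((norm_snd_le _).trans (hop k)) (norm_nonneg _) zero_le_one
        _ = _ := one_mul _
  have hFD : ∀ z ∈ ball (0 : ℕ →ᵇ X × Y) ρ, HasFDerivAt F (D' z) z := by
    intro x hx
    obtain ⟨ε, hε, hεb⟩ := Metric.isOpen_iff.1 isOpen_ball x hx
    refine hasFDerivAt_bcf (D := D) hε (fun k y hy => ?_) (fun h k => hD'app x hx h k) ?_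
    · refine (hasFDerivAt_orbitComp d hG k (hεb hy)).congr_of_eventuallyEq ?_
      filter_upwards [isOpen_ball.mem_nhds (hεb hy)] with z hz using hFapp z hz k
    · intro η hη
      obtain ⟨ε, hε, H⟩ := hmod x hx η hη
      exact ⟨ε, hε, fun k y hy => (H k y hy).2⟩
  have hD'c : ContinuousOn D' (ball 0 ρ) := by
    intro x hx
    refine ContinuousAt.continuousWithinAt (continuousAt_clm_of_norm_sub_le fun η hη => ?_)
    obtain ⟨ε, hε, H⟩ := hmod x hx η hη
    refine ⟨ε, hε, fun y hy => norm_sub_le_bcf hη.le (fun h t => hD'app y (H 0 y hy).1 h t)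
      (fun h t => hD'app x hx h t) fun k => (H k y hy).2⟩
  obtain ⟨J, hJ1, hJ2, hJ3, hJ4⟩ := exists_inverse_id_sub hc0 hc1 hFD hD'c hD'le
  have hF0 : F 0 = 0 := by
    ext1 k
    rw [hFapp 0 (mem_ball_self hρ), hcomp0]; rfl
  rw [hF0, sub_zero] at hJ1 hJ3 hJ4
  -- The source term carries the initial datum v in the first component at time 0; z - F z = S v
  -- then says that z is an orbit starting over v.
  let S : X →L[ℝ] ℕ →ᵇ X × Y := bcfLift
    (fun k => if k = 0 then ContinuousLinearMap.inl ℝ X Y else 0) 1 (fun k u => by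
      split_ifs <;> simp)
  have hS0 : ∀ v, S v 0 = (v, 0) := fun v => by simp [S]
  have hSs : ∀ v k, S v (k + 1) = 0 := fun v k => by simp [S]
  have hSn : ∀ v, ‖S v‖ ≤ ‖v‖ := fun v => by
    refine (norm_le (by positivity)).2 fun k => ?_
    cases k with
    | zero => rw [hS0]; simp
    | succ k => rw [hSs]; simp
  have hSb : ∀ v ∈ ball (0 : X) ((1 - c) * ρ), S v ∈ ball (0 : ℕ →ᵇ X × Y) ((1 - c) * ρ) := by
    intro v hv
    rw [mem_ball_zero_iff] at hv ⊢
    exact (hSn v).trans_lt hv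
  have hpos : 0 < (1 - c) * ρ := by positivity
  let P : (ℕ →ᵇ X × Y) →L[ℝ] Y := (ContinuousLinearMap.snd ℝ X Y).comp (evalCLM ℝ 0)
  have hφC : ContDiffOn ℝ 1 (fun v => P (J (S v))) (ball 0 ((1 - c) * ρ)) :=
    P.contDiff.comp_contDiffOn (hJ3.comp S.contDiff.contDiffOn hSb)
  have hJ0 : J 0 = 0 := by
    have := hJ2 0 (mem_ball_self hρ)
    simpa [hF0] using this
  have hφd : ∀ v ∈ ball (0 : X) ((1 - c) * ρ),
      fderiv ℝ (fun v => P (J (S v))) v = P.comp ((fderiv ℝ J (S v)).comp S) := by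
    intro v hv
    have : HasFDerivAt J (fderiv ℝ J (S v)) (S v) :=
      ((hJ3.contDiffAt (isOpen_ball.mem_nhds (hSb v hv))).differentiableAt one_ne_zero).hasFDerivAt
    exact (P.hasFDerivAt.comp v (this.comp v S.hasFDerivAt)).fderiv
  -- bounds on solutions of the linearized equation
  have hlin : ∀ z ∈ ball (0 : ℕ →ᵇ X × Y) ρ, ∀ (e : ℝ), 0 ≤ e →
      (∀ k h, ‖(d k).symm ((DG k (z k) h).2 - d k h.2)‖ ≤ e * ‖h‖) →
      ∀ (w : ℕ →ᵇ X × Y) (u : X), w - D' z w = S u → ‖(w 0).2‖ ≤ e / ((1 - c₁) * (1 - c)) * ‖u‖ := by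
    intro z hz e he hze w u hw
    have hw' : ‖w‖ ≤ ‖u‖ / (1 - c) := by
      rw [le_div_iff₀ hc']
      have a : w = S u + D' z w := by rw [← hw]; abel
      have b : ‖w‖ ≤ ‖u‖ + c * ‖w‖ := by
        calc ‖w‖ = ‖S u + D' z w‖ := by rw [← a]
          _ ≤ ‖S u‖ + ‖D' z w‖ := norm_add_le _ _
          _ ≤ _ := add_le_add (hSn u) ((D' z).le_of_opNorm_le (hD'le z hz) w)
      linarith
    have hcomp : ∀ k, (w k).2 =
        (d k).symm (w (k + 1)).2 - (d k).symm ((DG k (z k) (w k)).2 - d k (w k).2) := by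
      intro k
      have h3 : (w k - D' z w k).2 = 0 := by
        have := congrArg (fun f : ℕ →ᵇ X × Y => (f k).2) hw
        cases k with
        | zero => simpa [hS0] using this
        | succ k => simpa [hSs] using this
      rw [hD'app z hz, Prod.snd_sub, orbitDeriv_apply_snd, sub_eq_zero] at h3
      conv_lhs => rw [h3, map_sub]
    have hbdd : BddAbove (Set.range fun k => ‖(w k).2‖) :=
      ⟨‖w‖, by rintro _ ⟨k, rfl⟩; exact (norm_snd_le _).trans (w.norm_coe_le_norm k)⟩
    -- The second components satisfy a backward recursion with contraction c₁ and forcing e‖w‖, so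
    -- their supremum absorbs itself. With e = 0 at the zero orbit this gives tangency, with e = c₂
    -- the slope bound.
    have hsup : (⨆ k, ‖(w k).2‖) ≤ c₁ * (⨆ k, ‖(w k).2‖) + e * ‖w‖ := by
      refine ciSup_le fun k => ?_
      rw [hcomp k]
      refine (norm_sub_le _ _).trans (add_le_add ((hd k _).trans ?_) ((hze k _).trans ?_))
      · gcongr; exact le_ciSup hbdd (k + 1)
      · gcongr; exact w.norm_coe_le_norm k
    have h4 : (⨆ k, ‖(w k).2‖) ≤ e * ‖w‖ / (1 - c₁) := by
      rw [le_div_iff₀ hc1']; linarith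
    calc ‖(w 0).2‖ ≤ ⨆ k, ‖(w k).2‖ := le_ciSup hbdd 0
      _ ≤ e * ‖w‖ / (1 - c₁) := h4
      _ ≤ e * (‖u‖ / (1 - c)) / (1 - c₁) := by gcongr
      _ = _ := by field_simp
  have hlinJ : ∀ v ∈ ball (0 : X) ((1 - c) * ρ), ∀ u,
      fderiv ℝ J (S v) (S u) - D' (J (S v)) (fderiv ℝ J (S v) (S u)) = S u :=
    fun v hv u => hJ4 _ (hSb v hv) _
  refine ⟨fun v => P (J (S v)), fun v => J (S v), by simp [hJ0], hφC, ?_, fun v hv => ?_⟩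
  · rw [hφd 0 (mem_ball_self hpos)]
    ext u
    have := hlin 0 (mem_ball_self hρ) 0 le_rfl (fun k h => by simp [h0]) _ u
      (by simpa [hJ0] using hlinJ 0 (mem_ball_self hpos) u)
    simpa [P] using this
  · obtain ⟨hb, he⟩ := hJ1 _ (hSb v hv)
    have hcomp : ∀ k, J (S v) k = S v k + orbitComp G d k (J (S v)) := by
      intro k
      rw [← hFapp _ hb]
      conv_rhs => rw [← he]
      rw [he]
      have := congrArg (fun f : ℕ →ᵇ X × Y => f k) he
      simp only [BoundedContinuousFunction.coe_sub, Pi.sub_apply] at this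
      rw [← this]; abel
    refine ⟨?_, fun k => ?_, fun k => norm_apply_lt hb k, ?_⟩
    · refine Prod.ext ?_ rfl
      change (J (S v) 0).1 = v
      rw [hcomp 0, hS0]
      simp [orbitComp]
    · refine Prod.ext ?_ ?_
      · change (J (S v) (k + 1)).1 = (G k (J (S v) k)).1
        rw [hcomp (k + 1), hSs]
        simp [orbitComp]
      · have h5 : (J (S v) k).2 = (orbitComp G d k (J (S v))).2 := by
          conv_lhs => rw [hcomp k]
          cases k with
          | zero => simp [hS0]
          | succ k => simp [hSs]
        have h6 := congrArg (d k) h5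
        simp only [orbitComp, ContinuousLinearEquiv.apply_symm_apply] at h6
        have h7 : (J (S v) (k + 1)).2 = d k (J (S v) k).2 + ((G k (J (S v) k)).2 - d k (J (S v) k).2) := by
          nth_rewrite 1 [h6]; abel
        rw [h7]; abel
    · rw [hφd v hv]
      refine ContinuousLinearMap.opNorm_le_bound _ (by positivity) fun u => ?_
      exact hlin _ hb c₂ h2 (fun k h => hu k _ h (norm_apply_lt hb k)) _ u (hlinJ v hv u)

end HadamardPerron

/-! ### Local flows of `C^1` vector fields -/

section Flow

open Metric BoundedContinuousFunction

variable {Y : Type*} [NormedAddCommGroup Y] [NormedSpace ℝ Y]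

theorem neg_one_le_one : (-1 : ℝ) ≤ 1 := by norm_num

/-- Time is rescaled to the fixed interval [-1, 1], so that Picard's operator acts on one Banach
space and the length ε of the time interval becomes a small factor. The projection `projIcc` only
extends integrands to the line and does not change the integrals. -/
theorem exists_smul_primitive {ε : ℝ} (hε : 0 < ε) :
    ∃ A : (Icc (-1 : ℝ) 1 →ᵇ Y) →L[ℝ] (Icc (-1 : ℝ) 1 →ᵇ Y),
      (∀ γ t, A γ t = ε • ∫ s in (0 : ℝ)..t, γ (projIcc (-1) 1 neg_one_le_one s)) ∧ ‖A‖ ≤ ε := by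
  have hc : ∀ γ : Icc (-1 : ℝ) 1 →ᵇ Y,
      Continuous fun s : ℝ => γ (projIcc (-1) 1 neg_one_le_one s) :=
    fun γ => γ.continuous.comp continuous_projIcc
  have hn : ∀ (γ : Icc (-1 : ℝ) 1 →ᵇ Y) (t : Icc (-1 : ℝ) 1),
      ‖ε • ∫ s in (0 : ℝ)..t, γ (projIcc (-1) 1 neg_one_le_one s)‖ ≤ ε * ‖γ‖ := by
    intro γ t
    have h1 := intervalIntegral.norm_integral_le_of_norm_le_const (a := 0) (b := (t : ℝ))
      (f := fun s => γ (projIcc (-1) 1 neg_one_le_one s)) (C := ‖γ‖)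
      (fun s _ => γ.norm_coe_le_norm _)
    have h2 : |(t : ℝ) - 0| ≤ 1 := by rw [sub_zero]; exact abs_le.2 t.2
    rw [norm_smul, Real.norm_of_nonneg hε.le]
    gcongr
    calc _ ≤ ‖γ‖ * |(t : ℝ) - 0| := h1
      _ ≤ ‖γ‖ * 1 := by gcongr
      _ = ‖γ‖ := mul_one _
  let A : (Icc (-1 : ℝ) 1 →ᵇ Y) →ₗ[ℝ] (Icc (-1 : ℝ) 1 →ᵇ Y) :=
    { toFun := fun γ => mkOfCompact ⟨fun t =>
          ε • ∫ s in (0 : ℝ)..t, γ (projIcc (-1) 1 neg_one_le_one s),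
        ((intervalIntegral.continuous_primitive (fun a b => (hc γ).intervalIntegrable a b)
          0).comp continuous_subtype_val).const_smul ε⟩
      map_add' := fun γ γ' => by
        ext t
        change ε • ∫ s in (0 : ℝ)..t, (γ (projIcc (-1) 1 neg_one_le_one s) +
          γ' (projIcc (-1) 1 neg_one_le_one s)) = _
        rw [intervalIntegral.integral_add ((hc γ).intervalIntegrable _ _)
          ((hc γ').intervalIntegrable _ _), smul_add]
        rfl
      map_smul' := fun c γ => by
        ext t
        change ε • ∫ s in (0 : ℝ)..t, c • γ (projIcc (-1) 1 neg_one_le_one s) = _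
        rw [intervalIntegral.integral_smul, smul_comm]
        rfl }
  exact ⟨A.mkContinuous ε fun γ => (norm_le (mul_nonneg hε.le (norm_nonneg γ))).2 (hn γ),
    fun γ t => rfl, LinearMap.mkContinuous_norm_le _ hε.le _⟩

open Classical in
/-- Composition with `F`, on functions on a compact space. -/
def compOp {T Y : Type*} [TopologicalSpace T] [CompactSpace T] [NormedAddCommGroup Y] (F : Y → Y) (γ : T →ᵇ Y) : T →ᵇ Y :=
  if h : Continuous fun t => F (γ t) then mkOfCompact ⟨fun t => F (γ t), h⟩ else 0

theorem compOp_apply {T Y : Type*} [TopologicalSpace T] [CompactSpace T] [NormedAddCommGroup Y]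
    {F : Y → Y} {γ : T →ᵇ Y}
    (h : Continuous fun t => F (γ t)) (t : T) : compOp F γ t = F (γ t) := by
  simp only [compOp, dif_pos h]; rfl

/-- The derivative at γ is multiplication by F'(γ(t)). Uniformity in t comes from the compactness of
the range of γ, around which F' is uniformly continuous; thus F of class C^1 is enough. -/
theorem exists_hasFDerivAt_compOp {T : Type*} [TopologicalSpace T] [CompactSpace T] [Nonempty T]
    {F : Y → Y} {y₀ : Y} {R L : ℝ}
    (hF : ∀ y ∈ ball y₀ R, DifferentiableAt ℝ F y) (hF' : ContinuousOn (fderiv ℝ F) (ball y₀ R))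
    (hL : ∀ y ∈ ball y₀ R, ‖fderiv ℝ F y‖ ≤ L) :
    ∃ D : (T →ᵇ Y) → (T →ᵇ Y) →L[ℝ] T →ᵇ Y, (∀ γ ∈ ball (const T y₀) R,
      HasFDerivAt (compOp F) (D γ) γ ∧ ‖D γ‖ ≤ L) ∧ ContinuousOn D (ball (const T y₀) R) := by
  classical
  have hmem : ∀ γ ∈ ball (const T y₀) R, ∀ t, γ t ∈ ball y₀ R := fun γ hγ t =>
    (dist_coe_le_dist (f := γ) (g := const T y₀) t).trans_lt hγ
  have hcont : ∀ γ ∈ ball (const T y₀) R, Continuous fun t => F (γ t) := fun γ hγ =>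
    continuous_iff_continuousAt.2 fun t =>
      ContinuousAt.comp (f := γ) (hF _ (hmem γ hγ t)).continuousAt γ.continuous.continuousAt
  have hcont' : ∀ γ ∈ ball (const T y₀) R, Continuous fun t => fderiv ℝ F (γ t) := fun γ hγ =>
    continuous_iff_continuousAt.2 fun t =>
      ContinuousAt.comp (f := γ) (hF'.continuousAt (isOpen_ball.mem_nhds (hmem γ hγ t)))
        γ.continuous.continuousAt
  have hDex : ∀ γ : T →ᵇ Y, γ ∈ ball (const T y₀) R → ∃ D : (T →ᵇ Y) →L[ℝ] T →ᵇ Y,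
      (∀ h t, D h t = fderiv ℝ F (γ t) (h t)) ∧ ‖D‖ ≤ L := by
    intro γ hγ
    have hL0 : 0 ≤ L := (norm_nonneg _).trans (hL _ (hmem γ hγ (Classical.arbitrary T)))
    refine ⟨LinearMap.mkContinuous
      { toFun := fun h => mkOfCompact ⟨fun t => fderiv ℝ F (γ t) (h t),
          (hcont' γ hγ).clm_apply h.continuous⟩
        map_add' := fun h h' => by ext t; simp
        map_smul' := fun c h => by ext t; simp } L (fun h => (norm_le (by positivity)).2 fun t =>
          ((fderiv ℝ F (γ t)).le_opNorm _).trans (mul_le_mul (hL _ (hmem γ hγ t))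
            (h.norm_coe_le_norm t) (norm_nonneg _) hL0)), fun h t => rfl,
      LinearMap.mkContinuous_norm_le _ hL0 _⟩
  choose! D hD using hDex
  have hmod : ∀ γ ∈ ball (const T y₀) R, ∀ η > 0, ∃ ε > 0, ∀ t, ∀ γ' ∈ ball γ ε,
      γ' ∈ ball (const T y₀) R ∧ ‖fderiv ℝ F (γ' t) - fderiv ℝ F (γ t)‖ ≤ η := by
    intro γ hγ η hη
    have hK : IsCompact (Set.range γ) := isCompact_range γ.continuous
    have hu := hK.uniformContinuousAt_of_continuousAt (fderiv ℝ F)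
      (by rintro _ ⟨t, rfl⟩; exact hF'.continuousAt (isOpen_ball.mem_nhds (hmem γ hγ t)))
      (Metric.dist_mem_uniformity hη)
    obtain ⟨ε, hε, H⟩ := Metric.mem_uniformity_dist.1 hu
    obtain ⟨ε', hε', H'⟩ := Metric.isOpen_iff.1 isOpen_ball γ hγ
    refine ⟨min ε ε', lt_min hε hε', fun t γ' hγ' =>
      ⟨H' (ball_subset_ball (min_le_right _ _) hγ'), ?_⟩⟩
    have hd : dist (γ t) (γ' t) < ε := by
      rw [dist_comm]
      exact (dist_coe_le_dist t).trans_lt (hγ'.trans_le (min_le_left _ _))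
    have := H hd (mem_range_self t)
    rw [← dist_eq_norm, dist_comm]
    exact le_of_lt this
  refine ⟨D, fun γ hγ => ⟨?_, (hD γ hγ).2⟩, fun γ hγ => ?_⟩
  · obtain ⟨ε, hε, H⟩ := Metric.isOpen_iff.1 isOpen_ball γ hγ
    let Dt : T → (T →ᵇ Y) → (T →ᵇ Y) →L[ℝ] Y := fun t γ => (fderiv ℝ F (γ t)).comp (evalCLM ℝ t)
    refine hasFDerivAt_bcf (x := γ) (D := Dt) hε
      (fun t γ' hγ' => ?_) (fun h t => (hD γ hγ).1 h t) ?_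
    · have h1 : HasFDerivAt (fun γ : T →ᵇ Y => F (γ t))
          ((fderiv ℝ F (γ' t)).comp (evalCLM ℝ t)) γ' :=
        (hF _ (hmem γ' (H hγ') t)).hasFDerivAt.comp γ'
          (evalCLM ℝ t : (T →ᵇ Y) →L[ℝ] Y).hasFDerivAt
      refine h1.congr_of_eventuallyEq ?_
      filter_upwards [isOpen_ball.mem_nhds (H hγ')] with z hz using compOp_apply (hcont z hz) t
    · intro η hη
      obtain ⟨ε, hε, H⟩ := hmod γ hγ η hη
      refine ⟨ε, hε, fun t y hy => ContinuousLinearMap.opNorm_le_bound _ hη.le fun h => ?_⟩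
      exact (ContinuousLinearMap.le_opNorm (fderiv ℝ F (y t) - fderiv ℝ F (γ t)) (h t)).trans
        (mul_le_mul (H t y hy).2 (h.norm_coe_le_norm t) (norm_nonneg _) hη.le)
  · refine ContinuousAt.continuousWithinAt (continuousAt_clm_of_norm_sub_le fun η hη => ?_)
    obtain ⟨ε, hε, H⟩ := hmod γ hγ η hη
    refine ⟨ε, hε, fun y hy => ContinuousLinearMap.opNorm_le_bound _ hη.le fun h =>
      (norm_le (by positivity)).2 fun t => ?_⟩
    have e : (D y - D γ) h t = (fderiv ℝ F (y t) - fderiv ℝ F (γ t)) (h t) := by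
      simp [(hD y (H t y hy).1).1, (hD γ hγ).1]
    rw [e]
    exact (ContinuousLinearMap.le_opNorm _ _).trans
        (mul_le_mul (H t y hy).2 (h.norm_coe_le_norm t) (norm_nonneg _) hη.le)

variable [CompleteSpace Y]

/-- A `C^1` vector field has a local flow, which is `C^1` in the initial condition. -/
theorem exists_local_flow {F : Y → Y} {y₀ : Y} (hF : ContDiffAt ℝ 1 F y₀) {N : Set Y}
    (hN : N ∈ 𝓝 y₀) :
    ∃ ε > 0, ∃ σ : Y → ℝ → Y, (∀ᶠ y in 𝓝 y₀, σ y 0 = y ∧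
      ∀ t ∈ Ioo (-ε) ε, HasDerivAt (σ y) (F (σ y t)) t ∧ σ y t ∈ N) ∧
      ∀ t, ContDiffAt ℝ 1 (fun y => σ y t) y₀ := by
  obtain ⟨u, hu, hFu⟩ := hF.contDiffOn le_rfl (by simp)
  obtain ⟨R₁, hR₁, hb₁⟩ := Metric.mem_nhds_iff.1 (inter_mem hu hN)
  have hF1 : ContDiffOn ℝ 1 F (ball y₀ R₁) := hFu.mono fun y hy => (hb₁ hy).1
  have hF1' := (contDiffOn_succ_iff_fderiv_of_isOpen (n := 0) isOpen_ball).1 hF1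
  have hFc : ContinuousOn (fderiv ℝ F) (ball y₀ R₁) := hF1'.2.2.continuousOn
  have hnorm : ContinuousAt (fun y => ‖fderiv ℝ F y‖) y₀ :=
    (hFc.continuousAt (ball_mem_nhds _ hR₁)).norm
  set L : ℝ := ‖fderiv ℝ F y₀‖ + 1 with hLdef
  have hL0 : 0 < L := by positivity
  obtain ⟨R₂, hR₂, hb₂⟩ := Metric.mem_nhds_iff.1
    (hnorm.eventually (gt_mem_nhds (show ‖fderiv ℝ F y₀‖ < L by rw [hLdef]; linarith)))
  set R := min R₁ R₂ with hRdef
  have hR : 0 < R := lt_min hR₁ hR₂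
  have hsub : ball y₀ R ⊆ ball y₀ R₁ := ball_subset_ball (min_le_left _ _)
  have hFd : ∀ y ∈ ball y₀ R, DifferentiableAt ℝ F y := fun y hy =>
    (hF1'.1 y (hsub hy)).differentiableAt (isOpen_ball.mem_nhds (hsub hy))
  have : Nonempty (Icc (-1 : ℝ) 1) := ⟨⟨0, by norm_num⟩⟩
  obtain ⟨D, hD1, hD2⟩ := exists_hasFDerivAt_compOp (T := Icc (-1 : ℝ) 1) hFd (hFc.mono hsub)
    (fun y hy => (hb₂ (ball_subset_ball (min_le_right _ _) hy)).le)
  -- The first bound makes Picard's operator a 1/2-contraction; the second moves the constant curve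
  -- y₀ by at most R/4, which leaves R/4 of the radius R/2 for the initial conditions.
  set ε : ℝ := min (1 / (2 * L)) (R / (4 * (‖F y₀‖ + 1))) with hεdef
  have hε : 0 < ε := lt_min (by positivity) (by positivity)
  have hεL : ε * L ≤ 1 / 2 := by
    calc ε * L ≤ 1 / (2 * L) * L := by gcongr; exact min_le_left _ _
      _ = 1 / 2 := by field_simp
  have hεF : ε * ‖F y₀‖ ≤ R / 4 := by
    calc ε * ‖F y₀‖ ≤ R / (4 * (‖F y₀‖ + 1)) * (‖F y₀‖ + 1) := by
          gcongr
          · exact min_le_right _ _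
          · linarith
      _ = R / 4 := by field_simp
  let cst : Y →L[ℝ] (Icc (-1 : ℝ) 1 →ᵇ Y) := LinearMap.mkContinuous
    { toFun := fun y => const _ y, map_add' := fun _ _ => rfl, map_smul' := fun _ _ => rfl } 1
    (fun y => (norm_le (by positivity)).2 fun t => by rw [one_mul]; exact le_rfl)
  have hcst : ∀ y t, cst y t = y := fun y t => rfl
  have hcst' : ∀ y, cst y = const _ y := fun y => rfl
  obtain ⟨A, hAe, hA⟩ := exists_smul_primitive (Y := Y) hε
  -- The integral curve from y solves γ - A(F ∘ γ) = y. Inverting id - A(F ∘ ·) gives existence, and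
  -- the smoothness of the inverse is the smooth dependence on y.
  obtain ⟨J, hJ1, -, hJ3, -⟩ := exists_inverse_id_sub (F := fun γ => A (compOp F γ))
    (D := fun γ => A.comp (D γ)) (x₀ := const (Icc (-1 : ℝ) 1) y₀) (R := R) (c := 1 / 2)
    (by norm_num) (by norm_num)
    (fun γ hγ => A.hasFDerivAt.comp γ (hD1 γ hγ).1)
    (continuousOn_const.clm_comp hD2)
    (fun γ hγ => (A.opNorm_comp_le _).trans ((mul_le_mul hA (hD1 γ hγ).2 (norm_nonneg _)
      hε.le).trans hεL))
  set x₁ := const (Icc (-1 : ℝ) 1) y₀ - A (compOp F (const (Icc (-1 : ℝ) 1) y₀)) with hx₁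
  have hconst : ‖compOp F (const (Icc (-1 : ℝ) 1) y₀)‖ ≤ ‖F y₀‖ := by
    refine (norm_le (by positivity)).2 fun t => ?_
    rw [compOp_apply (by simpa using continuous_const)]
    simp
  have hin : ∀ y ∈ ball y₀ (R / 4), cst y ∈ ball x₁ ((1 - 1 / 2) * R) := by
    intro y hy
    rw [mem_ball, dist_eq_norm] at hy ⊢
    have e : cst y - x₁ = cst (y - y₀) + A (compOp F (const (Icc (-1 : ℝ) 1) y₀)) := by
      rw [hx₁, map_sub, hcst' y₀]; abel
    rw [e]
    have h1 : ‖cst (y - y₀)‖ ≤ ‖y - y₀‖ := (norm_le (by positivity)).2 fun t => by rw [hcst]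
    have h2 : ‖A (compOp F (const (Icc (-1 : ℝ) 1) y₀))‖ ≤ ε * ‖F y₀‖ :=
      (A.le_opNorm _).trans (mul_le_mul hA hconst (norm_nonneg _) hε.le)
    calc _ ≤ _ := norm_add_le _ _
      _ ≤ ‖y - y₀‖ + ε * ‖F y₀‖ := add_le_add h1 h2
      _ < R / 4 + R / 4 := by linarith
      _ = (1 - 1 / 2) * R := by ring
  have hσ0 : ∀ y ∈ ball y₀ (R / 4), ∀ s : Icc (-1 : ℝ) 1, J (cst y) s = y + ε • ∫ r in (0 : ℝ)..s,
      F (J (cst y) (projIcc (-1) 1 neg_one_le_one r)) := by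
    intro y hy s
    obtain ⟨h1, h2⟩ := hJ1 _ (hin y hy)
    have hc : Continuous fun t => F (J (cst y) t) :=
      continuous_iff_continuousAt.2 fun t => ContinuousAt.comp (f := J (cst y))
        (hFd _ ((dist_coe_le_dist t).trans_lt h1)).continuousAt (J (cst y)).continuous.continuousAt
    have h3 := congrArg (fun f : Icc (-1 : ℝ) 1 →ᵇ Y => f s) h2
    simp only [BoundedContinuousFunction.coe_sub, Pi.sub_apply] at h3
    rw [sub_eq_iff_eq_add, hcst] at h3
    rw [h3]
    congr 1
    rw [hAe]
    congr 2
    ext r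
    rw [compOp_apply hc]
  refine ⟨ε, hε, fun y t => J (cst y) (projIcc (-1) 1 neg_one_le_one (t / ε)), ?_, fun t => ?_⟩
  · filter_upwards [ball_mem_nhds y₀ (show 0 < R / 4 by positivity)] with y hy
    obtain ⟨h1, h2⟩ := hJ1 _ (hin y hy)
    have hc : Continuous fun t => F (J (cst y) t) :=
      continuous_iff_continuousAt.2 fun t => ContinuousAt.comp (f := J (cst y))
        (hFd _ ((dist_coe_le_dist t).trans_lt h1)).continuousAt (J (cst y)).continuous.continuousAt
    have hc' : Continuous fun r : ℝ => F (J (cst y) (projIcc (-1) 1 neg_one_le_one r)) :=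
      hc.comp continuous_projIcc
    refine ⟨?_, fun t ht => ⟨?_, ?_⟩⟩
    · have h0 : projIcc (-1 : ℝ) 1 neg_one_le_one (0 / ε) = ⟨0, by norm_num⟩ := by
        rw [zero_div]; exact projIcc_of_mem _ _
      simp only [h0]
      rw [hσ0 y hy]; simp
    · have hts : t / ε ∈ Ioo (-1 : ℝ) 1 := by
        constructor
        · rw [lt_div_iff₀ hε]; linarith [ht.1]
        · rw [div_lt_iff₀ hε]; linarith [ht.2]
      have hd1 : HasDerivAt (fun s : ℝ => y + ε • ∫ r in (0 : ℝ)..s,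
          F (J (cst y) (projIcc (-1) 1 neg_one_le_one r)))
          (ε • F (J (cst y) (projIcc (-1) 1 neg_one_le_one (t / ε)))) (t / ε) :=
        ((hc'.integral_hasStrictDerivAt 0 (t / ε)).hasDerivAt.const_smul ε).const_add y
      have hd2 : HasDerivAt (fun s : ℝ => J (cst y) (projIcc (-1) 1 neg_one_le_one s))
          (ε • F (J (cst y) (projIcc (-1) 1 neg_one_le_one (t / ε)))) (t / ε) := by
        refine hd1.congr_of_eventuallyEq ?_
        filter_upwards [Ioo_mem_nhds hts.1 hts.2] with s hs
        rw [hσ0 y hy, projIcc_of_mem _ (Ioo_subset_Icc_self hs)]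
      have hd3 := hd2.scomp t ((hasDerivAt_id t).div_const ε)
      have e : (1 / ε) • ε • F (J (cst y) (projIcc (-1) 1 neg_one_le_one (t / ε))) =
          F (J (cst y) (projIcc (-1) 1 neg_one_le_one (t / ε))) := by
        rw [smul_smul, one_div, inv_mul_cancel₀ hε.ne', one_smul]
      rw [e] at hd3
      exact hd3
    · exact (hb₁ (hsub ((dist_coe_le_dist _).trans_lt h1))).2
  · have h1 : ContDiffAt ℝ 1 J (cst y₀) :=
      hJ3.contDiffAt (isOpen_ball.mem_nhds (hin y₀ (mem_ball_self (by positivity))))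
    exact (evalCLM ℝ (projIcc (-1) 1 neg_one_le_one (t / ε)) :
      (Icc (-1 : ℝ) 1 →ᵇ Y) →L[ℝ] Y).contDiff.contDiffAt.comp y₀
        (h1.comp y₀ cst.contDiff.contDiffAt)

end Flow

/-! ### The tangent bundle in charts -/

section TangentBundle

variable {d : ℕ} {M : Type*} [MetricSpace M] [ChartedSpace (EuclideanSpace ℝ (Fin d)) M]

instance finiteDimensional_tangentSpace (x : M) : FiniteDimensional ℝ (TangentSpace (𝓡 d) x) :=
  inferInstanceAs (FiniteDimensional ℝ (EuclideanSpace ℝ (Fin d)))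

theorem finrank_tangentSpace (x : M) : Module.finrank ℝ (TangentSpace (𝓡 d) x) = d :=
  finrank_euclideanSpace_fin (𝕜 := ℝ) (n := d)

variable [IsManifold (𝓡 d) ∞ M]

/-- The derivative at `x` of the chart around `c`. -/
def chartD (c x : M) : TangentSpace (𝓡 d) x →L[ℝ] EuclideanSpace ℝ (Fin d) :=
  (trivializationAt (EuclideanSpace ℝ (Fin d)) (TangentSpace (𝓡 d)) c).continuousLinearMapAt ℝ x

/-- The inverse of the derivative at `x` of the chart around `c`. -/
def chartDInv (c x : M) : EuclideanSpace ℝ (Fin d) →L[ℝ] TangentSpace (𝓡 d) x :=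
  (trivializationAt (EuclideanSpace ℝ (Fin d)) (TangentSpace (𝓡 d)) c).symmL ℝ x

theorem chartDInv_chartD {c x : M} (hx : x ∈ (chartAt (EuclideanSpace ℝ (Fin d)) c).source)
    (v : TangentSpace (𝓡 d) x) : chartDInv c x (chartD c x v) = v :=
  Trivialization.symmL_continuousLinearMapAt _ (by simpa using hx) v

theorem chartD_chartDInv {c x : M} (hx : x ∈ (chartAt (EuclideanSpace ℝ (Fin d)) c).source)
    (v : EuclideanSpace ℝ (Fin d)) : chartD c x (chartDInv c x v) = v :=
  Trivialization.continuousLinearMapAt_symmL _ (by simpa using hx) v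

theorem chartD_eq_mfderiv {c x : M} (hx : x ∈ (chartAt (EuclideanSpace ℝ (Fin d)) c).source) :
    chartD c x = mfderiv (𝓡 d) 𝓘(ℝ, EuclideanSpace ℝ (Fin d)) (extChartAt (𝓡 d) c) x :=
  TangentBundle.continuousLinearMapAt_trivializationAt hx

theorem chartDInv_eq_mfderiv {c x : M} (hx : x ∈ (chartAt (EuclideanSpace ℝ (Fin d)) c).source) :
    chartDInv c x = mfderiv 𝓘(ℝ, EuclideanSpace ℝ (Fin d)) (𝓡 d) (extChartAt (𝓡 d) c).symm
      (extChartAt (𝓡 d) c x) := by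
  have h := TangentBundle.symmL_trivializationAt (I := 𝓡 d) hx
  have hr : range (𝓡 d) = univ := by simp
  rw [hr, mfderivWithin_univ] at h
  exact h

/-- Vectors in different fibres are compared through one chart around the limit base point; near it
`chartD` agrees with the fibre coordinate of the bundle trivialization. Limits in the tangent bundle
are computed this way throughout. -/
theorem tendsto_tangentBundle_iff {ι : Type*} {l : Filter ι} {F : ι → TangentBundle (𝓡 d) M}
    {p : TangentBundle (𝓡 d) M} {c : M}
    (hc : p.proj ∈ (chartAt (EuclideanSpace ℝ (Fin d)) c).source) :
    Tendsto F l (𝓝 p) ↔ Tendsto (fun i => (F i).proj) l (𝓝 p.proj) ∧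
      Tendsto (fun i => chartD c (F i).proj (F i).snd) l (𝓝 (chartD c p.proj p.snd)) := by
  have hp : p ∈ (trivializationAt (EuclideanSpace ℝ (Fin d)) (TangentSpace (𝓡 d)) c).source := by
    rw [TangentBundle.trivializationAt_source]; exact hc
  rw [Trivialization.tendsto_nhds_iff _ hp]
  refine and_congr_right fun hb => ?_
  have hopen := (chartAt (EuclideanSpace ℝ (Fin d)) c).open_source.mem_nhds hc
  have key : ∀ q : TangentBundle (𝓡 d) M,
      q.proj ∈ (chartAt (EuclideanSpace ℝ (Fin d)) c).source →
      chartD c q.proj q.snd =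
        (trivializationAt (EuclideanSpace ℝ (Fin d)) (TangentSpace (𝓡 d)) c q).2 := by
    intro q hq
    have := Trivialization.coe_linearMapAt_of_mem (R := ℝ)
      (trivializationAt (EuclideanSpace ℝ (Fin d)) (TangentSpace (𝓡 d)) c) (b := q.proj)
      (by simpa using hq)
    exact congrFun this q.snd
  rw [key p hc]
  refine tendsto_congr' ?_
  filter_upwards [hb hopen] with i hi using (key _ hi).symm

theorem mem_chart_self (x : M) : x ∈ (chartAt (EuclideanSpace ℝ (Fin d)) x).source :=
  mem_chart_source _ x

instance locallyCompact_tangentBundle : LocallyCompactSpace (TangentBundle (𝓡 d) M) :=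
  Manifold.locallyCompact_of_finiteDimensional (𝓡 d).tangent

theorem tendsto_snd_of_tendsto {ι : Type*} {l : Filter ι} {F : ι → TangentBundle (𝓡 d) M}
    {p : TangentBundle (𝓡 d) M} (h : Tendsto F l (𝓝 p)) :
    Tendsto (fun i => (F i).proj) l (𝓝 p.proj) :=
  ((tendsto_tangentBundle_iff (mem_chart_self _)).1 h).1

theorem tendsto_add_tangentBundle {ι : Type*} {l : Filter ι} {x : ι → M} {x₀ : M}
    {v w : ∀ i, TangentSpace (𝓡 d) (x i)} {v₀ w₀ : TangentSpace (𝓡 d) x₀}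
    (hv : Tendsto (fun i => (⟨x i, v i⟩ : TangentBundle (𝓡 d) M)) l (𝓝 ⟨x₀, v₀⟩))
    (hw : Tendsto (fun i => (⟨x i, w i⟩ : TangentBundle (𝓡 d) M)) l (𝓝 ⟨x₀, w₀⟩)) :
    Tendsto (fun i => (⟨x i, v i + w i⟩ : TangentBundle (𝓡 d) M)) l (𝓝 ⟨x₀, v₀ + w₀⟩) := by
  have h1 := (tendsto_tangentBundle_iff (mem_chart_self x₀)).1 hv
  have h2 := (tendsto_tangentBundle_iff (mem_chart_self x₀)).1 hw
  refine (tendsto_tangentBundle_iff (mem_chart_self x₀)).2 ⟨h1.1, ?_⟩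
  simpa only [map_add] using h1.2.add h2.2

theorem tendsto_smul_tangentBundle {ι : Type*} {l : Filter ι} {x : ι → M} {x₀ : M} {a : ι → ℝ}
    {a₀ : ℝ} {v : ∀ i, TangentSpace (𝓡 d) (x i)} {v₀ : TangentSpace (𝓡 d) x₀}
    (ha : Tendsto a l (𝓝 a₀))
    (hv : Tendsto (fun i => (⟨x i, v i⟩ : TangentBundle (𝓡 d) M)) l (𝓝 ⟨x₀, v₀⟩)) :
    Tendsto (fun i => (⟨x i, a i • v i⟩ : TangentBundle (𝓡 d) M)) l (𝓝 ⟨x₀, a₀ • v₀⟩) := by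
  have h1 := (tendsto_tangentBundle_iff (mem_chart_self x₀)).1 hv
  refine (tendsto_tangentBundle_iff (mem_chart_self x₀)).2 ⟨h1.1, ?_⟩
  simpa only [map_smul] using ha.smul h1.2

theorem tendsto_chartDInv {x₀ : M} (c : M)
    (hc : x₀ ∈ (chartAt (EuclideanSpace ℝ (Fin d)) c).source) {ι : Type*} {l : Filter ι}
    {x : ι → M} {u : ι → EuclideanSpace ℝ (Fin d)} {u₀ : EuclideanSpace ℝ (Fin d)}
    (hx : Tendsto x l (𝓝 x₀)) (hu : Tendsto u l (𝓝 u₀)) :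
    Tendsto (fun i => (⟨x i, chartDInv c (x i) (u i)⟩ : TangentBundle (𝓡 d) M)) l
      (𝓝 ⟨x₀, chartDInv c x₀ u₀⟩) := by
  refine (tendsto_tangentBundle_iff hc).2 ⟨hx, ?_⟩
  rw [chartD_chartDInv hc]
  refine hu.congr' ?_
  filter_upwards [hx ((chartAt (EuclideanSpace ℝ (Fin d)) c).open_source.mem_nhds hc)] with i hi
  exact (chartD_chartDInv hi _).symm

theorem tangentVector_unique {ι : Type*} {l : Filter ι} [l.NeBot] {F : ι → TangentBundle (𝓡 d) M}
    {x : M} {v w : TangentSpace (𝓡 d) x} (hv : Tendsto F l (𝓝 ⟨x, v⟩))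
    (hw : Tendsto F l (𝓝 ⟨x, w⟩)) : v = w := by
  have h1 := (tendsto_tangentBundle_iff (mem_chart_self x)).1 hv
  have h2 := (tendsto_tangentBundle_iff (mem_chart_self x)).1 hw
  have := tendsto_nhds_unique h1.2 h2.2
  rw [← chartDInv_chartD (mem_chart_self x) v, ← chartDInv_chartD (mem_chart_self x) w]
  exact congrArg _ this

instance t2Space_tangentBundle : T2Space (TangentBundle (𝓡 d) M) := by
  refine t2_iff_nhds.2 fun {p q} h => ?_
  have hp : Tendsto id (𝓝 p ⊓ 𝓝 q) (𝓝 p) := tendsto_id.mono_left inf_le_left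
  have hq : Tendsto id (𝓝 p ⊓ 𝓝 q) (𝓝 q) := tendsto_id.mono_left inf_le_right
  have hb : p.proj = q.proj := tendsto_nhds_unique (tendsto_snd_of_tendsto hp)
    (tendsto_snd_of_tendsto hq)
  obtain ⟨x, v⟩ := p
  obtain ⟨y, w⟩ := q
  obtain rfl : x = y := hb
  rw [tangentVector_unique hp hq]

variable [RiemannianBundle (fun x : M => TangentSpace (𝓡 d) x)]
  [IsContMDiffRiemannianBundle (𝓡 d) ∞ (EuclideanSpace ℝ (Fin d))
      (fun x : M => TangentSpace (𝓡 d) x)]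

instance isContinuousRiemannianBundle_tangent :
    IsContinuousRiemannianBundle (EuclideanSpace ℝ (Fin d))
      (fun x : M => TangentSpace (𝓡 d) x) := by
  obtain ⟨g, hg, h⟩ := IsContMDiffRiemannianBundle.exists_contMDiff (IB := 𝓡 d) (n := ∞)
    (F := EuclideanSpace ℝ (Fin d)) (E := fun x : M => TangentSpace (𝓡 d) x)
  exact ⟨⟨g, hg.continuous, h⟩⟩

theorem continuous_norm_tangentBundle :
    Continuous fun p : TangentBundle (𝓡 d) M => ‖p.snd‖ := by
  have h : Continuous fun p : TangentBundle (𝓡 d) M => inner ℝ p.snd p.snd :=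
    Continuous.inner_bundle (F := EuclideanSpace ℝ (Fin d))
      (E := fun x : M => TangentSpace (𝓡 d) x) continuous_id continuous_id
  simpa only [norm_eq_sqrt_real_inner] using h.sqrt

variable [CompactSpace M]

/-- Over a compact base, a bounded set of tangent vectors is relatively compact: base points
converge, and near the limit the chart coordinates are controlled by the Riemannian norm. -/
theorem exists_limit_tangentBundle {ι : Type*} (𝒰 : Ultrafilter ι)
    {F : ι → TangentBundle (𝓡 d) M} {R : ℝ} (hF : ∀ᶠ i in (𝒰 : Filter ι), ‖(F i).snd‖ ≤ R) :
    ∃ p, Tendsto F 𝒰 (𝓝 p) := by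
  obtain ⟨x, hx⟩ : ∃ x, Tendsto (fun i => (F i).proj) 𝒰 (𝓝 x) := by
    obtain ⟨x, -, hx⟩ := isCompact_univ.ultrafilter_le_nhds (𝒰.map fun i => (F i).proj) (by simp)
    exact ⟨x, hx⟩
  obtain ⟨C, hC, hev⟩ := eventually_norm_trivializationAt_lt (EuclideanSpace ℝ (Fin d))
    (fun x : M => TangentSpace (𝓡 d) x) x
  have hb : ∀ᶠ i in (𝒰 : Filter ι), chartD x (F i).proj (F i).snd ∈ Metric.closedBall 0 (C * R) := by
    filter_upwards [hx.eventually hev, hF] with i h1 h2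
    rw [mem_closedBall_zero_iff]
    exact (ContinuousLinearMap.le_opNorm _ _).trans (mul_le_mul h1.le h2 (norm_nonneg _) hC.le)
  obtain ⟨u, -, hu⟩ := (isCompact_closedBall (0 : EuclideanSpace ℝ (Fin d)) (C * R)).ultrafilter_le_nhds
    (𝒰.map fun i => chartD x (F i).proj (F i).snd) (by rw [Ultrafilter.coe_map]; exact tendsto_principal.2 hb)
  refine ⟨⟨x, chartDInv x x u⟩, (tendsto_tangentBundle_iff (mem_chart_self x)).2 ⟨hx, ?_⟩⟩
  rw [chartD_chartDInv (mem_chart_self x)]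
  exact hu

theorem norm_limit {ι : Type*} {l : Filter ι} {F : ι → TangentBundle (𝓡 d) M}
    {p : TangentBundle (𝓡 d) M} (h : Tendsto F l (𝓝 p)) :
    Tendsto (fun i => ‖(F i).snd‖) l (𝓝 ‖p.snd‖) :=
  (continuous_norm_tangentBundle.tendsto p).comp h

/-- The form of all compactness arguments below: if a uniform statement fails arbitrarily close to
the limit, counterexamples can be chosen along an ultrafilter, where bounded vectors converge
without extracting subsequences. -/
theorem eventually_forall_of_ultrafilter {α β : Type*} {l : Filter α} {P : α → β → Prop}
    (h : ∀ (𝒰 : Ultrafilter α) (b : α → β), (𝒰 : Filter α) ≤ l →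
      (∀ᶠ a in (𝒰 : Filter α), ¬ P a (b a)) → False) : ∀ᶠ a in l, ∀ b, P a b := by
  by_contra hcon
  rw [Filter.not_eventually] at hcon
  have := Filter.frequently_iff_neBot.1 hcon
  let 𝒰 := Ultrafilter.of (l ⊓ 𝓟 {a | ¬ ∀ b, P a b})
  have h𝒰 : (𝒰 : Filter α) ≤ l ⊓ 𝓟 {a | ¬ ∀ b, P a b} := Ultrafilter.of_le _
  have hev : ∀ᶠ a in (𝒰 : Filter α), ¬ ∀ b, P a b := h𝒰 (mem_inf_of_right (mem_principal_self _))
  classical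
  have hne : ∃ a, ¬ ∀ b, P a b := hev.exists
  obtain ⟨a₀, ha₀⟩ := hne
  obtain ⟨b₀, -⟩ := not_forall.1 ha₀
  refine h 𝒰 (fun a => if h : ∃ b, ¬ P a b then h.choose else b₀) (h𝒰.trans inf_le_left) ?_
  filter_upwards [hev] with a ha
  have h' : ∃ b, ¬ P a b := not_forall.1 ha
  rw [dif_pos h']
  exact h'.choose_spec

/-! ### The `C^1` topology -/

theorem tangentCMap_apply (g : M ≃ₘ^1⟮𝓡 d, 𝓡 d⟯ M) (x : M) (v : TangentSpace (𝓡 d) x) :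
    tangentCMap g ⟨x, v⟩ = ⟨g x, mfderiv (𝓡 d) (𝓡 d) g x v⟩ := rfl

theorem mdifferentiable_diffeo (g : M ≃ₘ^1⟮𝓡 d, 𝓡 d⟯ M) : MDifferentiable (𝓡 d) (𝓡 d) g :=
  g.contMDiff.mdifferentiable one_ne_zero

theorem contMDiff_iterate (g : M ≃ₘ^1⟮𝓡 d, 𝓡 d⟯ M) (n : ℕ) :
    ContMDiff (𝓡 d) (𝓡 d) 1 g^[n] := by
  induction n with
  | zero => exact contMDiff_id
  | succ n ih => rw [Function.iterate_succ]; exact ih.comp g.contMDiff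

theorem tangentCMap_iterate (g : M ≃ₘ^1⟮𝓡 d, 𝓡 d⟯ M) (n : ℕ) (x : M)
    (v : TangentSpace (𝓡 d) x) :
    (tangentCMap g)^[n] ⟨x, v⟩ = ⟨g^[n] x, mfderiv (𝓡 d) (𝓡 d) g^[n] x v⟩ := by
  have h : (tangentCMap g)^[n] = tangentMap (𝓡 d) (𝓡 d) g^[n] := by
    induction n with
    | zero => exact tangentMap_id.symm
    | succ n ih =>
      rw [Function.iterate_succ', Function.iterate_succ', ih,
        tangentMap_comp (mdifferentiable_diffeo g)
          ((contMDiff_iterate g n).mdifferentiable one_ne_zero)]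
      rfl
  rw [h]; rfl

theorem tangentCMap_symm_tangentCMap (g : M ≃ₘ^1⟮𝓡 d, 𝓡 d⟯ M) (p : TangentBundle (𝓡 d) M) :
    tangentCMap g.symm (tangentCMap g p) = p := by
  change (tangentMap (𝓡 d) (𝓡 d) g.symm ∘ tangentMap (𝓡 d) (𝓡 d) g) p = p
  rw [← tangentMap_comp (mdifferentiable_diffeo g.symm) (mdifferentiable_diffeo g)]
  have : (g.symm ∘ g : M → M) = id := by ext x; simp
  rw [this, tangentMap_id]; rfl

theorem tangentCMap_tangentCMap_symm (g : M ≃ₘ^1⟮𝓡 d, 𝓡 d⟯ M) (p : TangentBundle (𝓡 d) M) :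
    tangentCMap g (tangentCMap g.symm p) = p :=
  tangentCMap_symm_tangentCMap g.symm p

/-- Evaluation is jointly continuous for the compact-open topology because the tangent bundle is
locally compact; diffeomorphism and vector may therefore vary simultaneously. -/
theorem tendsto_tangentCMap {ι : Type*} {l : Filter ι} {f : M ≃ₘ^1⟮𝓡 d, 𝓡 d⟯ M}
    {g : ι → M ≃ₘ^1⟮𝓡 d, 𝓡 d⟯ M} (hg : Tendsto g l (c1Nhds f))
    {F : ι → TangentBundle (𝓡 d) M} {p : TangentBundle (𝓡 d) M} (hF : Tendsto F l (𝓝 p)) :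
    Tendsto (fun i => tangentCMap (g i) (F i)) l (𝓝 (tangentCMap f p)) := by
  have h1 : Tendsto (tangentCMap (d := d) (M := M)) (c1Nhds f) (𝓝 (tangentCMap f)) := by
    rw [c1Nhds, nhds_induced]; exact tendsto_comap
  exact (continuous_eval.tendsto (tangentCMap f, p)).comp ((h1.comp hg).prodMk_nhds hF)

theorem tendsto_tangentCMap_iterate {ι : Type*} {l : Filter ι} {f : M ≃ₘ^1⟮𝓡 d, 𝓡 d⟯ M}
    {g : ι → M ≃ₘ^1⟮𝓡 d, 𝓡 d⟯ M} (hg : Tendsto g l (c1Nhds f))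
    {F : ι → TangentBundle (𝓡 d) M} {p : TangentBundle (𝓡 d) M} (hF : Tendsto F l (𝓝 p)) (n : ℕ) :
    Tendsto (fun i => (tangentCMap (g i))^[n] (F i)) l (𝓝 ((tangentCMap f)^[n] p)) := by
  induction n with
  | zero => exact hF
  | succ n ih => simpa only [Function.iterate_succ', Function.comp_apply] using tendsto_tangentCMap hg ih

theorem tangentCMap_proj (g : M ≃ₘ^1⟮𝓡 d, 𝓡 d⟯ M) (p : TangentBundle (𝓡 d) M) :
    (tangentCMap g p).proj = g p.proj := rfl

theorem tendsto_diffeo {ι : Type*} {l : Filter ι} {f : M ≃ₘ^1⟮𝓡 d, 𝓡 d⟯ M}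
    {g : ι → M ≃ₘ^1⟮𝓡 d, 𝓡 d⟯ M} (hg : Tendsto g l (c1Nhds f))
    {x : ι → M} {x₀ : M} (hx : Tendsto x l (𝓝 x₀)) (n : ℕ) :
    Tendsto (fun i => (g i)^[n] (x i)) l (𝓝 (f^[n] x₀)) := by
  have h0 : Tendsto (fun i => (⟨x i, chartDInv x₀ (x i) 0⟩ : TangentBundle (𝓡 d) M)) l
      (𝓝 ⟨x₀, chartDInv x₀ x₀ 0⟩) :=
    tendsto_chartDInv x₀ (mem_chart_self x₀) hx tendsto_const_nhds
  have := tendsto_snd_of_tendsto (tendsto_tangentCMap_iterate hg h0 n)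
  simpa only [tangentCMap_iterate] using this

theorem tangentCMap_snd_ne_zero (g : M ≃ₘ^1⟮𝓡 d, 𝓡 d⟯ M) {p : TangentBundle (𝓡 d) M}
    (h : (tangentCMap g p).snd = 0) : p.snd = 0 := by
  have h1 := tangentCMap_symm_tangentCMap g p
  have h2 : tangentCMap g p = ⟨g p.proj, 0⟩ :=
    congrArg (fun v => (⟨g p.proj, v⟩ : TangentBundle (𝓡 d) M)) h
  rw [h2, tangentCMap_apply, map_zero] at h1
  rw [← h1]

/-- Otherwise unit vectors shrunk more and more by diffeomorphisms tending to f would converge to a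
unit vector in the kernel of the invertible map Df. The candidate constant is let tend to 0 along
with g. -/
theorem eventually_le_norm_tangentCMap (f : M ≃ₘ^1⟮𝓡 d, 𝓡 d⟯ M) :
    ∃ c > 0, ∀ᶠ g in c1Nhds f, ∀ p : TangentBundle (𝓡 d) M, c * ‖p.snd‖ ≤ ‖(tangentCMap g p).snd‖ := by
  have key : ∀ᶠ q : ℝ × (M ≃ₘ^1⟮𝓡 d, 𝓡 d⟯ M) in 𝓝[>] 0 ×ˢ c1Nhds f,
      ∀ p : TangentBundle (𝓡 d) M, ‖p.snd‖ = 1 → q.1 ≤ ‖(tangentCMap q.2 p).snd‖ := by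
    refine eventually_forall_of_ultrafilter fun 𝒰 p h𝒰 hcon => ?_
    have hg : Tendsto (fun q : ℝ × (M ≃ₘ^1⟮𝓡 d, 𝓡 d⟯ M) => q.2) 𝒰 (c1Nhds f) :=
      tendsto_snd.mono_left h𝒰
    have hc : Tendsto (fun q : ℝ × (M ≃ₘ^1⟮𝓡 d, 𝓡 d⟯ M) => q.1) 𝒰 (𝓝 0) :=
      (tendsto_fst.mono_left h𝒰).mono_right nhdsWithin_le_nhds
    simp only [Classical.not_imp, not_le] at hcon
    obtain ⟨p₀, hp₀⟩ := exists_limit_tangentBundle 𝒰 (F := p) (R := 1)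
      (hcon.mono fun q h => h.1.le)
    have h1 : ‖p₀.snd‖ = 1 := tendsto_nhds_unique (norm_limit hp₀)
      (tendsto_const_nhds.congr' (hcon.mono fun q h => h.1.symm))
    have h2 : ‖(tangentCMap f p₀).snd‖ ≤ 0 :=
      le_of_tendsto_of_tendsto (norm_limit (tendsto_tangentCMap hg hp₀)) hc
        (hcon.mono fun q h => h.2.le)
    have h3 := tangentCMap_snd_ne_zero f (norm_le_zero_iff.1 h2)
    rw [h3] at h1
    simp at h1
  obtain ⟨c, hc0, hc⟩ : ∃ c > (0 : ℝ), ∀ᶠ g in c1Nhds f,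
      ∀ p : TangentBundle (𝓡 d) M, ‖p.snd‖ = 1 → c ≤ ‖(tangentCMap g p).snd‖ := by
    obtain ⟨c, hc⟩ := (key.curry.and self_mem_nhdsWithin).exists
    exact ⟨c, hc.2, hc.1⟩
  refine ⟨c, hc0, hc.mono fun g hg p => ?_⟩
  obtain ⟨x, v⟩ := p
  rcases eq_or_ne v 0 with rfl | hv
  · simp
  · have hv' : 0 < ‖v‖ := norm_pos_iff.2 hv
    have := hg ⟨x, ‖v‖⁻¹ • v⟩ (by simp [norm_smul, hv'.ne'])
    rw [tangentCMap_apply, map_smul, norm_smul, norm_inv, norm_norm] at this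
    rw [tangentCMap_apply]
    calc c * ‖v‖ ≤ ‖v‖⁻¹ * ‖mfderiv (𝓡 d) (𝓡 d) g x v‖ * ‖v‖ := by gcongr
      _ = _ := by field_simp

/-- The lower bound on Dg keeps the inverse images of a compact set of vectors bounded; any limit q₀
of them satisfies Df q₀ = p₀, which forces q₀ = Df⁻¹ p₀. Continuity of inversion lets every
statement be applied to the inverse diffeomorphism. -/
theorem tendsto_c1_symm (f : M ≃ₘ^1⟮𝓡 d, 𝓡 d⟯ M) :
    Tendsto (fun g : M ≃ₘ^1⟮𝓡 d, 𝓡 d⟯ M => g.symm) (c1Nhds f) (c1Nhds f.symm) := by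
  have h0 : c1Nhds f.symm = comap tangentCMap (𝓝 (tangentCMap f.symm)) := by
    rw [c1Nhds, nhds_induced]
  rw [h0, tendsto_comap_iff, ContinuousMap.tendsto_nhds_compactOpen]
  intro K hK O hO hKO
  obtain ⟨c, hc, hcg⟩ := eventually_le_norm_tangentCMap f
  obtain ⟨R, hR⟩ := hK.exists_bound_of_continuousOn (f := fun p : TangentBundle (𝓡 d) M => ‖p.snd‖)
    continuous_norm_tangentBundle.continuousOn
  suffices h : ∀ᶠ g in c1Nhds f, ∀ p, p ∈ K → tangentCMap g.symm p ∈ O from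
    h.mono fun g hg p hp => hg p hp
  refine eventually_forall_of_ultrafilter fun 𝒰 p h𝒰 hcon => ?_
  simp only [Classical.not_imp] at hcon
  obtain ⟨p₀, hp₀, hp⟩ := hK.ultrafilter_le_nhds (𝒰.map p) (by
    rw [Ultrafilter.coe_map]
    exact tendsto_principal.2 (hcon.mono fun q h => h.1))
  have hp' : Tendsto p 𝒰 (𝓝 p₀) := hp
  obtain ⟨q₀, hq₀⟩ := exists_limit_tangentBundle 𝒰 (F := fun g => tangentCMap g.symm (p g))
    (R := R / c) (by
      filter_upwards [hcon, h𝒰 hcg] with g h1 h2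
      have := h2 (tangentCMap g.symm (p g))
      rw [tangentCMap_tangentCMap_symm] at this
      rw [le_div_iff₀ hc, mul_comm]
      refine this.trans ?_
      simpa using hR (p g) h1.1)
  have h1 := tendsto_tangentCMap (tendsto_id.mono_left h𝒰) hq₀
  simp only [id, tangentCMap_tangentCMap_symm] at h1
  have h2 : tangentCMap f q₀ = p₀ := tendsto_nhds_unique h1 hp'
  have h3 : q₀ ∈ O := by
    rw [← tangentCMap_symm_tangentCMap f q₀, h2]; exact hKO hp₀
  obtain ⟨g, hg1, hg2⟩ := (hcon.and (hq₀.eventually (hO.mem_nhds h3))).exists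
  exact hg1.2 hg2

end TangentBundle

/-! ### Limits of cones and of splittings -/

section Cones

variable {d : ℕ} {M : Type*} [MetricSpace M] [CompactSpace M]
  [ChartedSpace (EuclideanSpace ℝ (Fin d)) M] [IsManifold (𝓡 d) ∞ M]
  [RiemannianBundle (fun x : M => TangentSpace (𝓡 d) x)]
  [IsContMDiffRiemannianBundle (𝓡 d) ∞ (EuclideanSpace ℝ (Fin d))
      (fun x : M => TangentSpace (𝓡 d) x)]

/-- The vectors over `U` that lie in the cones `C`. -/
def coneSet (U : Set M) (C : ∀ x : M, Set (TangentSpace (𝓡 d) x)) :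
    Set (TangentBundle (𝓡 d) M) := {p | p.proj ∈ U ∧ p.snd ∈ C p.proj}

/-- The vectors whose forward orbit under `Dg` stays in the cones `C` over `U`. -/
def allTime (g : M ≃ₘ^1⟮𝓡 d, 𝓡 d⟯ M) (U : Set M) (C : ∀ x : M, Set (TangentSpace (𝓡 d) x)) :
    Set (TangentBundle (𝓡 d) M) := {p | ∀ k : ℕ, (tangentCMap g)^[k] p ∈ coneSet U C}

/-- A cone field that is strictly invariant under the inverse of `f`. -/
structure BackInvariant (f : M ≃ₘ^1⟮𝓡 d, 𝓡 d⟯ M) (U : Set M)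
    (C : ∀ x : M, Set (TangentSpace (𝓡 d) x)) : Prop where
  cone : IsConeField U C
  back : ∀ x ∈ U, f x ∈ U → closure (mfderiv (𝓡 d) (𝓡 d) f x ⁻¹' C (f x)) ⊆ C x

theorem isOpenMap_mfderiv (f : M ≃ₘ^1⟮𝓡 d, 𝓡 d⟯ M) (x : M) :
    IsOpenMap (mfderiv (𝓡 d) (𝓡 d) f x) := by
  have := (f.mfderivToContinuousLinearEquiv one_ne_zero x).toHomeomorph.isOpenMap
  exact this

theorem tangentCMap_iterate_proj (g : M ≃ₘ^1⟮𝓡 d, 𝓡 d⟯ M) (n : ℕ) (p : TangentBundle (𝓡 d) M) :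
    ((tangentCMap g)^[n] p).proj = g^[n] p.proj := by
  obtain ⟨x, v⟩ := p
  rw [tangentCMap_iterate]

variable {f : M ≃ₘ^1⟮𝓡 d, 𝓡 d⟯ M} {U : Set M} {C : ∀ x : M, Set (TangentSpace (𝓡 d) x)}

theorem zero_mem_coneSet (h : IsConeField U C) {x : M} (hx : x ∈ U) :
    (⟨x, 0⟩ : TangentBundle (𝓡 d) M) ∈ coneSet U C := ⟨hx, h.zero_mem x hx⟩

theorem smul_mem_coneSet (h : IsConeField U C) {x : M} {v : TangentSpace (𝓡 d) x}
    (hv : (⟨x, v⟩ : TangentBundle (𝓡 d) M) ∈ coneSet U C) (c : ℝ) :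
    (⟨x, c • v⟩ : TangentBundle (𝓡 d) M) ∈ coneSet U C := ⟨hv.1, h.smul_mem x hv.1 c v hv.2⟩

theorem smul_mem_allTime (h : IsConeField U C) {g : M ≃ₘ^1⟮𝓡 d, 𝓡 d⟯ M} {x : M}
    {v : TangentSpace (𝓡 d) x} (hv : (⟨x, v⟩ : TangentBundle (𝓡 d) M) ∈ allTime g U C) (c : ℝ) :
    (⟨x, c • v⟩ : TangentBundle (𝓡 d) M) ∈ allTime g U C := by
  intro k
  have := hv k
  rw [tangentCMap_iterate] at this ⊢
  rw [map_smul]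
  exact smul_mem_coneSet h this c

theorem tangentCMap_mem_allTime {g : M ≃ₘ^1⟮𝓡 d, 𝓡 d⟯ M} {p : TangentBundle (𝓡 d) M}
    (hp : p ∈ allTime g U C) (n : ℕ) : (tangentCMap g)^[n] p ∈ allTime g U C := by
  intro k
  rw [← Function.iterate_add_apply]
  exact hp _

/-- Strict invariance turns a closed condition into an open one: being in the closure of the cones
one step later implies being in the cone now. This is how open cones survive passage to limits. -/
theorem mem_coneSet_of_closure (h : BackInvariant f U C) {p : TangentBundle (𝓡 d) M}
    (hU : p.proj ∈ U) (hfU : f p.proj ∈ U) (hp : tangentCMap f p ∈ closure (coneSet U C)) :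
    p ∈ coneSet U C := by
  have h1 := h.cone.mem_closure (tangentCMap f p) hfU hp
  refine ⟨hU, h.back _ hU hfU ?_⟩
  exact (isOpenMap_mfderiv f p.proj).preimage_closure_subset_closure_preimage h1

theorem limit_mem_coneSet (h : BackInvariant f U C) {ι : Type*} {l : Filter ι} [l.NeBot]
    {g : ι → M ≃ₘ^1⟮𝓡 d, 𝓡 d⟯ M} (hg : Tendsto g l (c1Nhds f)) {F : ι → TangentBundle (𝓡 d) M}
    {p : TangentBundle (𝓡 d) M} (hF : Tendsto F l (𝓝 p)) (hU : p.proj ∈ U) (hfU : f p.proj ∈ U)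
    (hFC : ∀ᶠ i in l, tangentCMap (g i) (F i) ∈ closure (coneSet U C)) : p ∈ coneSet U C :=
  mem_coneSet_of_closure h hU hfU
    (isClosed_closure.mem_of_tendsto (tendsto_tangentCMap hg hF) hFC)

/-- A limit is only known to be in the closures of the cones; membership at time k is recovered from
the closure condition at time k+1. -/
theorem limit_mem_allTime (h : BackInvariant f U C) {ι : Type*} {l : Filter ι} [l.NeBot]
    {g : ι → M ≃ₘ^1⟮𝓡 d, 𝓡 d⟯ M} (hg : Tendsto g l (c1Nhds f)) {F : ι → TangentBundle (𝓡 d) M}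
    {p : TangentBundle (𝓡 d) M} (hF : Tendsto F l (𝓝 p)) (hU : ∀ k, f^[k] p.proj ∈ U)
    (hFC : ∀ᶠ i in l, F i ∈ allTime (g i) U C) : p ∈ allTime f U C := by
  intro k
  refine limit_mem_coneSet h hg (tendsto_tangentCMap_iterate hg hF k) ?_ ?_ ?_
  · rw [tangentCMap_iterate_proj]; exact hU k
  · rw [tangentCMap_iterate_proj, ← Function.iterate_succ_apply' f]; exact hU (k + 1)
  · filter_upwards [hFC] with i hi
    have := hi (k + 1)
    rw [Function.iterate_succ_apply'] at this
    exact subset_closure this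

theorem eventually_mem_coneSet (h : IsConeField U C) {ι : Type*} {l : Filter ι}
    {F : ι → TangentBundle (𝓡 d) M} {p : TangentBundle (𝓡 d) M} (hF : Tendsto F l (𝓝 p))
    (hp : p ∈ coneSet U C) (h0 : p.snd ≠ 0) : ∀ᶠ i in l, F i ∈ coneSet U C ∧ (F i).snd ≠ 0 :=
  (hF.eventually (h.isOpen.mem_nhds ⟨hp.1, hp.2, h0⟩)).mono fun _ hi => ⟨⟨hi.1, hi.2.1⟩, hi.2.2⟩

theorem tendsto_zero_tangentBundle {ι : Type*} {l : Filter ι} {x : ι → M} {x₀ : M}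
    {v : ∀ i, TangentSpace (𝓡 d) (x i)} (hx : Tendsto x l (𝓝 x₀))
    (hv : Tendsto (fun i => ‖v i‖) l (𝓝 0)) :
    Tendsto (fun i => (⟨x i, v i⟩ : TangentBundle (𝓡 d) M)) l (𝓝 ⟨x₀, 0⟩) := by
  refine (tendsto_tangentBundle_iff (mem_chart_self x₀)).2 ⟨hx, ?_⟩
  obtain ⟨K, hK, hev⟩ := eventually_norm_trivializationAt_lt (EuclideanSpace ℝ (Fin d))
    (fun x : M => TangentSpace (𝓡 d) x) x₀
  rw [map_zero]
  refine squeeze_zero_norm' ?_ (by simpa using hv.const_mul K)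
  filter_upwards [hx.eventually hev] with i hi
  exact (ContinuousLinearMap.le_opNorm _ _).trans (by gcongr; exact hi.le)

/-- The limit of a family of subspaces of tangent spaces, along a filter. -/
def limSub {ι : Type*} (l : Filter ι) (x : ι → M) (x₀ : M)
    (A : ∀ i, Submodule ℝ (TangentSpace (𝓡 d) (x i))) (hx : Tendsto x l (𝓝 x₀)) :
    Submodule ℝ (TangentSpace (𝓡 d) x₀) where
  carrier := {a | ∃ α : ∀ i, TangentSpace (𝓡 d) (x i), (∀ i, α i ∈ A i) ∧
    Tendsto (fun i => (⟨x i, α i⟩ : TangentBundle (𝓡 d) M)) l (𝓝 ⟨x₀, a⟩)}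
  zero_mem' := ⟨fun _ => 0, fun i => (A i).zero_mem,
    tendsto_zero_tangentBundle hx (by simpa using tendsto_const_nhds)⟩
  add_mem' := by
    rintro a b ⟨α, hα, hα'⟩ ⟨β, hβ, hβ'⟩
    exact ⟨fun i => α i + β i, fun i => (A i).add_mem (hα i) (hβ i),
      tendsto_add_tangentBundle hα' hβ'⟩
  smul_mem' := by
    rintro c a ⟨α, hα, hα'⟩
    exact ⟨fun i => c • α i, fun i => (A i).smul_mem c (hα i),
      tendsto_smul_tangentBundle tendsto_const_nhds hα'⟩

/-- The uniform angle bound passes to the limit and gives a trivial intersection. It also bounds the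
components of a convergent family of vectors, so these converge too and the limits span. -/
theorem isCompl_limSub {ι : Type*} (𝒰 : Ultrafilter ι) {x : ι → M} {x₀ : M}
    (hx : Tendsto x 𝒰 (𝓝 x₀)) {A B : ∀ i, Submodule ℝ (TangentSpace (𝓡 d) (x i))} {c : ℝ}
    (hAB : ∀ᶠ i in (𝒰 : Filter ι), A i ⊔ B i = ⊤)
    (hc : ∀ᶠ i in (𝒰 : Filter ι), ∀ a ∈ A i, ∀ b ∈ B i, ‖a‖ ≤ c * ‖a + b‖) :
    IsCompl (limSub (𝒰 : Filter ι) x x₀ A hx) (limSub (𝒰 : Filter ι) x x₀ B hx) := by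
  constructor
  · rw [Submodule.disjoint_def]
    rintro a ⟨α, hα, hα'⟩ ⟨β, hβ, hβ'⟩
    have h1 := tendsto_add_tangentBundle hα'
      (tendsto_smul_tangentBundle (tendsto_const_nhds (x := (-1 : ℝ))) hβ')
    have h2 := (norm_limit h1).const_mul c
    have h3 : ‖a‖ ≤ c * ‖a + (-1 : ℝ) • a‖ := by
      refine le_of_tendsto_of_tendsto (norm_limit hα') h2 ?_
      filter_upwards [hc] with i hi
      exact hi _ (hα i) _ ((B i).smul_mem _ (hβ i))
    have h4 : a + (-1 : ℝ) • a = 0 := by simp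
    rw [h4, norm_zero, mul_zero] at h3
    exact norm_le_zero_iff.1 h3
  · rw [codisjoint_iff, Submodule.eq_top_iff']
    intro u
    set w : ∀ i, TangentSpace (𝓡 d) (x i) := fun i => chartDInv x₀ (x i) (chartD x₀ x₀ u) with hw
    have hwu : Tendsto (fun i => (⟨x i, w i⟩ : TangentBundle (𝓡 d) M)) 𝒰 (𝓝 ⟨x₀, u⟩) := by
      have := tendsto_chartDInv x₀ (mem_chart_self x₀) hx
        (tendsto_const_nhds (x := chartD x₀ x₀ u))
      rwa [chartDInv_chartD (mem_chart_self x₀)] at this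
    have hex : ∀ i, ∃ a ∈ A i, ∃ b ∈ B i, A i ⊔ B i = ⊤ → a + b = w i := by
      intro i
      by_cases h : A i ⊔ B i = ⊤
      · obtain ⟨a, ha, b, hb, hab⟩ := Submodule.mem_sup.1 (h ▸ Submodule.mem_top : w i ∈ A i ⊔ B i)
        exact ⟨a, ha, b, hb, fun _ => hab⟩
      · exact ⟨0, (A i).zero_mem, 0, (B i).zero_mem, fun h' => absurd h' h⟩
    choose a ha b hb hab using hex
    have hbd : ∀ᶠ i in (𝒰 : Filter ι), ‖w i‖ ≤ ‖u‖ + 1 :=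
      (norm_limit hwu).eventually (ge_mem_nhds (lt_add_one ‖u‖))
    obtain ⟨p, hp⟩ := exists_limit_tangentBundle 𝒰
      (F := fun i => (⟨x i, a i⟩ : TangentBundle (𝓡 d) M)) (R := |c| * (‖u‖ + 1)) (by
        filter_upwards [hbd, hAB, hc] with i h1 h2 h3
        have := h3 _ (ha i) _ (hb i)
        rw [hab i h2] at this
        calc ‖a i‖ ≤ c * ‖w i‖ := this
          _ ≤ |c| * (‖u‖ + 1) := by gcongr; exact le_abs_self c)
    have hpx : p.proj = x₀ := tendsto_nhds_unique (tendsto_snd_of_tendsto hp) hx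
    obtain ⟨y, a₀⟩ := p
    obtain rfl : y = x₀ := hpx
    have hb' : Tendsto (fun i => (⟨x i, b i⟩ : TangentBundle (𝓡 d) M)) 𝒰
        (𝓝 ⟨y, u + (-1 : ℝ) • a₀⟩) := by
      refine (tendsto_add_tangentBundle hwu
        (tendsto_smul_tangentBundle (tendsto_const_nhds (x := (-1 : ℝ))) hp)).congr' ?_
      filter_upwards [hAB] with i hi
      rw [← hab i hi]; simp
    exact Submodule.mem_sup.2 ⟨a₀, ⟨a, ha, hp⟩, u + (-1 : ℝ) • a₀, ⟨b, hb, hb'⟩, by simp⟩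

/-- The ratio β/α would grow by the factor κ > 1 every n steps and yet stay below c. Here β is the
size of the component in the dominating direction of a vector that never leaves the cone. -/
theorem eq_zero_of_dominated {α β : ℕ → ℝ} {c κ : ℝ} {n : ℕ} (hκ : 1 < κ)
    (hα : ∀ k, 0 ≤ α k) (hβ : ∀ k, 0 ≤ β k) (hβ0 : β 0 ≠ 0 → ∀ k, β k ≠ 0)
    (hβα : ∀ k, β k ≤ c * α k)
    (hdom : ∀ k, κ * α (k + n) * β k ≤ α k * β (k + n)) : β 0 = 0 := by
  by_contra h0
  have hpos : ∀ k, 0 < β k := fun k => lt_of_le_of_ne (hβ k) (hβ0 h0 k).symm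
  have hαpos : ∀ k, 0 < α k := fun k => by
    rcases (hα k).lt_or_eq with h | h
    · exact h
    · have := hβα k
      rw [← h, mul_zero] at this
      exact absurd this (not_le.2 (hpos k))
  have key : ∀ k : ℕ, κ ^ k * α (k * n) * β 0 ≤ α 0 * β (k * n) := by
    intro k
    induction k with
    | zero => simp
    | succ k ih =>
      have h1 := hdom (k * n)
      have e : (k + 1) * n = k * n + n := by ring
      rw [e]
      refine le_of_mul_le_mul_right ?_ (hpos (k * n))
      calc κ ^ (k + 1) * α (k * n + n) * β 0 * β (k * n)
          = κ ^ k * β 0 * (κ * α (k * n + n) * β (k * n)) := by ring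
        _ ≤ κ ^ k * β 0 * (α (k * n) * β (k * n + n)) := by
          gcongr
          exact mul_nonneg (pow_nonneg (by linarith) _) (hβ 0)
        _ = (κ ^ k * α (k * n) * β 0) * β (k * n + n) := by ring
        _ ≤ (α 0 * β (k * n)) * β (k * n + n) := by
          gcongr; exact hβ _
        _ = _ := by ring
  obtain ⟨k, hk⟩ := pow_unbounded_of_one_lt (c * α 0 / β 0) hκ
  rw [div_lt_iff₀ (hpos 0)] at hk
  have h2 := (key k).trans (mul_le_mul_of_nonneg_left (hβα (k * n)) (hα 0))
  have h3 : κ ^ k * β 0 * α (k * n) ≤ c * α 0 * α (k * n) := by linarith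
  exact absurd (le_of_mul_le_mul_right h3 (hαpos _)) (not_le.2 hk)

end Cones

/-! ### Splittings inside cone fields, near the initial diffeomorphism -/

section ConeSplitting

variable {d : ℕ} {M : Type*} [MetricSpace M] [CompactSpace M]
  [ChartedSpace (EuclideanSpace ℝ (Fin d)) M] [IsManifold (𝓡 d) ∞ M]
  [RiemannianBundle (fun x : M => TangentSpace (𝓡 d) x)]
  [IsContMDiffRiemannianBundle (𝓡 d) ∞ (EuclideanSpace ℝ (Fin d))
      (fun x : M => TangentSpace (𝓡 d) x)]

/-- Scalar invariance of a set of tangent vectors. -/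
def ScalarInvariant (P : Set (TangentBundle (𝓡 d) M)) : Prop :=
  ∀ (x : M) (v : TangentSpace (𝓡 d) x) (c : ℝ),
    (⟨x, v⟩ : TangentBundle (𝓡 d) M) ∈ P → (⟨x, c • v⟩ : TangentBundle (𝓡 d) M) ∈ P

theorem ScalarInvariant.closure {P : Set (TangentBundle (𝓡 d) M)} (hP : ScalarInvariant P) :
    ScalarInvariant (closure P) := by
  intro x v c h
  obtain ⟨𝒰, h𝒰, hx⟩ := mem_closure_iff_ultrafilter.1 h
  have h1 : Tendsto (fun p : TangentBundle (𝓡 d) M => (⟨p.proj, c • p.snd⟩ : TangentBundle (𝓡 d) M))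
      𝒰 (𝓝 ⟨x, c • v⟩) :=
    tendsto_smul_tangentBundle (v := fun p : TangentBundle (𝓡 d) M => p.snd)
      tendsto_const_nhds hx
  exact mem_closure_of_tendsto h1 (Filter.mem_of_superset h𝒰 fun p hp => hP _ _ c hp)

/-- The vectors over `S` in a family of subspaces. -/
def subSet (S : Set M) (A : ∀ x : M, Submodule ℝ (TangentSpace (𝓡 d) x)) :
    Set (TangentBundle (𝓡 d) M) := {p | p.proj ∈ S ∧ p.snd ∈ A p.proj}

theorem scalarInvariant_subSet (S : Set M) (A : ∀ x : M, Submodule ℝ (TangentSpace (𝓡 d) x)) :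
    ScalarInvariant (subSet S A) := fun x _ c h => ⟨h.1, (A x).smul_mem c h.2⟩

theorem scalarInvariant_coneSet {U : Set M} {C : ∀ x : M, Set (TangentSpace (𝓡 d) x)}
    (h : IsConeField U C) : ScalarInvariant (coneSet U C) :=
  fun _ _ c hv => smul_mem_coneSet h hv c

theorem scalarInvariant_allTime {U : Set M} {C : ∀ x : M, Set (TangentSpace (𝓡 d) x)}
    (h : IsConeField U C) (g : M ≃ₘ^1⟮𝓡 d, 𝓡 d⟯ M) : ScalarInvariant (allTime g U C) :=
  fun _ _ c hv => smul_mem_allTime h hv c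

/-- If the limits of the vectors in `P i` and of those in `Q i` are transverse, the angle between
`P i` and `Q i` is bounded from below. -/
theorem exists_angle {ι : Type*} {l : Filter ι} {P Q : ι → Set (TangentBundle (𝓡 d) M)}
    (hP : ∀ i, ScalarInvariant (P i)) (hQ : ∀ i, ScalarInvariant (Q i))
    (h : ∀ (𝒰 : Ultrafilter (ℝ × ι)) (x : ℝ × ι → M) (v w : ∀ q, TangentSpace (𝓡 d) (x q)) (x₀ : M)
      (v₀ : TangentSpace (𝓡 d) x₀), Tendsto Prod.snd (𝒰 : Filter (ℝ × ι)) l →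
      (∀ᶠ q in (𝒰 : Filter (ℝ × ι)), (⟨x q, v q⟩ : TangentBundle (𝓡 d) M) ∈ P q.2) →
      (∀ᶠ q in (𝒰 : Filter (ℝ × ι)), (⟨x q, w q⟩ : TangentBundle (𝓡 d) M) ∈ Q q.2) →
      Tendsto (fun q => (⟨x q, v q⟩ : TangentBundle (𝓡 d) M)) 𝒰 (𝓝 ⟨x₀, v₀⟩) →
      Tendsto (fun q => (⟨x q, w q⟩ : TangentBundle (𝓡 d) M)) 𝒰 (𝓝 ⟨x₀, -v₀⟩) → v₀ = 0) :
    ∃ C : ℝ, 0 ≤ C ∧ ∀ᶠ i in l, ∀ (x : M) (v w : TangentSpace (𝓡 d) x),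
      (⟨x, v⟩ : TangentBundle (𝓡 d) M) ∈ P i → (⟨x, w⟩ : TangentBundle (𝓡 d) M) ∈ Q i →
      ‖v‖ ≤ C * ‖v + w‖ ∧ ‖w‖ ≤ C * ‖v + w‖ := by
  -- The constant is itself a variable tending to infinity. Counterexamples normalized by ‖v‖ = 1
  -- satisfy v + w → 0, so the limit of w is the opposite of that of v.
  have key : ∀ᶠ q : ℝ × ι in atTop ×ˢ l,
      ∀ b : (x : M) × (TangentSpace (𝓡 d) x × TangentSpace (𝓡 d) x),
      (⟨b.1, b.2.1⟩ : TangentBundle (𝓡 d) M) ∈ P q.2 →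
      (⟨b.1, b.2.2⟩ : TangentBundle (𝓡 d) M) ∈ Q q.2 → ‖b.2.1‖ ≤ q.1 * ‖b.2.1 + b.2.2‖ := by
    refine eventually_forall_of_ultrafilter fun 𝒰 b h𝒰 hcon => ?_
    simp only [Classical.not_imp, not_le] at hcon
    have hT : Tendsto (fun q : ℝ × ι => q.1) 𝒰 atTop := tendsto_fst.mono_left h𝒰
    have hpos : ∀ᶠ q in (𝒰 : Filter (ℝ × ι)), 0 < ‖(b q).2.1‖ := by
      filter_upwards [hcon, hT.eventually_ge_atTop 0] with q hq h0
      exact lt_of_le_of_lt (mul_nonneg h0 (norm_nonneg _)) hq.2.2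
    set v : ∀ q, TangentSpace (𝓡 d) (b q).1 := fun q => ‖(b q).2.1‖⁻¹ • (b q).2.1 with hv
    set w : ∀ q, TangentSpace (𝓡 d) (b q).1 := fun q => ‖(b q).2.1‖⁻¹ • (b q).2.2 with hw
    have hv1 : ∀ᶠ q in (𝒰 : Filter (ℝ × ι)), ‖v q‖ = 1 := by
      filter_upwards [hpos] with q hq
      rw [hv]; simp only [norm_smul, norm_inv, norm_norm]
      exact inv_mul_cancel₀ hq.ne'
    have hvw : Tendsto (fun q => ‖v q + w q‖) 𝒰 (𝓝 0) := by
      refine squeeze_zero' (Eventually.of_forall fun _ => norm_nonneg _) ?_ hT.inv_tendsto_atTop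
      filter_upwards [hcon, hpos, hT.eventually_gt_atTop 0] with q hq h0 h1
      simp only [hv, hw, Pi.inv_apply, ← smul_add, norm_smul, norm_inv, norm_norm]
      rw [inv_mul_le_iff₀ h0, ← div_eq_mul_inv, le_div_iff₀ h1, mul_comm]
      exact hq.2.2.le
    obtain ⟨⟨x₀, v₀⟩, hp⟩ := exists_limit_tangentBundle 𝒰
      (F := fun q => (⟨(b q).1, v q⟩ : TangentBundle (𝓡 d) M)) (R := 1) (hv1.mono fun q hq => hq.le)
    have hs := tendsto_zero_tangentBundle (tendsto_snd_of_tendsto hp) hvw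
    have hw' : Tendsto (fun q => (⟨(b q).1, w q⟩ : TangentBundle (𝓡 d) M)) 𝒰 (𝓝 ⟨x₀, -v₀⟩) := by
      have := tendsto_add_tangentBundle hs
        (tendsto_smul_tangentBundle (tendsto_const_nhds (x := (-1 : ℝ))) hp)
      simpa using this
    have h0 := h 𝒰 (fun q => (b q).1) v w x₀ v₀ (tendsto_snd.mono_left h𝒰)
      (hcon.mono fun q hq => hP _ _ _ _ hq.1) (hcon.mono fun q hq => hQ _ _ _ _ hq.2.1) hp hw'
    have h1 : ‖v₀‖ = 1 := tendsto_nhds_unique (norm_limit hp)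
      (tendsto_const_nhds.congr' (hv1.mono fun q h => h.symm))
    rw [h0] at h1
    simp at h1
  obtain ⟨C, hC, hC0⟩ := (key.curry.and (eventually_ge_atTop 0)).exists
  -- The extra 1 pays for ‖w‖ ≤ ‖v + w‖ + ‖v‖.
  refine ⟨C + 1, by linarith, hC.mono fun i hi x v w hv hw => ?_⟩
  have h1 := hi ⟨x, v, w⟩ hv hw
  have h2 : ‖w‖ ≤ ‖v + w‖ + ‖v‖ := by
    have := norm_sub_le (v + w) v
    rwa [add_sub_cancel_left] at this
  have h3 := norm_nonneg (v + w)
  simp only at h1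
  constructor <;> nlinarith

/-- A dominated splitting `B ⊕ A` over `Λ` (with `B` dominating) and invariant cone fields
around it. -/
structure ConeSplitting (f : M ≃ₘ^1⟮𝓡 d, 𝓡 d⟯ M) (Λ U : Set M)
    (A B : ∀ x : M, Submodule ℝ (TangentSpace (𝓡 d) x))
    (Ca Cb : ∀ x : M, Set (TangentSpace (𝓡 d) x)) (n₀ : ℕ) : Prop where
  mem : ∀ x ∈ Λ, f x ∈ Λ
  mem_symm : ∀ x ∈ Λ, f.symm x ∈ Λ
  isCompl : ∀ x ∈ Λ, IsCompl (A x) (B x)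
  mapA : ∀ p ∈ subSet Λ A, tangentCMap f p ∈ subSet Λ A
  mapA_symm : ∀ p ∈ subSet Λ A, tangentCMap f.symm p ∈ subSet Λ A
  mapB : ∀ p ∈ subSet Λ B, tangentCMap f p ∈ subSet Λ B
  mapB_symm : ∀ p ∈ subSet Λ B, tangentCMap f.symm p ∈ subSet Λ B
  dom : ∀ m ≥ n₀, ∀ x ∈ Λ, ∀ a ∈ A x, ∀ b ∈ B x,
    2 * ‖((tangentCMap f)^[m] ⟨x, a⟩).snd‖ * ‖b‖ ≤ ‖a‖ * ‖((tangentCMap f)^[m] ⟨x, b⟩).snd‖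
  subset : closure Λ ⊆ U
  isOpen : IsOpen U
  backA : BackInvariant f U Ca
  backB : BackInvariant f.symm U Cb
  subA : ∀ x ∈ Λ, (A x : Set (TangentSpace (𝓡 d) x)) ⊆ Ca x
  subB : ∀ x ∈ Λ, (B x : Set (TangentSpace (𝓡 d) x)) ⊆ Cb x
  transA : ∀ x ∈ Λ, ∀ v ∈ Ca x, v ∈ B x → v = 0
  transB : ∀ x ∈ Λ, ∀ v ∈ Cb x, v ∈ A x → v = 0

theorem tangentCMap_symm_iterate (g : M ≃ₘ^1⟮𝓡 d, 𝓡 d⟯ M) (n : ℕ) (p : TangentBundle (𝓡 d) M) :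
    (tangentCMap g)^[n] ((tangentCMap g.symm)^[n] p) = p :=
  Function.LeftInverse.iterate (tangentCMap_tangentCMap_symm g) n p

theorem tendsto_const_c1 {ι : Type*} (l : Filter ι) (f : M ≃ₘ^1⟮𝓡 d, 𝓡 d⟯ M) :
    Tendsto (fun _ : ι => f) l (c1Nhds f) := by
  let _ : TopologicalSpace (M ≃ₘ^1⟮𝓡 d, 𝓡 d⟯ M) := c1Topology
  exact tendsto_const_nhds

theorem iterate_mem_of_forall {α : Type*} {T : α → α} {P : Set α} (h : ∀ p ∈ P, T p ∈ P) {p : α}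
    (hp : p ∈ P) (n : ℕ) : T^[n] p ∈ P := by
  induction n with
  | zero => exact hp
  | succ n ih => rw [Function.iterate_succ_apply']; exact h _ ih

namespace ConeSplitting

variable {f : M ≃ₘ^1⟮𝓡 d, 𝓡 d⟯ M} {Λ U : Set M}
    {A B : ∀ x : M, Submodule ℝ (TangentSpace (𝓡 d) x)}
    {Ca Cb : ∀ x : M, Set (TangentSpace (𝓡 d) x)} {n₀ : ℕ}

/-- The structure is symmetric under inversion of f with exchange of the two bundles; domination for
the inverse is the original one read from the preimage of x. Statements are proved for A and used
for both. -/
theorem symm (H : ConeSplitting f Λ U A B Ca Cb n₀) : ConeSplitting f.symm Λ U B A Cb Ca n₀ where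
  mem := H.mem_symm
  mem_symm := H.mem
  isCompl x hx := (H.isCompl x hx).symm
  mapA := H.mapB_symm
  mapA_symm := H.mapB
  mapB := H.mapA_symm
  mapB_symm := H.mapA
  dom m hm x hx b hb a ha := by
    have ha' := iterate_mem_of_forall H.mapA_symm (p := ⟨x, a⟩) ⟨hx, ha⟩ m
    have hb' := iterate_mem_of_forall H.mapB_symm (p := ⟨x, b⟩) ⟨hx, hb⟩ m
    have h1 := tangentCMap_symm_iterate f m ⟨x, a⟩
    have h2 := tangentCMap_symm_iterate f m ⟨x, b⟩
    rw [tangentCMap_iterate f.symm m] at h1 h2 ha' hb'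
    have := H.dom m hm _ ha'.1 _ ha'.2 _ hb'.2
    rw [h1, h2] at this
    rw [tangentCMap_iterate, tangentCMap_iterate]
    simp only at this ⊢
    linarith
  subset := H.subset
  isOpen := H.isOpen
  backA := H.backB
  backB := H.backA
  subA := H.subB
  subB := H.subA
  transA := H.transB
  transB := H.transA

theorem mem_closure (H : ConeSplitting f Λ U A B Ca Cb n₀) {x : M} (hx : x ∈ closure Λ) :
    f x ∈ closure Λ := map_mem_closure f.contMDiff.continuous hx H.mem

theorem iterate_mem_closure (H : ConeSplitting f Λ U A B Ca Cb n₀) {x : M} (hx : x ∈ closure Λ)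
    (n : ℕ) : f^[n] x ∈ closure Λ := iterate_mem_of_forall (fun _ => H.mem_closure) hx n

theorem proj_mem_closure {P : Set (TangentBundle (𝓡 d) M)} {S : Set M}
    (hP : ∀ p ∈ P, p.proj ∈ S) {p : TangentBundle (𝓡 d) M} (hp : p ∈ closure P) :
    p.proj ∈ closure S :=
  map_mem_closure (FiberBundle.continuous_proj (EuclideanSpace ℝ (Fin d)) (TangentSpace (𝓡 d))) hp hP

theorem closure_subset_allTime (H : ConeSplitting f Λ U A B Ca Cb n₀) :
    closure (subSet Λ A) ⊆ allTime f U Ca := by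
  intro p hp
  have hK := proj_mem_closure (S := Λ) (fun q hq => hq.1) hp
  obtain ⟨𝒰, h𝒰, hx⟩ := mem_closure_iff_ultrafilter.1 hp
  refine limit_mem_allTime H.backA (tendsto_const_c1 _ f) (F := id) hx
    (fun k => H.subset (H.iterate_mem_closure hK k)) (Filter.mem_of_superset h𝒰 fun q hq k => ?_)
  have := iterate_mem_of_forall H.mapA hq k
  exact ⟨H.subset (subset_closure this.1), H.subA _ this.1 this.2⟩

/-- Transversality extends from Λ to its closure because the nonzero cone vectors form an open set:
a nonzero limit of vectors of B inside it would have vectors of B over Λ nearby in the cone. -/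
theorem eq_zero_of_mem (H : ConeSplitting f Λ U A B Ca Cb n₀) {x : M} {v : TangentSpace (𝓡 d) x}
    (hv : (⟨x, v⟩ : TangentBundle (𝓡 d) M) ∈ coneSet U Ca)
    (hB : (⟨x, v⟩ : TangentBundle (𝓡 d) M) ∈ closure (subSet Λ B)) : v = 0 := by
  by_contra h0
  obtain ⟨q, hq1, hq2⟩ := mem_closure_iff.1 hB _ H.backA.cone.isOpen ⟨hv.1, hv.2, h0⟩
  exact hq1.2.2 (H.transA _ hq2.1 _ hq1.2.1 hq2.2)

theorem limit_mem (H : ConeSplitting f Λ U A B Ca Cb n₀) {ι : Type*} {l : Filter ι} [l.NeBot]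
    {g : ι → M ≃ₘ^1⟮𝓡 d, 𝓡 d⟯ M} (hg : Tendsto g l (c1Nhds f)) {F : ι → TangentBundle (𝓡 d) M}
    {p : TangentBundle (𝓡 d) M} (hF : Tendsto F l (𝓝 p)) (hK : p.proj ∈ closure Λ)
    (hFC : ∀ᶠ i in l, F i ∈ allTime (g i) U Ca) : p ∈ allTime f U Ca :=
  limit_mem_allTime H.backA hg hF (fun k => H.subset (H.iterate_mem_closure hK k)) hFC

theorem exists_angle_closure (H : ConeSplitting f Λ U A B Ca Cb n₀) :
    ∃ C : ℝ, 0 ≤ C ∧ ∀ (x : M) (v w : TangentSpace (𝓡 d) x), x ∈ closure Λ →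
      (⟨x, v⟩ : TangentBundle (𝓡 d) M) ∈ allTime f U Ca →
      (⟨x, w⟩ : TangentBundle (𝓡 d) M) ∈ closure (subSet Λ B) →
      ‖v‖ ≤ C * ‖v + w‖ ∧ ‖w‖ ≤ C * ‖v + w‖ := by
  obtain ⟨C, hC, h⟩ := exists_angle (ι := Unit) (l := ⊤)
    (P := fun _ => {p | p.proj ∈ closure Λ ∧ p ∈ allTime f U Ca})
    (Q := fun _ => closure (subSet Λ B))
    (fun _ x v c h => ⟨h.1, smul_mem_allTime H.backA.cone h.2 c⟩)
    (fun _ => (scalarInvariant_subSet Λ B).closure)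
    (fun 𝒰 x v w x₀ v₀ _ hv hw hvl hwl => by
      have hx₀ : x₀ ∈ closure Λ := isClosed_closure.mem_of_tendsto (tendsto_snd_of_tendsto hvl)
        (hv.mono fun q hq => hq.1)
      have h1 : (⟨x₀, -v₀⟩ : TangentBundle (𝓡 d) M) ∈ closure (subSet Λ B) :=
        isClosed_closure.mem_of_tendsto hwl hw
      have h2 := (scalarInvariant_subSet Λ B).closure x₀ (-v₀) (-1) h1
      rw [smul_neg, neg_smul, one_smul, neg_neg] at h2
      exact H.eq_zero_of_mem (H.limit_mem (tendsto_const_c1 _ f) hvl hx₀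
        (hv.mono fun q hq => hq.2) 0) h2)
  exact ⟨C, hC, fun x v w hx hv hw => eventually_top.1 h () x v w ⟨hx, hv⟩ hw⟩

theorem limSub_subset_closure {𝒰 : Ultrafilter M} {x₀ : M}
    (h𝒰 : Tendsto id (𝒰 : Filter M) (𝓝 x₀)) (hΛ : Λ ∈ 𝒰) {a : TangentSpace (𝓡 d) x₀}
    (ha : a ∈ limSub (𝒰 : Filter M) id x₀ A h𝒰) :
    (⟨x₀, a⟩ : TangentBundle (𝓡 d) M) ∈ closure (subSet Λ A) := by
  obtain ⟨α, hα, hα'⟩ := ha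
  exact mem_closure_of_tendsto hα' (Filter.mem_of_superset hΛ fun x hx => ⟨hx, hα x⟩)

theorem isCompl_limSub (H : ConeSplitting f Λ U A B Ca Cb n₀) {𝒰 : Ultrafilter M} {x₀ : M}
    (h𝒰 : Tendsto id (𝒰 : Filter M) (𝓝 x₀)) (hΛ : Λ ∈ 𝒰) :
    IsCompl (limSub (𝒰 : Filter M) id x₀ A h𝒰) (limSub (𝒰 : Filter M) id x₀ B h𝒰) := by
  obtain ⟨C, hC, h⟩ := H.exists_angle_closure
  refine DomPesin.isCompl_limSub 𝒰 h𝒰 (c := C)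
    (Filter.mem_of_superset hΛ fun x hx => (H.isCompl x hx).sup_eq_top)
    (Filter.mem_of_superset hΛ fun x hx a ha b hb => ?_)
  exact (h x a b (subset_closure hx) (H.closure_subset_allTime (subset_closure ⟨hx, ha⟩))
    (subset_closure ⟨hx, hb⟩)).1

theorem dom_limSub (H : ConeSplitting f Λ U A B Ca Cb n₀) {𝒰 : Ultrafilter M} {x₀ : M}
    (h𝒰 : Tendsto id (𝒰 : Filter M) (𝓝 x₀)) (hΛ : Λ ∈ 𝒰) {a b : TangentSpace (𝓡 d) x₀}
    (ha : a ∈ limSub (𝒰 : Filter M) id x₀ A h𝒰) (hb : b ∈ limSub (𝒰 : Filter M) id x₀ B h𝒰)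
    {m : ℕ} (hm : n₀ ≤ m) (k : ℕ) :
    2 * ‖((tangentCMap f)^[k + m] ⟨x₀, a⟩).snd‖ * ‖((tangentCMap f)^[k] ⟨x₀, b⟩).snd‖ ≤
      ‖((tangentCMap f)^[k] ⟨x₀, a⟩).snd‖ * ‖((tangentCMap f)^[k + m] ⟨x₀, b⟩).snd‖ := by
  obtain ⟨α, hα, hα'⟩ := ha
  obtain ⟨β, hβ, hβ'⟩ := hb
  have hf := tendsto_const_c1 (𝒰 : Filter M) f
  refine le_of_tendsto_of_tendsto
    (((norm_limit (tendsto_tangentCMap_iterate hf hα' (k + m))).const_mul 2).mul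
      (norm_limit (tendsto_tangentCMap_iterate hf hβ' k)))
    ((norm_limit (tendsto_tangentCMap_iterate hf hα' k)).mul
      (norm_limit (tendsto_tangentCMap_iterate hf hβ' (k + m)))) ?_
  filter_upwards [hΛ] with x hx
  have h1 := iterate_mem_of_forall H.mapA (p := ⟨x, α x⟩) ⟨hx, hα x⟩ k
  have h2 := iterate_mem_of_forall H.mapB (p := ⟨x, β x⟩) ⟨hx, hβ x⟩ k
  have e : ∀ p, (tangentCMap f)^[k + m] p = (tangentCMap f)^[m] ((tangentCMap f)^[k] p) := fun p => by
    rw [add_comm, Function.iterate_add_apply]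
  change 2 * ‖((tangentCMap f)^[k + m] ⟨x, α x⟩).snd‖ * ‖((tangentCMap f)^[k] ⟨x, β x⟩).snd‖ ≤
    ‖((tangentCMap f)^[k] ⟨x, α x⟩).snd‖ * ‖((tangentCMap f)^[k + m] ⟨x, β x⟩).snd‖
  rw [e, e]
  rw [tangentCMap_iterate f k x] at h1 h2
  rw [tangentCMap_iterate f k x, tangentCMap_iterate f k x]
  exact H.dom m hm _ h1.1 _ h1.2 _ h2.2

/-- If v = a + b stays in the cones, it keeps a definite angle with the limits of B, so the iterates
of b are bounded by a multiple of those of a. Domination makes them outgrow those of a unless b = 0.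
In particular the limit space does not depend on the ultrafilter. -/
theorem mem_limSub_iff (H : ConeSplitting f Λ U A B Ca Cb n₀) {𝒰 : Ultrafilter M} {x₀ : M}
    (h𝒰 : Tendsto id (𝒰 : Filter M) (𝓝 x₀)) (hΛ : Λ ∈ 𝒰) (v : TangentSpace (𝓡 d) x₀) :
    v ∈ limSub (𝒰 : Filter M) id x₀ A h𝒰 ↔
      (⟨x₀, v⟩ : TangentBundle (𝓡 d) M) ∈ allTime f U Ca := by
  refine ⟨fun h => H.closure_subset_allTime (limSub_subset_closure h𝒰 hΛ h), fun hv => ?_⟩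
  have hx₀ : x₀ ∈ closure Λ := mem_closure_of_tendsto h𝒰 hΛ
  obtain ⟨a, ha, b, hb, hab⟩ := Submodule.mem_sup.1
    ((H.isCompl_limSub h𝒰 hΛ).sup_eq_top ▸ Submodule.mem_top : v ∈ _ ⊔ _)
  suffices hb0 : b = 0 by rwa [← hab, hb0, add_zero]
  obtain ⟨C, hC, hang⟩ := H.exists_angle_closure
  have hB := limSub_subset_closure h𝒰 hΛ hb
  have hBk : ∀ k, (tangentCMap f)^[k] ⟨x₀, b⟩ ∈ closure (subSet Λ B) := fun k =>
    map_mem_closure ((tangentCMap f).continuous.iterate k) hB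
      fun p hp => iterate_mem_of_forall H.mapB hp k
  have key : ‖((tangentCMap f)^[0] ⟨x₀, b⟩).snd‖ = 0 := by
    refine eq_zero_of_dominated (κ := 2) (n := n₀) (c := C + 1 + C)
      (α := fun k => ‖((tangentCMap f)^[k] ⟨x₀, a⟩).snd‖)
      (β := fun k => ‖((tangentCMap f)^[k] ⟨x₀, b⟩).snd‖) (by norm_num)
      (fun _ => norm_nonneg _) (fun _ => norm_nonneg _) ?_ ?_
      (fun k => H.dom_limSub h𝒰 hΛ ha hb le_rfl k)
    · intro h0 k hk
      induction k with
      | zero => exact h0 hk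
      | succ k ih =>
        rw [Function.iterate_succ_apply'] at hk
        exact ih (by rw [tangentCMap_snd_ne_zero f (norm_eq_zero.1 hk), norm_zero])
    · intro k
      have h1 := tangentCMap_mem_allTime hv k
      have h2 := (scalarInvariant_subSet Λ B).closure _ _ (-1) (hBk k)
      rw [tangentCMap_iterate] at h1 h2
      rw [tangentCMap_iterate, tangentCMap_iterate]
      have h3 := hang _ _ _ (H.iterate_mem_closure hx₀ k) h1 h2
      have h4 : mfderiv (𝓡 d) (𝓡 d) f^[k] x₀ v + (-1 : ℝ) • mfderiv (𝓡 d) (𝓡 d) f^[k] x₀ b =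
          mfderiv (𝓡 d) (𝓡 d) f^[k] x₀ a := by
        rw [← hab, map_add]; simp
      rw [h4, norm_smul, norm_neg, norm_one, one_mul] at h3
      have h5 := norm_nonneg (mfderiv (𝓡 d) (𝓡 d) f^[k] x₀ a)
      simp only
      nlinarith [h3.2]
  exact norm_eq_zero.1 key

/-- Over the closure of `Λ`, the vectors that stay in the cones form a dominated splitting. -/
theorem exists_splitting (H : ConeSplitting f Λ U A B Ca Cb n₀) {x₀ : M} (hx₀ : x₀ ∈ closure Λ) :
    ∃ F E : Submodule ℝ (TangentSpace (𝓡 d) x₀), IsCompl F E ∧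
      (∀ v, v ∈ F ↔ (⟨x₀, v⟩ : TangentBundle (𝓡 d) M) ∈ allTime f U Ca) ∧
      (∀ v, v ∈ E ↔ (⟨x₀, v⟩ : TangentBundle (𝓡 d) M) ∈ allTime f.symm U Cb) ∧
      ∀ m ≥ n₀, ∀ a ∈ F, ∀ b ∈ E,
        2 * ‖((tangentCMap f)^[m] ⟨x₀, a⟩).snd‖ * ‖b‖ ≤
          ‖a‖ * ‖((tangentCMap f)^[m] ⟨x₀, b⟩).snd‖ := by
  obtain ⟨𝒰, hΛ, h𝒰⟩ := mem_closure_iff_ultrafilter.1 hx₀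
  have h𝒰' : Tendsto id (𝒰 : Filter M) (𝓝 x₀) := h𝒰
  refine ⟨_, _, H.isCompl_limSub h𝒰' hΛ, H.mem_limSub_iff h𝒰' hΛ, H.symm.mem_limSub_iff h𝒰' hΛ,
    fun m hm a ha b hb => ?_⟩
  have := H.dom_limSub h𝒰' hΛ ha hb hm 0
  rwa [zero_add] at this

end ConeSplitting

end ConeSplitting

/-! ### Dominated splittings over maximal invariant sets, from cones -/

section Adapted

variable {d : ℕ} {M : Type*} [MetricSpace M] [CompactSpace M]
  [ChartedSpace (EuclideanSpace ℝ (Fin d)) M] [IsManifold (𝓡 d) ∞ M]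
  [RiemannianBundle (fun x : M => TangentSpace (𝓡 d) x)]
  [IsContMDiffRiemannianBundle (𝓡 d) ∞ (EuclideanSpace ℝ (Fin d))
      (fun x : M => TangentSpace (𝓡 d) x)]

theorem maxInvariant_subset (g : M ≃ₘ^1⟮𝓡 d, 𝓡 d⟯ M) (V : Set M) : maxInvariant g V ⊆ V :=
  fun _ hx => (hx 0).1

theorem maxInvariant_symm (g : M ≃ₘ^1⟮𝓡 d, 𝓡 d⟯ M) (V : Set M) :
    maxInvariant g.symm V = maxInvariant g V := by
  ext x; exact forall_congr' fun n => and_comm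

theorem map_mem_maxInvariant {g : M ≃ₘ^1⟮𝓡 d, 𝓡 d⟯ M} {V : Set M} {x : M}
    (hx : x ∈ maxInvariant g V) : g x ∈ maxInvariant g V := by
  intro n
  refine ⟨by rw [← Function.iterate_succ_apply g]; exact (hx (n + 1)).1, ?_⟩
  cases n with
  | zero => exact (hx 1).1
  | succ n => rw [Function.iterate_succ_apply, g.symm_apply_apply]; exact (hx n).2

theorem iterate_mem_maxInvariant {g : M ≃ₘ^1⟮𝓡 d, 𝓡 d⟯ M} {V : Set M} {x : M}
    (hx : x ∈ maxInvariant g V) (n : ℕ) : g^[n] x ∈ maxInvariant g V :=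
  iterate_mem_of_forall (fun _ => map_mem_maxInvariant) hx n

theorem symm_mem_maxInvariant {g : M ≃ₘ^1⟮𝓡 d, 𝓡 d⟯ M} {V : Set M} {x : M}
    (hx : x ∈ maxInvariant g V) : g.symm x ∈ maxInvariant g V := by
  rw [← maxInvariant_symm] at hx ⊢
  exact map_mem_maxInvariant hx

/-- The properties of a diffeomorphism `g` and of an open set `V` which imply that the vectors that
stay in the cones over `V` form a dominated splitting over the maximal invariant set of `V`. -/
structure Adapted (g : M ≃ₘ^1⟮𝓡 d, 𝓡 d⟯ M) (U V : Set M)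
    (Ca Cb : ∀ x : M, Set (TangentSpace (𝓡 d) x)) (C : ℝ) (n₀ : ℕ) : Prop where
  subset : V ⊆ U
  coneA : IsConeField U Ca
  coneB : IsConeField U Cb
  backA : ∀ p : TangentBundle (𝓡 d) M, p.proj ∈ V → g p.proj ∈ V →
    tangentCMap g p ∈ closure (coneSet U Ca) → p ∈ coneSet U Ca
  backB : ∀ p : TangentBundle (𝓡 d) M, p.proj ∈ V → g.symm p.proj ∈ V →
    tangentCMap g.symm p ∈ closure (coneSet U Cb) → p ∈ coneSet U Cb
  angle : ∀ (x : M) (v w : TangentSpace (𝓡 d) x), x ∈ maxInvariant g V →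
    (⟨x, v⟩ : TangentBundle (𝓡 d) M) ∈ allTime g U Ca →
    (⟨x, w⟩ : TangentBundle (𝓡 d) M) ∈ allTime g.symm U Cb →
    ‖v‖ ≤ C * ‖v + w‖ ∧ ‖w‖ ≤ C * ‖v + w‖
  dom : ∀ m ≥ n₀, ∀ (x : M) (v w : TangentSpace (𝓡 d) x), x ∈ maxInvariant g V →
    (⟨x, v⟩ : TangentBundle (𝓡 d) M) ∈ allTime g U Ca →
    (⟨x, w⟩ : TangentBundle (𝓡 d) M) ∈ allTime g.symm U Cb →
    19 / 10 * ‖((tangentCMap g)^[m] ⟨x, v⟩).snd‖ * ‖w‖ ≤ ‖v‖ * ‖((tangentCMap g)^[m] ⟨x, w⟩).snd‖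

/-- The backward orbit of the image is the old backward orbit with one point added in front; only
that new point needs the invariance of the cones. -/
theorem map_mem_allTime_symm {g : M ≃ₘ^1⟮𝓡 d, 𝓡 d⟯ M} {U V : Set M}
    {C : ∀ x : M, Set (TangentSpace (𝓡 d) x)}
    (back : ∀ p : TangentBundle (𝓡 d) M, p.proj ∈ V → g.symm p.proj ∈ V →
      tangentCMap g.symm p ∈ closure (coneSet U C) → p ∈ coneSet U C)
    {p : TangentBundle (𝓡 d) M} (hx : p.proj ∈ V) (hgx : g p.proj ∈ V)
    (hp : p ∈ allTime g.symm U C) : tangentCMap g p ∈ allTime g.symm U C := by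
  intro k
  cases k with
  | zero =>
    change tangentCMap g p ∈ coneSet U C
    refine back _ hgx ?_ ?_
    · rw [tangentCMap_proj, g.symm_apply_apply]; exact hx
    · rw [tangentCMap_symm_tangentCMap]; exact subset_closure (hp 0)
  | succ k => rw [Function.iterate_succ_apply, tangentCMap_symm_tangentCMap]; exact hp k

theorem iterate_mem_allTime_symm {g : M ≃ₘ^1⟮𝓡 d, 𝓡 d⟯ M} {U V : Set M}
    {C : ∀ x : M, Set (TangentSpace (𝓡 d) x)}
    (back : ∀ p : TangentBundle (𝓡 d) M, p.proj ∈ V → g.symm p.proj ∈ V →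
      tangentCMap g.symm p ∈ closure (coneSet U C) → p ∈ coneSet U C)
    {p : TangentBundle (𝓡 d) M} (hx : p.proj ∈ maxInvariant g V)
    (hp : p ∈ allTime g.symm U C) (n : ℕ) : (tangentCMap g)^[n] p ∈ allTime g.symm U C := by
  induction n with
  | zero => exact hp
  | succ n ih =>
    rw [Function.iterate_succ_apply']
    refine map_mem_allTime_symm back ?_ ?_ ih
    · rw [tangentCMap_iterate_proj]; exact (hx n).1
    · rw [tangentCMap_iterate_proj, ← Function.iterate_succ_apply' g]; exact (hx (n + 1)).1

theorem tangentCMap_iterate_snd_ne_zero (g : M ≃ₘ^1⟮𝓡 d, 𝓡 d⟯ M) {p : TangentBundle (𝓡 d) M} {n : ℕ}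
    (h : ((tangentCMap g)^[n] p).snd = 0) : p.snd = 0 := by
  induction n with
  | zero => exact h
  | succ n ih => rw [Function.iterate_succ_apply'] at h; exact ih (tangentCMap_snd_ne_zero g h)

/-- The invertible linear map `Dg^n(x)`. -/
def iterEquiv (g : M ≃ₘ^1⟮𝓡 d, 𝓡 d⟯ M) (n : ℕ) (x : M) :
    TangentSpace (𝓡 d) x ≃ₗ[ℝ] TangentSpace (𝓡 d) (g^[n] x) :=
  LinearEquiv.ofInjectiveOfFinrankEq (mfderiv (𝓡 d) (𝓡 d) g^[n] x).toLinearMap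
    (by
      rw [← LinearMap.ker_eq_bot, LinearMap.ker_eq_bot']
      intro v hv
      exact tangentCMap_iterate_snd_ne_zero g (p := ⟨x, v⟩) (n := n)
        (by rw [tangentCMap_iterate]; exact hv))
    (by rw [finrank_tangentSpace, finrank_tangentSpace])

theorem tangentCMap_iterate_eq (g : M ≃ₘ^1⟮𝓡 d, 𝓡 d⟯ M) (n : ℕ) (x : M) (v : TangentSpace (𝓡 d) x) :
    (tangentCMap g)^[n] ⟨x, v⟩ = ⟨g^[n] x, iterEquiv g n x v⟩ := tangentCMap_iterate g n x v

namespace Adapted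

variable {g : M ≃ₘ^1⟮𝓡 d, 𝓡 d⟯ M} {U V W : Set M}
    {Ca Cb : ∀ x : M, Set (TangentSpace (𝓡 d) x)} {C : ℝ} {n₀ : ℕ}

theorem symm (H : Adapted g U V Ca Cb C n₀) : Adapted g.symm U V Cb Ca C n₀ where
  subset := H.subset
  coneA := H.coneB
  coneB := H.coneA
  backA := H.backB
  backB := H.backA
  angle x v w hx hv hw := by
    rw [maxInvariant_symm] at hx
    have := H.angle x w v hx hw hv
    rw [add_comm] at this
    exact this.symm
  dom m hm x v w hx hv hw := by
    have hx' := iterate_mem_maxInvariant hx m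
    rw [maxInvariant_symm] at hx'
    have hw' := iterate_mem_allTime_symm (g := g.symm) H.backA (p := ⟨x, w⟩) hx hw m
    have hv' := tangentCMap_mem_allTime hv m
    have h1 := tangentCMap_symm_iterate g m ⟨x, v⟩
    have h2 := tangentCMap_symm_iterate g m ⟨x, w⟩
    rw [tangentCMap_iterate g.symm m] at h1 h2 hv' hw'
    have := H.dom m hm _ _ _ hx' hw' hv'
    rw [h1, h2] at this
    rw [tangentCMap_iterate, tangentCMap_iterate]
    simp only at this ⊢
    linarith

theorem mem_coneSet_of_iterate (H : Adapted g U V Ca Cb C n₀) {p : TangentBundle (𝓡 d) M}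
    (hp : p.proj ∈ maxInvariant g V) {n : ℕ} (h : (tangentCMap g)^[n] p ∈ coneSet U Ca) :
    ∀ j ≤ n, (tangentCMap g)^[j] p ∈ coneSet U Ca := by
  intro j hj
  induction hj using Nat.decreasingInduction with
  | self => exact h
  | of_succ k hk ih =>
    rw [Function.iterate_succ_apply'] at ih
    refine H.backA _ ?_ ?_ (subset_closure ih)
    · rw [tangentCMap_iterate_proj]; exact (hp k).1
    · rw [tangentCMap_iterate_proj, ← Function.iterate_succ_apply' g]; exact (hp (k + 1)).1

/-- By backward invariance, a vector in the cone at time ν i is in it at all earlier times. As ν i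
tends to infinity every fixed time is eventually covered, and one more step removes the closure. -/
theorem limit_mem_allTime (H : Adapted g U V Ca Cb C n₀) {ι : Type*} {l : Filter ι} [l.NeBot]
    {ν : ι → ℕ} (hν : Tendsto ν l atTop) {F : ι → TangentBundle (𝓡 d) M}
    {p : TangentBundle (𝓡 d) M} (hF : Tendsto F l (𝓝 p)) (hp : p.proj ∈ maxInvariant g V)
    (hFC : ∀ᶠ i in l, (F i).proj ∈ maxInvariant g V ∧ (tangentCMap g)^[ν i] (F i) ∈ coneSet U Ca) :
    p ∈ allTime g U Ca := by
  have h1 : ∀ k, (tangentCMap g)^[k] p ∈ closure (coneSet U Ca) := fun k => by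
    refine mem_closure_of_tendsto ((((tangentCMap g).continuous.iterate k).tendsto p).comp hF) ?_
    filter_upwards [hFC, hν.eventually_ge_atTop k] with i h1 h2
    exact H.mem_coneSet_of_iterate h1.1 h1.2 k h2
  intro k
  refine H.backA _ ?_ ?_ ?_
  · rw [tangentCMap_iterate_proj]; exact (hp k).1
  · rw [tangentCMap_iterate_proj, ← Function.iterate_succ_apply' g]; exact (hp (k + 1)).1
  · rw [← Function.iterate_succ_apply' (tangentCMap g)]; exact h1 (k + 1)

/-- The growth argument used for f over the closure of Λ: a component in E would be expanded
relative to the one in F without bound. Hence the splitting inside the cones is unique, and thereby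
invariant. -/
theorem mem_of_isCompl (H : Adapted g U V Ca Cb C n₀) {x : M} (hx : x ∈ maxInvariant g V)
    {F E : Submodule ℝ (TangentSpace (𝓡 d) x)} (hFE : IsCompl F E)
    (hF : ∀ v ∈ F, (⟨x, v⟩ : TangentBundle (𝓡 d) M) ∈ allTime g U Ca)
    (hE : ∀ v ∈ E, (⟨x, v⟩ : TangentBundle (𝓡 d) M) ∈ allTime g.symm U Cb)
    {v : TangentSpace (𝓡 d) x} (hv : (⟨x, v⟩ : TangentBundle (𝓡 d) M) ∈ allTime g U Ca) : v ∈ F := by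
  obtain ⟨a, ha, b, hb, hab⟩ := Submodule.mem_sup.1
    (hFE.sup_eq_top ▸ Submodule.mem_top : v ∈ F ⊔ E)
  suffices hb0 : b = 0 by rwa [← hab, hb0, add_zero]
  have hak := fun k => tangentCMap_mem_allTime (hF a ha) k
  have hvk := fun k => tangentCMap_mem_allTime hv k
  have hbk := fun k => iterate_mem_allTime_symm H.backB (p := ⟨x, b⟩) hx (hE b hb) k
  have key : ‖((tangentCMap g)^[0] ⟨x, b⟩).snd‖ = 0 := by
    refine eq_zero_of_dominated (κ := 19 / 10) (n := n₀) (c := C)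
      (α := fun k => ‖((tangentCMap g)^[k] ⟨x, a⟩).snd‖)
      (β := fun k => ‖((tangentCMap g)^[k] ⟨x, b⟩).snd‖) (by norm_num)
      (fun _ => norm_nonneg _) (fun _ => norm_nonneg _) ?_ ?_ ?_
    · exact fun h0 k hk => h0 (norm_eq_zero.2 (tangentCMap_iterate_snd_ne_zero g (norm_eq_zero.1 hk)))
    · intro k
      have h1 := hvk k
      have h2 := hbk k
      rw [tangentCMap_iterate] at h1 h2
      rw [tangentCMap_iterate, tangentCMap_iterate]
      have h3 := H.angle _ _ _ (iterate_mem_maxInvariant hx k) h1 (smul_mem_allTime H.coneB h2 (-1))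
      have h4 : mfderiv (𝓡 d) (𝓡 d) g^[k] x v + (-1 : ℝ) • mfderiv (𝓡 d) (𝓡 d) g^[k] x b =
          mfderiv (𝓡 d) (𝓡 d) g^[k] x a := by
        rw [← hab, map_add]; simp
      rw [h4, norm_smul, norm_neg, norm_one, one_mul] at h3
      exact h3.2
    · intro k
      have e : ∀ p, (tangentCMap g)^[k + n₀] p = (tangentCMap g)^[n₀] ((tangentCMap g)^[k] p) :=
        fun p => by rw [add_comm, Function.iterate_add_apply]
      have h1 := hak k
      have h2 := hbk k
      rw [tangentCMap_iterate g k x] at h1 h2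
      rw [e, e, tangentCMap_iterate g k x, tangentCMap_iterate g k x]
      exact H.dom n₀ le_rfl _ _ _ (iterate_mem_maxInvariant hx k) h1 h2
  exact norm_eq_zero.1 key

/-- Subspaces in the cones at gⁿ(x) and g⁻ⁿ(x) are transported to x. Their vectors stay in the cones
up to time n, so for large n they make a uniform angle and their limits stay forever. The function
D, constant along orbits, makes the dimensions match. -/
theorem exists_isCompl (H : Adapted g U V Ca Cb C n₀) {D : M → ℕ}
    (hD : ∀ y ∈ V, g y ∈ V → D (g y) = D y)
    (hFE : ∀ y ∈ V, ∃ F E : Submodule ℝ (TangentSpace (𝓡 d) y),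
      (F : Set (TangentSpace (𝓡 d) y)) ⊆ Ca y ∧ (E : Set (TangentSpace (𝓡 d) y)) ⊆ Cb y ∧
      Module.finrank ℝ F = D y ∧ d ≤ D y + Module.finrank ℝ E)
    {x : M} (hx : x ∈ maxInvariant g V) :
    ∃ F E : Submodule ℝ (TangentSpace (𝓡 d) x), IsCompl F E ∧
      (∀ v ∈ F, (⟨x, v⟩ : TangentBundle (𝓡 d) M) ∈ allTime g U Ca) ∧
      (∀ v ∈ E, (⟨x, v⟩ : TangentBundle (𝓡 d) M) ∈ allTime g.symm U Cb) := by
  have hDf : ∀ n, D (g^[n] x) = D x := fun n => by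
    induction n with
    | zero => rfl
    | succ n ih =>
      rw [Function.iterate_succ_apply', hD _ (hx n).1, ih]
      rw [← Function.iterate_succ_apply' g]; exact (hx (n + 1)).1
  have hDb : ∀ n, D (g.symm^[n] x) = D x := fun n => by
    induction n with
    | zero => rfl
    | succ n ih =>
      have h1 := (hx (n + 1)).2
      have h2 : g (g.symm^[n + 1] x) = g.symm^[n] x := by
        rw [Function.iterate_succ_apply', g.apply_symm_apply]
      rw [← ih, ← h2, hD _ h1 (by rw [h2]; exact (hx n).2)]
  choose! F E hF hE hdF hdE using hFE
  set F' : ℕ → Submodule ℝ (TangentSpace (𝓡 d) x) := fun n =>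
    (F (g^[n] x)).map (iterEquiv g n x).symm.toLinearMap with hF'
  set E' : ℕ → Submodule ℝ (TangentSpace (𝓡 d) x) := fun n =>
    (E (g.symm^[n] x)).map (iterEquiv g.symm n x).symm.toLinearMap with hE'
  have hFc : ∀ n, ∀ v ∈ F' n, (tangentCMap g)^[n] ⟨x, v⟩ ∈ coneSet U Ca := by
    rintro n v ⟨w, hw, rfl⟩
    rw [tangentCMap_iterate_eq]
    refine ⟨H.subset (hx n).1, ?_⟩
    simp only [LinearEquiv.coe_coe, LinearEquiv.apply_symm_apply]
    exact hF _ (hx n).1 hw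
  have hEc : ∀ n, ∀ v ∈ E' n, (tangentCMap g.symm)^[n] ⟨x, v⟩ ∈ coneSet U Cb := by
    rintro n v ⟨w, hw, rfl⟩
    rw [tangentCMap_iterate_eq]
    refine ⟨H.subset (hx n).2, ?_⟩
    simp only [LinearEquiv.coe_coe, LinearEquiv.apply_symm_apply]
    exact hE _ (hx n).2 hw
  have hx' : x ∈ maxInvariant g.symm V := by rwa [maxInvariant_symm]
  have hsc : ∀ (h : M ≃ₘ^1⟮𝓡 d, 𝓡 d⟯ M) (Cc : ∀ x : M, Set (TangentSpace (𝓡 d) x)),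
      IsConeField U Cc → ∀ n : ℕ, ScalarInvariant
      {p : TangentBundle (𝓡 d) M | p.proj = x ∧ (tangentCMap h)^[n] p ∈ coneSet U Cc} := by
    intro h Cc hc n y v c hv
    refine ⟨hv.1, ?_⟩
    have := hv.2
    rw [tangentCMap_iterate] at this ⊢
    rw [map_smul]
    exact smul_mem_coneSet hc this c
  obtain ⟨c, hc, hang⟩ := exists_angle (ι := ℕ) (l := atTop)
    (P := fun n => {p | p.proj = x ∧ (tangentCMap g)^[n] p ∈ coneSet U Ca})
    (Q := fun n => {p | p.proj = x ∧ (tangentCMap g.symm)^[n] p ∈ coneSet U Cb})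
    (hsc g Ca H.coneA) (hsc g.symm Cb H.coneB)
    (fun 𝒰 y v w x₀ v₀ hl hv hw hvl hwl => by
      have hyx : x₀ = x := tendsto_nhds_unique (tendsto_snd_of_tendsto hvl)
        (tendsto_const_nhds.congr' (hv.mono fun q hq => hq.1.symm))
      subst hyx
      have h1 := H.limit_mem_allTime hl hvl hx (hv.mono fun q hq => ⟨by rw [hq.1]; exact hx, hq.2⟩)
      have h2 := H.symm.limit_mem_allTime hl hwl hx'
        (hw.mono fun q hq => ⟨by rw [hq.1]; exact hx', hq.2⟩)
      have h3 := (H.angle _ _ _ hx h1 h2).1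
      rw [add_neg_cancel, norm_zero, mul_zero] at h3
      exact norm_le_zero_iff.1 h3)
  have hang' : ∀ᶠ n in (hyperfilter ℕ : Filter ℕ), ∀ a ∈ F' n, ∀ b ∈ E' n, ‖a‖ ≤ c * ‖a + b‖ :=
    (hang.filter_mono Nat.hyperfilter_le_atTop).mono fun n hn a ha b hb =>
      (hn x a b ⟨rfl, hFc n a ha⟩ ⟨rfl, hEc n b hb⟩).1
  have hc0 : Tendsto (fun _ : ℕ => x) (hyperfilter ℕ : Filter ℕ) (𝓝 x) := tendsto_const_nhds
  refine ⟨limSub (hyperfilter ℕ : Filter ℕ) (fun _ => x) x F' hc0,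
    limSub (hyperfilter ℕ : Filter ℕ) (fun _ => x) x E' hc0, isCompl_limSub (hyperfilter ℕ) hc0
      (c := c) (hang'.mono fun n hn => ?_) hang', ?_, ?_⟩
  -- The dimensions sum to at least d since D takes the same value at both ends of the orbit
  -- segment, and the angle bound excludes a common vector.
  · refine Submodule.eq_top_of_disjoint _ _ ?_ ?_
    · rw [hF', hE']
      simp only
      rw [LinearEquiv.finrank_map_eq, LinearEquiv.finrank_map_eq, finrank_tangentSpace,
        hdF _ (hx n).1, hDf, ← hDb n]
      exact hdE _ (hx n).2
    · rw [Submodule.disjoint_def]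
      intro a ha ha'
      have := hn a ha (-a) ((E' n).neg_mem ha')
      rw [add_neg_cancel, norm_zero, mul_zero] at this
      exact norm_le_zero_iff.1 this
  · rintro a ⟨α, hα, hα'⟩
    exact H.limit_mem_allTime (Nat.hyperfilter_le_atTop) hα' hx
      (Eventually.of_forall fun n => ⟨hx, hFc n _ (hα n)⟩)
  · rintro a ⟨α, hα, hα'⟩
    exact H.symm.limit_mem_allTime (Nat.hyperfilter_le_atTop) hα' hx'
      (Eventually.of_forall fun n => ⟨hx', hEc n _ (hα n)⟩)

end Adapted

end Adapted

/-! ### Persistence of the estimates when g is near f and V is near the closure of Λ -/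

section Robust

variable {d : ℕ} {M : Type*} [MetricSpace M] [CompactSpace M]
  [ChartedSpace (EuclideanSpace ℝ (Fin d)) M] [IsManifold (𝓡 d) ∞ M]
  [RiemannianBundle (fun x : M => TangentSpace (𝓡 d) x)]
  [IsContMDiffRiemannianBundle (𝓡 d) ∞ (EuclideanSpace ℝ (Fin d))
      (fun x : M => TangentSpace (𝓡 d) x)]

/-- The filter of pairs `(g, V)` where `g` is `C^1`-close to `f` and `V` is contained in a small
neighbourhood of `K`. -/
def nearFilter (f : M ≃ₘ^1⟮𝓡 d, 𝓡 d⟯ M) (K : Set M) : Filter ((M ≃ₘ^1⟮𝓡 d, 𝓡 d⟯ M) × Set M) :=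
  c1Nhds f ×ˢ (𝓝ˢ K).smallSets

theorem tendsto_nearFilter_symm (f : M ≃ₘ^1⟮𝓡 d, 𝓡 d⟯ M) (K : Set M) :
    Tendsto (fun q : (M ≃ₘ^1⟮𝓡 d, 𝓡 d⟯ M) × Set M => (q.1.symm, q.2)) (nearFilter f K)
      (nearFilter f.symm K) := (tendsto_c1_symm f).prodMap tendsto_id

theorem exists_open_of_eventually_near {f : M ≃ₘ^1⟮𝓡 d, 𝓡 d⟯ M} {K : Set M}
    {P : (M ≃ₘ^1⟮𝓡 d, 𝓡 d⟯ M) × Set M → Prop} (h : ∀ᶠ q in nearFilter f K, P q) :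
    ∃ V₀ : Set M, IsOpen V₀ ∧ K ⊆ V₀ ∧ ∀ᶠ g in c1Nhds f, ∀ V ⊆ V₀, P (g, V) := by
  obtain ⟨pa, ha, pb, hb, hab⟩ := eventually_prod_iff.1 h
  obtain ⟨s, hs, hsb⟩ := eventually_smallSets.1 hb
  obtain ⟨V₀, hV₀, hK, hV₀s⟩ := mem_nhdsSet_iff_exists.1 hs
  exact ⟨V₀, hV₀, hK, ha.mono fun g hg V hV => hab hg (hsb V (hV.trans hV₀s))⟩

/-- Counterexamples over shrinking neighbourhoods accumulate over K itself, where the splitting of f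
is available. -/
theorem limit_mem_of_smallSets {ι : Type*} {l : Filter ι} [l.NeBot] {K : Set M} (hK : IsClosed K)
    {V : ι → Set M} (hV : Tendsto V l (𝓝ˢ K).smallSets) {x : ι → M} {x₀ : M}
    (hx : Tendsto x l (𝓝 x₀)) (hxV : ∀ᶠ i in l, x i ∈ V i) : x₀ ∈ K := by
  by_contra h
  have hdis : Disjoint (𝓝ˢ K) (𝓝 x₀) := by
    rw [disjoint_nhdsSet_nhds, hK.closure_eq]; exact h
  have h1 : Tendsto x l (𝓝ˢ K) := fun s hs => by
    have hVs := hV.eventually (eventually_smallSets.2 ⟨s, hs, fun t ht => ht⟩)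
    exact mem_map.2 (by filter_upwards [hVs, hxV] with i hi hi' using hi hi')
  exact hx.not_tendsto hdis.symm h1

theorem norm_inv_norm_smul {x : M} {v : TangentSpace (𝓡 d) x} (hv : v ≠ 0) : ‖‖v‖⁻¹ • v‖ = 1 := by
  rw [norm_smul, norm_inv, norm_norm, inv_mul_cancel₀ (norm_ne_zero_iff.2 hv)]

theorem norm_eq_one_of_limit {ι : Type*} {l : Filter ι} [l.NeBot] {F : ι → TangentBundle (𝓡 d) M}
    {p : TangentBundle (𝓡 d) M} (h : Tendsto F l (𝓝 p)) (h1 : ∀ᶠ i in l, ‖(F i).snd‖ = 1) :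
    ‖p.snd‖ = 1 :=
  tendsto_nhds_unique (norm_limit h) (tendsto_const_nhds.congr' (h1.mono fun _ h => h.symm))

/-- The identification of nearby tangent spaces given by the chart around `x₀`. -/
def transport (x₀ x : M) : TangentSpace (𝓡 d) x₀ →L[ℝ] TangentSpace (𝓡 d) x :=
  (chartDInv x₀ x).comp (chartD x₀ x₀)

theorem transport_injective {x₀ x : M} (hx : x ∈ (chartAt (EuclideanSpace ℝ (Fin d)) x₀).source) :
    Function.Injective (transport (d := d) x₀ x) := by
  intro u v h
  have h1 : chartD x₀ x (transport x₀ x u) = chartD x₀ x (transport x₀ x v) := congrArg _ h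
  simp only [transport, ContinuousLinearMap.comp_apply, chartD_chartDInv hx] at h1
  rw [← chartDInv_chartD (mem_chart_self x₀) u, h1, chartDInv_chartD (mem_chart_self x₀)]

theorem finrank_map_transport {x₀ x : M}
    (hx : x ∈ (chartAt (EuclideanSpace ℝ (Fin d)) x₀).source)
    (F : Submodule ℝ (TangentSpace (𝓡 d) x₀)) :
    Module.finrank ℝ (F.map (transport x₀ x).toLinearMap) = Module.finrank ℝ F :=
  (Submodule.equivMapOfInjective _ (transport_injective hx) F).finrank_eq.symm

theorem mem_of_tendsto_submodule {ι : Type*} {l : Filter ι} [l.NeBot] {x₀ : M}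
    (F : Submodule ℝ (TangentSpace (𝓡 d) x₀)) {u : ι → TangentSpace (𝓡 d) x₀}
    {u₀ : TangentSpace (𝓡 d) x₀} (hu : ∀ᶠ i in l, u i ∈ F)
    (h : Tendsto (fun i => (⟨x₀, u i⟩ : TangentBundle (𝓡 d) M)) l (𝓝 ⟨x₀, u₀⟩)) : u₀ ∈ F := by
  have h1 := ((tendsto_tangentBundle_iff (mem_chart_self x₀)).1 h).2
  have h2 : chartD x₀ x₀ u₀ ∈ F.map (chartD x₀ x₀).toLinearMap :=
    (Submodule.closed_of_finiteDimensional (F.map (chartD x₀ x₀).toLinearMap)).mem_of_tendsto h1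
      (hu.mono fun i hi => ⟨u i, hi, rfl⟩)
  obtain ⟨w, hw, hwu⟩ := h2
  have h3 : chartD x₀ x₀ w = chartD x₀ x₀ u₀ := hwu
  rwa [← chartDInv_chartD (mem_chart_self x₀) u₀, ← h3, chartDInv_chartD (mem_chart_self x₀)]

theorem exists_limit_transport {ι : Type*} (𝒰 : Ultrafilter ι) {x : ι → M} {x₀ : M}
    (hx : Tendsto x 𝒰 (𝓝 x₀)) (F : Submodule ℝ (TangentSpace (𝓡 d) x₀))
    {u : ι → TangentSpace (𝓡 d) x₀} (hu : ∀ᶠ i in (𝒰 : Filter ι), u i ∈ F)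
    (hu1 : ∀ᶠ i in (𝒰 : Filter ι), ‖u i‖ = 1) :
    ∃ u₀ ∈ F, ‖u₀‖ = 1 ∧ Tendsto
      (fun i => (⟨x i, transport x₀ (x i) (u i)⟩ : TangentBundle (𝓡 d) M)) 𝒰 (𝓝 ⟨x₀, u₀⟩) := by
  obtain ⟨⟨y, u₀⟩, hp⟩ := exists_limit_tangentBundle 𝒰
    (F := fun i => (⟨x₀, u i⟩ : TangentBundle (𝓡 d) M)) (R := 1) (hu1.mono fun i h => h.le)
  obtain rfl : y = x₀ := tendsto_nhds_unique (tendsto_snd_of_tendsto hp) tendsto_const_nhds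
  refine ⟨u₀, mem_of_tendsto_submodule F hu hp, norm_eq_one_of_limit hp hu1, ?_⟩
  have h1 := ((tendsto_tangentBundle_iff (mem_chart_self y)).1 hp).2
  have := tendsto_chartDInv y (mem_chart_self y) hx h1
  rwa [chartDInv_chartD (mem_chart_self y)] at this

/-- If no nonzero vector of F is a limit of vectors of E i, the copy of F transported to x i
eventually meets E i trivially: otherwise unit vectors of F whose transports lie in E i would
converge to such a vector. -/
theorem eventually_finrank_add_le {ι : Type*} (𝒰 : Ultrafilter ι) {x : ι → M} {x₀ : M}
    (hx : Tendsto x 𝒰 (𝓝 x₀)) (F : Submodule ℝ (TangentSpace (𝓡 d) x₀))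
    (E : ∀ i, Submodule ℝ (TangentSpace (𝓡 d) (x i)))
    (h : ∀ (w : ∀ i, TangentSpace (𝓡 d) (x i)), ∀ v₀ ∈ F, (∀ᶠ i in (𝒰 : Filter ι), w i ∈ E i) →
      Tendsto (fun i => (⟨x i, w i⟩ : TangentBundle (𝓡 d) M)) 𝒰 (𝓝 ⟨x₀, v₀⟩) → v₀ = 0) :
    ∀ᶠ i in (𝒰 : Filter ι), Module.finrank ℝ F + Module.finrank ℝ (E i) ≤ d := by
  have hsrc : ∀ᶠ i in (𝒰 : Filter ι), x i ∈ (chartAt (EuclideanSpace ℝ (Fin d)) x₀).source :=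
    hx.eventually ((chartAt _ x₀).open_source.mem_nhds (mem_chart_self x₀))
  suffices hdis : ∀ᶠ i in (𝒰 : Filter ι),
      Disjoint (F.map (transport x₀ (x i)).toLinearMap) (E i) by
    filter_upwards [hdis, hsrc] with i hi hi'
    have := Submodule.finrank_add_finrank_le_of_disjoint hi
    rwa [finrank_map_transport hi', finrank_tangentSpace] at this
  by_contra hcon
  rw [← Ultrafilter.eventually_not] at hcon
  have hex : ∀ i, ∃ u : TangentSpace (𝓡 d) x₀,
      ¬ Disjoint (F.map (transport x₀ (x i)).toLinearMap) (E i) →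
      u ∈ F ∧ ‖u‖ = 1 ∧ transport x₀ (x i) u ∈ E i := by
    intro i
    by_cases hi : Disjoint (F.map (transport x₀ (x i)).toLinearMap) (E i)
    · exact ⟨0, fun h' => absurd hi h'⟩
    rw [Submodule.disjoint_def] at hi
    push Not at hi
    obtain ⟨_, ⟨u, hu, rfl⟩, huE, hu0⟩ := hi
    have hu0' : u ≠ 0 := by
      rintro rfl
      exact hu0 (map_zero _)
    refine ⟨‖u‖⁻¹ • u, fun _ => ⟨F.smul_mem _ hu, norm_inv_norm_smul hu0', ?_⟩⟩
    rw [map_smul]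
    exact (E i).smul_mem _ huE
  choose u hu using hex
  obtain ⟨u₀, hu₀, hu1, hlim⟩ := exists_limit_transport 𝒰 hx F (u := u)
    (hcon.mono fun i hi => (hu i hi).1) (hcon.mono fun i hi => (hu i hi).2.1)
  have := h _ u₀ hu₀ (hcon.mono fun i hi => (hu i hi).2.2) hlim
  rw [this, norm_zero] at hu1
  exact one_ne_zero hu1.symm

/-- The dimension of the space of vectors over `x` that stay in the cones. -/
def stableDim (f : M ≃ₘ^1⟮𝓡 d, 𝓡 d⟯ M) (U : Set M) (C : ∀ x : M, Set (TangentSpace (𝓡 d) x))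
    (x : M) : ℕ :=
  Module.finrank ℝ (Submodule.span ℝ
    {v : TangentSpace (𝓡 d) x | (⟨x, v⟩ : TangentBundle (𝓡 d) M) ∈ allTime f U C})

theorem stableDim_eq {f : M ≃ₘ^1⟮𝓡 d, 𝓡 d⟯ M} {U : Set M} {C : ∀ x : M, Set (TangentSpace (𝓡 d) x)}
    {x : M} {F : Submodule ℝ (TangentSpace (𝓡 d) x)}
    (hF : ∀ v, v ∈ F ↔ (⟨x, v⟩ : TangentBundle (𝓡 d) M) ∈ allTime f U C) :
    stableDim f U C x = Module.finrank ℝ F := by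
  have : {v : TangentSpace (𝓡 d) x | (⟨x, v⟩ : TangentBundle (𝓡 d) M) ∈ allTime f U C} = F := by
    ext v; exact (hF v).symm
  rw [stableDim, this, Submodule.span_eq]

theorem dom_trans {v w v₁ w₁ v₂ w₂ : ℝ} (hw₁ : 0 < w₁) (hw : 0 ≤ w) (hw₂ : 0 ≤ w₂) (h : 0 ≤ v₁)
    (h₁ : 19 / 10 * v₁ * w ≤ v * w₁) (h₂ : 19 / 10 * v₂ * w₁ ≤ v₁ * w₂) :
    19 / 10 * v₂ * w ≤ v * w₂ := by
  refine le_of_mul_le_mul_right ?_ hw₁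
  calc 19 / 10 * v₂ * w * w₁ = w * (19 / 10 * v₂ * w₁) := by ring
    _ ≤ w * (v₁ * w₂) := by gcongr
    _ = (v₁ * w) * w₂ := by ring
    _ ≤ (v * w₁) * w₂ := by
        exact mul_le_mul_of_nonneg_right (by nlinarith [mul_nonneg h hw]) hw₂
    _ = _ := by ring

theorem dom_of_unit {v w v₁ w₁ : ℝ} (hv : 0 < v) (hw : 0 < w)
    (h : 19 / 10 * (v⁻¹ * v₁) ≤ w⁻¹ * w₁) : 19 / 10 * v₁ * w ≤ v * w₁ := by
  have h4 := mul_le_mul_of_nonneg_left h (mul_pos hv hw).le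
  calc _ = v * w * (19 / 10 * (v⁻¹ * v₁)) := by field_simp
    _ ≤ _ := h4
    _ = _ := by field_simp

theorem norm_tangentCMap_iterate_smul (g : M ≃ₘ^1⟮𝓡 d, 𝓡 d⟯ M) (n : ℕ) (x : M) (c : ℝ)
    (v : TangentSpace (𝓡 d) x) : ‖((tangentCMap g)^[n] ⟨x, c • v⟩).snd‖ =
      |c| * ‖((tangentCMap g)^[n] ⟨x, v⟩).snd‖ := by
  rw [tangentCMap_iterate, tangentCMap_iterate, map_smul]
  exact norm_smul c (mfderiv (𝓡 d) (𝓡 d) g^[n] x v)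

theorem norm_tangentCMap_iterate_zero (g : M ≃ₘ^1⟮𝓡 d, 𝓡 d⟯ M) (n : ℕ) (x : M) :
    ‖((tangentCMap g)^[n] ⟨x, 0⟩).snd‖ = 0 := by
  have := norm_tangentCMap_iterate_smul g n x 0 0
  rwa [zero_smul, abs_zero, zero_mul] at this

namespace ConeSplitting

variable {f : M ≃ₘ^1⟮𝓡 d, 𝓡 d⟯ M} {Λ U : Set M}
    {A B : ∀ x : M, Submodule ℝ (TangentSpace (𝓡 d) x)}
    {Ca Cb : ∀ x : M, Set (TangentSpace (𝓡 d) x)} {n₀ : ℕ}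

theorem eventually_subset (H : ConeSplitting f Λ U A B Ca Cb n₀) :
    ∀ᶠ q in nearFilter f (closure Λ), q.2 ⊆ U :=
  tendsto_snd.eventually (eventually_smallSets.2
    ⟨U, H.isOpen.mem_nhdsSet.2 H.subset, fun _ ht => ht⟩)

/-- Unit counterexamples converge to a unit vector which strict invariance for f puts in the open
cone; the counterexamples would then be in the cones as well. -/
theorem eventually_back (H : ConeSplitting f Λ U A B Ca Cb n₀) :
    ∀ᶠ q in nearFilter f (closure Λ), ∀ p : TangentBundle (𝓡 d) M, p.proj ∈ q.2 →
      tangentCMap q.1 p ∈ closure (coneSet U Ca) → p ∈ coneSet U Ca := by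
  have key : ∀ᶠ q in nearFilter f (closure Λ), ∀ p : TangentBundle (𝓡 d) M, p.proj ∈ q.2 →
      ‖p.snd‖ = 1 → tangentCMap q.1 p ∈ closure (coneSet U Ca) → p ∈ coneSet U Ca := by
    refine eventually_forall_of_ultrafilter fun 𝒰 p h𝒰 hcon => ?_
    simp only [Classical.not_imp] at hcon
    obtain ⟨p₀, hp₀⟩ := exists_limit_tangentBundle 𝒰 (F := p) (R := 1)
      (hcon.mono fun q h => h.2.1.le)
    have h1 : ‖p₀.snd‖ = 1 := norm_eq_one_of_limit hp₀ (hcon.mono fun q h => h.2.1)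
    have hK := limit_mem_of_smallSets isClosed_closure (tendsto_snd.mono_left h𝒰)
      (tendsto_snd_of_tendsto hp₀) (hcon.mono fun q h => h.1)
    have h2 := limit_mem_coneSet H.backA (tendsto_fst.mono_left h𝒰) hp₀ (H.subset hK)
      (H.subset (H.mem_closure hK)) (hcon.mono fun q h => h.2.2.1)
    obtain ⟨q, hq1, hq2⟩ := (hcon.and (eventually_mem_coneSet H.backA.cone hp₀ h2
      (norm_ne_zero_iff.1 (by rw [h1]; exact one_ne_zero)))).exists
    exact hq1.2.2.2 hq2.1
  filter_upwards [key, H.eventually_subset] with q hq hqU p hp hpc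
  obtain ⟨x, v⟩ := p
  rcases eq_or_ne v 0 with rfl | hv
  · exact zero_mem_coneSet H.backA.cone (hqU hp)
  · have h1 : (⟨x, ‖v‖⁻¹ • v⟩ : TangentBundle (𝓡 d) M) ∈ coneSet U Ca := by
      refine hq ⟨x, ‖v‖⁻¹ • v⟩ hp (norm_inv_norm_smul hv) ?_
      rw [tangentCMap_apply, map_smul]
      exact (scalarInvariant_coneSet H.backA.cone).closure _ _ _ hpc
    have h2 := smul_mem_coneSet H.backA.cone h1 ‖v‖
    rwa [smul_smul, mul_inv_cancel₀ (norm_ne_zero_iff.2 hv), one_smul] at h2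

/-- Limits of all-time vectors of g lie in the two summands of the splitting of f over the closure
of Λ, which intersect trivially. -/
theorem eventually_angle (H : ConeSplitting f Λ U A B Ca Cb n₀) :
    ∃ C : ℝ, 0 ≤ C ∧ ∀ᶠ q in nearFilter f (closure Λ), ∀ (x : M) (v w : TangentSpace (𝓡 d) x),
      x ∈ q.2 → (⟨x, v⟩ : TangentBundle (𝓡 d) M) ∈ allTime q.1 U Ca →
      (⟨x, w⟩ : TangentBundle (𝓡 d) M) ∈ allTime q.1.symm U Cb →
      ‖v‖ ≤ C * ‖v + w‖ ∧ ‖w‖ ≤ C * ‖v + w‖ := by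
  obtain ⟨C, hC, h⟩ := exists_angle (l := nearFilter f (closure Λ))
    (P := fun q => {p | p.proj ∈ q.2 ∧ p ∈ allTime q.1 U Ca})
    (Q := fun q => allTime q.1.symm U Cb)
    (fun _ x v c h => ⟨h.1, smul_mem_allTime H.backA.cone h.2 c⟩)
    (fun _ => scalarInvariant_allTime H.backB.cone _)
    (fun 𝒰 x v w x₀ v₀ hl hv hw hvl hwl => by
      have hK := limit_mem_of_smallSets isClosed_closure (tendsto_snd.comp hl)
        (tendsto_snd_of_tendsto hvl) (hv.mono fun q h => h.1)
      have hg : Tendsto (fun q : ℝ × ((M ≃ₘ^1⟮𝓡 d, 𝓡 d⟯ M) × Set M) => q.2.1) (𝒰 : Filter _)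
        (c1Nhds f) := tendsto_fst.comp hl
      have h1 := H.limit_mem hg hvl hK (hv.mono fun q h => h.2)
      have h2 := H.symm.limit_mem ((tendsto_c1_symm f).comp hg) hwl hK hw
      obtain ⟨F, E, hFE, hF, hE, -⟩ := H.exists_splitting hK
      rw [← hF] at h1
      rw [← hE] at h2
      have := E.neg_mem h2
      rw [neg_neg] at this
      exact Submodule.disjoint_def.1 hFE.disjoint _ h1 this)
  exact ⟨C, hC, h.mono fun q hq x v w hx hv hw => hq x v w ⟨hx, hv⟩ hw⟩

/-- The gap between 2 and 19/10 absorbs the perturbation: limits of counterexamples satisfy both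
2‖Df^m v‖ ≤ ‖Df^m w‖ and ‖Df^m w‖ ≤ (19/10)‖Df^m v‖, so the unit vector v would be killed by Df^m.
-/
theorem eventually_dom_unit (H : ConeSplitting f Λ U A B Ca Cb n₀) {m : ℕ} (hm : n₀ ≤ m) :
    ∀ᶠ q in nearFilter f (closure Λ),
      ∀ b : (x : M) × (TangentSpace (𝓡 d) x × TangentSpace (𝓡 d) x),
      b.1 ∈ q.2 → (⟨b.1, b.2.1⟩ : TangentBundle (𝓡 d) M) ∈ allTime q.1 U Ca →
      (⟨b.1, b.2.2⟩ : TangentBundle (𝓡 d) M) ∈ allTime q.1.symm U Cb → ‖b.2.1‖ = 1 → ‖b.2.2‖ = 1 →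
      19 / 10 * ‖((tangentCMap q.1)^[m] ⟨b.1, b.2.1⟩).snd‖ ≤
        ‖((tangentCMap q.1)^[m] ⟨b.1, b.2.2⟩).snd‖ := by
  refine eventually_forall_of_ultrafilter fun 𝒰 b h𝒰 hcon => ?_
  simp only [Classical.not_imp, not_le] at hcon
  have hg : Tendsto (fun q : (M ≃ₘ^1⟮𝓡 d, 𝓡 d⟯ M) × Set M => q.1) (𝒰 : Filter _) (c1Nhds f) :=
    tendsto_fst.mono_left h𝒰
  obtain ⟨⟨x₀, v₀⟩, hv⟩ := exists_limit_tangentBundle 𝒰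
    (F := fun q => (⟨(b q).1, (b q).2.1⟩ : TangentBundle (𝓡 d) M)) (R := 1)
    (hcon.mono fun q h => h.2.2.2.1.le)
  obtain ⟨⟨y₀, w₀⟩, hw⟩ := exists_limit_tangentBundle 𝒰
    (F := fun q => (⟨(b q).1, (b q).2.2⟩ : TangentBundle (𝓡 d) M)) (R := 1)
    (hcon.mono fun q h => h.2.2.2.2.1.le)
  obtain rfl : y₀ = x₀ := tendsto_nhds_unique (tendsto_snd_of_tendsto hw)
    (tendsto_snd_of_tendsto hv)
  have hv1 : ‖v₀‖ = 1 := norm_eq_one_of_limit hv (hcon.mono fun q h => h.2.2.2.1)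
  have hw1 : ‖w₀‖ = 1 := norm_eq_one_of_limit hw (hcon.mono fun q h => h.2.2.2.2.1)
  have hK := limit_mem_of_smallSets isClosed_closure (tendsto_snd.mono_left h𝒰)
    (tendsto_snd_of_tendsto hv) (hcon.mono fun q h => h.1)
  have h1 := H.limit_mem hg hv hK (hcon.mono fun q h => h.2.1)
  have h2 := H.symm.limit_mem ((tendsto_c1_symm f).comp hg) hw hK (hcon.mono fun q h => h.2.2.1)
  obtain ⟨F, E, hFE, hF, hE, hdom⟩ := H.exists_splitting hK
  have h3 := hdom m hm v₀ ((hF _).2 h1) w₀ ((hE _).2 h2)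
  rw [hv1, hw1, mul_one, one_mul] at h3
  have h4 := le_of_tendsto_of_tendsto (norm_limit (tendsto_tangentCMap_iterate hg hw m))
    ((norm_limit (tendsto_tangentCMap_iterate hg hv m)).const_mul (19 / 10))
    (hcon.mono fun q h => h.2.2.2.2.2.le)
  have h5 : ((tangentCMap f)^[m] ⟨y₀, v₀⟩).snd = 0 := by
    rw [← norm_le_zero_iff]; linarith
  have h6 : v₀ = 0 := tangentCMap_iterate_snd_ne_zero f h5
  rw [h6, norm_zero] at hv1
  exact one_ne_zero hv1.symm

theorem eventually_dom (H : ConeSplitting f Λ U A B Ca Cb n₀) {m : ℕ} (hm : n₀ ≤ m) :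
    ∀ᶠ q in nearFilter f (closure Λ), ∀ (x : M) (v w : TangentSpace (𝓡 d) x),
      x ∈ q.2 → (⟨x, v⟩ : TangentBundle (𝓡 d) M) ∈ allTime q.1 U Ca →
      (⟨x, w⟩ : TangentBundle (𝓡 d) M) ∈ allTime q.1.symm U Cb →
      19 / 10 * ‖((tangentCMap q.1)^[m] ⟨x, v⟩).snd‖ * ‖w‖ ≤
        ‖v‖ * ‖((tangentCMap q.1)^[m] ⟨x, w⟩).snd‖ := by
  filter_upwards [H.eventually_dom_unit hm] with q hq x v w hx hv hw
  rcases eq_or_ne v 0 with rfl | hv0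
  · rw [norm_tangentCMap_iterate_zero, norm_zero, mul_zero, zero_mul, zero_mul]
  rcases eq_or_ne w 0 with rfl | hw0
  · rw [norm_tangentCMap_iterate_zero, norm_zero, mul_zero, mul_zero]
  have h1 := hq ⟨x, ‖v‖⁻¹ • v, ‖w‖⁻¹ • w⟩ hx (smul_mem_allTime H.backA.cone hv _)
    (smul_mem_allTime H.backB.cone hw _) (norm_inv_norm_smul hv0) (norm_inv_norm_smul hw0)
  dsimp only at h1
  rw [norm_tangentCMap_iterate_smul, norm_tangentCMap_iterate_smul, abs_of_nonneg (by positivity),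
    abs_of_nonneg (by positivity)] at h1
  exact dom_of_unit (norm_pos_iff.2 hv0) (norm_pos_iff.2 hw0) h1

/-- Closeness of g to f gives domination only at finitely many times, here n₀ ≤ m < 2n₀. A later
time is split as k + n₀ with n₀ ≤ k < m, and the two estimates compose because the constant exceeds
1. -/
theorem eventually_adapted (H : ConeSplitting f Λ U A B Ca Cb n₀) (hn₀ : 1 ≤ n₀) :
    ∃ C : ℝ, 0 ≤ C ∧ ∀ᶠ q in nearFilter f (closure Λ), Adapted q.1 U q.2 Ca Cb C n₀ := by
  obtain ⟨C, hC, hang⟩ := H.eventually_angle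
  have hdom : ∀ᶠ q in nearFilter f (closure Λ), ∀ m ∈ Finset.Ico n₀ (2 * n₀), _ :=
    (Filter.eventually_all_finset _).2 fun m hm => H.eventually_dom (Finset.mem_Ico.1 hm).1
  have hbackB := (tendsto_nearFilter_symm f (closure Λ)).eventually H.symm.eventually_back
  refine ⟨C, hC, ?_⟩
  filter_upwards [hang, hdom, hbackB, H.eventually_back, H.eventually_subset] with q h1 h2 h3 h4 h5
  refine ⟨h5, H.backA.cone, H.backB.cone, fun p hp _ => h4 p hp, fun p hp _ => h3 p hp,
    fun x v w hx => h1 x v w (maxInvariant_subset _ _ hx), fun m hm => ?_⟩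
  induction m using Nat.strong_induction_on with
  | _ m ih =>
    intro x v w hx hv hw
    rcases lt_or_ge m (2 * n₀) with hm2 | hm2
    · exact h2 m (Finset.mem_Ico.2 ⟨hm, hm2⟩) x v w (maxInvariant_subset _ _ hx) hv hw
    obtain ⟨k, rfl⟩ : ∃ k, m = k + n₀ := ⟨m - n₀, by omega⟩
    have h6 := h2 n₀ (Finset.mem_Ico.2 ⟨le_rfl, by omega⟩) x v w (maxInvariant_subset _ _ hx) hv hw
    have hv' := tangentCMap_mem_allTime hv n₀
    have hw' := iterate_mem_allTime_symm (V := q.2) (p := ⟨x, w⟩) (fun p hp _ => h3 p hp) hx hw n₀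
    rw [Function.iterate_add_apply, Function.iterate_add_apply]
    rw [tangentCMap_iterate q.1 n₀] at hv' hw' h6 ⊢
    rw [tangentCMap_iterate q.1 n₀] at h6 ⊢
    have h7 := ih k (by omega) (by omega) _ _ _ (iterate_mem_maxInvariant hx n₀) hv' hw'
    replace h6 : 19 / 10 * ‖mfderiv (𝓡 d) (𝓡 d) q.1^[n₀] x v‖ * ‖w‖ ≤
      ‖v‖ * ‖mfderiv (𝓡 d) (𝓡 d) q.1^[n₀] x w‖ := h6
    rcases (norm_nonneg (mfderiv (𝓡 d) (𝓡 d) q.1^[n₀] x w)).eq_or_lt with h0 | h0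
    · have hw0 : w = 0 := tangentCMap_iterate_snd_ne_zero (p := ⟨x, w⟩) q.1 (n := n₀)
        (by rw [tangentCMap_iterate]; exact norm_eq_zero.1 h0.symm)
      rw [hw0, norm_zero, mul_zero]; positivity
    exact dom_trans h0 (norm_nonneg _) (norm_nonneg _) (norm_nonneg _) h6 h7

end ConeSplitting

end Robust

/-! ### Existence of the splitting for nearby diffeomorphisms -/

section Existence

variable {d : ℕ} {M : Type*} [MetricSpace M] [CompactSpace M]
  [ChartedSpace (EuclideanSpace ℝ (Fin d)) M] [IsManifold (𝓡 d) ∞ M]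
  [RiemannianBundle (fun x : M => TangentSpace (𝓡 d) x)]
  [IsContMDiffRiemannianBundle (𝓡 d) ∞ (EuclideanSpace ℝ (Fin d))
      (fun x : M => TangentSpace (𝓡 d) x)]

theorem tangentCMap_eq_of_snd (g : M ≃ₘ^1⟮𝓡 d, 𝓡 d⟯ M) (p : TangentBundle (𝓡 d) M) :
    (⟨g.symm (g p.proj), mfderiv (𝓡 d) (𝓡 d) g.symm (g p.proj) (mfderiv (𝓡 d) (𝓡 d) g p.proj p.snd)⟩ :
      TangentBundle (𝓡 d) M) = p := tangentCMap_symm_tangentCMap g p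

theorem exists_mfderiv_eq (g : M ≃ₘ^1⟮𝓡 d, 𝓡 d⟯ M) (x : M) (w : TangentSpace (𝓡 d) (g x)) :
    ∃ v, mfderiv (𝓡 d) (𝓡 d) g x v = w :=
  (g.mfderivToContinuousLinearEquiv one_ne_zero x).surjective w

/-- A nearest point of `K`. -/
def nearestPoint (K : Set M) (y : M) : M :=
  open Classical in if h : ∃ z ∈ K, Metric.infDist y K = dist y z then h.choose else y

theorem nearestPoint_spec {K : Set M} (hK : IsClosed K) (hne : K.Nonempty) (y : M) :
    nearestPoint K y ∈ K ∧ Metric.infDist y K = dist y (nearestPoint K y) := by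
  have h := hK.isCompact.exists_infDist_eq_dist hne y
  rw [nearestPoint, dif_pos h]
  exact h.choose_spec

theorem tendsto_nearestPoint {K : Set M} (hK : IsClosed K) {x₀ : M} (hx₀ : x₀ ∈ K) :
    Tendsto (nearestPoint K) (𝓝 x₀) (𝓝[K] x₀) := by
  refine tendsto_nhdsWithin_iff.2 ⟨?_, Eventually.of_forall fun y =>
    (nearestPoint_spec hK ⟨x₀, hx₀⟩ y).1⟩
  rw [tendsto_iff_dist_tendsto_zero]
  have h1 : Tendsto (fun y => dist y x₀ + dist y x₀) (𝓝 x₀) (𝓝 0) := by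
    have : Tendsto (fun y => dist y x₀) (𝓝 x₀) (𝓝 0) := tendsto_iff_dist_tendsto_zero.1 tendsto_id
    simpa using this.add this
  refine squeeze_zero (fun _ => dist_nonneg) (fun y => ?_) h1
  have h2 := (nearestPoint_spec hK ⟨x₀, hx₀⟩ y).2
  calc dist (nearestPoint K y) x₀ ≤ dist (nearestPoint K y) y + dist y x₀ := dist_triangle _ _ _
    _ ≤ dist y x₀ + dist y x₀ := by
      rw [dist_comm _ y, ← h2]
      gcongr
      exact Metric.infDist_le_dist_of_mem hx₀

namespace ConeSplitting

variable {f : M ≃ₘ^1⟮𝓡 d, 𝓡 d⟯ M} {Λ U : Set M}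
    {A B : ∀ x : M, Submodule ℝ (TangentSpace (𝓡 d) x)}
    {Ca Cb : ∀ x : M, Set (TangentSpace (𝓡 d) x)} {n₀ : ℕ}

theorem stableDim_map (H : ConeSplitting f Λ U A B Ca Cb n₀) {x : M} (hx : x ∈ closure Λ) :
    stableDim f U Ca (f x) = stableDim f U Ca x := by
  obtain ⟨F, E, hFE, hF, -⟩ := H.exists_splitting hx
  obtain ⟨F', E', hFE', hF', -⟩ := H.exists_splitting (H.mem_closure hx)
  rw [stableDim_eq hF, stableDim_eq hF']
  have h1 : F' = F.map (iterEquiv f 1 x).toLinearMap := by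
    ext w
    rw [hF']
    constructor
    · intro hw
      obtain ⟨v, rfl⟩ := exists_mfderiv_eq f x w
      refine ⟨v, (hF v).2 fun k => ?_, rfl⟩
      cases k with
      | zero =>
        have hw0 : tangentCMap f ⟨x, v⟩ ∈ coneSet U Ca := hw 0
        exact mem_coneSet_of_closure (p := ⟨x, v⟩) H.backA (H.subset hx)
          (H.subset (H.mem_closure hx)) (subset_closure hw0)
      | succ k => exact hw k
    · rintro ⟨v, hv, rfl⟩
      exact tangentCMap_mem_allTime ((hF v).1 hv) 1
  rw [h1]
  exact LinearEquiv.finrank_map_eq (iterEquiv f 1 x) F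

/-- The dimensions of both summands can only drop at nearby points, by transversality to the
complementary summand at x₀; since they add up to d, neither changes. -/
theorem eventually_stableDim_eq (H : ConeSplitting f Λ U A B Ca Cb n₀) {x₀ : M}
    (hx₀ : x₀ ∈ closure Λ) :
    ∀ᶠ x in 𝓝[closure Λ] x₀, stableDim f U Ca x = stableDim f U Ca x₀ := by
  refine mem_iff_ultrafilter.2 fun 𝒰 h𝒰 => ?_
  have hK : ∀ᶠ x in (𝒰 : Filter M), x ∈ closure Λ := h𝒰 self_mem_nhdsWithin
  have hlim : Tendsto id (𝒰 : Filter M) (𝓝 x₀) := h𝒰.trans nhdsWithin_le_nhds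
  obtain ⟨F₀, E₀, hFE₀, hF₀, hE₀, -⟩ := H.exists_splitting hx₀
  have hex : ∀ x : M, ∃ F E : Submodule ℝ (TangentSpace (𝓡 d) x), x ∈ closure Λ →
      IsCompl F E ∧ (∀ v, v ∈ F ↔ (⟨x, v⟩ : TangentBundle (𝓡 d) M) ∈ allTime f U Ca) ∧
      (∀ v, v ∈ E ↔ (⟨x, v⟩ : TangentBundle (𝓡 d) M) ∈ allTime f.symm U Cb) := by
    intro x
    by_cases hx : x ∈ closure Λ
    · obtain ⟨F, E, h1, h2, h3, -⟩ := H.exists_splitting hx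
      exact ⟨F, E, fun _ => ⟨h1, h2, h3⟩⟩
    · exact ⟨⊥, ⊥, fun h => absurd h hx⟩
  choose F E hFE using hex
  have h1 := eventually_finrank_add_le 𝒰 hlim F₀ E fun w v₀ hv₀ hw hwl => by
    have := H.symm.limit_mem (tendsto_const_c1 _ _) hwl hx₀
      ((hw.and hK).mono fun x hx => ((hFE x hx.2).2.2 _).1 hx.1)
    exact Submodule.disjoint_def.1 hFE₀.disjoint _ hv₀ ((hE₀ _).2 this)
  have h2 := eventually_finrank_add_le 𝒰 hlim E₀ F fun w v₀ hv₀ hw hwl => by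
    have := H.limit_mem (tendsto_const_c1 _ _) hwl hx₀
      ((hw.and hK).mono fun x hx => ((hFE x hx.2).2.1 _).1 hx.1)
    exact Submodule.disjoint_def.1 hFE₀.disjoint _ ((hF₀ _).2 this) hv₀
  filter_upwards [h1, h2, hK] with x h1 h2 hx
  have h3 := Submodule.finrank_add_eq_of_isCompl hFE₀
  have h4 := Submodule.finrank_add_eq_of_isCompl (hFE x hx).1
  rw [finrank_tangentSpace] at h3 h4
  rw [stableDim_eq (hFE x hx).2.1, stableDim_eq hF₀]
  simp only [id] at h1 h2
  omega

/-- The locally constant extension of the dimension of the stable directions. -/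
def _root_.DomPesin.nearDim (f : M ≃ₘ^1⟮𝓡 d, 𝓡 d⟯ M) (U K : Set M)
    (C : ∀ x : M, Set (TangentSpace (𝓡 d) x)) (y : M) : ℕ := stableDim f U C (nearestPoint K y)

theorem eventually_nearDim_eq (H : ConeSplitting f Λ U A B Ca Cb n₀) {x₀ : M}
    (hx₀ : x₀ ∈ closure Λ) :
    ∀ᶠ y in 𝓝 x₀, nearDim f U (closure Λ) Ca y = stableDim f U Ca x₀ :=
  (tendsto_nearestPoint isClosed_closure hx₀).eventually (H.eventually_stableDim_eq hx₀)

/-- The unit sphere of F is compact and the nonzero vectors of the cones form an open set; scaling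
does the rest. -/
theorem eventually_transport_mem (hC : IsConeField U Ca) {x₀ : M} (hU : IsOpen U) (hx₀ : x₀ ∈ U)
    (F : Submodule ℝ (TangentSpace (𝓡 d) x₀)) (hF : (F : Set (TangentSpace (𝓡 d) x₀)) ⊆ Ca x₀) :
    ∀ᶠ y in 𝓝 x₀, ∀ u ∈ F, transport x₀ y u ∈ Ca y := by
  have key : ∀ᶠ y in 𝓝 x₀, ∀ u : TangentSpace (𝓡 d) x₀, u ∈ F → ‖u‖ = 1 →
      (⟨y, transport x₀ y u⟩ : TangentBundle (𝓡 d) M) ∈ coneSet U Ca := by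
    refine eventually_forall_of_ultrafilter fun 𝒰 u h𝒰 hcon => ?_
    simp only [Classical.not_imp] at hcon
    obtain ⟨u₀, hu₀, hu1, hlim⟩ := exists_limit_transport 𝒰 (x := id) h𝒰 F (u := u)
      (hcon.mono fun _ h => h.1) (hcon.mono fun _ h => h.2.1)
    obtain ⟨y, hy1, hy2⟩ := (hcon.and (eventually_mem_coneSet hC hlim ⟨hx₀, hF hu₀⟩
      (norm_ne_zero_iff.1 (by rw [hu1]; exact one_ne_zero)))).exists
    exact hy1.2.2 hy2.1
  filter_upwards [key, hU.mem_nhds hx₀] with y hy hyU u hu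
  rcases eq_or_ne u 0 with rfl | hu0
  · rw [map_zero]; exact hC.zero_mem y hyU
  have h1 := smul_mem_coneSet hC (hy _ (F.smul_mem ‖u‖⁻¹ hu) (norm_inv_norm_smul hu0)) ‖u‖
  rw [map_smul, smul_smul, mul_inv_cancel₀ (norm_ne_zero_iff.2 hu0), one_smul] at h1
  exact h1.2

theorem eventually_nearDim_map (H : ConeSplitting f Λ U A B Ca Cb n₀) :
    ∀ᶠ q in nearFilter f (closure Λ), ∀ y ∈ q.2, nearDim f U (closure Λ) Ca (q.1 y) =
      nearDim f U (closure Λ) Ca y := by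
  refine eventually_forall_of_ultrafilter fun 𝒰 y h𝒰 hcon => ?_
  simp only [Classical.not_imp] at hcon
  have hg : Tendsto (fun q : (M ≃ₘ^1⟮𝓡 d, 𝓡 d⟯ M) × Set M => q.1) (𝒰 : Filter _) (c1Nhds f) :=
    tendsto_fst.mono_left h𝒰
  obtain ⟨x₀, -, hx⟩ := isCompact_univ.ultrafilter_le_nhds (𝒰.map y) (by simp)
  have hx' : Tendsto y 𝒰 (𝓝 x₀) := hx
  have hK := limit_mem_of_smallSets isClosed_closure (tendsto_snd.mono_left h𝒰) hx'
    (hcon.mono fun q h => h.1)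
  have h1 := hx'.eventually (H.eventually_nearDim_eq hK)
  have h2 := (tendsto_diffeo hg hx' 1).eventually (H.eventually_nearDim_eq (H.mem_closure hK))
  obtain ⟨q, hq1, hq2, hq3⟩ := (hcon.and (h1.and h2)).exists
  refine hq1.2 ?_
  rw [hq2, ← H.stableDim_map hK]
  exact hq3

/-- The summands for f at a nearby point of the closure of Λ, moved to y by a chart, stay in the
open cones. No invariance under g is claimed: these are the seeds for the limiting construction. -/
theorem eventually_exists_subspaces (H : ConeSplitting f Λ U A B Ca Cb n₀) :
    ∀ᶠ q in nearFilter f (closure Λ), ∀ y ∈ q.2, ∃ F E : Submodule ℝ (TangentSpace (𝓡 d) y),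
      (F : Set (TangentSpace (𝓡 d) y)) ⊆ Ca y ∧ (E : Set (TangentSpace (𝓡 d) y)) ⊆ Cb y ∧
      Module.finrank ℝ F = nearDim f U (closure Λ) Ca y ∧
      d ≤ nearDim f U (closure Λ) Ca y + Module.finrank ℝ E := by
  refine eventually_forall_of_ultrafilter fun 𝒰 y h𝒰 hcon => ?_
  simp only [Classical.not_imp] at hcon
  obtain ⟨x₀, -, hx⟩ := isCompact_univ.ultrafilter_le_nhds (𝒰.map y) (by simp)
  have hx' : Tendsto y 𝒰 (𝓝 x₀) := hx
  have hK := limit_mem_of_smallSets isClosed_closure (tendsto_snd.mono_left h𝒰) hx'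
    (hcon.mono fun q h => h.1)
  obtain ⟨F₀, E₀, hFE₀, hF₀, hE₀, -⟩ := H.exists_splitting hK
  have h1 := hx'.eventually (H.eventually_nearDim_eq hK)
  have h2 := hx'.eventually (eventually_transport_mem H.backA.cone H.isOpen (H.subset hK) F₀
    fun v hv => ((hF₀ v).1 hv 0).2)
  have h3 := hx'.eventually (eventually_transport_mem H.backB.cone H.isOpen (H.subset hK) E₀
    fun v hv => ((hE₀ v).1 hv 0).2)
  have hsrc := hx'.eventually ((chartAt (EuclideanSpace ℝ (Fin d)) x₀).open_source.mem_nhds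
    (mem_chart_self x₀))
  obtain ⟨q, hq, hq1, hq2, hq3, hq4⟩ := (hcon.and (h1.and (h2.and (h3.and hsrc)))).exists
  refine hq.2 ⟨F₀.map (transport x₀ (y q)).toLinearMap, E₀.map (transport x₀ (y q)).toLinearMap,
    ?_, ?_, ?_, ?_⟩
  · rintro _ ⟨u, hu, rfl⟩; exact hq2 u hu
  · rintro _ ⟨u, hu, rfl⟩; exact hq3 u hu
  · rw [finrank_map_transport hq4, hq1, stableDim_eq hF₀]
  · have h5 := Submodule.finrank_add_eq_of_isCompl hFE₀
    rw [finrank_tangentSpace] at h5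
    rw [finrank_map_transport hq4, hq1, stableDim_eq hF₀, h5]

theorem eventually_exists_isCompl (H : ConeSplitting f Λ U A B Ca Cb n₀) (hn₀ : 1 ≤ n₀) :
    ∃ C : ℝ, 0 ≤ C ∧ ∀ᶠ q in nearFilter f (closure Λ), Adapted q.1 U q.2 Ca Cb C n₀ ∧
      ∀ x ∈ maxInvariant q.1 q.2, ∃ F E : Submodule ℝ (TangentSpace (𝓡 d) x), IsCompl F E ∧
        (∀ v ∈ F, (⟨x, v⟩ : TangentBundle (𝓡 d) M) ∈ allTime q.1 U Ca) ∧
        (∀ v ∈ E, (⟨x, v⟩ : TangentBundle (𝓡 d) M) ∈ allTime q.1.symm U Cb) := by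
  obtain ⟨C, hC, h⟩ := H.eventually_adapted hn₀
  refine ⟨C, hC, ?_⟩
  filter_upwards [h, H.eventually_nearDim_map, H.eventually_exists_subspaces] with q h1 h2 h3
  exact ⟨h1, fun x hx => h1.exists_isCompl (fun y hy _ => h2 y hy) h3 hx⟩

/-- Vectors close to the unit vectors that stay in the cones are in the cones, uniformly. -/
theorem exists_mem_coneSet_of_close (H : ConeSplitting f Λ U A B Ca Cb n₀) {c : M} {W : Set M}
    (hW : IsCompact W) (hWc : W ⊆ (chartAt (EuclideanSpace ℝ (Fin d)) c).source) :
    ∃ δ > 0, ∀ᶠ q in nearFilter f (closure Λ), ∀ x ∈ W, x ∈ q.2 → ∀ v : TangentSpace (𝓡 d) x,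
      (⟨x, v⟩ : TangentBundle (𝓡 d) M) ∈ allTime q.1 U Ca → ‖v‖ = 1 →
      ∀ y ∈ (chartAt (EuclideanSpace ℝ (Fin d)) c).source, ∀ w : TangentSpace (𝓡 d) y,
        ‖extChartAt (𝓡 d) c y - extChartAt (𝓡 d) c x‖ < δ → ‖chartD c y w - chartD c x v‖ < δ →
        (⟨y, w⟩ : TangentBundle (𝓡 d) M) ∈ coneSet U Ca := by
  have key : ∀ᶠ q : ℝ × ((M ≃ₘ^1⟮𝓡 d, 𝓡 d⟯ M) × Set M) in 𝓝[>] 0 ×ˢ nearFilter f (closure Λ),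
      ∀ b : TangentBundle (𝓡 d) M × TangentBundle (𝓡 d) M, b.1.proj ∈ W → b.1.proj ∈ q.2.2 →
        b.1 ∈ allTime q.2.1 U Ca → ‖b.1.snd‖ = 1 →
        b.2.proj ∈ (chartAt (EuclideanSpace ℝ (Fin d)) c).source →
        ‖extChartAt (𝓡 d) c b.2.proj - extChartAt (𝓡 d) c b.1.proj‖ < q.1 →
        ‖chartD c b.2.proj b.2.snd - chartD c b.1.proj b.1.snd‖ < q.1 → b.2 ∈ coneSet U Ca := by
    refine eventually_forall_of_ultrafilter fun 𝒰 b h𝒰 hcon => ?_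
    simp only [Classical.not_imp] at hcon
    have hg : Tendsto (fun q : ℝ × ((M ≃ₘ^1⟮𝓡 d, 𝓡 d⟯ M) × Set M) => q.2.1) (𝒰 : Filter _)
      (c1Nhds f) := tendsto_fst.comp (tendsto_snd.mono_left h𝒰)
    have hV : Tendsto (fun q : ℝ × ((M ≃ₘ^1⟮𝓡 d, 𝓡 d⟯ M) × Set M) => q.2.2) (𝒰 : Filter _)
      (𝓝ˢ (closure Λ)).smallSets := tendsto_snd.comp (tendsto_snd.mono_left h𝒰)
    have hδ : Tendsto (fun q : ℝ × ((M ≃ₘ^1⟮𝓡 d, 𝓡 d⟯ M) × Set M) => q.1) (𝒰 : Filter _) (𝓝 0) :=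
      (tendsto_fst.mono_left h𝒰).mono_right nhdsWithin_le_nhds
    obtain ⟨p, hp⟩ := exists_limit_tangentBundle 𝒰 (F := fun q => (b q).1) (R := 1)
      (hcon.mono fun q h => h.2.2.2.1.le)
    have hp1 := norm_eq_one_of_limit hp (hcon.mono fun q h => h.2.2.2.1)
    have hbase := tendsto_snd_of_tendsto hp
    have hK := limit_mem_of_smallSets isClosed_closure hV hbase (hcon.mono fun q h => h.2.1)
    have hpW : p.proj ∈ W := hW.isClosed.mem_of_tendsto hbase (hcon.mono fun q h => h.1)
    have hpc := hWc hpW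
    have hpA := H.limit_mem hg hp hK (hcon.mono fun q h => h.2.2.1)
    have hp' := (tendsto_tangentBundle_iff hpc).1 hp
    have hpc' : p.proj ∈ (extChartAt (𝓡 d) c).source := by rwa [extChartAt_source]
    have hφ : Tendsto (fun q => extChartAt (𝓡 d) c (b q).1.proj) 𝒰 (𝓝 (extChartAt (𝓡 d) c p.proj)) :=
      ((continuousAt_extChartAt' hpc').tendsto).comp hbase
    have hφ2 : Tendsto (fun q => extChartAt (𝓡 d) c (b q).2.proj) 𝒰
        (𝓝 (extChartAt (𝓡 d) c p.proj)) := by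
      have h1 : Tendsto (fun q => extChartAt (𝓡 d) c (b q).2.proj - extChartAt (𝓡 d) c (b q).1.proj)
          𝒰 (𝓝 0) := squeeze_zero_norm' (hcon.mono fun q h => h.2.2.2.2.2.1.le) hδ
      simpa using h1.add hφ
    have hbase2 : Tendsto (fun q => (b q).2.proj) 𝒰 (𝓝 p.proj) := by
      have h1 := ((continuousAt_extChartAt_symm' hpc').tendsto).comp hφ2
      rw [(extChartAt (𝓡 d) c).left_inv hpc'] at h1
      refine h1.congr' (hcon.mono fun q h => ?_)
      exact (extChartAt (𝓡 d) c).left_inv (by rw [extChartAt_source]; exact h.2.2.2.2.1)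
    have hsnd : Tendsto (fun q => chartD c (b q).2.proj (b q).2.snd) 𝒰
        (𝓝 (chartD c p.proj p.snd)) := by
      have h1 : Tendsto (fun q => chartD c (b q).2.proj (b q).2.snd -
          chartD c (b q).1.proj (b q).1.snd) 𝒰 (𝓝 0) :=
        squeeze_zero_norm' (hcon.mono fun q h => h.2.2.2.2.2.2.1.le) hδ
      simpa using h1.add hp'.2
    have hlim : Tendsto (fun q => (b q).2) 𝒰 (𝓝 p) :=
      (tendsto_tangentBundle_iff hpc).2 ⟨hbase2, hsnd⟩
    obtain ⟨q, hq1, hq2⟩ := (hcon.and (eventually_mem_coneSet H.backA.cone hlim (hpA 0)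
      (norm_ne_zero_iff.1 (by rw [hp1]; exact one_ne_zero)))).exists
    exact hq1.2.2.2.2.2.2.2 hq2.1
  obtain ⟨δ, hδ, hδ0⟩ := (key.curry.and self_mem_nhdsWithin).exists
  exact ⟨δ, hδ0, hδ.mono fun q hq x hxW hxV v hv hv1 y hy w h1 h2 =>
    hq ⟨⟨x, v⟩, ⟨y, w⟩⟩ hxW hxV hv hv1 hy h1 h2⟩

end ConeSplitting

theorem tangentCMap_symm_mem_subSet {g : M ≃ₘ^1⟮𝓡 d, 𝓡 d⟯ M} {S : Set M}
    (hS : ∀ x ∈ S, g.symm x ∈ S) {E : ∀ x : M, Submodule ℝ (TangentSpace (𝓡 d) x)}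
    (h : ∀ x ∈ S, (E x).map (mfderiv (𝓡 d) (𝓡 d) g x).toLinearMap = E (g x))
    {p : TangentBundle (𝓡 d) M} (hp : p ∈ subSet S E) : tangentCMap g.symm p ∈ subSet S E := by
  obtain ⟨x, v⟩ := p
  obtain ⟨hx, hv⟩ := hp
  simp only at hx hv
  obtain ⟨y, rfl⟩ : ∃ y, g y = x := ⟨g.symm x, g.apply_symm_apply x⟩
  have hy : y ∈ S := by have := hS _ hx; rwa [g.symm_apply_apply] at this
  rw [← h y hy] at hv
  obtain ⟨w, hw, rfl⟩ := hv
  change tangentCMap g.symm (tangentCMap g ⟨y, w⟩) ∈ _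
  rw [tangentCMap_symm_tangentCMap g ⟨y, w⟩]
  exact ⟨hy, hw⟩

/-- The hypotheses of the stable manifold theorem, in terms of `ConeSplitting`. -/
theorem exists_coneSplitting {f : M ≃ₘ^1⟮𝓡 d, 𝓡 d⟯ M} {Λ U : Set M} (hΛ : f '' Λ = Λ)
    {Ecu Ecs : ∀ x : M, Submodule ℝ (TangentSpace (𝓡 d) x)}
    (hE : IsDominatedSplitting f Λ Ecu Ecs) (hU : IsOpen U) (hΛU : closure Λ ⊆ U)
    {Ccu Ccs : ∀ x : M, Set (TangentSpace (𝓡 d) x)}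
    (hCcu : IsConeField U Ccu) (hCcs : IsConeField U Ccs) (hinv : StrictlyInvariant f U Ccu Ccs)
    (hsub : Subordinate Λ Ecu Ecs Ccu Ccs) (htrans : ConesTransverse Λ Ecu Ecs Ccu Ccs) :
    ∃ n₀ : ℕ, 1 ≤ n₀ ∧ ConeSplitting f Λ U Ecs Ecu Ccs Ccu n₀ := by
  obtain ⟨n₀, hn₀, hdom⟩ := hE.dominated
  have hmem : ∀ x ∈ Λ, f x ∈ Λ := fun x hx => hΛ ▸ mem_image_of_mem f hx
  have hmem' : ∀ x ∈ Λ, f.symm x ∈ Λ := fun x hx => by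
    rw [← hΛ] at hx
    obtain ⟨y, hy, rfl⟩ := hx
    rwa [f.symm_apply_apply]
  have hmap : ∀ E : ∀ x : M, Submodule ℝ (TangentSpace (𝓡 d) x),
      (∀ x ∈ Λ, (E x).map (mfderiv (𝓡 d) (𝓡 d) f x).toLinearMap = E (f x)) →
      ∀ p ∈ subSet Λ E, tangentCMap f p ∈ subSet Λ E := fun E h p hp =>
    ⟨hmem _ hp.1, (h _ hp.1).le ⟨p.snd, hp.2, rfl⟩⟩
  refine ⟨n₀, hn₀, hmem, hmem', fun x hx => (hE.isCompl x hx).symm, hmap _ hE.map_cs,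
    fun _ => tangentCMap_symm_mem_subSet hmem' hE.map_cs, hmap _ hE.map_cu,
    fun _ => tangentCMap_symm_mem_subSet hmem' hE.map_cu, ?_, hΛU, hU, ⟨hCcs, hinv.cs⟩,
    ⟨hCcu, ?_⟩, fun x hx => (hsub x hx).2, fun x hx => (hsub x hx).1, fun x hx => (htrans x hx).2,
    fun x hx => (htrans x hx).1⟩
  · intro m hm x hx a ha b hb
    rcases eq_or_ne a 0 with rfl | ha0
    · rw [norm_tangentCMap_iterate_zero, norm_zero, mul_zero, zero_mul, zero_mul]
    rcases eq_or_ne b 0 with rfl | hb0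
    · rw [norm_tangentCMap_iterate_zero, norm_zero, mul_zero, mul_zero]
    have h1 := hdom m hm x hx (‖b‖⁻¹ • b) ((Ecu x).smul_mem _ hb) (‖a‖⁻¹ • a)
      ((Ecs x).smul_mem _ ha) (norm_inv_norm_smul hb0) (norm_inv_norm_smul ha0)
    have e : ∀ v : TangentSpace (𝓡 d) x, ‖mfderiv (𝓡 d) (𝓡 d) f^[m] x (‖v‖⁻¹ • v)‖ =
        ‖v‖⁻¹ * ‖((tangentCMap f)^[m] ⟨x, v⟩).snd‖ := by
      intro v
      have := norm_tangentCMap_iterate_smul f m x ‖v‖⁻¹ v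
      rw [abs_of_nonneg (by positivity), tangentCMap_iterate f m x (‖v‖⁻¹ • v)] at this
      exact this
    rw [e, e] at h1
    have ha' := norm_pos_iff.2 ha0
    have hb' := norm_pos_iff.2 hb0
    have h2 := mul_le_mul_of_nonneg_left h1.le (mul_pos ha' hb').le
    calc _ = ‖a‖ * ‖b‖ * (2 * (‖a‖⁻¹ * ‖((tangentCMap f)^[m] ⟨x, a⟩).snd‖)) := by field_simp
      _ ≤ _ := h2
      _ = _ := by field_simp
  -- Invariance of the cu cones under the inverse: at x = f y the preimage of the cone under the
  -- derivative of the inverse is contained in its image under Df.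
  · intro x hx hfx
    obtain ⟨y, rfl⟩ : ∃ y, f y = x := ⟨f.symm x, f.apply_symm_apply x⟩
    have hy : y ∈ U := by rwa [f.symm_apply_apply] at hfx
    refine (closure_mono ?_).trans (hinv.cu y hy hx)
    intro v hv
    obtain ⟨w, rfl⟩ := exists_mfderiv_eq f y v
    refine ⟨w, ?_, rfl⟩
    have h1 := tangentCMap_eq_of_snd f ⟨y, w⟩
    have h2 : (⟨f.symm (f y), mfderiv (𝓡 d) (𝓡 d) f.symm (f y) (mfderiv (𝓡 d) (𝓡 d) f y w)⟩ :
      TangentBundle (𝓡 d) M) ∈ coneSet U Ccu := ⟨hfx, hv⟩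
    rw [h1] at h2
    exact h2.2

/-- Two rounds of domination give (19/10)² > 2, which recovers the factor required in the
definition. -/
theorem two_mul_lt_of_dom {a₁ a₂ b₁ b₂ : ℝ} (h₁ : 0 < a₁) (h₂ : 0 < a₂)
    (h : 19 / 10 * a₁ ≤ b₁) (h' : 19 / 10 * a₂ * b₁ ≤ a₁ * b₂) : 2 * a₂ < b₂ := by
  have h3 := mul_le_mul_of_nonneg_left h h₂.le
  have h4 := mul_pos h₁ h₂
  refine lt_of_mul_lt_mul_left ?_ h₁.le
  nlinarith

/-- An adapted pair with complementary subspaces has a dominated splitting in the cones. -/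
theorem Adapted.exists_dominatedSplitting {g : M ≃ₘ^1⟮𝓡 d, 𝓡 d⟯ M} {U V : Set M}
    {Ca Cb : ∀ x : M, Set (TangentSpace (𝓡 d) x)} {C : ℝ} {n₀ : ℕ}
    (H : Adapted g U V Ca Cb C n₀) (hn₀ : 1 ≤ n₀)
    (hex : ∀ x ∈ maxInvariant g V, ∃ F E : Submodule ℝ (TangentSpace (𝓡 d) x), IsCompl F E ∧
        (∀ v ∈ F, (⟨x, v⟩ : TangentBundle (𝓡 d) M) ∈ allTime g U Ca) ∧
        (∀ v ∈ E, (⟨x, v⟩ : TangentBundle (𝓡 d) M) ∈ allTime g.symm U Cb)) :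
    ∃ Ecu Ecs : ∀ x : M, Submodule ℝ (TangentSpace (𝓡 d) x),
      IsDominatedSplitting g (maxInvariant g V) Ecu Ecs ∧
      Subordinate (maxInvariant g V) Ecu Ecs Cb Ca := by
  choose! F E hFE hF hE using hex
  have hFiff : ∀ x ∈ maxInvariant g V, ∀ v, v ∈ F x ↔
      (⟨x, v⟩ : TangentBundle (𝓡 d) M) ∈ allTime g U Ca := fun x hx v =>
    ⟨hF x hx v, fun hv => H.mem_of_isCompl hx (hFE x hx) (hF x hx) (hE x hx) hv⟩
  have hEiff : ∀ x ∈ maxInvariant g V, ∀ v, v ∈ E x ↔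
      (⟨x, v⟩ : TangentBundle (𝓡 d) M) ∈ allTime g.symm U Cb := fun x hx v =>
    ⟨hE x hx v, fun hv => H.symm.mem_of_isCompl (by rwa [maxInvariant_symm]) (hFE x hx).symm
      (hE x hx) (hF x hx) hv⟩
  -- The time 2n₀ leaves room for two successive rounds of domination by 19/10.
  refine ⟨E, F, ⟨fun x hx => (hFE x hx).symm, fun x hx => ?_, fun x hx => ?_, 2 * n₀, by omega, ?_⟩,
    fun x hx => ⟨fun v hv => (hE x hx v hv 0).2, fun v hv => (hF x hx v hv 0).2⟩⟩
  · ext w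
    obtain ⟨v, rfl⟩ := exists_mfderiv_eq g x w
    rw [hEiff _ (map_mem_maxInvariant hx)]
    constructor
    · rintro ⟨v', hv', hvv⟩
      rw [← hvv]
      exact map_mem_allTime_symm H.backB (p := ⟨x, v'⟩) (maxInvariant_subset _ _ hx)
        (maxInvariant_subset _ _ (map_mem_maxInvariant hx)) ((hEiff x hx v').1 hv')
    · intro hw
      refine ⟨v, (hEiff x hx v).2 ?_, rfl⟩
      have := tangentCMap_mem_allTime hw 1
      change tangentCMap g.symm (tangentCMap g ⟨x, v⟩) ∈ _ at this
      rwa [tangentCMap_symm_tangentCMap] at this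
  · ext w
    obtain ⟨v, rfl⟩ := exists_mfderiv_eq g x w
    rw [hFiff _ (map_mem_maxInvariant hx)]
    constructor
    · rintro ⟨v', hv', hvv⟩
      rw [← hvv]
      exact tangentCMap_mem_allTime ((hFiff x hx v').1 hv') 1
    · intro hw
      refine ⟨v, (hFiff x hx v).2 fun k => ?_, rfl⟩
      cases k with
      | zero =>
        have hw0 : tangentCMap g ⟨x, v⟩ ∈ coneSet U Ca := hw 0
        exact H.backA ⟨x, v⟩ (maxInvariant_subset _ _ hx)
          (maxInvariant_subset _ _ (map_mem_maxInvariant hx)) (subset_closure hw0)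
      | succ k => exact hw k
  · intro m hm x hx v hv w hw hv1 hw1
    obtain ⟨k, rfl⟩ : ∃ k, m = k + n₀ := ⟨m - n₀, by omega⟩
    have hw' := tangentCMap_mem_allTime ((hFiff x hx w).1 hw) n₀
    have hv' := iterate_mem_allTime_symm H.backB (p := ⟨x, v⟩) hx ((hEiff x hx v).1 hv) n₀
    have h1 := H.dom n₀ le_rfl x w v hx (hF x hx w hw) (hE x hx v hv)
    have hpos : ∀ n, 0 < ‖((tangentCMap g)^[n] ⟨x, w⟩).snd‖ := fun n => by
      refine norm_pos_iff.2 fun h0 => ?_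
      have h4 : w = 0 := tangentCMap_iterate_snd_ne_zero (p := ⟨x, w⟩) g h0
      rw [h4, norm_zero] at hw1
      exact one_ne_zero hw1.symm
    have e : ∀ u : TangentSpace (𝓡 d) x, ‖mfderiv (𝓡 d) (𝓡 d) g^[k + n₀] x u‖ =
        ‖((tangentCMap g)^[k] ((tangentCMap g)^[n₀] ⟨x, u⟩)).snd‖ := fun u => by
      rw [← Function.iterate_add_apply, tangentCMap_iterate]
    have hk := hpos (k + n₀)
    rw [Function.iterate_add_apply] at hk
    rw [e, e]
    have h2 := hpos n₀
    rw [hv1, hw1, mul_one, one_mul] at h1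
    rw [tangentCMap_iterate g n₀] at hw' hv' h1 h2 hk ⊢
    rw [tangentCMap_iterate g n₀] at h1 ⊢
    have h3 := H.dom k (by omega) _ _ _ (iterate_mem_maxInvariant hx n₀) hw' hv'
    exact two_mul_lt_of_dom h2 hk h1 h3

end Existence

/-! ### The geodesic equation of a metric on an open subset of a Euclidean space -/

section GeodesicEquation

variable {E : Type*} [NormedAddCommGroup E] [InnerProductSpace ℝ E] [FiniteDimensional ℝ E]

theorem hasDerivAt_of_inner {P : ℝ → E} {P' : E} {t : ℝ}
    (h : ∀ w : E, HasDerivAt (fun s => inner ℝ (P s) w) (inner ℝ P' w) t) : HasDerivAt P P' t := by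
  have e : ∀ v : E, ∑ i, inner ℝ v (stdOrthonormalBasis ℝ E i) • stdOrthonormalBasis ℝ E i = v :=
    fun v => by simpa only [real_inner_comm] using (stdOrthonormalBasis ℝ E).sum_repr' v
  have h1 := HasDerivAt.fun_sum (u := Finset.univ)
    fun i _ => (h (stdOrthonormalBasis ℝ E i)).smul_const (stdOrthonormalBasis ℝ E i)
  simpa only [e] using h1

/-- The force `(1/2) ∇_u ⟪G(u) p, p⟫` in the Euler-Lagrange equation. -/
def metricForce (G : E → E →L[ℝ] E) (u p : E) : E :=
  ∑ i, (1 / 2 * inner ℝ (fderiv ℝ G u (stdOrthonormalBasis ℝ E i) p) p) • stdOrthonormalBasis ℝ E i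

theorem inner_metricForce (G : E → E →L[ℝ] E) (u p w : E) :
    inner ℝ (metricForce G u p) w = 1 / 2 * inner ℝ (fderiv ℝ G u w p) p := by
  conv_rhs => rw [← (stdOrthonormalBasis ℝ E).sum_repr' w]
  simp only [metricForce, sum_inner, inner_smul_left, map_sum, map_smul, sum_apply,
    smul_apply, Finset.mul_sum]
  refine Finset.sum_congr rfl fun i _ => ?_
  simp only [conj_trivial]
  ring

/-- The geodesic spray of the metric `G`. -/
def spray (G : E → E →L[ℝ] E) (u p : E) : E :=
  (G u).inverse (metricForce G u p - fderiv ℝ G u p p)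

/-- A smooth Riemannian metric on the open set `Ω`. -/
structure IsMetricField (G : E → E →L[ℝ] E) (Ω : Set E) : Prop where
  isOpen : IsOpen Ω
  contDiffOn : ContDiffOn ℝ ∞ G Ω
  symm : ∀ u ∈ Ω, ∀ a b, inner ℝ (G u a) b = inner ℝ (G u b) a
  pos : ∀ u ∈ Ω, ∀ a, a ≠ 0 → 0 < inner ℝ (G u a) a

variable {G : E → E →L[ℝ] E} {Ω : Set E}

theorem IsMetricField.exists_equiv (h : IsMetricField G Ω) {u : E} (hu : u ∈ Ω) :
    ∃ e : E ≃L[ℝ] E, (e : E →L[ℝ] E) = G u := by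
  have hinj : Function.Injective (G u).toLinearMap := by
    rw [← LinearMap.ker_eq_bot, LinearMap.ker_eq_bot']
    intro a ha
    by_contra h0
    have h1 := h.pos u hu a h0
    have h2 : G u a = 0 := ha
    rw [h2, inner_zero_left] at h1
    exact lt_irrefl _ h1
  refine ⟨(LinearEquiv.ofInjectiveEndo (G u).toLinearMap hinj).toContinuousLinearEquiv, ?_⟩
  ext a
  rfl

theorem IsMetricField.inverse_apply (h : IsMetricField G Ω) {u : E} (hu : u ∈ Ω) (a : E) :
    (G u).inverse (G u a) = a := by
  obtain ⟨e, he⟩ := h.exists_equiv hu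
  rw [← he, ContinuousLinearMap.inverse_equiv]
  exact e.symm_apply_apply a

theorem IsMetricField.apply_inverse (h : IsMetricField G Ω) {u : E} (hu : u ∈ Ω) (a : E) :
    G u ((G u).inverse a) = a := by
  obtain ⟨e, he⟩ := h.exists_equiv hu
  rw [← he, ContinuousLinearMap.inverse_equiv]
  exact e.apply_symm_apply a

theorem IsMetricField.differentiableAt (h : IsMetricField G Ω) {u : E} (hu : u ∈ Ω) :
    DifferentiableAt ℝ G u :=
  (h.contDiffOn.contDiffAt (h.isOpen.mem_nhds hu)).differentiableAt (by simp)

theorem IsMetricField.contDiffAt_spray (h : IsMetricField G Ω) {q : E × E} (hq : q.1 ∈ Ω) :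
    ContDiffAt ℝ ∞ (fun q : E × E => spray G q.1 q.2) q := by
  have hG : ContDiffAt ℝ ∞ G q.1 := h.contDiffOn.contDiffAt (h.isOpen.mem_nhds hq)
  have h1 : ContDiffAt ℝ ∞ (fun q : E × E => fderiv ℝ G q.1) q :=
    (hG.fderiv_right (m := ∞) (by simp)).comp q contDiffAt_fst
  obtain ⟨e, he⟩ := h.exists_equiv hq
  have h2 : ContDiffAt ℝ ∞ (fun q : E × E => (G q.1).inverse) q := by
    have h3 : ContDiffAt ℝ ∞ (ContinuousLinearMap.inverse : (E →L[ℝ] E) → E →L[ℝ] E) (G q.1) := by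
      rw [← he]; exact contDiffAt_map_inverse e
    exact h3.comp q (hG.comp q contDiffAt_fst)
  have h4 : ContDiffAt ℝ ∞ (fun q : E × E => q.2) q := contDiffAt_snd
  refine h2.clm_apply (ContDiffAt.sub ?_ ((h1.clm_apply h4).clm_apply h4))
  refine ContDiffAt.sum fun i _ => ContDiffAt.smul ?_ contDiffAt_const
  exact contDiffAt_const.mul (((h1.clm_apply contDiffAt_const).clm_apply h4).inner ℝ h4)

/-- The Euler-Lagrange equation, at time `t`. -/
def ELAt (G : E → E →L[ℝ] E) (c : ℝ → E) (t : ℝ) : Prop :=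
  HasDerivAt (fun s => G (c s) (deriv c s)) (metricForce G (c t) (deriv c t)) t

theorem IsMetricField.hasDerivAt_momentum (h : IsMetricField G Ω) {c p : ℝ → E} {t : ℝ} {p' : E}
    (hc : c t ∈ Ω) (h1 : HasDerivAt c (p t) t) (h2 : HasDerivAt p p' t) :
    HasDerivAt (fun s => G (c s) (p s)) (fderiv ℝ G (c t) (p t) (p t) + G (c t) p') t := by
  have h3 : HasDerivAt (fun s => G (c s)) (fderiv ℝ G (c t) (p t)) t :=
    (h.differentiableAt hc).hasFDerivAt.comp_hasDerivAt t h1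
  exact h3.clm_apply h2

theorem IsMetricField.hasDerivAt_deriv_of_elAt (h : IsMetricField G Ω) {c : ℝ → E} {t : ℝ}
    (hc : c t ∈ Ω) (h1 : DifferentiableAt ℝ c t) (h2 : DifferentiableAt ℝ (deriv c) t)
    (hEL : ELAt G c t) : HasDerivAt (deriv c) (spray G (c t) (deriv c t)) t := by
  have h3 := (h.hasDerivAt_momentum hc h1.hasDerivAt h2.hasDerivAt).unique hEL
  have h4 : spray G (c t) (deriv c t) = deriv (deriv c) t := by
    rw [spray, ← h3, add_sub_cancel_left, h.inverse_apply hc]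
  rw [h4]
  exact h2.hasDerivAt

theorem IsMetricField.elAt_of_hasDerivAt (h : IsMetricField G Ω) {c : ℝ → E} {t : ℝ}
    (hc : c t ∈ Ω) (h1 : DifferentiableAt ℝ c t)
    (h2 : HasDerivAt (deriv c) (spray G (c t) (deriv c t)) t) : ELAt G c t := by
  have h3 := h.hasDerivAt_momentum hc h1.hasDerivAt h2
  rwa [spray, h.apply_inverse hc, add_sub_cancel] at h3

/-- Conservation of energy. -/
theorem IsMetricField.hasDerivAt_energy (h : IsMetricField G Ω) {c : ℝ → E} {t : ℝ}
    (hc : c t ∈ Ω) (h1 : DifferentiableAt ℝ c t) (h2 : DifferentiableAt ℝ (deriv c) t)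
    (hEL : ELAt G c t) : HasDerivAt (fun s => inner ℝ (G (c s) (deriv c s)) (deriv c s)) 0 t := by
  have h3 := HasDerivAt.inner ℝ hEL h2.hasDerivAt
  have h4 := (h.hasDerivAt_momentum hc h1.hasDerivAt h2.hasDerivAt).unique hEL
  refine h3.congr_deriv ?_
  have h5 : inner ℝ (metricForce G (c t) (deriv c t)) (deriv c t) =
      inner ℝ (fderiv ℝ G (c t) (deriv c t) (deriv c t)) (deriv c t) +
        inner ℝ (G (c t) (deriv (deriv c) t)) (deriv c t) := by rw [← inner_add_left, h4]
  rw [inner_metricForce] at h5 ⊢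
  rw [h.symm _ hc (deriv c t)]
  linarith

/-- The Euler-Lagrange equation is invariant under changes of coordinates. -/
theorem IsMetricField.elAt_of_comp {G₂ : E → E →L[ℝ] E} {Ω₂ : Set E} (h : IsMetricField G Ω)
    (h₂ : IsMetricField G₂ Ω₂) {τ : E → E} {y : ℝ → E} {t : ℝ} (hy : y t ∈ Ω) (hτy : τ (y t) ∈ Ω₂)
    (hτ : ContDiffAt ℝ ∞ τ (y t))
    (hG : ∀ᶠ u in 𝓝 (y t), ∀ a b, inner ℝ (G u a) b =
      inner ℝ (G₂ (τ u) (fderiv ℝ τ u a)) (fderiv ℝ τ u b))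
    (hyd : ContDiffAt ℝ ∞ y t) (hEL : ELAt G₂ (fun s => τ (y s)) t) : ELAt G y t := by
  have hy1 : DifferentiableAt ℝ y t := hyd.differentiableAt (by simp)
  have hτ1 : DifferentiableAt ℝ τ (y t) := hτ.differentiableAt (by simp)
  have hτ2 : DifferentiableAt ℝ (fderiv ℝ τ) (y t) :=
    (hτ.fderiv_right (m := ∞) (by simp)).differentiableAt (by simp)
  -- Second derivatives of the coordinate change appear on both sides of the Euler-Lagrange
  -- equation; their symmetry makes them cancel.
  have hsymm : ∀ v w : E, fderiv ℝ (fderiv ℝ τ) (y t) v w = fderiv ℝ (fderiv ℝ τ) (y t) w v :=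
    fun v w => (hτ.isSymmSndFDerivAt (by
      rw [minSmoothness_of_isRCLikeNormedField]; exact WithTop.coe_le_coe.2 le_top)) v w
  have hev1 : ∀ᶠ s in 𝓝 t, DifferentiableAt ℝ y s := by
    filter_upwards [(hyd.of_le (m := 1) (by simp)).eventually (by simp)] with s hs
    exact hs.differentiableAt one_ne_zero
  have hev2 : ∀ᶠ u in 𝓝 (y t), DifferentiableAt ℝ τ u := by
    filter_upwards [(hτ.of_le (m := 1) (by simp)).eventually (by simp)] with s hs
    exact hs.differentiableAt one_ne_zero
  have hder : ∀ᶠ s in 𝓝 t, deriv (fun s => τ (y s)) s = fderiv ℝ τ (y s) (deriv y s) := by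
    filter_upwards [hev1, hy1.continuousAt.eventually hev2] with s h1 h2
    exact (h2.hasFDerivAt.comp_hasDerivAt s h1.hasDerivAt).deriv
  refine hasDerivAt_of_inner fun w => ?_
  have hw : HasDerivAt (fun s => fderiv ℝ τ (y s) w) (fderiv ℝ (fderiv ℝ τ) (y t) (deriv y t) w) t := by
    have := (hτ2.hasFDerivAt.comp_hasDerivAt t hy1.hasDerivAt).clm_apply (hasDerivAt_const t w)
    simpa using this
  have h3 := HasDerivAt.inner ℝ hEL hw
  have h4 := h3.congr_of_eventuallyEq (f₁ := fun s => inner ℝ (G (y s) (deriv y s)) w) (by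
    filter_upwards [hder, hy1.continuousAt.eventually hG] with s h1 h2
    rw [h2, h1])
  refine h4.congr_deriv ?_
  rw [inner_metricForce, inner_metricForce, hder.self_of_nhds]
  set a := deriv y t with ha
  have hl : Tendsto (fun s : ℝ => y t + s • w) (𝓝 0) (𝓝 (y t)) := by
    have : Continuous fun s : ℝ => y t + s • w := by fun_prop
    simpa using this.tendsto 0
  have hl0 : y t + (0 : ℝ) • w = y t := by rw [zero_smul, add_zero]
  have e2 : HasDerivAt (fun s : ℝ => inner ℝ (G (y t + s • w) a) a)
      (inner ℝ (fderiv ℝ G (y t) w a) a) 0 := by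
    have h5 : HasDerivAt (fun s : ℝ => G (y t + s • w)) (fderiv ℝ G (y t) w) 0 :=
      (h.differentiableAt hy).hasFDerivAt.hasLineDerivAt w
    have := HasDerivAt.inner ℝ (h5.clm_apply (hasDerivAt_const 0 a)) (hasDerivAt_const 0 a)
    refine this.congr_deriv ?_
    rw [inner_zero_right, zero_add, map_zero, add_zero]
  have e3 : HasDerivAt (fun s : ℝ => fderiv ℝ τ (y t + s • w) a)
      (fderiv ℝ (fderiv ℝ τ) (y t) w a) 0 := by
    have h5 : HasDerivAt (fun s : ℝ => fderiv ℝ τ (y t + s • w)) (fderiv ℝ (fderiv ℝ τ) (y t) w) 0 :=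
      hτ2.hasFDerivAt.hasLineDerivAt w
    refine (h5.clm_apply (hasDerivAt_const 0 a)).congr_deriv ?_
    rw [map_zero, add_zero]
  have e4 : HasDerivAt (fun s : ℝ => τ (y t + s • w)) (fderiv ℝ τ (y t) w) 0 :=
    hτ1.hasFDerivAt.hasLineDerivAt w
  have e5 : HasDerivAt (fun s : ℝ => G₂ (τ (y t + s • w))) (fderiv ℝ G₂ (τ (y t)) (fderiv ℝ τ (y t) w)) 0 :=
    HasFDerivAt.comp_hasDerivAt (0 : ℝ) (by
      rw [hl0]; exact (h₂.differentiableAt hτy).hasFDerivAt) e4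
  have e6 := HasDerivAt.inner ℝ (e5.clm_apply e3) e3
  -- Differentiating the pullback identity for the metrics at the velocity a, in the direction w,
  -- expresses the force of G through that of G₂ and the second derivative of τ.
  have e7 := e2.unique (e6.congr_of_eventuallyEq (by
    filter_upwards [hl.eventually hG] with s hs
    exact hs a a))
  rw [e7]
  simp only [hl0, inner_add_left]
  rw [h₂.symm _ hτy (fderiv ℝ (fderiv ℝ τ) (y t) w a), hsymm a w]
  ring

end GeodesicEquation

/-! ### The Riemannian metric and the geodesic equation in charts -/

section ChartMetric

variable {d : ℕ} {M : Type*} [MetricSpace M]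
  [ChartedSpace (EuclideanSpace ℝ (Fin d)) M] [IsManifold (𝓡 d) ∞ M]
  [RiemannianBundle (fun x : M => TangentSpace (𝓡 d) x)]
  [IsContMDiffRiemannianBundle (𝓡 d) ∞ (EuclideanSpace ℝ (Fin d))
      (fun x : M => TangentSpace (𝓡 d) x)]

theorem mem_extChartAt_source_iff {c x : M} :
    x ∈ (extChartAt (𝓡 d) c).source ↔ x ∈ (chartAt (EuclideanSpace ℝ (Fin d)) c).source := by
  rw [extChartAt_source]

/-- The pullback of the Riemannian metric under a linear map. -/
def pullbackForm (y : M) (L : EuclideanSpace ℝ (Fin d) →L[ℝ] TangentSpace (𝓡 d) y) :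
    EuclideanSpace ℝ (Fin d) →ₗ[ℝ] EuclideanSpace ℝ (Fin d) →ₗ[ℝ] ℝ :=
  LinearMap.mk₂ ℝ (fun a b => inner ℝ (L a) (L b))
    (fun a a' b => by rw [map_add, inner_add_left])
    (fun r a b => by rw [map_smul, real_inner_smul_left, smul_eq_mul])
    (fun a b b' => by rw [map_add, inner_add_right])
    (fun r a b => by rw [map_smul, real_inner_smul_right, smul_eq_mul])

theorem chartMetric_eq_pullbackForm (c : M) (u a b : EuclideanSpace ℝ (Fin d)) :
    chartMetric c u a b = pullbackForm ((extChartAt (𝓡 d) c).symm u)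
      (mfderiv 𝓘(ℝ, EuclideanSpace ℝ (Fin d)) (𝓡 d) (extChartAt (𝓡 d) c).symm u) a b := rfl

theorem chartMetric_extChartAt {c x : M} (hx : x ∈ (chartAt (EuclideanSpace ℝ (Fin d)) c).source)
    (a b : EuclideanSpace ℝ (Fin d)) :
    chartMetric c (extChartAt (𝓡 d) c x) a b = inner ℝ (chartDInv c x a) (chartDInv c x b) := by
  -- The two base points agree only propositionally. All tangent spaces are the same model space, so
  -- the linear map is kept fixed while the base point is replaced.
  have key : ∀ (y : M) (_ : y = x) (L : EuclideanSpace ℝ (Fin d) →L[ℝ] EuclideanSpace ℝ (Fin d)),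
      pullbackForm y L a b = pullbackForm x L a b := by
    rintro y rfl L; rfl
  rw [chartMetric_eq_pullbackForm]
  refine (key _ ((extChartAt (𝓡 d) c).left_inv (mem_extChartAt_source_iff.2 hx)) _).trans ?_
  change _ = pullbackForm x (chartDInv c x) a b
  rw [chartDInv_eq_mfderiv hx]

theorem inner_eq_chartMetric {c x : M} (hx : x ∈ (chartAt (EuclideanSpace ℝ (Fin d)) c).source)
    (v w : TangentSpace (𝓡 d) x) :
    inner ℝ v w = chartMetric c (extChartAt (𝓡 d) c x) (chartD c x v) (chartD c x w) := by
  rw [chartMetric_extChartAt hx, chartDInv_chartD hx, chartDInv_chartD hx]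

/-- The operator representing the Riemannian metric in the chart around `c`. -/
def metricMap (c : M) (u : EuclideanSpace ℝ (Fin d)) :
    EuclideanSpace ℝ (Fin d) →L[ℝ] EuclideanSpace ℝ (Fin d) :=
  ∑ i, ∑ j, chartMetric c u (stdOrthonormalBasis ℝ (EuclideanSpace ℝ (Fin d)) j)
    (stdOrthonormalBasis ℝ (EuclideanSpace ℝ (Fin d)) i) •
    (innerSL ℝ (stdOrthonormalBasis ℝ (EuclideanSpace ℝ (Fin d)) j)).smulRight
      (stdOrthonormalBasis ℝ (EuclideanSpace ℝ (Fin d)) i)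

theorem inner_metricMap (c : M) (u a b : EuclideanSpace ℝ (Fin d)) :
    inner ℝ (metricMap c u a) b = chartMetric c u a b := by
  set e := stdOrthonormalBasis ℝ (EuclideanSpace ℝ (Fin d)) with he
  let chartForm := pullbackForm ((extChartAt (𝓡 d) c).symm u)
    (mfderiv 𝓘(ℝ, EuclideanSpace ℝ (Fin d)) (𝓡 d) (extChartAt (𝓡 d) c).symm u)
  have h1 : chartMetric c u a b =
      chartForm (∑ j, inner ℝ (e j) a • e j) (∑ i, inner ℝ (e i) b • e i) := by
    rw [e.sum_repr', e.sum_repr']; rfl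
  have h2 : ∀ i j, chartForm (e i) (e j) = chartMetric c u (e i) (e j) := fun _ _ => rfl
  rw [h1]
  simp only [map_sum, map_smul, sum_inner, inner_smul_left, LinearMap.sum_apply,
    LinearMap.smul_apply, metricMap, sum_apply, smul_apply, ContinuousLinearMap.smulRight_apply,
    innerSL_apply_apply, conj_trivial, h2, smul_eq_mul, Finset.mul_sum]
  refine Finset.sum_congr rfl fun j _ => Finset.sum_congr rfl fun i _ => ?_
  simp only [← he]
  ring

theorem contMDiffOn_chartDInv (c : M) (a : EuclideanSpace ℝ (Fin d)) :
    ContMDiffOn 𝓘(ℝ, EuclideanSpace ℝ (Fin d)) (𝓡 d).tangent ∞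
      (fun u => (⟨(extChartAt (𝓡 d) c).symm u, chartDInv c ((extChartAt (𝓡 d) c).symm u) a⟩ :
        TangentBundle (𝓡 d) M)) (extChartAt (𝓡 d) c).target := by
  have hmem : ∀ u ∈ (extChartAt (𝓡 d) c).target,
      (extChartAt (𝓡 d) c).symm u ∈ (chartAt (EuclideanSpace ℝ (Fin d)) c).source := fun u hu => by
    have := (extChartAt (𝓡 d) c).map_target hu
    rwa [extChartAt_source] at this
  refine (Trivialization.contMDiffOn_iff
    (e := trivializationAt (EuclideanSpace ℝ (Fin d)) (TangentSpace (𝓡 d)) c) ?_).2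
    ⟨contMDiffOn_extChartAt_symm c, ?_⟩
  · intro u hu
    rw [TangentBundle.trivializationAt_source]
    exact hmem u hu
  · refine contMDiffOn_const (c := a) |>.congr fun u hu => ?_
    have h1 := Trivialization.coe_linearMapAt_of_mem (R := ℝ)
      (trivializationAt (EuclideanSpace ℝ (Fin d)) (TangentSpace (𝓡 d)) c)
      (b := (extChartAt (𝓡 d) c).symm u) (by simpa using hmem u hu)
    have h2 := chartD_chartDInv (hmem u hu) a
    exact (congrFun h1 (chartDInv c ((extChartAt (𝓡 d) c).symm u) a)).symm.trans h2

theorem contDiffOn_chartMetric (c : M) (a b : EuclideanSpace ℝ (Fin d)) :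
    ContDiffOn ℝ ∞ (fun u => chartMetric c u a b) (extChartAt (𝓡 d) c).target := by
  have h := ContMDiffOn.inner_bundle (contMDiffOn_chartDInv c a) (contMDiffOn_chartDInv c b)
  refine h.contDiffOn.congr fun u hu => ?_
  have hm := (extChartAt (𝓡 d) c).map_target hu
  rw [extChartAt_source] at hm
  have := chartMetric_extChartAt hm a b
  rwa [(extChartAt (𝓡 d) c).right_inv hu] at this

theorem isMetricField_metricMap (c : M) :
    IsMetricField (metricMap c) (extChartAt (𝓡 d) c).target where
  isOpen := isOpen_extChartAt_target c
  contDiffOn := by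
    exact ContDiffOn.sum fun i _ => ContDiffOn.sum fun j _ =>
      (contDiffOn_chartMetric c _ _).smul contDiffOn_const
  symm u hu a b := by
    rw [inner_metricMap, inner_metricMap]
    exact real_inner_comm _ _
  pos u hu a ha := by
    rw [inner_metricMap]
    have hm := (extChartAt (𝓡 d) c).map_target hu
    rw [extChartAt_source] at hm
    have h := chartMetric_extChartAt hm a a
    rw [(extChartAt (𝓡 d) c).right_inv hu] at h
    rw [h, real_inner_self_eq_norm_sq]
    have : chartDInv c ((extChartAt (𝓡 d) c).symm u) a ≠ 0 := fun h0 => ha (by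
      rw [← chartD_chartDInv hm a, h0, map_zero])
    have := norm_pos_iff.2 this
    positivity

/-- The change of coordinates between two charts. -/
def chartChange (c₁ c₂ : M) : EuclideanSpace ℝ (Fin d) → EuclideanSpace ℝ (Fin d) :=
  fun u => extChartAt (𝓡 d) c₂ ((extChartAt (𝓡 d) c₁).symm u)

theorem hasMFDerivAt_extChartAt {c x : M} (hx : x ∈ (chartAt (EuclideanSpace ℝ (Fin d)) c).source) :
    HasMFDerivAt (𝓡 d) 𝓘(ℝ, EuclideanSpace ℝ (Fin d)) (extChartAt (𝓡 d) c) x (chartD c x) := by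
  rw [chartD_eq_mfderiv hx]
  exact (mdifferentiableAt_extChartAt hx).hasMFDerivAt

theorem contMDiffAt_extChartAt_symm {c x : M}
    (hx : x ∈ (chartAt (EuclideanSpace ℝ (Fin d)) c).source) :
    ContMDiffAt 𝓘(ℝ, EuclideanSpace ℝ (Fin d)) (𝓡 d) ∞ (extChartAt (𝓡 d) c).symm
      (extChartAt (𝓡 d) c x) :=
  (contMDiffOn_extChartAt_symm c).contMDiffAt ((isOpen_extChartAt_target c).mem_nhds
    ((extChartAt (𝓡 d) c).map_source (mem_extChartAt_source_iff.2 hx)))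

theorem hasMFDerivAt_extChartAt_symm {c x : M}
    (hx : x ∈ (chartAt (EuclideanSpace ℝ (Fin d)) c).source) :
    HasMFDerivAt 𝓘(ℝ, EuclideanSpace ℝ (Fin d)) (𝓡 d) (extChartAt (𝓡 d) c).symm
      (extChartAt (𝓡 d) c x) (chartDInv c x) := by
  rw [chartDInv_eq_mfderiv hx]
  exact ((contMDiffAt_extChartAt_symm hx).mdifferentiableAt (by simp)).hasMFDerivAt

theorem hasFDerivAt_chartChange {c₁ c₂ x : M}
    (h₁ : x ∈ (chartAt (EuclideanSpace ℝ (Fin d)) c₁).source)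
    (h₂ : x ∈ (chartAt (EuclideanSpace ℝ (Fin d)) c₂).source) :
    HasFDerivAt (chartChange (d := d) c₁ c₂) ((chartD c₂ x).comp (chartDInv c₁ x))
      (extChartAt (𝓡 d) c₁ x) := by
  have key : ∀ (y : M) (_ : y = x), HasMFDerivAt (𝓡 d) 𝓘(ℝ, EuclideanSpace ℝ (Fin d))
      (extChartAt (𝓡 d) c₂) y
      (chartD c₂ x : EuclideanSpace ℝ (Fin d) →L[ℝ] EuclideanSpace ℝ (Fin d)) := by
    rintro y rfl; exact hasMFDerivAt_extChartAt h₂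
  have h := (key _ ((extChartAt (𝓡 d) c₁).left_inv (mem_extChartAt_source_iff.2 h₁))).comp
    (extChartAt (𝓡 d) c₁ x) (hasMFDerivAt_extChartAt_symm h₁)
  exact h.hasFDerivAt

theorem contDiffAt_chartChange {c₁ c₂ x : M}
    (h₁ : x ∈ (chartAt (EuclideanSpace ℝ (Fin d)) c₁).source)
    (h₂ : x ∈ (chartAt (EuclideanSpace ℝ (Fin d)) c₂).source) :
    ContDiffAt ℝ ∞ (chartChange (d := d) c₁ c₂) (extChartAt (𝓡 d) c₁ x) := by
  have h3 : ContMDiffAt (𝓡 d) 𝓘(ℝ, EuclideanSpace ℝ (Fin d)) ∞ (extChartAt (𝓡 d) c₂)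
      ((extChartAt (𝓡 d) c₁).symm (extChartAt (𝓡 d) c₁ x)) := by
    rw [(extChartAt (𝓡 d) c₁).left_inv (mem_extChartAt_source_iff.2 h₁)]
    exact contMDiffAt_extChartAt' h₂
  exact (h3.comp _ (contMDiffAt_extChartAt_symm h₁)).contDiffAt

theorem metricMap_chartChange {c₁ c₂ x : M}
    (h₁ : x ∈ (chartAt (EuclideanSpace ℝ (Fin d)) c₁).source)
    (h₂ : x ∈ (chartAt (EuclideanSpace ℝ (Fin d)) c₂).source) :
    ∀ᶠ u in 𝓝 (extChartAt (𝓡 d) c₁ x), ∀ a b : EuclideanSpace ℝ (Fin d),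
      inner ℝ (metricMap c₁ u a) b = inner ℝ (metricMap c₂ (chartChange c₁ c₂ u)
        (fderiv ℝ (chartChange c₁ c₂) u a)) (fderiv ℝ (chartChange c₁ c₂) u b) := by
  have hx := mem_extChartAt_source_iff.2 h₁
  have hcont : Tendsto (extChartAt (𝓡 d) c₁).symm (𝓝 (extChartAt (𝓡 d) c₁ x)) (𝓝 x) := by
    have := (continuousAt_extChartAt_symm' hx).tendsto
    rwa [(extChartAt (𝓡 d) c₁).left_inv hx] at this
  filter_upwards [(isOpen_extChartAt_target c₁).mem_nhds ((extChartAt (𝓡 d) c₁).map_source hx),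
    hcont.eventually ((chartAt (EuclideanSpace ℝ (Fin d)) c₂).open_source.mem_nhds h₂)]
    with u hu hu2 a b
  have hu1 := (extChartAt (𝓡 d) c₁).map_target hu
  rw [extChartAt_source] at hu1
  have e := (extChartAt (𝓡 d) c₁).right_inv hu
  rw [inner_metricMap, inner_metricMap]
  have h3 := hasFDerivAt_chartChange hu1 hu2
  rw [e] at h3
  rw [h3.fderiv]
  have h4 := chartMetric_extChartAt hu1 a b
  rw [e] at h4
  rw [h4, inner_eq_chartMetric hu2]
  rfl

/-! ### Geodesics -/

/-- The curve `γ` is smooth and satisfies the geodesic equation at time `t`. -/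
structure GeodAt (γ : ℝ → M) (t : ℝ) : Prop where
  contMDiffAt : ContMDiffAt 𝓘(ℝ, ℝ) (𝓡 d) ∞ γ t
  elAt : ∀ c : M, γ t ∈ (chartAt (EuclideanSpace ℝ (Fin d)) c).source →
    ELAt (metricMap c) (fun s => extChartAt (𝓡 d) c (γ s)) t

theorem fderiv_chartMetric {c : M} {u : EuclideanSpace ℝ (Fin d)}
    (hu : u ∈ (extChartAt (𝓡 d) c).target) (p w : EuclideanSpace ℝ (Fin d)) :
    fderiv ℝ (fun u => chartMetric c u p p) u w = inner ℝ (fderiv ℝ (metricMap c) u w p) p := by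
  have h1 := ((isMetricField_metricMap c).differentiableAt hu).hasFDerivAt
  have h2 : HasFDerivAt (fun u => metricMap c u p) ((fderiv ℝ (metricMap c) u).flip p) u := by
    simpa using h1.clm_apply (hasFDerivAt_const p u)
  have h3 : HasFDerivAt (fun u => chartMetric c u p p)
      ((innerSL ℝ p).comp ((fderiv ℝ (metricMap c) u).flip p)) u := by
    refine ((innerSL ℝ p).hasFDerivAt.comp u h2).congr_of_eventuallyEq
      (Eventually.of_forall fun v => ?_)
    change _ = inner ℝ p (metricMap c v p)
    rw [real_inner_comm, inner_metricMap]
  rw [h3.fderiv]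
  change inner ℝ p (fderiv ℝ (metricMap c) u w p) = _
  exact real_inner_comm _ _

/-- Testing the vector equation against all constant w loses nothing in finite dimension; the
pointwise form is what can be localized, glued and solved. -/
theorem isGeodesic_iff {γ : ℝ → M} : IsGeodesic d γ ↔ ∀ t, GeodAt (d := d) γ t := by
  have key : ∀ (c : M) (t : ℝ), γ t ∈ (chartAt (EuclideanSpace ℝ (Fin d)) c).source →
      (ELAt (metricMap c) (fun s => extChartAt (𝓡 d) c (γ s)) t ↔
        ∀ w : EuclideanSpace ℝ (Fin d),
        HasDerivAt
        (fun s => chartMetric c (extChartAt (𝓡 d) c (γ s))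
          (deriv (fun τ => extChartAt (𝓡 d) c (γ τ)) s) w)
        (1 / 2 * fderiv ℝ
          (fun u => chartMetric c u (deriv (fun τ => extChartAt (𝓡 d) c (γ τ)) t)
            (deriv (fun τ => extChartAt (𝓡 d) c (γ τ)) t))
          (extChartAt (𝓡 d) c (γ t)) w) t) := by
    intro c t ht
    have hu := (extChartAt (𝓡 d) c).map_source (mem_extChartAt_source_iff.2 ht)
    simp only [fderiv_chartMetric hu, ← inner_metricForce]
    simp only [← inner_metricMap]
    refine ⟨fun h w => ?_, fun h => hasDerivAt_of_inner h⟩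
    have := HasDerivAt.inner ℝ h (hasDerivAt_const t w)
    simpa using this
  constructor
  · intro h t
    exact ⟨h.contMDiff.contMDiffAt, fun c hc =>
      (key c t hc).2 (h.equation c t (mem_extChartAt_source_iff.2 hc))⟩
  · intro h
    exact ⟨fun t => (h t).contMDiffAt, fun c t hc =>
      (key c t (mem_extChartAt_source_iff.1 hc)).1 ((h t).elAt c (mem_extChartAt_source_iff.1 hc))⟩

theorem ELAt.congr {G : EuclideanSpace ℝ (Fin d) → EuclideanSpace ℝ (Fin d) →L[ℝ] EuclideanSpace ℝ (Fin d)}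
    {c c' : ℝ → EuclideanSpace ℝ (Fin d)} {t : ℝ} (h : ELAt G c t) (hc : c' =ᶠ[𝓝 t] c) :
    ELAt G c' t := by
  have hd := hc.deriv
  have h1 := HasDerivAt.congr_of_eventuallyEq (f₁ := fun s => G (c' s) (deriv c' s)) h (by
    filter_upwards [hc, hd] with s h1 h2
    rw [h1, h2])
  rw [← hc.self_of_nhds, ← hd.self_of_nhds] at h1
  exact h1

theorem GeodAt.congr {γ γ' : ℝ → M} {t : ℝ} (h : GeodAt (d := d) γ t) (hγ : γ' =ᶠ[𝓝 t] γ) :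
    GeodAt (d := d) γ' t where
  contMDiffAt := h.contMDiffAt.congr_of_eventuallyEq hγ
  elAt c hc := by
    rw [hγ.self_of_nhds] at hc
    exact (h.elAt c hc).congr (hγ.mono fun s hs => by simp only [hs])

theorem contDiffAt_extChartAt_comp {γ : ℝ → M} {t : ℝ} {n : ℕ∞ω} (hn : n ≤ (∞ : ℕ∞ω))
    (h : ContMDiffAt 𝓘(ℝ, ℝ) (𝓡 d) n γ t) {c : M}
    (hc : γ t ∈ (chartAt (EuclideanSpace ℝ (Fin d)) c).source) :
    ContDiffAt ℝ n (fun s => extChartAt (𝓡 d) c (γ s)) t := by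
  have h1 : ContMDiffAt (𝓡 d) 𝓘(ℝ, EuclideanSpace ℝ (Fin d)) n (extChartAt (𝓡 d) c) (γ t) :=
    (contMDiffAt_extChartAt' (n := ∞) hc).of_le hn
  exact (h1.comp t h).contDiffAt

/-- Coordinate invariance of the Euler-Lagrange equation reduces the condition in all charts to one
chart. -/
theorem geodAt_of_elAt {γ : ℝ → M} {t : ℝ} (h : ContMDiffAt 𝓘(ℝ, ℝ) (𝓡 d) ∞ γ t) {c : M}
    (hc : γ t ∈ (chartAt (EuclideanSpace ℝ (Fin d)) c).source)
    (hEL : ELAt (metricMap c) (fun s => extChartAt (𝓡 d) c (γ s)) t) : GeodAt (d := d) γ t := by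
  refine ⟨h, fun c' hc' => ?_⟩
  have hm' := mem_extChartAt_source_iff.2 hc'
  refine (isMetricField_metricMap c').elAt_of_comp (isMetricField_metricMap c)
    (τ := chartChange c' c) (y := fun s => extChartAt (𝓡 d) c' (γ s))
    ((extChartAt (𝓡 d) c').map_source hm') ?_ (contDiffAt_chartChange hc' hc)
    (metricMap_chartChange hc' hc) (contDiffAt_extChartAt_comp le_rfl h hc') (hEL.congr ?_)
  · rw [chartChange, (extChartAt (𝓡 d) c').left_inv hm']
    exact (extChartAt (𝓡 d) c).map_source (mem_extChartAt_source_iff.2 hc)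
  · filter_upwards [h.continuousAt.eventually
      ((chartAt (EuclideanSpace ℝ (Fin d)) c').open_source.mem_nhds hc')] with s hs
    rw [chartChange, (extChartAt (𝓡 d) c').left_inv (mem_extChartAt_source_iff.2 hs)]

/-- The velocity of a curve, as an element of the tangent bundle. -/
def velocity (γ : ℝ → M) (t : ℝ) : TangentBundle (𝓡 d) M :=
  ⟨γ t, mfderiv 𝓘(ℝ, ℝ) (𝓡 d) γ t (1 : ℝ)⟩

theorem hasDerivAt_extChartAt_comp {γ : ℝ → M} {t : ℝ}
    (h : MDifferentiableAt 𝓘(ℝ, ℝ) (𝓡 d) γ t) {c : M}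
    (hc : γ t ∈ (chartAt (EuclideanSpace ℝ (Fin d)) c).source) :
    HasDerivAt (fun s => extChartAt (𝓡 d) c (γ s)) (chartD c (γ t) (velocity (d := d) γ t).snd) t := by
  have h1 := (hasMFDerivAt_extChartAt hc).comp t h.hasMFDerivAt
  have h2 : HasFDerivAt (fun s => extChartAt (𝓡 d) c (γ s))
      ((chartD c (γ t)).comp (mfderiv 𝓘(ℝ, ℝ) (𝓡 d) γ t :
        ℝ →L[ℝ] EuclideanSpace ℝ (Fin d))) t := h1.hasFDerivAt
  exact h2.hasDerivAt

theorem eventually_contMDiffAt {γ : ℝ → M} {t : ℝ} (h : ContMDiffAt 𝓘(ℝ, ℝ) (𝓡 d) ∞ γ t) :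
    ∀ᶠ s in 𝓝 t, ContMDiffAt 𝓘(ℝ, ℝ) (𝓡 d) 1 γ s :=
  (contMDiffAt_iff_contMDiffAt_nhds (by simp)).1 (h.of_le (m := 1) (by simp))

theorem continuousAt_velocity {γ : ℝ → M} {t : ℝ} (h : ContMDiffAt 𝓘(ℝ, ℝ) (𝓡 d) ∞ γ t) :
    ContinuousAt (velocity (d := d) γ) t := by
  refine (tendsto_tangentBundle_iff (c := γ t) (mem_chart_self _)).2 ⟨h.continuousAt, ?_⟩
  have hc := mem_chart_self (d := d) (γ t)
  have h1 : ContinuousAt (deriv fun s => extChartAt (𝓡 d) (γ t) (γ s)) t :=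
    (((contDiffAt_extChartAt_comp le_rfl h hc).fderiv_right (m := 0) (by simp)).continuousAt).clm_apply
      continuousAt_const
  have h2 := hasDerivAt_extChartAt_comp (h.mdifferentiableAt (by simp)) hc
  rw [ContinuousAt, h2.deriv] at h1
  refine h1.congr' ?_
  filter_upwards [eventually_contMDiffAt h, h.continuousAt.eventually
    ((chartAt (EuclideanSpace ℝ (Fin d)) (γ t)).open_source.mem_nhds hc)] with s h3 h4
  exact (hasDerivAt_extChartAt_comp (h3.mdifferentiableAt one_ne_zero) h4).deriv

theorem GeodAt.hasDerivAt_pair {γ : ℝ → M} {t : ℝ} (h : GeodAt (d := d) γ t) {c : M}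
    (hc : γ t ∈ (chartAt (EuclideanSpace ℝ (Fin d)) c).source) :
    HasDerivAt (fun s => (extChartAt (𝓡 d) c (γ s), deriv (fun s => extChartAt (𝓡 d) c (γ s)) s))
      (deriv (fun s => extChartAt (𝓡 d) c (γ s)) t, spray (metricMap c) (extChartAt (𝓡 d) c (γ t))
        (deriv (fun s => extChartAt (𝓡 d) c (γ s)) t)) t := by
  have h1 := contDiffAt_extChartAt_comp le_rfl h.contMDiffAt hc
  have h2 : DifferentiableAt ℝ (deriv fun s => extChartAt (𝓡 d) c (γ s)) t :=
    ((h1.fderiv_right (m := ∞) le_rfl).differentiableAt (by simp)).clm_apply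
      (differentiableAt_const _)
  have h3 := h1.differentiableAt (by simp)
  exact h3.hasDerivAt.prodMk ((isMetricField_metricMap c).hasDerivAt_deriv_of_elAt
    ((extChartAt (𝓡 d) c).map_source (mem_extChartAt_source_iff.2 hc)) h3 h2 (h.elAt c hc))

/-- Local uniqueness of geodesics. -/
theorem eventuallyEq_of_velocity_eq {γ γ' : ℝ → M} {t : ℝ} (h : ∀ᶠ s in 𝓝 t, GeodAt (d := d) γ s)
    (h' : ∀ᶠ s in 𝓝 t, GeodAt (d := d) γ' s)
    (hv : velocity (d := d) γ t = velocity (d := d) γ' t) : γ =ᶠ[𝓝 t] γ' := by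
  set c := γ t with hcdef
  have hγ : γ t = γ' t := congrArg TotalSpace.proj hv
  have hc : γ t ∈ (chartAt (EuclideanSpace ℝ (Fin d)) c).source := mem_chart_self _
  have hc' : γ' t ∈ (chartAt (EuclideanSpace ℝ (Fin d)) c).source := hγ ▸ hc
  set y : ℝ → EuclideanSpace ℝ (Fin d) × EuclideanSpace ℝ (Fin d) := fun s =>
    (extChartAt (𝓡 d) c (γ s), deriv (fun s => extChartAt (𝓡 d) c (γ s)) s) with hy
  set y' : ℝ → EuclideanSpace ℝ (Fin d) × EuclideanSpace ℝ (Fin d) := fun s =>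
    (extChartAt (𝓡 d) c (γ' s), deriv (fun s => extChartAt (𝓡 d) c (γ' s)) s) with hy'
  have e1 := hasDerivAt_extChartAt_comp (h.self_of_nhds.contMDiffAt.mdifferentiableAt (by simp)) hc
  have e2 := hasDerivAt_extChartAt_comp (h'.self_of_nhds.contMDiffAt.mdifferentiableAt (by simp)) hc'
  have hyy : y t = y' t := by
    have e3 : ∀ p q : TangentBundle (𝓡 d) M, p = q → chartD c p.proj p.snd = chartD c q.proj q.snd := by
      rintro p _ rfl; rfl
    have e4 := e3 _ _ hv
    refine Prod.ext (by simp only [hy, hy', hγ]) ?_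
    change deriv (fun s => extChartAt (𝓡 d) c (γ s)) t = deriv (fun s => extChartAt (𝓡 d) c (γ' s)) t
    rw [e1.deriv, e2.deriv]
    exact e4
  set F : EuclideanSpace ℝ (Fin d) × EuclideanSpace ℝ (Fin d) →
    EuclideanSpace ℝ (Fin d) × EuclideanSpace ℝ (Fin d) := fun q => (q.2, spray (metricMap c) q.1 q.2)
  have hyt : (y t).1 ∈ (extChartAt (𝓡 d) c).target :=
    (extChartAt (𝓡 d) c).map_source (mem_extChartAt_source_iff.2 hc)
  have hF : ContDiffAt ℝ 1 F (y t) :=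
    contDiffAt_snd.prodMk (((isMetricField_metricMap c).contDiffAt_spray hyt).of_le (by simp))
  obtain ⟨K, s, hs, hK⟩ := hF.exists_lipschitzOnWith
  have hsrc : ∀ᶠ s in 𝓝 t, γ s ∈ (chartAt (EuclideanSpace ℝ (Fin d)) c).source :=
    h.self_of_nhds.contMDiffAt.continuousAt.eventually ((chartAt _ c).open_source.mem_nhds hc)
  have hsrc' : ∀ᶠ s in 𝓝 t, γ' s ∈ (chartAt (EuclideanSpace ℝ (Fin d)) c).source :=
    h'.self_of_nhds.contMDiffAt.continuousAt.eventually ((chartAt _ c).open_source.mem_nhds hc')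
  have hyd : ∀ᶠ s in 𝓝 t, HasDerivAt y (F (y s)) s := by
    filter_upwards [h, hsrc] with s h1 h2 using h1.hasDerivAt_pair h2
  have hyd' : ∀ᶠ s in 𝓝 t, HasDerivAt y' (F (y' s)) s := by
    filter_upwards [h', hsrc'] with s h1 h2 using h1.hasDerivAt_pair h2
  have key := ODE_solution_unique_of_eventually (v := fun _ => F) (s := fun _ => s) (K := K)
    (Eventually.of_forall fun _ => hK)
    (hyd.and (hyd.self_of_nhds.continuousAt.eventually hs))
    (hyd'.and (hyd'.self_of_nhds.continuousAt.eventually (hyy ▸ hs))) hyy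
  filter_upwards [key, hsrc, hsrc'] with s h1 h2 h3
  have h4 : extChartAt (𝓡 d) c (γ s) = extChartAt (𝓡 d) c (γ' s) := congrArg Prod.fst h1
  exact (extChartAt (𝓡 d) c).injOn (mem_extChartAt_source_iff.2 h2)
    (mem_extChartAt_source_iff.2 h3) h4

/-- Uniqueness of geodesics. -/
theorem eqOn_of_velocity_eq {γ γ' : ℝ → M} {J : Set ℝ} (hJ : IsOpen J) (hJc : IsPreconnected J)
    {t : ℝ} (ht : t ∈ J) (h : ∀ s ∈ J, GeodAt (d := d) γ s) (h' : ∀ s ∈ J, GeodAt (d := d) γ' s)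
    (hv : velocity (d := d) γ t = velocity (d := d) γ' t) : EqOn γ γ' J := by
  have hev : ∀ s ∈ J, ∀ᶠ r in 𝓝 s, GeodAt (d := d) γ r := fun s hs =>
    Filter.mem_of_superset (hJ.mem_nhds hs) h
  have hev' : ∀ s ∈ J, ∀ᶠ r in 𝓝 s, GeodAt (d := d) γ' r := fun s hs =>
    Filter.mem_of_superset (hJ.mem_nhds hs) h'
  -- The times at which the germs agree form an open set. It is closed in J because velocities are
  -- continuous and a common velocity gives a common germ.
  have hsub : J ⊆ {s | γ =ᶠ[𝓝 s] γ'} := by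
    refine hJc.subset_of_closure_inter_subset isOpen_setOfPred_eventually_nhds
      ⟨t, ht, eventuallyEq_of_velocity_eq (hev t ht) (hev' t ht) hv⟩ ?_
    rintro s ⟨hs, hsJ⟩
    refine eventuallyEq_of_velocity_eq (hev s hsJ) (hev' s hsJ) ?_
    obtain ⟨𝒰, h𝒰, hlim⟩ := mem_closure_iff_ultrafilter.1 hs
    have h1 := (continuousAt_velocity (h s hsJ).contMDiffAt).tendsto.mono_left hlim
    have h2 := (continuousAt_velocity (h' s hsJ).contMDiffAt).tendsto.mono_left hlim
    refine tendsto_nhds_unique h1 (h2.congr' (Filter.mem_of_superset h𝒰 fun r hr => ?_))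
    have hr' : γ =ᶠ[𝓝 r] γ' := hr
    change velocity γ' r = velocity γ r
    rw [velocity, velocity, hr'.mfderiv_eq, hr'.self_of_nhds]
  exact fun s hs => (hsub hs).self_of_nhds

theorem GeodAt.hasDerivAt_energy {γ : ℝ → M} {t : ℝ} (h : GeodAt (d := d) γ t) :
    HasDerivAt (fun s => ‖(velocity (d := d) γ s).snd‖ ^ 2) 0 t := by
  have hc := mem_chart_self (d := d) (γ t)
  have h1 := contDiffAt_extChartAt_comp le_rfl h.contMDiffAt hc
  have h2 : DifferentiableAt ℝ (deriv fun s => extChartAt (𝓡 d) (γ t) (γ s)) t :=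
    ((h1.fderiv_right (m := ∞) le_rfl).differentiableAt (by simp)).clm_apply
      (differentiableAt_const _)
  have h3 := (isMetricField_metricMap (γ t)).hasDerivAt_energy
    ((extChartAt (𝓡 d) (γ t)).map_source (mem_extChartAt_source_iff.2 hc))
    (h1.differentiableAt (by simp)) h2 (h.elAt _ hc)
  refine h3.congr_of_eventuallyEq ?_
  filter_upwards [eventually_contMDiffAt h.contMDiffAt, h.contMDiffAt.continuousAt.eventually
    ((chartAt (EuclideanSpace ℝ (Fin d)) (γ t)).open_source.mem_nhds hc)] with s h4 h5
  rw [inner_metricMap, (hasDerivAt_extChartAt_comp (h4.mdifferentiableAt one_ne_zero) h5).deriv]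
  exact (real_inner_self_eq_norm_sq _).symm.trans (inner_eq_chartMetric h5 _ _)

/-- Geodesics have constant speed. -/
theorem norm_velocity_eq {γ : ℝ → M} {J : Set ℝ} (hJ : IsOpen J) (hJc : IsPreconnected J)
    (h : ∀ s ∈ J, GeodAt (d := d) γ s) {s t : ℝ} (hs : s ∈ J) (ht : t ∈ J) :
    ‖(velocity (d := d) γ s).snd‖ = ‖(velocity (d := d) γ t).snd‖ := by
  have := hJ.is_const_of_deriv_eq_zero hJc
    (f := fun s => ‖(velocity (d := d) γ s).snd‖ ^ 2)
    (fun r hr => (h r hr).hasDerivAt_energy.differentiableAt.differentiableWithinAt)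
    (fun r hr => (h r hr).hasDerivAt_energy.deriv) hs ht
  exact (pow_left_inj₀ (norm_nonneg _) (norm_nonneg _) two_ne_zero).1 this

end ChartMetric

/-! ### Homogeneity of the geodesic equation and smoothness of its solutions -/

section Homogeneous

variable {E : Type*} [NormedAddCommGroup E] [InnerProductSpace ℝ E] [FiniteDimensional ℝ E]
  {G : E → E →L[ℝ] E}

theorem metricForce_smul (a : ℝ) (u p : E) :
    metricForce G u (a • p) = (a * a) • metricForce G u p := by
  simp only [metricForce, map_smul, inner_smul_left, inner_smul_right, Finset.smul_sum, smul_smul,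
    conj_trivial]
  refine Finset.sum_congr rfl fun i _ => ?_
  congr 1; ring

theorem spray_smul (a : ℝ) (u p : E) : spray G u (a • p) = (a * a) • spray G u p := by
  simp only [spray, metricForce_smul, map_smul, smul_apply, smul_smul, ← smul_sub]

theorem ELAt.comp_affine {c : ℝ → E} {t a b : ℝ} (h : ELAt G c (a * t + b)) :
    ELAt G (fun s => c (a * s + b)) t := by
  have e : ∀ s, deriv (fun s => c (a * s + b)) s = a • deriv c (a * s + b) := fun s => by
    have := deriv_comp_mul_left a (fun s => c (s + b)) s
    rw [this, deriv_comp_add_const]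
  rw [ELAt]
  simp only [e, map_smul, metricForce_smul]
  have h1 : HasDerivAt (fun s : ℝ => a * s + b) a t := by
    simpa using ((hasDerivAt_id t).const_mul a).add_const b
  rw [mul_smul]
  have h2 : HasDerivAt (fun s => G (c s) (deriv c s))
      (metricForce G (c (a * t + b)) (deriv c (a * t + b))) (a * t + b) := h
  exact (HasDerivAt.scomp t h2 h1).const_smul a

/-- Bootstrap: if y is C^n then y' = F(y) is C^n, so y is C^{n+1}. The flow construction alone only
yields differentiable curves in time, while geodesics are required to be smooth. -/
theorem contDiffOn_of_hasDerivAt {Y : Type*} [NormedAddCommGroup Y] [NormedSpace ℝ Y]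
    {F : Y → Y} {y : ℝ → Y} {J : Set ℝ} (hJ : IsOpen J)
    (hF : ∀ t ∈ J, ContDiffAt ℝ ∞ F (y t)) (hy : ∀ t ∈ J, HasDerivAt y (F (y t)) t) :
    ContDiffOn ℝ ∞ y J := by
  rw [contDiffOn_infty]
  intro n
  induction n with
  | zero =>
    exact contDiffOn_zero.2 fun t ht => (hy t ht).continuousAt.continuousWithinAt
  | succ n ih =>
    have : ((n + 1 : ℕ) : ℕ∞ω) = (n : ℕ∞ω) + 1 := by push_cast; rfl
    rw [this, contDiffOn_succ_iff_deriv_of_isOpen hJ]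
    refine ⟨fun t ht => (hy t ht).differentiableAt.differentiableWithinAt, by simp, ?_⟩
    have h1 : ContDiffOn ℝ n (fun t => F (y t)) J := fun t ht =>
      (((hF t ht).of_le (mod_cast le_top)).comp t (ih.contDiffAt (hJ.mem_nhds ht))).contDiffWithinAt
    exact h1.congr fun t ht => (hy t ht).deriv

end Homogeneous

/-! ### Local geodesics with small initial velocity -/

section Exponential

variable {d : ℕ} {M : Type*} [MetricSpace M]
  [ChartedSpace (EuclideanSpace ℝ (Fin d)) M] [IsManifold (𝓡 d) ∞ M]
  [RiemannianBundle (fun x : M => TangentSpace (𝓡 d) x)]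
  [IsContMDiffRiemannianBundle (𝓡 d) ∞ (EuclideanSpace ℝ (Fin d))
      (fun x : M => TangentSpace (𝓡 d) x)]

/-- The spray is quadratic in the velocity, so slowing time by τ = ε/4 and dividing initial
velocities by τ trades the short lifetime ε of the flow for the lifetime 4 at small velocities. The
rescaling fixes (u₀, 0), so C^1 dependence at that point is kept. -/
theorem exists_local_geodesics {c x₀ : M}
    (hx₀ : x₀ ∈ (chartAt (EuclideanSpace ℝ (Fin d)) c).source) :
    ∃ Γ : EuclideanSpace ℝ (Fin d) × EuclideanSpace ℝ (Fin d) → ℝ → EuclideanSpace ℝ (Fin d),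
      (∀ᶠ q in 𝓝 (extChartAt (𝓡 d) c x₀, (0 : EuclideanSpace ℝ (Fin d))),
        Γ q 0 = q.1 ∧ HasDerivAt (Γ q) q.2 0 ∧ ∀ t ∈ Ioo (-4 : ℝ) 4,
          Γ q t ∈ (extChartAt (𝓡 d) c).target ∧
          GeodAt (d := d) (fun s => (extChartAt (𝓡 d) c).symm (Γ q s)) t) ∧
      ∀ t, ContDiffAt ℝ 1 (fun q => Γ q t) (extChartAt (𝓡 d) c x₀, 0) := by
  set u₀ := extChartAt (𝓡 d) c x₀ with hu₀
  have hm := isMetricField_metricMap (d := d) c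
  have hu₀t : u₀ ∈ (extChartAt (𝓡 d) c).target :=
    (extChartAt (𝓡 d) c).map_source (mem_extChartAt_source_iff.2 hx₀)
  set F : EuclideanSpace ℝ (Fin d) × EuclideanSpace ℝ (Fin d) →
    EuclideanSpace ℝ (Fin d) × EuclideanSpace ℝ (Fin d) := fun q => (q.2, spray (metricMap c) q.1 q.2)
  have hF : ∀ q : EuclideanSpace ℝ (Fin d) × EuclideanSpace ℝ (Fin d),
      q.1 ∈ (extChartAt (𝓡 d) c).target → ContDiffAt ℝ ∞ F q := fun q hq =>
    contDiffAt_snd.prodMk (hm.contDiffAt_spray hq)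
  obtain ⟨ε, hε, σ, hσ, hσc⟩ := exists_local_flow (y₀ := (u₀, (0 : EuclideanSpace ℝ (Fin d))))
    ((hF (u₀, 0) hu₀t).of_le (by simp))
    (N := {q | q.1 ∈ (extChartAt (𝓡 d) c).target})
    (continuousAt_fst.eventually ((isOpen_extChartAt_target c).mem_nhds hu₀t))
  set τ := ε / 4 with hτ
  have hτ0 : 0 < τ := by positivity
  set S : EuclideanSpace ℝ (Fin d) × EuclideanSpace ℝ (Fin d) →
    EuclideanSpace ℝ (Fin d) × EuclideanSpace ℝ (Fin d) := fun q => (q.1, τ⁻¹ • q.2) with hS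
  have hS0 : S (u₀, 0) = (u₀, 0) := by simp [hS]
  have hSc : ContDiff ℝ 1 S := contDiff_fst.prodMk (contDiff_snd.const_smul _)
  refine ⟨fun q t => (σ (S q) (τ * t)).1, ?_, fun t => ?_⟩
  swap
  · have := hσc (τ * t)
    rw [← hS0] at this
    exact (this.comp _ hSc.contDiffAt).fst
  have hSt : Tendsto S (𝓝 (u₀, 0)) (𝓝 (u₀, 0)) := by
    have := hSc.continuous.tendsto (u₀, (0 : EuclideanSpace ℝ (Fin d)))
    rwa [hS0] at this
  filter_upwards [hSt.eventually hσ] with q hq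
  obtain ⟨hq0, hq1⟩ := hq
  set y := σ (S q) with hy
  have hin : ∀ t ∈ Ioo (-4 : ℝ) 4, τ * t ∈ Ioo (-ε) ε := fun t ht =>
    ⟨by rw [hτ]; nlinarith [ht.1], by rw [hτ]; nlinarith [ht.2]⟩
  have hd : ∀ t ∈ Ioo (-4 : ℝ) 4, HasDerivAt (fun t => y (τ * t)) (τ • F (y (τ * t))) t :=
    fun t ht => by
      have h1 : HasDerivAt (fun s : ℝ => τ * s) τ t := by
        simpa using (hasDerivAt_id t).const_mul τ
      exact HasDerivAt.scomp t (hq1 _ (hin t ht)).1 h1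
  have hd1 : ∀ t ∈ Ioo (-4 : ℝ) 4, HasDerivAt (fun t => (y (τ * t)).1) (τ • (y (τ * t)).2) t :=
    fun t ht => (hd t ht).fst
  have hd2 : ∀ t ∈ Ioo (-4 : ℝ) 4, HasDerivAt (fun t => τ • (y (τ * t)).2)
      (spray (metricMap c) (y (τ * t)).1 (τ • (y (τ * t)).2)) t := fun t ht => by
    rw [spray_smul, mul_smul]
    have h1 : HasDerivAt (fun t => (y (τ * t)).2)
        (τ • spray (metricMap c) (y (τ * t)).1 (y (τ * t)).2) t := (hd t ht).snd
    exact h1.const_smul τ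
  have hmem : ∀ t ∈ Ioo (-4 : ℝ) 4, (y (τ * t)).1 ∈ (extChartAt (𝓡 d) c).target := fun t ht =>
    (hq1 _ (hin t ht)).2
  have hsm : ContDiffOn ℝ ∞ y (Ioo (-ε) ε) := contDiffOn_of_hasDerivAt isOpen_Ioo
    (fun t ht => hF _ (hq1 t ht).2) fun t ht => (hq1 t ht).1
  refine ⟨by simp [hq0, hS], ?_, fun t ht => ⟨hmem t ht, ?_⟩⟩
  · have := hd1 0 (by norm_num)
    rw [mul_zero] at this
    rw [hq0] at this
    simpa [hS, smul_smul, hτ0.ne'] using this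
  have hsrc : (extChartAt (𝓡 d) c).symm (y (τ * t)).1 ∈
      (chartAt (EuclideanSpace ℝ (Fin d)) c).source := by
    have := (extChartAt (𝓡 d) c).map_target (hmem t ht)
    rwa [extChartAt_source] at this
  refine geodAt_of_elAt ?_ hsrc ?_
  · have h1 : ContDiffAt ℝ ∞ (fun t => (y (τ * t)).1) t :=
      ((hsm.contDiffAt (isOpen_Ioo.mem_nhds (hin t ht))).comp t
        (contDiffAt_const.mul contDiffAt_id)).fst
    have h2 := contMDiffAt_extChartAt_symm hsrc
    rw [(extChartAt (𝓡 d) c).right_inv (hmem t ht)] at h2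
    exact h2.comp t h1.contMDiffAt
  · refine ELAt.congr (c := fun t => (y (τ * t)).1) ?_ ?_
    · have hder : deriv (fun t => (y (τ * t)).1) =ᶠ[𝓝 t] fun t => τ • (y (τ * t)).2 := by
        filter_upwards [isOpen_Ioo.mem_nhds ht] with s hs using (hd1 s hs).deriv
      refine hm.elAt_of_hasDerivAt (hmem t ht) (hd1 t ht).differentiableAt ?_
      rw [hder.self_of_nhds]
      exact (hd2 t ht).congr_of_eventuallyEq hder
    · filter_upwards [isOpen_Ioo.mem_nhds ht] with s hs
      exact (extChartAt (𝓡 d) c).right_inv (hmem s hs)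

theorem velocity_extChartAt_symm {c : M} {y : ℝ → EuclideanSpace ℝ (Fin d)}
    {p : EuclideanSpace ℝ (Fin d)} {t : ℝ} (hy : y t ∈ (extChartAt (𝓡 d) c).target)
    (hd : HasDerivAt y p t) :
    velocity (d := d) (fun s => (extChartAt (𝓡 d) c).symm (y s)) t =
      ⟨(extChartAt (𝓡 d) c).symm (y t), chartDInv c ((extChartAt (𝓡 d) c).symm (y t)) p⟩ := by
  have hsrc : (extChartAt (𝓡 d) c).symm (y t) ∈
      (chartAt (EuclideanSpace ℝ (Fin d)) c).source := by
    have := (extChartAt (𝓡 d) c).map_target hy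
    rwa [extChartAt_source] at this
  have h2 := hasMFDerivAt_extChartAt_symm hsrc
  rw [(extChartAt (𝓡 d) c).right_inv hy] at h2
  have h3 := h2.comp t hd.hasFDerivAt.hasMFDerivAt
  have h4 := h3.mfderiv
  rw [velocity]
  have h5 : mfderiv 𝓘(ℝ, ℝ) (𝓡 d) (fun s => (extChartAt (𝓡 d) c).symm (y s)) t =
    (chartDInv c ((extChartAt (𝓡 d) c).symm (y t))).comp
      (ContinuousLinearMap.toSpanSingleton ℝ p : ℝ →L[ℝ] EuclideanSpace ℝ (Fin d)) := h4
  rw [h5]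
  congr 1
  change chartDInv c _ ((1 : ℝ) • p) = _
  rw [one_smul]

theorem GeodAt.comp_affine {γ : ℝ → M} {t a b : ℝ} (h : GeodAt (d := d) γ (a * t + b)) :
    GeodAt (d := d) (fun s => γ (a * s + b)) t where
  contMDiffAt := by
    have h1 : ContDiffAt ℝ ∞ (fun s : ℝ => a * s + b) t := by fun_prop
    exact ContMDiffAt.comp t h.contMDiffAt h1.contMDiffAt
  elAt c hc := (h.elAt c hc).comp_affine

theorem velocity_comp_affine {γ : ℝ → M} {t a b : ℝ}
    (h : MDifferentiableAt 𝓘(ℝ, ℝ) (𝓡 d) γ (a * t + b)) :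
    velocity (d := d) (fun s => γ (a * s + b)) t =
      ⟨γ (a * t + b), a • (velocity (d := d) γ (a * t + b)).snd⟩ := by
  have h1 : HasDerivAt (fun s : ℝ => a * s + b) a t := by
    simpa using ((hasDerivAt_id t).const_mul a).add_const b
  have h3 := HasMFDerivAt.comp t h.hasMFDerivAt h1.hasFDerivAt.hasMFDerivAt
  have h5 : mfderiv 𝓘(ℝ, ℝ) (𝓡 d) (fun s => γ (a * s + b)) t =
    (mfderiv 𝓘(ℝ, ℝ) (𝓡 d) γ (a * t + b)).comp
      (ContinuousLinearMap.toSpanSingleton ℝ a : ℝ →L[ℝ] ℝ) := h3.mfderiv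
  rw [velocity, h5]
  congr 1
  change mfderiv 𝓘(ℝ, ℝ) (𝓡 d) γ (a * t + b) ((1 : ℝ) • a) = _
  have : (1 : ℝ) • a = a • (1 : ℝ) := by simp
  rw [this]
  exact map_smul _ _ _

end Exponential

/-! ### Geodesic completeness and the exponential map in charts -/

section ExponentialMap

variable {d : ℕ} {M : Type*} [MetricSpace M]
  [ChartedSpace (EuclideanSpace ℝ (Fin d)) M] [IsManifold (𝓡 d) ∞ M]
  [RiemannianBundle (fun x : M => TangentSpace (𝓡 d) x)]
  [IsContMDiffRiemannianBundle (𝓡 d) ∞ (EuclideanSpace ℝ (Fin d))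
      (fun x : M => TangentSpace (𝓡 d) x)]

theorem GeodAt.mdifferentiableAt {γ : ℝ → M} {t : ℝ} (h : GeodAt (d := d) γ t) :
    MDifferentiableAt 𝓘(ℝ, ℝ) (𝓡 d) γ t := h.contMDiffAt.mdifferentiableAt (by simp)

theorem velocity_congr {γ γ' : ℝ → M} {t : ℝ} (h : γ =ᶠ[𝓝 t] γ') :
    velocity (d := d) γ t = velocity (d := d) γ' t := by
  rw [velocity, velocity, h.mfderiv_eq, h.self_of_nhds]

theorem glue_geodesics {γ η : ℝ → M} {a b a' b' s : ℝ} (hs : s ∈ Ioo a b) (hs' : s ∈ Ioo a' b')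
    (h : ∀ t ∈ Ioo a b, GeodAt (d := d) γ t) (h' : ∀ t ∈ Ioo a' b', GeodAt (d := d) η t)
    (hb : b ≤ b') (hv : velocity (d := d) γ s = velocity (d := d) η s) :
    ∃ ζ : ℝ → M, (∀ t ∈ Ioo a b', GeodAt (d := d) ζ t) ∧ EqOn ζ γ (Ioo a b) := by
  have heq : EqOn γ η (Ioo (max a a') b) :=
    eqOn_of_velocity_eq isOpen_Ioo isPreconnected_Ioo ⟨max_lt hs.1 hs'.1, hs.2⟩
      (fun t ht => h t ⟨(le_max_left _ _).trans_lt ht.1, ht.2⟩)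
      (fun t ht => h' t ⟨(le_max_right _ _).trans_lt ht.1, ht.2.trans_le hb⟩) hv
  have hζ : EqOn (fun t => if t ≤ s then γ t else η t) γ (Ioo a b) := fun t ht => by
    by_cases hts : t ≤ s
    · simp [hts]
    · simp only [hts, if_false]
      exact (heq ⟨(max_lt hs.1 hs'.1).trans (not_le.1 hts), ht.2⟩).symm
  refine ⟨_, fun t ht => ?_, hζ⟩
  by_cases htb : t < b
  · exact (h t ⟨ht.1, htb⟩).congr (hζ.eventuallyEq_of_mem (isOpen_Ioo.mem_nhds ⟨ht.1, htb⟩))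
  · have hst : s < t := hs.2.trans_le (not_lt.1 htb)
    refine (h' t ⟨hs'.1.trans hst, ht.2⟩).congr ?_
    filter_upwards [lt_mem_nhds hst] with r hr
    simp [not_le.2 hr]

/-- There is a geodesic with initial velocity `p` on the interval `J`. -/
def HasGeodesic (p : TangentBundle (𝓡 d) M) (J : Set ℝ) : Prop :=
  ∃ γ : ℝ → M, (∀ t ∈ J, GeodAt (d := d) γ t) ∧ velocity (d := d) γ 0 = p

/-- Velocities tending to zero converge to a point of the zero section, near which local geodesics
live for a definite time; compactness of M makes the bound uniform. -/
theorem exists_hasGeodesic [CompactSpace M] : ∃ δ > 0, ∀ p : TangentBundle (𝓡 d) M,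
    ‖p.snd‖ ≤ δ → HasGeodesic p (Ioo (-4) 4) := by
  have key : ∀ᶠ δ : ℝ in 𝓝[>] 0, ∀ p : TangentBundle (𝓡 d) M,
      ‖p.snd‖ ≤ δ → HasGeodesic p (Ioo (-4) 4) := by
    refine eventually_forall_of_ultrafilter fun 𝒰 p h𝒰 hcon => ?_
    have h0 : Tendsto (fun δ : ℝ => δ) 𝒰 (𝓝 0) := h𝒰.trans nhdsWithin_le_nhds
    have hle : ∀ᶠ δ in (𝒰 : Filter ℝ), ‖(p δ).snd‖ ≤ δ := hcon.mono fun δ h => by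
      by_contra h1; exact h fun h2 => absurd h2 h1
    obtain ⟨x₀, -, hx₀⟩ := isCompact_univ.ultrafilter_le_nhds (𝒰.map fun δ => (p δ).proj) (by simp)
    have hp : Tendsto (fun δ => (⟨(p δ).proj, (p δ).snd⟩ : TangentBundle (𝓡 d) M)) 𝒰 (𝓝 ⟨x₀, 0⟩) :=
      tendsto_zero_tangentBundle hx₀ (tendsto_of_tendsto_of_tendsto_of_le_of_le' tendsto_const_nhds
        h0 (Eventually.of_forall fun _ => norm_nonneg _) hle)
    obtain ⟨Γ, hΓ, -⟩ := exists_local_geodesics (d := d) (mem_chart_self x₀)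
    have h1 := (tendsto_tangentBundle_iff (mem_chart_self x₀)).1 hp
    rw [map_zero] at h1
    have hsrc := h1.1.eventually ((chartAt (EuclideanSpace ℝ (Fin d)) x₀).open_source.mem_nhds
      (mem_chart_self x₀))
    have h2 : Tendsto (fun δ => (extChartAt (𝓡 d) x₀ (p δ).proj,
        chartD x₀ (p δ).proj (p δ).snd)) 𝒰 (𝓝 (extChartAt (𝓡 d) x₀ x₀, 0)) :=
      ((continuousAt_extChartAt x₀).tendsto.comp h1.1).prodMk_nhds h1.2
    obtain ⟨δ, h3, h4, h5⟩ := ((h2.eventually hΓ).and (hsrc.and hcon)).exists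
    refine h5 fun _ => ⟨_, fun t ht => (h3.2.2 t ht).2, ?_⟩
    have h6 := (h3.2.2 0 (by norm_num)).1
    have h7 := velocity_extChartAt_symm h6 h3.2.1
    rw [h7, h3.1]
    have e := (extChartAt (𝓡 d) x₀).left_inv (mem_extChartAt_source_iff.2 h4)
    have e2 : ∀ y : M, y = (p δ).proj → ∀ w, chartD x₀ (p δ).proj (p δ).snd = w →
        (⟨y, chartDInv x₀ y w⟩ : TangentBundle (𝓡 d) M) = p δ := by
      rintro y rfl w rfl
      rw [chartDInv_chartD h4]
    exact e2 _ e _ rfl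
  obtain ⟨δ, h1, h2⟩ := (key.and self_mem_nhdsWithin).exists
  exact ⟨δ, h2, h1⟩

/-- Geodesics have constant speed, so the velocity at time n is still at most δ and the geodesic can
be prolonged by the same amount again. -/
theorem HasGeodesic.extend {δ : ℝ}
    (hδ : ∀ p : TangentBundle (𝓡 d) M, ‖p.snd‖ ≤ δ → HasGeodesic p (Ioo (-4) 4))
    {p : TangentBundle (𝓡 d) M} (hp : ‖p.snd‖ ≤ δ) (n : ℕ) : HasGeodesic p (Ioo (-1) (n + 1)) := by
  induction n with
  | zero =>
    obtain ⟨γ, h1, h2⟩ := hδ p hp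
    exact ⟨γ, fun t ht => h1 t ⟨by linarith [ht.1], by norm_num at ht; linarith [ht.2]⟩, h2⟩
  | succ n ih =>
    obtain ⟨γ, h1, h2⟩ := ih
    have hn : (0 : ℝ) ≤ n := Nat.cast_nonneg n
    have hs : (n : ℝ) ∈ Ioo (-1 : ℝ) (n + 1) := ⟨by linarith, by linarith⟩
    have h0 : (0 : ℝ) ∈ Ioo (-1 : ℝ) (n + 1) := ⟨by linarith, by linarith⟩
    have h3 := norm_velocity_eq isOpen_Ioo isPreconnected_Ioo h1 hs h0
    obtain ⟨η, h4, h5⟩ := hδ (velocity (d := d) γ n) (by rw [h3, h2]; exact hp)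
    obtain ⟨ζ, h6, h7⟩ := glue_geodesics (η := fun t => η (1 * t + -n)) (a' := n - 4)
      (b' := n + 4) hs ⟨by linarith, by linarith⟩ h1
      (fun t ht => GeodAt.comp_affine (h4 _ ⟨by linarith [ht.1], by linarith [ht.2]⟩))
      (by linarith) (by
        have e : (1 : ℝ) * n + -n = 0 := by ring
        have key : ∀ q : TangentBundle (𝓡 d) M, q = velocity (d := d) γ n →
            (⟨q.proj, (1 : ℝ) • q.snd⟩ : TangentBundle (𝓡 d) M) = velocity (d := d) γ n := by
          rintro q rfl; rw [one_smul]
        rw [velocity_comp_affine (h4 _ (by rw [e]; norm_num)).mdifferentiableAt, e]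
        exact (key _ h5).symm)
    refine ⟨ζ, fun t ht => h6 t ⟨ht.1, ?_⟩, ?_⟩
    · have := ht.2; push_cast at this; linarith
    · rw [← h2]
      exact velocity_congr (h7.eventuallyEq_of_mem (isOpen_Ioo.mem_nhds h0))

/-- Completeness for compact M. It ensures that `expMap`, which has a default value when there is no
geodesic, is always the genuine exponential map. -/
theorem exists_isGeodesicFrom [CompactSpace M] (x : M) (v : TangentSpace (𝓡 d) x) :
    ∃ γ : ℝ → M, IsGeodesicFrom x v γ := by
  obtain ⟨δ, hδ0, hδ⟩ := exists_hasGeodesic (d := d) (M := M)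
  -- global geodesics with small velocity
  have hsmall : ∀ v : TangentSpace (𝓡 d) x, ‖v‖ ≤ δ → ∃ γ : ℝ → M,
      (∀ t, GeodAt (d := d) γ t) ∧ velocity (d := d) γ 0 = ⟨x, v⟩ := by
    intro v hv
    have h1 : ∀ n : ℕ, HasGeodesic (⟨x, v⟩ : TangentBundle (𝓡 d) M) (Ioo (-(n + 1)) (n + 1)) := by
      intro n
      have hn : (0 : ℝ) ≤ n := Nat.cast_nonneg n
      obtain ⟨γ, a1, a2⟩ := HasGeodesic.extend hδ (p := ⟨x, v⟩) hv n
      obtain ⟨η, b1, b2⟩ := HasGeodesic.extend hδ (p := ⟨x, -v⟩) (by rwa [norm_neg]) n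
      have e : (-1 : ℝ) * 0 + 0 = 0 := by ring
      have h0 : (0 : ℝ) ∈ Ioo (-1 : ℝ) (n + 1) := ⟨by linarith, by linarith⟩
      have hvel : velocity (d := d) (fun t => η (-1 * t + 0)) 0 = ⟨x, v⟩ := by
        have key : ∀ q : TangentBundle (𝓡 d) M, q = ⟨x, -v⟩ →
            (⟨q.proj, (-1 : ℝ) • q.snd⟩ : TangentBundle (𝓡 d) M) = ⟨x, v⟩ := by
          rintro q rfl; simp
        rw [velocity_comp_affine (b1 _ (by rw [e]; exact h0)).mdifferentiableAt, e]
        exact key _ b2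
      obtain ⟨ζ, h6, h7⟩ := glue_geodesics (γ := fun t => η (-1 * t + 0)) (η := γ)
        (a := -(n + 1)) (b := 1) (a' := -1) (b' := n + 1) (s := 0)
        ⟨by linarith, by linarith⟩ h0
        (fun t ht => GeodAt.comp_affine (b1 _ ⟨by linarith [ht.2], by linarith [ht.1]⟩))
        a1 (by linarith) (hvel.trans a2.symm)
      exact ⟨ζ, h6, (velocity_congr (h7.eventuallyEq_of_mem (isOpen_Ioo.mem_nhds
        ⟨by linarith, by linarith⟩))).trans hvel⟩
    choose ζ hζ hζ0 using h1
    have hag : ∀ m n : ℕ, m ≤ n → EqOn (ζ m) (ζ n) (Ioo (-(m + 1)) (m + 1)) := fun m n hmn => by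
      have hmn' : (m : ℝ) ≤ n := by exact_mod_cast hmn
      have hm : (0 : ℝ) ≤ m := Nat.cast_nonneg m
      exact eqOn_of_velocity_eq isOpen_Ioo isPreconnected_Ioo (t := 0)
        ⟨by linarith, by linarith⟩ (hζ m)
        (fun t ht => hζ n t ⟨by linarith [ht.1], by linarith [ht.2]⟩)
        ((hζ0 m).trans (hζ0 n).symm)
    have hloc : ∀ n : ℕ, EqOn (fun t => ζ ⌈|t|⌉₊ t) (ζ n) (Ioo (-(n + 1)) (n + 1)) := by
      intro n t ht
      have h2 : |t| < n + 1 := abs_lt.2 ht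
      have h3 : |t| < (⌈|t|⌉₊ : ℝ) + 1 := (Nat.le_ceil _).trans_lt (lt_add_one _)
      rcases le_total ⌈|t|⌉₊ n with h | h
      · exact hag _ _ h (abs_lt.1 h3)
      · exact (hag _ _ h ht).symm
    have hnear : ∀ n : ℕ, ∀ t ∈ Ioo (-((n : ℝ) + 1)) (n + 1), (fun t => ζ ⌈|t|⌉₊ t) =ᶠ[𝓝 t] ζ n :=
      fun n t ht => (hloc n).eventuallyEq_of_mem (isOpen_Ioo.mem_nhds ht)
    refine ⟨fun t => ζ ⌈|t|⌉₊ t, fun t => ?_, ?_⟩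
    · have ht : t ∈ Ioo (-((⌈|t|⌉₊ : ℝ) + 1)) (⌈|t|⌉₊ + 1) :=
        abs_lt.1 ((Nat.le_ceil _).trans_lt (lt_add_one _))
      exact (hζ _ t ht).congr (hnear _ t ht)
    · exact (velocity_congr (hnear 0 0 (by norm_num))).trans (hζ0 0)
  -- general velocities are obtained by a linear change of time
  set s := δ / (‖v‖ + 1) with hs
  have hv1 : 0 < ‖v‖ + 1 := by positivity
  have hs0 : 0 < s := by positivity
  obtain ⟨γ, h1, h2⟩ := hsmall (s • v) (by
    rw [norm_smul, Real.norm_of_nonneg hs0.le, hs, div_mul_eq_mul_div, div_le_iff₀ hv1]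
    nlinarith)
  refine ⟨fun t => γ (s⁻¹ * t + 0), isGeodesic_iff.2 fun t => (h1 _).comp_affine, ?_⟩
  have key : ∀ q : TangentBundle (𝓡 d) M, q = ⟨x, s • v⟩ →
      (⟨q.proj, s⁻¹ • q.snd⟩ : TangentBundle (𝓡 d) M) = ⟨x, v⟩ := by
    rintro q rfl; simp [smul_smul, hs0.ne']
  refine (velocity_comp_affine (h1 _).mdifferentiableAt).trans ?_
  rw [mul_zero, add_zero]
  exact key _ h2

/-- By uniqueness the geodesic selected in `expMap` may be replaced by any local one defined on an
open interval containing 0 and 1. -/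
theorem expMap_eq [CompactSpace M] {x : M} {v : TangentSpace (𝓡 d) x} {γ : ℝ → M} {J : Set ℝ}
    (hJ : IsOpen J) (hJc : IsPreconnected J) (h0 : (0 : ℝ) ∈ J) (h1 : (1 : ℝ) ∈ J)
    (hγ : ∀ t ∈ J, GeodAt (d := d) γ t) (hv : velocity (d := d) γ 0 = ⟨x, v⟩) :
    expMap x v = γ 1 := by
  have h := exists_isGeodesicFrom x v
  rw [expMap, dif_pos h]
  exact eqOn_of_velocity_eq hJ hJc h0 (fun t _ => isGeodesic_iff.1 h.choose_spec.1 t) hγ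
    (h.choose_spec.2.trans hv.symm) h1

/-- The exponential map in a chart. -/
theorem exists_expMap_chart [CompactSpace M] {c x₀ : M}
    (hx₀ : x₀ ∈ (chartAt (EuclideanSpace ℝ (Fin d)) c).source) :
    ∃ (e : EuclideanSpace ℝ (Fin d) × EuclideanSpace ℝ (Fin d) → EuclideanSpace ℝ (Fin d)),
      ∃ ρ > 0, ContDiffOn ℝ 1 e (Metric.ball (extChartAt (𝓡 d) c x₀, 0) ρ) ∧
      ∀ q ∈ Metric.ball (extChartAt (𝓡 d) c x₀, (0 : EuclideanSpace ℝ (Fin d))) ρ,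
        q.1 ∈ (extChartAt (𝓡 d) c).target ∧ e q ∈ (extChartAt (𝓡 d) c).target ∧
        expMap ((extChartAt (𝓡 d) c).symm q.1) (chartDInv c ((extChartAt (𝓡 d) c).symm q.1) q.2) =
          (extChartAt (𝓡 d) c).symm (e q) ∧
        e (q.1, 0) = q.1 ∧ ∀ w, fderiv ℝ e (q.1, 0) (0, w) = w := by
  obtain ⟨Γ, hΓ, hΓc⟩ := exists_local_geodesics (d := d) hx₀
  have hΓ1 : ∀ᶠ q in 𝓝 (extChartAt (𝓡 d) c x₀, (0 : EuclideanSpace ℝ (Fin d))),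
      ContDiffAt ℝ 1 (fun q => Γ q 1) q := (hΓc 1).eventually (by simp)
  obtain ⟨ρ, hρ, hb⟩ := Metric.eventually_nhds_iff_ball.1 (hΓ.and hΓ1)
  -- `exp` at all times of the local geodesics
  have hexp : ∀ q ∈ Metric.ball (extChartAt (𝓡 d) c x₀, (0 : EuclideanSpace ℝ (Fin d))) ρ,
      ∀ s ∈ Icc (0 : ℝ) 1,
      expMap ((extChartAt (𝓡 d) c).symm q.1)
        (chartDInv c ((extChartAt (𝓡 d) c).symm q.1) (s • q.2)) =
          (extChartAt (𝓡 d) c).symm (Γ q s) := by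
    intro q hq s hs
    obtain ⟨⟨h1, h2, h3⟩, -⟩ := hb q hq
    have hin : ∀ t ∈ Ioo (-2 : ℝ) 2, s * t + 0 ∈ Ioo (-4 : ℝ) 4 := fun t ht => by
      constructor <;> nlinarith [ht.1, ht.2, hs.1, hs.2]
    have h4 := expMap_eq (γ := fun t => (extChartAt (𝓡 d) c).symm (Γ q (s * t + 0)))
      (x := (extChartAt (𝓡 d) c).symm q.1)
      (v := chartDInv c ((extChartAt (𝓡 d) c).symm q.1) (s • q.2)) (J := Ioo (-2) 2)
      isOpen_Ioo isPreconnected_Ioo (by norm_num) (by norm_num)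
      (fun t ht => GeodAt.comp_affine (γ := fun t => (extChartAt (𝓡 d) c).symm (Γ q t))
        (h3 _ (hin t ht)).2) (by
        have h5 := (h3 _ (hin 0 (by norm_num))).2.mdifferentiableAt
        have h0 := h3 0 (by norm_num)
        refine (velocity_comp_affine (γ := fun t => (extChartAt (𝓡 d) c).symm (Γ q t)) h5).trans ?_
        have key : ∀ q' : TangentBundle (𝓡 d) M,
            q' = ⟨(extChartAt (𝓡 d) c).symm q.1, chartDInv c ((extChartAt (𝓡 d) c).symm q.1) q.2⟩ →
            (⟨q'.proj, s • q'.snd⟩ : TangentBundle (𝓡 d) M) = ⟨(extChartAt (𝓡 d) c).symm q.1,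
              chartDInv c ((extChartAt (𝓡 d) c).symm q.1) (s • q.2)⟩ := by
          rintro q' rfl; rw [map_smul]
        rw [mul_zero, add_zero]
        refine key _ ((velocity_extChartAt_symm h0.1 h2).trans ?_)
        rw [h1])
    simpa using h4
  have hzero : ∀ q ∈ Metric.ball (extChartAt (𝓡 d) c x₀, (0 : EuclideanSpace ℝ (Fin d))) ρ,
      (q.1, (0 : EuclideanSpace ℝ (Fin d))) ∈
        Metric.ball (extChartAt (𝓡 d) c x₀, (0 : EuclideanSpace ℝ (Fin d))) ρ := fun q hq => by
    rw [mem_ball_iff_norm] at hq ⊢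
    refine lt_of_le_of_lt ?_ hq
    simp only [Prod.mk_sub_mk, sub_self, Prod.norm_def, norm_zero, Prod.fst_sub, Prod.snd_sub]
    exact max_le (le_max_left _ _) ((norm_nonneg _).trans (le_max_left _ _))
  have hinj : InjOn (extChartAt (𝓡 d) c).symm (extChartAt (𝓡 d) c).target :=
    (extChartAt (𝓡 d) c).symm.injOn
  -- Both sides represent exp at s times the velocity: the geodesic with velocity s p at time 1 is
  -- the one with velocity p at time s.
  have hray : ∀ q ∈ Metric.ball (extChartAt (𝓡 d) c x₀, (0 : EuclideanSpace ℝ (Fin d))) ρ,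
      ∀ s ∈ Icc (0 : ℝ) 1,
      (q.1, s • q.2) ∈ Metric.ball (extChartAt (𝓡 d) c x₀, (0 : EuclideanSpace ℝ (Fin d))) ρ →
      Γ (q.1, s • q.2) 1 = Γ q s := by
    intro q hq s hs hqs
    have h1 := hexp q hq s hs
    have h2 := hexp _ hqs 1 (by norm_num)
    simp only [one_smul] at h2
    exact hinj ((hb _ hqs).1.2.2 1 (by norm_num)).1
      ((hb _ hq).1.2.2 s ⟨by linarith [hs.1], by linarith [hs.2]⟩).1 (h2.symm.trans h1)
  refine ⟨fun q => Γ q 1, ρ, hρ, fun q hq => (hb q hq).2.contDiffWithinAt, fun q hq => ?_⟩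
  obtain ⟨⟨h1, h2, h3⟩, -⟩ := hb q hq
  have hq0 := hzero q hq
  obtain ⟨⟨z1, z2, z3⟩, z4⟩ := hb _ hq0
  refine ⟨?_, (h3 1 (by norm_num)).1, ?_, ?_, ?_⟩
  · rw [← h1]; exact (h3 0 (by norm_num)).1
  · simpa using hexp q hq 1 (by norm_num)
  · have h5 := hray (q.1, 0) hq0 0 (by norm_num) (by simpa using hq0)
    simp only [smul_zero] at h5
    exact h5.trans z1
  · intro w
    -- a small multiple of `w`
    obtain ⟨a, ha, haw⟩ : ∃ a : ℝ, 0 < a ∧ ∀ s ∈ Icc (0 : ℝ) 1,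
        (q.1, s • a • w) ∈ Metric.ball (extChartAt (𝓡 d) c x₀, (0 : EuclideanSpace ℝ (Fin d))) ρ := by
      have hc : ContinuousAt (fun a : ℝ => (q.1, a • w)) 0 := by fun_prop
      have hq0' : (q.1, (0 : ℝ) • w) ∈
          Metric.ball (extChartAt (𝓡 d) c x₀, (0 : EuclideanSpace ℝ (Fin d))) ρ := by
        rw [zero_smul]; exact hq0
      have hev := hc.eventually (Metric.isOpen_ball.mem_nhds hq0')
      obtain ⟨r, hr, hr'⟩ := Metric.eventually_nhds_iff_ball.1 hev
      refine ⟨r / 2, by positivity, fun s hs => ?_⟩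
      rw [smul_smul]
      refine hr' _ ?_
      rw [Real.ball_zero_eq_Ioo]
      constructor <;> nlinarith [hs.1, hs.2]
    have hqa : (q.1, a • w) ∈ Metric.ball (extChartAt (𝓡 d) c x₀, (0 : EuclideanSpace ℝ (Fin d))) ρ :=
      by simpa using haw 1 (by norm_num)
    have hd1 : HasDerivAt (fun s : ℝ => Γ (q.1, s • a • w) 1)
        (fderiv ℝ (fun q => Γ q 1) (q.1, 0) (0, a • w)) 0 := by
      have hl : HasDerivAt (fun s : ℝ => (q.1, s • a • w)) (0, a • w) 0 := by
        have := (hasDerivAt_const (0 : ℝ) q.1).prodMk ((hasDerivAt_id (0 : ℝ)).smul_const (a • w))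
        simpa using this
      have hz : HasFDerivAt (fun q => Γ q 1) (fderiv ℝ (fun q => Γ q 1) (q.1, 0))
          (q.1, (0 : ℝ) • a • w) := by
        rw [zero_smul]
        exact (z4.differentiableAt one_ne_zero).hasFDerivAt
      exact hz.comp_hasDerivAt (0 : ℝ) hl
    -- The derivative of exp at the zero vector along a w is the initial velocity of the geodesic.
    -- The ray identity holds for s in [0, 1] only, but a one-sided derivative determines it.
    have hd2 : HasDerivWithinAt (Γ (q.1, a • w)) (fderiv ℝ (fun q => Γ q 1) (q.1, 0) (0, a • w))
        (Icc 0 1) 0 := by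
      refine hd1.hasDerivWithinAt.congr (fun s hs => ?_) ?_
      · exact (hray (q.1, a • w) hqa s hs (haw s hs)).symm
      · exact (hray (q.1, a • w) hqa 0 (by norm_num) (haw 0 (by norm_num))).symm
    have h6 := (uniqueDiffOn_Icc (zero_lt_one' ℝ) 0 (by norm_num)).eq_deriv _ hd2
      ((hb _ hqa).1.2.1.hasDerivWithinAt)
    have h7 : ((0 : EuclideanSpace ℝ (Fin d)), a • w) = a • (0, w) := by simp
    rw [h7, map_smul] at h6
    exact smul_right_injective _ ha.ne' h6

end ExponentialMap

/-! ### Stable graphs when contraction holds only on average -/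

section ScaledGraph

open Metric

variable {X Y : Type*} [NormedAddCommGroup X] [NormedSpace ℝ X] [CompleteSpace X]
  [NormedAddCommGroup Y] [NormedSpace ℝ Y] [CompleteSpace Y]

/-- The weights `∏ (4/3) b_i`. -/
def weight (b : ℕ → ℝ) (k : ℕ) : ℝ := ∏ i ∈ Finset.range k, (4 / 3 * b i)

theorem weight_succ (b : ℕ → ℝ) (k : ℕ) : weight b (k + 1) = 4 / 3 * b k * weight b k := by
  rw [weight, Finset.prod_range_succ, mul_comm]; rfl

theorem weight_pos {b : ℕ → ℝ} (hb : ∀ k, 0 < b k) (k : ℕ) : 0 < weight b k :=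
  Finset.prod_pos fun i _ => by have := hb i; positivity

/-- A stable graph for a sequence of local diffeomorphisms with a dominated linear part, whose first
component contracts on average: the contraction at the time `k` is compensated by weights. -/
theorem exists_weighted_stable_graph {G : ℕ → X × Y → X × Y} {DG : ℕ → X × Y → (X × Y →L[ℝ] X × Y)}
    {D : ℕ → Y ≃L[ℝ] Y} {b : ℕ → ℝ} {ρ c₀ c₂ : ℝ} (hρ : 0 < ρ) (hc₀ : 0 < c₀) (hc₂0 : 0 ≤ c₂)
    (hc₂ : c₂ ≤ 1 / 20) (hb : ∀ k, c₀ ≤ b k) (hw : ∀ k, weight b k ≤ 1)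
    (hG0 : ∀ k, G k 0 = 0) (hG : ∀ k z, ‖z‖ < ρ → HasFDerivAt (G k) (DG k z) z)
    (hm : ∀ η > 0, ∃ δ > 0, ∀ k z z', ‖z‖ < ρ → ‖z'‖ < ρ → ‖z - z'‖ < δ → ‖DG k z - DG k z'‖ ≤ η)
    (hs : ∀ k h, ‖(DG k 0 h).1‖ ≤ b k * ‖h‖)
    (hd : ∀ k y, 19 / 10 * b k * ‖(D k).symm y‖ ≤ ‖y‖)
    (hDG : ∀ k z, ‖z‖ < ρ → ‖DG k z - DG k 0‖ ≤ c₀ * c₂)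
    (h0 : ∀ k h, (DG k 0 h).2 = D k h.2) :
    ∃ (φ : X → Y) (z : X → ℕ → X × Y), φ 0 = 0 ∧ ContDiffOn ℝ 1 φ (ball 0 (ρ / 5)) ∧
      fderiv ℝ φ 0 = 0 ∧ ∀ v ∈ ball (0 : X) (ρ / 5), z v 0 = (v, φ v) ∧
        (∀ k, z v (k + 1) = G k (z v k)) ∧ (∀ k, ‖z v k‖ < weight b k * ρ) ∧
        ‖fderiv ℝ φ v‖ ≤ 20 * c₂ := by
  have hbp : ∀ k, 0 < b k := fun k => hc₀.trans_le (hb k)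
  have hwp := weight_pos hbp
  -- This is the ratio of consecutive weights. Rescaling by it turns the rate b k on X into 3/4, and
  -- the bound (19/10 · b k)⁻¹ on the inverse of D k into 40/57 < 3/4.
  set a : ℕ → ℝ := fun k => (4 / 3 * b k)⁻¹ with ha
  have hap : ∀ k, 0 < a k := fun k => by have := hbp k; positivity
  have hab : ∀ k, a k * b k = 3 / 4 := fun k => by
    have := (hbp k).ne'; simp only [ha]; field_simp
  have hac : ∀ k, a k * c₀ ≤ 3 / 4 := fun k => by
    rw [← hab k]; exact mul_le_mul_of_nonneg_left (hb k) (hap k).le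
  have hww : ∀ k, (weight b (k + 1))⁻¹ * weight b k = a k := fun k => by
    have h1 := (hbp k).ne'; have h2 := (hwp k).ne'
    rw [weight_succ]; simp only [ha]; field_simp
  have hball : ∀ k (z : X × Y), ‖z‖ < ρ → ‖weight b k • z‖ < ρ := fun k z hz => by
    rw [norm_smul, Real.norm_of_nonneg (hwp k).le]
    exact (mul_le_of_le_one_left (norm_nonneg _) (hw k)).trans_lt hz
  -- Here c = 4/5 = 3/4 + 1/20 leaves 1/20 for the nonlinear part c₂. The factor 1 - c = 1/5 is the
  -- loss of radius, and (1 - 3/4)(1 - 4/5) = 1/20 is the origin of the slope 20 c₂.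
  have key := exists_stable_graph
    (G := fun k z => (weight b (k + 1))⁻¹ • G k (weight b k • z))
    (DG := fun k z => a k • DG k (weight b k • z))
    (d := fun k => (ContinuousLinearEquiv.smulLeft (Units.mk0 (a k) (hap k).ne')).trans (D k))
    (ρ := ρ) (c := 4 / 5) (c₁ := 3 / 4) (c₂ := c₂) hρ (by norm_num) (by norm_num) hc₂0
    (by linarith)
  refine Exists.elim (key ?_ ?_ ?_ ?_ ?_ ?_ ?_) ?_
  · intro k; simp [hG0]
  · intro k z hz
    have h1 : HasFDerivAt (fun z : X × Y => weight b k • z)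
        (weight b k • ContinuousLinearMap.id ℝ (X × Y)) z :=
      (weight b k • ContinuousLinearMap.id ℝ (X × Y)).hasFDerivAt
    have h2 := ((hG k _ (hball k z hz)).comp z h1).const_smul (weight b (k + 1))⁻¹
    refine h2.congr_fderiv ?_
    rw [← hww, mul_smul]
    ext h <;> simp
  · intro η hη
    obtain ⟨δ, hδ, h⟩ := hm (c₀ * η) (by positivity)
    refine ⟨δ, hδ, fun k z z' hz hz' hzz => ?_⟩
    have e : a k • DG k (weight b k • z) - a k • DG k (weight b k • z') =
        a k • (DG k (weight b k • z) - DG k (weight b k • z')) := (smul_sub _ _ _).symm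
    rw [e, norm_smul, Real.norm_of_nonneg (hap k).le]
    have h1 := h k _ _ (hball k z hz) (hball k z' hz') (by
      rw [← smul_sub, norm_smul, Real.norm_of_nonneg (hwp k).le]
      exact (mul_le_of_le_one_left (norm_nonneg _) (hw k)).trans_lt hzz)
    calc a k * ‖DG k (weight b k • z) - DG k (weight b k • z')‖ ≤ a k * (c₀ * η) :=
          mul_le_mul_of_nonneg_left h1 (hap k).le
      _ = a k * c₀ * η := by ring
      _ ≤ 1 * η := mul_le_mul_of_nonneg_right ((hac k).trans (by norm_num)) hη.le
      _ = η := one_mul η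
  · intro k z h hz
    have h1 := hDG k _ (hball k z hz)
    have h2 : ‖(DG k (weight b k • z) h).1‖ ≤ b k * ‖h‖ + c₀ * c₂ * ‖h‖ := by
      have e : (DG k (weight b k • z) h).1 =
          (DG k 0 h).1 + ((DG k (weight b k • z) - DG k 0) h).1 := by simp
      rw [e]
      refine (norm_add_le _ _).trans (add_le_add (hs k h) ((norm_fst_le _).trans ?_))
      exact ((DG k (weight b k • z) - DG k 0).le_opNorm h).trans
        (mul_le_mul_of_nonneg_right h1 (norm_nonneg _))
    have h3 : ‖((a k • DG k (weight b k • z)) h).1‖ = a k * ‖(DG k (weight b k • z) h).1‖ := by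
      rw [smul_apply, Prod.smul_fst, norm_smul, Real.norm_of_nonneg (hap k).le]
    rw [h3]
    calc _ ≤ a k * (b k * ‖h‖ + c₀ * c₂ * ‖h‖) := mul_le_mul_of_nonneg_left h2 (hap k).le
      _ = a k * b k * ‖h‖ + a k * c₀ * (c₂ * ‖h‖) := by ring
      _ ≤ 3 / 4 * ‖h‖ + 3 / 4 * (1 / 20 * ‖h‖) := by
        rw [hab]
        refine add_le_add le_rfl (mul_le_mul (hac k) ?_ (by positivity) (by norm_num))
        exact mul_le_mul_of_nonneg_right hc₂ (norm_nonneg _)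
      _ ≤ 4 / 5 * ‖h‖ := by nlinarith [norm_nonneg h]
  · intro k y
    change ‖(a k)⁻¹ • (D k).symm y‖ ≤ _
    rw [norm_smul, norm_inv, Real.norm_of_nonneg (hap k).le]
    have h1 := hd k y
    have h2 : (a k)⁻¹ = 4 / 3 * b k := inv_inv _
    rw [h2]
    nlinarith [norm_nonneg y]
  · intro k z h hz
    have h1 := (DG k (weight b k • z) - DG k 0).le_of_opNorm_le (hDG k _ (hball k z hz)) h
    have e : (a k • DG k (weight b k • z)) h = a k • DG k (weight b k • z) h := rfl
    change ‖(a k)⁻¹ • (D k).symm (((a k • DG k (weight b k • z)) h).2 - D k (a k • h.2))‖ ≤ _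
    rw [e, Prod.smul_snd, map_smul, ← smul_sub, map_smul, smul_smul, inv_mul_cancel₀ (hap k).ne',
      one_smul, ← h0, ← Prod.snd_sub, ← sub_apply]
    set y := ((DG k (weight b k • z) - DG k 0) h).2
    have h2 : ‖y‖ ≤ c₀ * c₂ * ‖h‖ := (norm_snd_le _).trans h1
    have h3 := hd k y
    -- The error c₀c₂ is proportional to the lower bound c₀ of all the rates, so division by the
    -- possibly small expansion of D k leaves at most c₂.
    have h4 : 19 / 10 * c₀ * ‖(D k).symm y‖ ≤ 19 / 10 * b k * ‖(D k).symm y‖ := by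
      have := hb k; gcongr
    refine le_of_mul_le_mul_left ?_ hc₀
    nlinarith [norm_nonneg ((D k).symm y)]
  · intro k h
    change ((a k • DG k (weight b k • 0)) h).2 = D k (a k • h.2)
    rw [smul_zero, map_smul, ← h0]
    rfl
  · rintro φ ⟨z, r1, r2, r3, r4⟩
    have e5 : (1 - 4 / 5 : ℝ) * ρ = ρ / 5 := by ring
    rw [e5] at r2 r4
    refine ⟨φ, fun v k => weight b k • z v k, r1, r2, r3, fun v hv => ?_⟩
    obtain ⟨s1, s2, s3, s4⟩ := r4 v hv
    refine ⟨by simp [weight, s1], fun k => ?_, fun k => ?_, ?_⟩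
    · change weight b (k + 1) • z v (k + 1) = G k (weight b k • z v k)
      rw [s2, smul_smul, mul_inv_cancel₀ (hwp _).ne', one_smul]
    · change ‖weight b k • z v k‖ < _
      rw [norm_smul, Real.norm_of_nonneg (hwp k).le]
      exact mul_lt_mul_of_pos_left (s3 k) (hwp k)
    · refine s4.trans_eq ?_
      rw [show (1 - 3 / 4 : ℝ) * (1 - 4 / 5) = 20⁻¹ by norm_num, div_inv_eq_mul, mul_comm]

end ScaledGraph

/-! ### Families of local parametrizations -/

section Families

variable {d : ℕ} {M : Type*} [MetricSpace M] [CompactSpace M]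
  [ChartedSpace (EuclideanSpace ℝ (Fin d)) M] [IsManifold (𝓡 d) ∞ M]
  [RiemannianBundle (fun x : M => TangentSpace (𝓡 d) x)]
  [IsContMDiffRiemannianBundle (𝓡 d) ∞ (EuclideanSpace ℝ (Fin d))
      (fun x : M => TangentSpace (𝓡 d) x)]

/-- In the chart around `c`, the maps `ε (φ x, ·)` are local parametrizations around the points `x`
of the compact set `W`, tangent to the identity. -/
structure ChartFamily (c : M) (W : Set M)
    (ε : EuclideanSpace ℝ (Fin d) × EuclideanSpace ℝ (Fin d) → EuclideanSpace ℝ (Fin d))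
    (O : Set (EuclideanSpace ℝ (Fin d) × EuclideanSpace ℝ (Fin d))) : Prop where
  isCompact : IsCompact W
  subset : W ⊆ (chartAt (EuclideanSpace ℝ (Fin d)) c).source
  isOpen : IsOpen O
  mem : ∀ x ∈ W, (extChartAt (𝓡 d) c x, (0 : EuclideanSpace ℝ (Fin d))) ∈ O
  contDiffOn : ContDiffOn ℝ 1 ε O
  target : ∀ q ∈ O, ε q ∈ (extChartAt (𝓡 d) c).target
  zero : ∀ x ∈ W, ε (extChartAt (𝓡 d) c x, 0) = extChartAt (𝓡 d) c x
  fderiv_zero : ∀ x ∈ W, ∀ w, fderiv ℝ ε (extChartAt (𝓡 d) c x, 0) (0, w) = w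

variable {c c' : M} {W W' : Set M}
  {ε : EuclideanSpace ℝ (Fin d) × EuclideanSpace ℝ (Fin d) → EuclideanSpace ℝ (Fin d)}
  {O : Set (EuclideanSpace ℝ (Fin d) × EuclideanSpace ℝ (Fin d))}

/-- The point with parameter `p` in the family around `x`. -/
def famPoint (c : M)
    (ε : EuclideanSpace ℝ (Fin d) × EuclideanSpace ℝ (Fin d) → EuclideanSpace ℝ (Fin d)) (x : M)
    (p : EuclideanSpace ℝ (Fin d)) : M :=
  (extChartAt (𝓡 d) c).symm (ε (extChartAt (𝓡 d) c x, p))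

/-- The derivative of the parametrization. -/
def famDeriv (c : M)
    (ε : EuclideanSpace ℝ (Fin d) × EuclideanSpace ℝ (Fin d) → EuclideanSpace ℝ (Fin d)) (x : M)
    (p : EuclideanSpace ℝ (Fin d)) :
    EuclideanSpace ℝ (Fin d) →L[ℝ] TangentSpace (𝓡 d) (famPoint c ε x p) :=
  (chartDInv c (famPoint c ε x p)).comp
    ((fderiv ℝ ε (extChartAt (𝓡 d) c x, p)).comp (ContinuousLinearMap.inr ℝ _ _))

/-- The tangent vectors of the parametrization. -/
def famTangent (c : M)
    (ε : EuclideanSpace ℝ (Fin d) × EuclideanSpace ℝ (Fin d) → EuclideanSpace ℝ (Fin d)) (x : M)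
    (p h : EuclideanSpace ℝ (Fin d)) : TangentBundle (𝓡 d) M :=
  ⟨famPoint c ε x p, famDeriv c ε x p h⟩

theorem ChartFamily.famPoint_mem_source (hF : ChartFamily c W ε O) {x : M}
    {p : EuclideanSpace ℝ (Fin d)} (hp : (extChartAt (𝓡 d) c x, p) ∈ O) :
    famPoint c ε x p ∈ (chartAt (EuclideanSpace ℝ (Fin d)) c).source := by
  have := (extChartAt (𝓡 d) c).map_target (hF.target _ hp)
  rwa [extChartAt_source] at this

theorem ChartFamily.extChartAt_famPoint (hF : ChartFamily c W ε O) {x : M}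
    {p : EuclideanSpace ℝ (Fin d)} (hp : (extChartAt (𝓡 d) c x, p) ∈ O) :
    extChartAt (𝓡 d) c (famPoint c ε x p) = ε (extChartAt (𝓡 d) c x, p) :=
  (extChartAt (𝓡 d) c).right_inv (hF.target _ hp)

theorem ChartFamily.famPoint_zero (hF : ChartFamily c W ε O) {x : M} (hx : x ∈ W) :
    famPoint c ε x 0 = x := by
  rw [famPoint, hF.zero x hx, (extChartAt (𝓡 d) c).left_inv
    (mem_extChartAt_source_iff.2 (hF.subset hx))]

theorem ChartFamily.famTangent_zero (hF : ChartFamily c W ε O) {x : M} (hx : x ∈ W)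
    (h : EuclideanSpace ℝ (Fin d)) : famTangent c ε x 0 h = ⟨x, chartDInv c x h⟩ := by
  have e : famDeriv c ε x 0 h = chartDInv c (famPoint c ε x 0) h :=
    congrArg (chartDInv c (famPoint c ε x 0)) (hF.fderiv_zero x hx h)
  rw [famTangent, e, hF.famPoint_zero hx]

theorem ChartFamily.contDiffAt (hF : ChartFamily c W ε O)
    {q : EuclideanSpace ℝ (Fin d) × EuclideanSpace ℝ (Fin d)} (hq : q ∈ O) : ContDiffAt ℝ 1 ε q :=
  hF.contDiffOn.contDiffAt (hF.isOpen.mem_nhds hq)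

theorem ChartFamily.contDiffAt_snd (hF : ChartFamily c W ε O) {u p : EuclideanSpace ℝ (Fin d)}
    (hq : (u, p) ∈ O) : ContDiffAt ℝ 1 (fun p => ε (u, p)) p :=
  (hF.contDiffAt hq).comp p (contDiffAt_const.prodMk contDiffAt_id)

theorem ChartFamily.hasFDerivAt (hF : ChartFamily c W ε O) {u p : EuclideanSpace ℝ (Fin d)}
    (hq : (u, p) ∈ O) : HasFDerivAt (fun p => ε (u, p))
      ((fderiv ℝ ε (u, p)).comp (ContinuousLinearMap.inr ℝ _ _)) p :=
  ((hF.contDiffAt hq).differentiableAt one_ne_zero).hasFDerivAt.comp p (hasFDerivAt_prodMk_right u p)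

theorem ChartFamily.hasMFDerivAt_famPoint (hF : ChartFamily c W ε O) {x : M}
    {p : EuclideanSpace ℝ (Fin d)} (hp : (extChartAt (𝓡 d) c x, p) ∈ O) :
    HasMFDerivAt 𝓘(ℝ, EuclideanSpace ℝ (Fin d)) (𝓡 d) (famPoint c ε x) p (famDeriv c ε x p) := by
  have h1 := hasMFDerivAt_extChartAt_symm (d := d) (hF.famPoint_mem_source hp)
  rw [hF.extChartAt_famPoint hp] at h1
  exact h1.comp p (hF.hasFDerivAt hp).hasMFDerivAt

theorem ChartFamily.contMDiffAt_famPoint (hF : ChartFamily c W ε O) {x : M}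
    {p : EuclideanSpace ℝ (Fin d)} (hp : (extChartAt (𝓡 d) c x, p) ∈ O) :
    ContMDiffAt 𝓘(ℝ, EuclideanSpace ℝ (Fin d)) (𝓡 d) 1 (famPoint c ε x) p := by
  have h1 := (contMDiffAt_extChartAt_symm (d := d) (hF.famPoint_mem_source hp)).of_le
    (m := 1) (by simp)
  rw [hF.extChartAt_famPoint hp] at h1
  exact h1.comp p (hF.contDiffAt_snd hp).contMDiffAt

theorem ChartFamily.tendsto_famTangent (hF : ChartFamily c W ε O) {ι : Type*} {l : Filter ι}
    {x : ι → M} {x₀ : M} {p h : ι → EuclideanSpace ℝ (Fin d)} {p₀ h₀ : EuclideanSpace ℝ (Fin d)}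
    (hx₀ : x₀ ∈ (chartAt (EuclideanSpace ℝ (Fin d)) c).source)
    (hp₀ : (extChartAt (𝓡 d) c x₀, p₀) ∈ O) (hx : Tendsto x l (𝓝 x₀)) (hp : Tendsto p l (𝓝 p₀))
    (hh : Tendsto h l (𝓝 h₀)) :
    Tendsto (fun i => famTangent c ε (x i) (p i) (h i)) l (𝓝 (famTangent c ε x₀ p₀ h₀)) := by
  have h1 : Tendsto (fun i => (extChartAt (𝓡 d) c (x i), p i)) l
      (𝓝 (extChartAt (𝓡 d) c x₀, p₀)) :=
    ((continuousAt_extChartAt' (mem_extChartAt_source_iff.2 hx₀)).tendsto.comp hx).prodMk_nhds hp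
  have h2 : ContinuousAt (fderiv ℝ ε) (extChartAt (𝓡 d) c x₀, p₀) :=
    ((hF.contDiffAt hp₀).fderiv_right (m := 0) (by simp)).continuousAt
  have h3 : Tendsto (fun i => fderiv ℝ ε (extChartAt (𝓡 d) c (x i), p i) (0, h i)) l
      (𝓝 (fderiv ℝ ε (extChartAt (𝓡 d) c x₀, p₀) (0, h₀))) :=
    (isBoundedBilinearMap_apply.continuous.tendsto (fderiv ℝ ε (extChartAt (𝓡 d) c x₀, p₀),
      ((0 : EuclideanSpace ℝ (Fin d)), h₀))).comp
      ((h2.tendsto.comp h1).prodMk_nhds (tendsto_const_nhds.prodMk_nhds hh))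
  have h4 : Tendsto (fun i => famPoint c ε (x i) (p i)) l (𝓝 (famPoint c ε x₀ p₀)) :=
    ((continuousOn_extChartAt_symm c).continuousAt ((isOpen_extChartAt_target c).mem_nhds
      (hF.target _ hp₀))).tendsto.comp ((hF.contDiffAt hp₀).continuousAt.tendsto.comp h1)
  exact tendsto_chartDInv c (hF.famPoint_mem_source hp₀) h4 h3

/-- The derivative of `g ^ n`, in the parametrization around `x` and the chart around `c'`. -/
def coordDeriv (g : M ≃ₘ^1⟮𝓡 d, 𝓡 d⟯ M) (n : ℕ) (c c' : M)
    (ε : EuclideanSpace ℝ (Fin d) × EuclideanSpace ℝ (Fin d) → EuclideanSpace ℝ (Fin d)) (x : M)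
    (p : EuclideanSpace ℝ (Fin d)) : EuclideanSpace ℝ (Fin d) →L[ℝ] EuclideanSpace ℝ (Fin d) :=
  (chartD c' (g^[n] (famPoint c ε x p))).comp
    ((mfderiv (𝓡 d) (𝓡 d) g^[n] (famPoint c ε x p)).comp (famDeriv c ε x p))

theorem coordDeriv_apply (g : M ≃ₘ^1⟮𝓡 d, 𝓡 d⟯ M) (n : ℕ) (x : M)
    (p h : EuclideanSpace ℝ (Fin d)) :
    coordDeriv g n c c' ε x p h = chartD c' ((tangentCMap g)^[n] (famTangent c ε x p h)).proj
      ((tangentCMap g)^[n] (famTangent c ε x p h)).snd := by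
  rw [famTangent, tangentCMap_iterate g n (famPoint c ε x p)]
  rfl

theorem ChartFamily.coordDeriv_zero (hF : ChartFamily c W ε O) (g : M ≃ₘ^1⟮𝓡 d, 𝓡 d⟯ M) (n : ℕ)
    {x : M} (hx : x ∈ W) (h : EuclideanSpace ℝ (Fin d)) :
    coordDeriv g n c c' ε x 0 h =
      chartD c' (g^[n] x) (mfderiv (𝓡 d) (𝓡 d) g^[n] x (chartDInv c x h)) := by
  rw [coordDeriv_apply, hF.famTangent_zero hx, tangentCMap_iterate g n x]

theorem ChartFamily.hasFDerivAt_coord (hF : ChartFamily c W ε O) (g : M ≃ₘ^1⟮𝓡 d, 𝓡 d⟯ M)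
    (n : ℕ) {x : M} {p : EuclideanSpace ℝ (Fin d)} (hp : (extChartAt (𝓡 d) c x, p) ∈ O)
    (hc' : g^[n] (famPoint c ε x p) ∈ (chartAt (EuclideanSpace ℝ (Fin d)) c').source) :
    HasFDerivAt (fun p => extChartAt (𝓡 d) c' (g^[n] (famPoint c ε x p)))
      (coordDeriv g n c c' ε x p) p := by
  have h1 := ((contMDiff_iterate g n).mdifferentiable one_ne_zero (famPoint c ε x p)).hasMFDerivAt
  exact ((hasMFDerivAt_extChartAt hc').comp p
    (h1.comp p (hF.hasMFDerivAt_famPoint hp))).hasFDerivAt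

theorem ChartFamily.tendsto_coordDeriv (hF : ChartFamily c W ε O) {ι : Type*} {l : Filter ι}
    {f : M ≃ₘ^1⟮𝓡 d, 𝓡 d⟯ M} {g : ι → M ≃ₘ^1⟮𝓡 d, 𝓡 d⟯ M} (hg : Tendsto g l (c1Nhds f)) (n : ℕ)
    {x : ι → M} {x₀ : M} {p h : ι → EuclideanSpace ℝ (Fin d)} {p₀ h₀ : EuclideanSpace ℝ (Fin d)}
    (hx₀ : x₀ ∈ (chartAt (EuclideanSpace ℝ (Fin d)) c).source)
    (hp₀ : (extChartAt (𝓡 d) c x₀, p₀) ∈ O) (hx : Tendsto x l (𝓝 x₀)) (hp : Tendsto p l (𝓝 p₀))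
    (hh : Tendsto h l (𝓝 h₀))
    (hc' : f^[n] (famPoint c ε x₀ p₀) ∈ (chartAt (EuclideanSpace ℝ (Fin d)) c').source) :
    Tendsto (fun i => (g i)^[n] (famPoint c ε (x i) (p i))) l (𝓝 (f^[n] (famPoint c ε x₀ p₀))) ∧
    Tendsto (fun i => coordDeriv (g i) n c c' ε (x i) (p i) (h i)) l
      (𝓝 (coordDeriv f n c c' ε x₀ p₀ h₀)) := by
  have h1 := tendsto_tangentCMap_iterate hg (hF.tendsto_famTangent hx₀ hp₀ hx hp hh) n
  have h2 := (tendsto_tangentBundle_iff (c := c') (by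
    rw [tangentCMap_iterate_proj]; exact hc')).1 h1
  simp only [← coordDeriv_apply, tangentCMap_iterate_proj] at h2
  exact h2

theorem opNorm_le_of_forall_norm_le_one {X Y : Type*} [NormedAddCommGroup X] [NormedSpace ℝ X]
    [NormedAddCommGroup Y] [NormedSpace ℝ Y] {L : X →L[ℝ] Y} {C : ℝ} (hC : 0 ≤ C)
    (h : ∀ x, ‖x‖ ≤ 1 → ‖L x‖ ≤ C) : ‖L‖ ≤ C :=
  L.opNorm_le_of_unit_norm hC fun x hx => h x hx.le

theorem exists_limit_of_norm_le {ι : Type*} (𝒰 : Ultrafilter ι) {h : ι → EuclideanSpace ℝ (Fin d)}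
    {R : ℝ} (hR : ∀ᶠ i in (𝒰 : Filter ι), ‖h i‖ ≤ R) :
    ∃ h₀, ‖h₀‖ ≤ R ∧ Tendsto h 𝒰 (𝓝 h₀) := by
  obtain ⟨h₀, h1, h2⟩ := (isCompact_closedBall (0 : EuclideanSpace ℝ (Fin d)) R).ultrafilter_le_nhds
    (𝒰.map h) (by
      rw [Ultrafilter.coe_map]
      exact tendsto_principal.2 (hR.mono fun i hi => by simpa using hi))
  exact ⟨h₀, by simpa using h1, h2⟩

theorem exists_limit_of_mem {ι : Type*} (𝒰 : Ultrafilter ι) (hW : IsCompact W) {x : ι → M}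
    (hx : ∀ᶠ i in (𝒰 : Filter ι), x i ∈ W) : ∃ x₀ ∈ W, Tendsto x 𝒰 (𝓝 x₀) :=
  hW.ultrafilter_le_nhds (𝒰.map x) (by
    rw [Ultrafilter.coe_map]; exact tendsto_principal.2 hx)

/-- Near the zero section, the iterates of diffeomorphisms close to `f` are defined in charts and
their derivatives are almost constant. -/
theorem ChartFamily.eventually_coordDeriv_close (hF : ChartFamily c W ε O)
    (f : M ≃ₘ^1⟮𝓡 d, 𝓡 d⟯ M) (n : ℕ) (hW' : IsCompact W')
    (hW'c : W' ⊆ (chartAt (EuclideanSpace ℝ (Fin d)) c').source) {η : ℝ} (hη : 0 < η) :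
    ∀ᶠ q : ℝ × (M ≃ₘ^1⟮𝓡 d, 𝓡 d⟯ M) in 𝓝[>] 0 ×ˢ c1Nhds f, ∀ x ∈ W, q.2^[n] x ∈ W' →
      ∀ p, ‖p‖ ≤ q.1 → (extChartAt (𝓡 d) c x, p) ∈ O ∧
        q.2^[n] (famPoint c ε x p) ∈ (chartAt (EuclideanSpace ℝ (Fin d)) c').source ∧
        ‖coordDeriv q.2 n c c' ε x p - coordDeriv q.2 n c c' ε x 0‖ ≤ η := by
  have key : ∀ᶠ q : ℝ × (M ≃ₘ^1⟮𝓡 d, 𝓡 d⟯ M) in 𝓝[>] 0 ×ˢ c1Nhds f,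
      ∀ b : M × EuclideanSpace ℝ (Fin d) × EuclideanSpace ℝ (Fin d), b.1 ∈ W →
      q.2^[n] b.1 ∈ W' → ‖b.2.1‖ ≤ q.1 → ‖b.2.2‖ ≤ 1 → (extChartAt (𝓡 d) c b.1, b.2.1) ∈ O ∧
        q.2^[n] (famPoint c ε b.1 b.2.1) ∈ (chartAt (EuclideanSpace ℝ (Fin d)) c').source ∧
        ‖(coordDeriv q.2 n c c' ε b.1 b.2.1 - coordDeriv q.2 n c c' ε b.1 0) b.2.2‖ ≤ η := by
    refine eventually_forall_of_ultrafilter fun 𝒰 b h𝒰 hcon => ?_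
    have hg : Tendsto (fun q : ℝ × (M ≃ₘ^1⟮𝓡 d, 𝓡 d⟯ M) => q.2) 𝒰 (c1Nhds f) :=
      tendsto_snd.mono_left h𝒰
    have hr : Tendsto (fun q : ℝ × (M ≃ₘ^1⟮𝓡 d, 𝓡 d⟯ M) => q.1) 𝒰 (𝓝 0) :=
      (tendsto_fst.mono_left h𝒰).mono_right nhdsWithin_le_nhds
    push Not at hcon
    obtain ⟨x₀, hx₀, hx⟩ := exists_limit_of_mem 𝒰 hF.isCompact (hcon.mono fun q h => h.1)
    obtain ⟨h₀, -, hh⟩ := exists_limit_of_norm_le 𝒰 (hcon.mono fun q h => h.2.2.2.1)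
    have hp : Tendsto (fun q => (b q).2.1) 𝒰 (𝓝 0) :=
      squeeze_zero_norm' (hcon.mono fun q h => h.2.2.1) hr
    have hx₀' := hF.subset hx₀
    have hO := hF.mem x₀ hx₀
    have hfx : f^[n] x₀ ∈ W' := hW'.isClosed.mem_of_tendsto (tendsto_diffeo hg hx n)
      (hcon.mono fun q h => h.2.1)
    have hfx' : f^[n] (famPoint c ε x₀ 0) ∈ (chartAt (EuclideanSpace ℝ (Fin d)) c').source := by
      rw [hF.famPoint_zero hx₀]; exact hW'c hfx
    obtain ⟨t1, t2⟩ := hF.tendsto_coordDeriv hg n hx₀' hO hx hp hh hfx'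
    obtain ⟨-, t3⟩ := hF.tendsto_coordDeriv hg n hx₀' hO hx (tendsto_const_nhds (x := 0)) hh hfx'
    have t4 := (t2.sub t3).norm
    rw [sub_self, norm_zero] at t4
    have hO' : ∀ᶠ q in (𝒰 : Filter _), (extChartAt (𝓡 d) c (b q).1, (b q).2.1) ∈ O :=
      (((continuousAt_extChartAt' (mem_extChartAt_source_iff.2 hx₀')).tendsto.comp hx).prodMk_nhds
        hp).eventually (hF.isOpen.mem_nhds hO)
    obtain ⟨q, s1, s2, s3, s4⟩ := (hO'.and ((t1.eventually
      ((chartAt (EuclideanSpace ℝ (Fin d)) c').open_source.mem_nhds hfx')).and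
        ((t4.eventually (gt_mem_nhds hη)).and hcon))).exists
    exact absurd s3 (not_lt.2 (s4.2.2.2.2 s1 s2).le)
  filter_upwards [key] with q hq x hx hx' p hp
  refine ⟨(hq (x, p, 0) hx hx' hp (by simp)).1, (hq (x, p, 0) hx hx' hp (by simp)).2.1,
    opNorm_le_of_forall_norm_le_one hη.le fun h hh => (hq (x, p, h) hx hx' hp hh).2.2⟩

/-- Equicontinuity of the derivatives in charts. -/
theorem ChartFamily.eventually_equicontinuous (hF : ChartFamily c W ε O)
    (g : M ≃ₘ^1⟮𝓡 d, 𝓡 d⟯ M) (n : ℕ) (hW' : IsCompact W') {ρ : ℝ}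
    (hgood : ∀ x ∈ W, g^[n] x ∈ W' → ∀ p, ‖p‖ ≤ ρ → (extChartAt (𝓡 d) c x, p) ∈ O ∧
      g^[n] (famPoint c ε x p) ∈ (chartAt (EuclideanSpace ℝ (Fin d)) c').source)
    {η : ℝ} (hη : 0 < η) :
    ∀ᶠ δ : ℝ in 𝓝[>] 0, ∀ x ∈ W, g^[n] x ∈ W' → ∀ p p', ‖p‖ ≤ ρ → ‖p'‖ ≤ ρ → ‖p - p'‖ ≤ δ →
      ‖coordDeriv g n c c' ε x p - coordDeriv g n c c' ε x p'‖ ≤ η := by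
  have key : ∀ᶠ δ : ℝ in 𝓝[>] 0,
      ∀ b : M × EuclideanSpace ℝ (Fin d) × EuclideanSpace ℝ (Fin d) × EuclideanSpace ℝ (Fin d),
      b.1 ∈ W → g^[n] b.1 ∈ W' → ‖b.2.1‖ ≤ ρ → ‖b.2.2.1‖ ≤ ρ → ‖b.2.1 - b.2.2.1‖ ≤ δ →
      ‖b.2.2.2‖ ≤ 1 →
        ‖(coordDeriv g n c c' ε b.1 b.2.1 - coordDeriv g n c c' ε b.1 b.2.2.1) b.2.2.2‖ ≤ η := by
    refine eventually_forall_of_ultrafilter fun 𝒰 b h𝒰 hcon => ?_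
    have hr : Tendsto (fun δ : ℝ => δ) 𝒰 (𝓝 0) := h𝒰.trans nhdsWithin_le_nhds
    push Not at hcon
    obtain ⟨x₀, hx₀, hx⟩ := exists_limit_of_mem 𝒰 hF.isCompact (hcon.mono fun q h => h.1)
    obtain ⟨p₀, hp₀, hp⟩ := exists_limit_of_norm_le 𝒰 (hcon.mono fun q h => h.2.2.1)
    obtain ⟨h₀, -, hh⟩ := exists_limit_of_norm_le 𝒰 (hcon.mono fun q h => h.2.2.2.2.2.1)
    have hpp : Tendsto (fun q => (b q).2.1 - (b q).2.2.1) 𝒰 (𝓝 0) :=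
      squeeze_zero_norm' (hcon.mono fun q h => h.2.2.2.2.1) hr
    have hp' : Tendsto (fun q => (b q).2.2.1) 𝒰 (𝓝 p₀) := by
      simpa using hp.sub hpp
    have hg : Tendsto (fun _ : ℝ => g) 𝒰 (c1Nhds g) := tendsto_const_c1 _ g
    have hfx : g^[n] x₀ ∈ W' := hW'.isClosed.mem_of_tendsto (tendsto_diffeo hg hx n)
      (hcon.mono fun q h => h.2.1)
    obtain ⟨hO, hs⟩ := hgood x₀ hx₀ hfx p₀ hp₀
    have t2 := (hF.tendsto_coordDeriv hg n (hF.subset hx₀) hO hx hp hh hs).2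
    have t3 := (hF.tendsto_coordDeriv hg n (hF.subset hx₀) hO hx hp' hh hs).2
    have t4 := (t2.sub t3).norm
    rw [sub_self, norm_zero] at t4
    obtain ⟨q, s1, s2⟩ := ((t4.eventually (gt_mem_nhds hη)).and hcon).exists
    exact absurd s1 (not_lt.2 s2.2.2.2.2.2.2.le)
  filter_upwards [key] with δ hδ x hx hx' p p' hp hp' hpp
  exact opNorm_le_of_forall_norm_le_one hη.le fun h hh => hδ (x, p, p', h) hx hx' hp hp' hpp hh

/-- Compactness again, with K tending to infinity. The bound controls the iterates of g between two
consecutive multiples of N. -/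
theorem ChartFamily.eventually_norm_le (hF : ChartFamily c W ε O)
    (g : M ≃ₘ^1⟮𝓡 d, 𝓡 d⟯ M) (n : ℕ) {ρ : ℝ}
    (hgood : ∀ x ∈ W, ∀ p, ‖p‖ ≤ ρ → (extChartAt (𝓡 d) c x, p) ∈ O) :
    ∀ᶠ K : ℝ in atTop, ∀ x ∈ W, ∀ p, ‖p‖ ≤ ρ → ∀ h,
      ‖((tangentCMap g)^[n] (famTangent c ε x p h)).snd‖ ≤ K * ‖h‖ := by
  have key : ∀ᶠ K : ℝ in atTop,
      ∀ b : M × EuclideanSpace ℝ (Fin d) × EuclideanSpace ℝ (Fin d),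
      b.1 ∈ W → ‖b.2.1‖ ≤ ρ → ‖b.2.2‖ ≤ 1 →
        ‖((tangentCMap g)^[n] (famTangent c ε b.1 b.2.1 b.2.2)).snd‖ ≤ K := by
    refine eventually_forall_of_ultrafilter fun 𝒰 b h𝒰 hcon => ?_
    push Not at hcon
    obtain ⟨x₀, hx₀, hx⟩ := exists_limit_of_mem 𝒰 hF.isCompact (hcon.mono fun q h => h.1)
    obtain ⟨p₀, hp₀, hp⟩ := exists_limit_of_norm_le 𝒰 (hcon.mono fun q h => h.2.1)
    obtain ⟨h₀, -, hh⟩ := exists_limit_of_norm_le 𝒰 (hcon.mono fun q h => h.2.2.1)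
    have h0 := hF.tendsto_famTangent (hF.subset hx₀) (hgood x₀ hx₀ p₀ hp₀) hx hp hh
    have h1 := norm_limit (tendsto_tangentCMap_iterate (tendsto_const_c1 (𝒰 : Filter ℝ) g) h0 n)
    have h2 : Tendsto (fun K : ℝ => K) 𝒰 atTop := h𝒰
    exact not_tendsto_nhds_of_tendsto_atTop (tendsto_atTop_mono' _ (hcon.mono fun q h => h.2.2.2.le)
      h2) _ h1
  filter_upwards [key, eventually_ge_atTop 0] with K hK hK0 x hx p hp h
  have h1 : ∀ h, ((tangentCMap g)^[n] (famTangent c ε x p h)) =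
      ⟨g^[n] (famPoint c ε x p), ((mfderiv (𝓡 d) (𝓡 d) g^[n] (famPoint c ε x p)).comp
        (famDeriv c ε x p)) h⟩ := fun h => tangentCMap_iterate g n (famPoint c ε x p) _
  have h4 : ∀ h, ‖((tangentCMap g)^[n] (famTangent c ε x p h)).snd‖ =
      ‖((mfderiv (𝓡 d) (𝓡 d) g^[n] (famPoint c ε x p)).comp (famDeriv c ε x p)) h‖ := fun h =>
    congrArg (fun q : TangentBundle (𝓡 d) M => ‖q.snd‖) (h1 h)
  have h2 := fun h hh => (h4 h).symm.trans_le (hK (x, p, h) hx hp hh)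
  have h3 : ‖(mfderiv (𝓡 d) (𝓡 d) g^[n] (famPoint c ε x p)).comp (famDeriv c ε x p)‖ ≤ K :=
    opNorm_le_of_forall_norm_le_one hK0 h2
  exact (h4 h).trans_le (ContinuousLinearMap.le_of_opNorm_le _ h3 h)

theorem ChartFamily.eventually_norm_chartDInv_le (hF : ChartFamily c W ε O) :
    ∀ᶠ K : ℝ in atTop, ∀ x ∈ W, ∀ h : EuclideanSpace ℝ (Fin d), ‖chartDInv c x h‖ ≤ K * ‖h‖ := by
  filter_upwards [hF.eventually_norm_le (Diffeomorph.refl (𝓡 d) M 1) 0 (ρ := 0)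
    (fun x hx p hp => by rw [norm_le_zero_iff.1 hp]; exact hF.mem x hx)] with K hK x hx h
  have h1 := hK x hx 0 (by simp) h
  rw [hF.famTangent_zero hx] at h1
  exact h1

theorem ChartFamily.eventually_norm_chartD_le (hF : ChartFamily c W ε O) :
    ∀ᶠ K : ℝ in atTop, ∀ x ∈ W, ∀ v : TangentSpace (𝓡 d) x, ‖chartD c x v‖ ≤ K * ‖v‖ := by
  have key : ∀ᶠ K : ℝ in atTop, ∀ q : TangentBundle (𝓡 d) M, q.proj ∈ W → ‖q.snd‖ ≤ 1 →
      ‖chartD c q.proj q.snd‖ ≤ K := by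
    refine eventually_forall_of_ultrafilter fun 𝒰 b h𝒰 hcon => ?_
    push Not at hcon
    obtain ⟨q, hq⟩ := exists_limit_tangentBundle 𝒰 (hcon.mono fun q h => h.2.1)
    have hqW : q.proj ∈ W := hF.isCompact.isClosed.mem_of_tendsto (tendsto_snd_of_tendsto hq)
      (hcon.mono fun q h => h.1)
    have h1 := ((tendsto_tangentBundle_iff (hF.subset hqW)).1 hq).2.norm
    have h2 : Tendsto (fun K : ℝ => K) 𝒰 atTop := h𝒰
    exact not_tendsto_nhds_of_tendsto_atTop (tendsto_atTop_mono' _ (hcon.mono fun q h => h.2.2.le)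
      h2) _ h1
  filter_upwards [key, eventually_ge_atTop 0] with K hK hK0 x hx v
  have h3 : ‖(chartD c x : TangentSpace (𝓡 d) x →L[ℝ] EuclideanSpace ℝ (Fin d))‖ ≤ K :=
    opNorm_le_of_forall_norm_le_one hK0 fun v hv => hK ⟨x, v⟩ hx hv
  exact ContinuousLinearMap.le_of_opNorm_le _ h3 v

end Families

/-! ### A finite atlas of translation and exponential coordinates -/

section Atlas

variable {d : ℕ} {M : Type*} [MetricSpace M] [CompactSpace M]
  [ChartedSpace (EuclideanSpace ℝ (Fin d)) M] [IsManifold (𝓡 d) ∞ M]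
  [RiemannianBundle (fun x : M => TangentSpace (𝓡 d) x)]
  [IsContMDiffRiemannianBundle (𝓡 d) ∞ (EuclideanSpace ℝ (Fin d))
      (fun x : M => TangentSpace (𝓡 d) x)]

variable (d M) in
/-- A finite atlas, with two families of parametrizations in each chart: the translations, and
the exponential maps. -/
structure ParamAtlas where
  centers : Finset M
  ctr : M → M
  W : M → Set M
  ε : Bool → M → EuclideanSpace ℝ (Fin d) × EuclideanSpace ℝ (Fin d) → EuclideanSpace ℝ (Fin d)
  O : Bool → M → Set (EuclideanSpace ℝ (Fin d) × EuclideanSpace ℝ (Fin d))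
  ctr_mem : ∀ x, ctr x ∈ centers
  mem_W : ∀ x, x ∈ W (ctr x)
  family : ∀ b, ∀ c ∈ centers, ChartFamily c (W c) (ε b c) (O b c)
  ε_false : ∀ c q, ε false c q = q.1 + q.2
  exp_eq : ∀ c ∈ centers, ∀ x ∈ W c, ∀ p, (extChartAt (𝓡 d) c x, p) ∈ O true c →
    expMap x (chartDInv c x p) = famPoint c (ε true c) x p

theorem exists_paramAtlas : Nonempty (ParamAtlas d M) := by
  have hch : ∀ c : M, ∃ (W : Set M) (e : EuclideanSpace ℝ (Fin d) × EuclideanSpace ℝ (Fin d) →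
      EuclideanSpace ℝ (Fin d)) (O : Set (EuclideanSpace ℝ (Fin d) × EuclideanSpace ℝ (Fin d))),
      W ∈ 𝓝 c ∧ ChartFamily c W e O ∧
      ∀ x ∈ W, ∀ p, (extChartAt (𝓡 d) c x, p) ∈ O →
        expMap x (chartDInv c x p) = famPoint c e x p := by
    intro c
    obtain ⟨e, ρ, hρ, he, h⟩ := exists_expMap_chart (d := d) (mem_chart_self c)
    obtain ⟨W, hW, hWs, hWc⟩ := local_compact_nhds (x := c)
      (n := (chartAt (EuclideanSpace ℝ (Fin d)) c).source ∩
        {x | (extChartAt (𝓡 d) c x, (0 : EuclideanSpace ℝ (Fin d))) ∈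
          Metric.ball (extChartAt (𝓡 d) c c, (0 : EuclideanSpace ℝ (Fin d))) ρ})
      (inter_mem ((chartAt (EuclideanSpace ℝ (Fin d)) c).open_source.mem_nhds (mem_chart_self c))
        (((continuousAt_extChartAt c).prodMk continuousAt_const).eventually
          (Metric.ball_mem_nhds _ hρ)))
    refine ⟨W, e, _, hW, ⟨hWc, fun x hx => (hWs hx).1, Metric.isOpen_ball, fun x hx => (hWs hx).2,
      he, fun q hq => (h q hq).2.1, fun x hx => ?_, fun x hx w => ?_⟩,
      fun x hx p hp => ?_⟩
    · exact (h _ (hWs hx).2).2.2.2.1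
    · exact (h _ (hWs hx).2).2.2.2.2 w
    · have h1 := (h _ hp).2.2.1
      have e1 : (extChartAt (𝓡 d) c).symm (extChartAt (𝓡 d) c x) = x :=
        (extChartAt (𝓡 d) c).left_inv (mem_extChartAt_source_iff.2 (hWs hx).1)
      have key : ∀ y : M, y = x → expMap y (chartDInv c y p) = expMap x (chartDInv c x p) := by
        rintro y rfl; rfl
      exact (key _ e1).symm.trans h1
  choose W e O hW hF he using hch
  obtain ⟨I, -, hI⟩ := (isCompact_univ (X := M)).elim_nhds_subcover W fun x _ => hW x
  have hcov : ∀ x : M, ∃ c ∈ I, x ∈ W c := fun x => by simpa using hI (mem_univ x)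
  choose ctr hctr hmem using hcov
  -- The flag `true` selects exponential maps and `false` translations; the latter are restricted to
  -- pairs for which both the base point and its translate stay in the chart.
  refine ⟨⟨I, ctr, W, fun b c => if b then e c else fun q => q.1 + q.2,
    fun b c => if b then O c else {q | q.1 ∈ (extChartAt (𝓡 d) c).target ∧
      q.1 + q.2 ∈ (extChartAt (𝓡 d) c).target}, hctr, hmem, fun b c _ => ?_,
      fun c q => by simp, fun c _ x hx p hp => ?_⟩⟩
  · cases b with
    | true => simpa using hF c
    | false =>
      have hmap : ∀ x ∈ W c, extChartAt (𝓡 d) c x ∈ (extChartAt (𝓡 d) c).target := fun x hx =>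
        (extChartAt (𝓡 d) c).map_source (mem_extChartAt_source_iff.2 ((hF c).subset hx))
      have hl : (fun q : EuclideanSpace ℝ (Fin d) × EuclideanSpace ℝ (Fin d) => q.1 + q.2) =
          (ContinuousLinearMap.fst ℝ _ _ + ContinuousLinearMap.snd ℝ _ _ :
            EuclideanSpace ℝ (Fin d) × EuclideanSpace ℝ (Fin d) →L[ℝ] EuclideanSpace ℝ (Fin d)) := by
        ext q; simp
      simp only [Bool.false_eq_true, if_false]
      refine ⟨(hF c).isCompact, (hF c).subset, ?_, fun x hx => ⟨hmap x hx, by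
        simpa using hmap x hx⟩, (contDiff_fst.add contDiff_snd).contDiffOn, fun q hq => hq.2,
        fun x hx => by simp, fun x hx w => ?_⟩
      · exact ((isOpen_extChartAt_target c).preimage continuous_fst).inter
          ((isOpen_extChartAt_target c).preimage (continuous_fst.add continuous_snd))
      · rw [hl, ContinuousLinearMap.fderiv]; simp
  · simp only [if_true] at hp ⊢
    exact he c x hx p hp

end Atlas

/-! ### Riemannian distances and membership in the stable set -/

section Distance

variable {d : ℕ} {M : Type*} [MetricSpace M] [CompactSpace M]
  [ChartedSpace (EuclideanSpace ℝ (Fin d)) M] [IsManifold (𝓡 d) ∞ M]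
  [RiemannianBundle (fun x : M => TangentSpace (𝓡 d) x)]
  [IsContMDiffRiemannianBundle (𝓡 d) ∞ (EuclideanSpace ℝ (Fin d))
      (fun x : M => TangentSpace (𝓡 d) x)]
  [IsRiemannianManifold (𝓡 d) M]

/-- The image of the segment from 0 to p joins the two points and has speed at most K‖p‖. This is
where the distance is tied to the Riemannian metric. -/
theorem ChartFamily.edist_iterate_le {c : M} {W : Set M}
    {ε : EuclideanSpace ℝ (Fin d) × EuclideanSpace ℝ (Fin d) → EuclideanSpace ℝ (Fin d)}
    {O : Set (EuclideanSpace ℝ (Fin d) × EuclideanSpace ℝ (Fin d))} (hF : ChartFamily c W ε O)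
    (g : M ≃ₘ^1⟮𝓡 d, 𝓡 d⟯ M) (n : ℕ) {ρ K : ℝ} {x : M} (hx : x ∈ W)
    (hgood : ∀ p, ‖p‖ ≤ ρ → (extChartAt (𝓡 d) c x, p) ∈ O)
    (hK : ∀ p, ‖p‖ ≤ ρ → ∀ h,
      ‖((tangentCMap g)^[n] (famTangent c ε x p h)).snd‖ ≤ K * ‖h‖)
    {p : EuclideanSpace ℝ (Fin d)} (hp : ‖p‖ ≤ ρ) :
    edist (g^[n] (famPoint c ε x p)) (g^[n] x) ≤ ENNReal.ofReal (K * ‖p‖) := by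
  have hsm : ∀ t ∈ Icc (0 : ℝ) 1, ‖t • p‖ ≤ ρ := fun t ht => by
    rw [norm_smul, Real.norm_of_nonneg ht.1]
    exact (mul_le_of_le_one_left (norm_nonneg _) ht.2).trans hp
  have hl : ∀ t : ℝ, HasFDerivAt (fun t : ℝ => t • p)
      (ContinuousLinearMap.toSpanSingleton ℝ p) t := fun t => by
    have := ((hasDerivAt_id t).smul_const p).hasFDerivAt
    simpa using this
  have hsmooth : ContMDiffOn 𝓘(ℝ, ℝ) (𝓡 d) 1 (fun t : ℝ => g^[n] (famPoint c ε x (t • p)))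
      (Icc 0 1) := fun t ht => by
    have h1 : ContDiffAt ℝ 1 (fun t : ℝ => t • p) t := contDiffAt_id.smul contDiffAt_const
    exact ((contMDiff_iterate g n).contMDiffAt.comp t
      ((hF.contMDiffAt_famPoint (hgood _ (hsm t ht))).comp t h1.contMDiffAt)).contMDiffWithinAt
  rw [edist_comm, IsRiemannianManifold.out (I := 𝓡 d) (g^[n] x)]
  refine (riemannianEDist_le_pathELength hsmooth (by simp [hF.famPoint_zero hx]) (by simp)
    zero_le_one).trans ?_
  rw [pathELength_eq_lintegral_mfderiv_Icc]
  have hbound : ∀ t ∈ Icc (0 : ℝ) 1,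
      ‖mfderiv 𝓘(ℝ, ℝ) (𝓡 d) (fun t : ℝ => g^[n] (famPoint c ε x (t • p))) t (1 : ℝ)‖ₑ ≤
        ENNReal.ofReal (K * ‖p‖) := by
    intro t ht
    have h1 := ((contMDiff_iterate g n).mdifferentiable one_ne_zero
      (famPoint c ε x (t • p))).hasMFDerivAt
    have h2 := (h1.comp t ((hF.hasMFDerivAt_famPoint (hgood _ (hsm t ht))).comp t
      (hl t).hasMFDerivAt)).mfderiv
    have h3 := hK (t • p) (hsm t ht) p
    have h4 : (tangentCMap g)^[n] (famTangent c ε x (t • p) p) =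
        ⟨g^[n] (famPoint c ε x (t • p)), mfderiv (𝓡 d) (𝓡 d) g^[n] (famPoint c ε x (t • p))
          (famDeriv c ε x (t • p) p)⟩ := tangentCMap_iterate g n (famPoint c ε x (t • p)) _
    have h5 : mfderiv 𝓘(ℝ, ℝ) (𝓡 d) (fun t : ℝ => g^[n] (famPoint c ε x (t • p))) t (1 : ℝ) =
        mfderiv (𝓡 d) (𝓡 d) g^[n] (famPoint c ε x (t • p))
          (famDeriv c ε x (t • p) p) := by
      refine (congrArg (fun L => L (1 : ℝ)) h2).trans ?_
      change mfderiv (𝓡 d) (𝓡 d) g^[n] (famPoint c ε x (t • p))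
          (famDeriv c ε x (t • p) ((1 : ℝ) • p)) = _
      rw [one_smul]
    have h6 : ‖mfderiv (𝓡 d) (𝓡 d) g^[n] (famPoint c ε x (t • p))
          (famDeriv c ε x (t • p) p)‖ ≤ K * ‖p‖ :=
      (congrArg (fun q : TangentBundle (𝓡 d) M => ‖q.snd‖) h4).symm.trans_le h3
    rw [h5, ← ofReal_norm]
    exact ENNReal.ofReal_le_ofReal h6
  refine (MeasureTheory.setLIntegral_mono' measurableSet_Icc hbound).trans ?_
  simp

end Distance

/-- The prefactor contributes (log A)/n, which tends to 0, so the limsup is at most -a/2. Replacing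
A by max A 1 keeps its logarithm meaningful. -/
theorem mem_stableSet_of_edist_le {M : Type*} [MetricSpace M] {f : M → M} {x y : M} {A a : ℝ}
    (ha : 0 < a) (h : ∀ n : ℕ, edist (f^[n] y) (f^[n] x) ≤ ENNReal.ofReal (A * Real.exp (-(a * n)))) :
    y ∈ stableSet f x := by
  set A' := max A 1 with hA'
  have hA0 : 0 < A' := lt_max_of_lt_right one_pos
  have hlim : Tendsto (fun n : ℕ => Real.log A' / n) atTop (𝓝 0) :=
    tendsto_const_nhds.div_atTop tendsto_natCast_atTop_atTop
  have hev : ∀ᶠ n : ℕ in atTop, ENNReal.log (edist (f^[n] y) (f^[n] x)) / (n : EReal) ≤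
      ((-(a / 2) : ℝ) : EReal) := by
    filter_upwards [hlim.eventually (gt_mem_nhds (half_pos ha)), eventually_ge_atTop 1] with n h1 h2
    have hn : (0 : ℝ) < n := by exact_mod_cast h2
    have h3 : edist (f^[n] y) (f^[n] x) ≤ ENNReal.ofReal (A' * Real.exp (-(a * n))) :=
      (h n).trans (ENNReal.ofReal_le_ofReal (mul_le_mul_of_nonneg_right (le_max_left _ _)
        (Real.exp_pos _).le))
    have h4 := ENNReal.log_monotone h3
    rw [ENNReal.log_ofReal_of_pos (by positivity), Real.log_mul hA0.ne' (Real.exp_pos _).ne',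
      Real.log_exp] at h4
    have h5 : ((n : ℕ) : EReal) = ((n : ℝ) : EReal) := rfl
    refine (EReal.div_le_div_right_of_nonneg (by positivity) h4).trans ?_
    rw [h5, ← EReal.coe_div, EReal.coe_le_coe_iff, div_le_iff₀ hn]
    rw [div_lt_iff₀ hn] at h1
    linarith
  refine (limsup_le_of_le (h := hev)).trans_lt ?_
  exact_mod_cast (by linarith : -(a / 2) < 0)

theorem exists_isometry {X Z : Type*} [NormedAddCommGroup X] [InnerProductSpace ℝ X]
    [FiniteDimensional ℝ X] [NormedAddCommGroup Z] [InnerProductSpace ℝ Z] [FiniteDimensional ℝ Z]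
    (h : Module.finrank ℝ X = Module.finrank ℝ Z) : ∃ i : X →ₗ[ℝ] Z, ∀ a, ‖i a‖ = ‖a‖ := by
  let i : X ≃ₗᵢ[ℝ] Z := (stdOrthonormalBasis ℝ X).equiv (stdOrthonormalBasis ℝ Z) (finCongr h)
  exact ⟨i.toLinearEquiv.toLinearMap, i.norm_map⟩

/-! ### Isometric frames adapted to a splitting -/

section Frames

variable {d : ℕ} {M : Type*} [MetricSpace M] [CompactSpace M]
  [ChartedSpace (EuclideanSpace ℝ (Fin d)) M] [IsManifold (𝓡 d) ∞ M]
  [RiemannianBundle (fun x : M => TangentSpace (𝓡 d) x)]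
  [IsContMDiffRiemannianBundle (𝓡 d) ∞ (EuclideanSpace ℝ (Fin d))
      (fun x : M => TangentSpace (𝓡 d) x)]

variable {X Y : Type*} [NormedAddCommGroup X] [InnerProductSpace ℝ X] [FiniteDimensional ℝ X]
  [NormedAddCommGroup Y] [InnerProductSpace ℝ Y] [FiniteDimensional ℝ Y]

/-- In the chart around `c`, the isomorphism `J` is isometric from the factors of `X × Y` to the
spaces of the splitting `Es ⊕ Fs` at `x`. -/
structure IsFrame (c x : M) (Es Fs : Submodule ℝ (TangentSpace (𝓡 d) x))
    (J : (X × Y) ≃L[ℝ] EuclideanSpace ℝ (Fin d)) : Prop where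
  fst_mem : ∀ a : X, chartDInv c x (J (a, 0)) ∈ Es
  norm_fst : ∀ a : X, ‖chartDInv c x (J (a, 0))‖ = ‖a‖
  snd_mem : ∀ b : Y, chartDInv c x (J (0, b)) ∈ Fs
  norm_snd : ∀ b : Y, ‖chartDInv c x (J (0, b))‖ = ‖b‖

variable {c x : M} {Es Fs : Submodule ℝ (TangentSpace (𝓡 d) x)}

/-- Prescribed isometries are needed at time 0, where the factors are the summands at x themselves
with their inclusions; at other times any isometries do. -/
theorem exists_frame_of_isometries (hx : x ∈ (chartAt (EuclideanSpace ℝ (Fin d)) c).source)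
    (hd : Disjoint Es Fs) (hdim : Module.finrank ℝ X + Module.finrank ℝ Y = d)
    (iX : X →ₗ[ℝ] TangentSpace (𝓡 d) x) (iY : Y →ₗ[ℝ] TangentSpace (𝓡 d) x)
    (hX : ∀ a, ‖iX a‖ = ‖a‖) (hY : ∀ b, ‖iY b‖ = ‖b‖) (hXm : ∀ a, iX a ∈ Es) (hYm : ∀ b, iY b ∈ Fs) :
    ∃ J : (X × Y) ≃L[ℝ] EuclideanSpace ℝ (Fin d), IsFrame c x Es Fs J ∧
      ∀ z, J z = chartD c x (iX z.1 + iY z.2) := by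
  let L : (X × Y) →ₗ[ℝ] EuclideanSpace ℝ (Fin d) :=
    (chartD c x).toLinearMap ∘ₗ (iX ∘ₗ LinearMap.fst ℝ X Y + iY ∘ₗ LinearMap.snd ℝ X Y)
  have hL : ∀ z, L z = chartD c x (iX z.1 + iY z.2) := fun z => rfl
  have hinj : Function.Injective L := by
    rw [injective_iff_map_eq_zero]
    intro z hz
    have h1 : iX z.1 + iY z.2 = 0 := by
      rw [← chartDInv_chartD hx (iX z.1 + iY z.2), ← hL, hz, map_zero]
    have h2 : iX z.1 = 0 := (Submodule.disjoint_def.1 hd) _ (hXm _) (by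
      rw [eq_neg_of_add_eq_zero_left h1]; exact Fs.neg_mem (hYm _))
    have h3 : iY z.2 = 0 := by rwa [h2, zero_add] at h1
    exact Prod.ext (norm_eq_zero.1 (by rw [← hX, h2, norm_zero]))
      (norm_eq_zero.1 (by rw [← hY, h3, norm_zero]))
  have hfr : Module.finrank ℝ (X × Y) = Module.finrank ℝ (EuclideanSpace ℝ (Fin d)) := by
    rw [Module.finrank_prod, hdim, finrank_euclideanSpace_fin]
  let J := (LinearEquiv.ofInjectiveOfFinrankEq L hinj hfr).toContinuousLinearEquiv
  have hJ : ∀ z, J z = chartD c x (iX z.1 + iY z.2) := fun z => rfl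
  refine ⟨J, ⟨fun a => ?_, fun a => ?_, fun b => ?_, fun b => ?_⟩, hJ⟩ <;>
    rw [hJ, chartDInv_chartD hx]
  · simpa using hXm a
  · simpa using hX a
  · simpa using hYm b
  · simpa using hY b

theorem finrank_add_finrank (hc : IsCompl Fs Es) :
    Module.finrank ℝ Es + Module.finrank ℝ Fs = d := by
  rw [add_comm, Submodule.finrank_add_eq_of_isCompl hc, finrank_tangentSpace]

theorem exists_isometry_submodule (hX : Module.finrank ℝ X = Module.finrank ℝ Es) :
    ∃ i : X →ₗ[ℝ] Es, ∀ a, ‖i a‖ = ‖a‖ := exists_isometry hX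

theorem exists_frame (hx : x ∈ (chartAt (EuclideanSpace ℝ (Fin d)) c).source)
    (hc : IsCompl Fs Es) (hX : Module.finrank ℝ X = Module.finrank ℝ Es)
    (hY : Module.finrank ℝ Y = Module.finrank ℝ Fs) :
    ∃ J : (X × Y) ≃L[ℝ] EuclideanSpace ℝ (Fin d), IsFrame c x Es Fs J := by
  have h1 : Module.finrank ℝ X + Module.finrank ℝ Y = d := by
    rw [hX, hY]; exact finrank_add_finrank hc
  obtain ⟨iX, hiX⟩ := exists_isometry_submodule (X := X) hX
  obtain ⟨iY, hiY⟩ := exists_isometry_submodule (X := Y) hY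
  obtain ⟨J, hJ, -⟩ := exists_frame_of_isometries (c := c) hx hc.disjoint.symm
    h1 (Es.subtype ∘ₗ iX) (Fs.subtype ∘ₗ iY) hiX hiY (fun a => (iX a).2) (fun b => (iY b).2)
  exact ⟨J, hJ⟩

variable {J : (X × Y) ≃L[ℝ] EuclideanSpace ℝ (Fin d)}

theorem IsFrame.chartDInv_eq (J : (X × Y) ≃L[ℝ] EuclideanSpace ℝ (Fin d)) (z : X × Y) :
    chartDInv c x (J z) = chartDInv c x (J (z.1, 0)) + chartDInv c x (J (0, z.2)) := by
  rw [← map_add, ← map_add]; simp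

theorem IsFrame.norm_le (hJ : IsFrame c x Es Fs J)
    (hx : x ∈ (chartAt (EuclideanSpace ℝ (Fin d)) c).source) {K : ℝ} (hK0 : 0 ≤ K)
    (hK : ∀ v : TangentSpace (𝓡 d) x, ‖chartD c x v‖ ≤ K * ‖v‖) (z : X × Y) :
    ‖J z‖ ≤ 2 * K * ‖z‖ := by
  have h1 := hK (chartDInv c x (J z))
  rw [chartD_chartDInv hx, IsFrame.chartDInv_eq] at h1
  refine h1.trans ?_
  have h2 := norm_add_le (chartDInv c x (J (z.1, 0))) (chartDInv c x (J (0, z.2)))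
  rw [hJ.norm_fst, hJ.norm_snd] at h2
  have h3 : ‖chartDInv c x (J (z.1, 0)) + chartDInv c x (J (0, z.2))‖ ≤ 2 * ‖z‖ := by
    refine h2.trans ?_
    linarith [norm_fst_le z, norm_snd_le z]
  refine (mul_le_mul_of_nonneg_left h3 hK0).trans (le_of_eq (by ring))

/-- A frame is isometric only on each factor. Its distortion is governed by the angle of the
splitting and by the chart, hence uniformly bounded along orbits. -/
theorem IsFrame.norm_le_mul (hJ : IsFrame c x Es Fs J) {C K : ℝ} (hC : 0 ≤ C)
    (hang : ∀ v ∈ Es, ∀ w ∈ Fs, ‖v‖ ≤ C * ‖v + w‖ ∧ ‖w‖ ≤ C * ‖v + w‖)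
    (hK : ∀ h : EuclideanSpace ℝ (Fin d), ‖chartDInv c x h‖ ≤ K * ‖h‖) (z : X × Y) :
    ‖z‖ ≤ C * K * ‖J z‖ := by
  have h1 := hang _ (hJ.fst_mem z.1) _ (hJ.snd_mem z.2)
  rw [hJ.norm_fst, hJ.norm_snd, ← IsFrame.chartDInv_eq] at h1
  have h2 := mul_le_mul_of_nonneg_left (hK (J z)) hC
  rw [← mul_assoc] at h2
  exact norm_prod_le_iff.2 ⟨h1.1.trans h2, h1.2.trans h2⟩

theorem IsFrame.symm_chartD_fst (hJ : IsFrame c x Es Fs J)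
    (hx : x ∈ (chartAt (EuclideanSpace ℝ (Fin d)) c).source) (hd : Disjoint Es Fs)
    {v : TangentSpace (𝓡 d) x} (hv : v ∈ Es) :
    (J.symm (chartD c x v)).2 = 0 ∧ ‖(J.symm (chartD c x v)).1‖ = ‖v‖ := by
  set z := J.symm (chartD c x v) with hz
  have h1 : v = chartDInv c x (J (z.1, 0)) + chartDInv c x (J (0, z.2)) := by
    rw [← IsFrame.chartDInv_eq, hz, J.apply_symm_apply, chartDInv_chartD hx]
  have h2 : chartDInv c x (J (0, z.2)) = 0 := Submodule.disjoint_def.1 hd _ (by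
    rw [eq_sub_of_add_eq' h1.symm]
    exact Es.sub_mem hv (hJ.fst_mem _)) (hJ.snd_mem _)
  have h3 : z.2 = 0 := norm_eq_zero.1 (by rw [← hJ.norm_snd, h2, norm_zero])
  refine ⟨h3, ?_⟩
  rw [h2, add_zero] at h1
  rw [← hJ.norm_fst, ← h1]

theorem IsFrame.symm_chartD_snd (hJ : IsFrame c x Es Fs J)
    (hx : x ∈ (chartAt (EuclideanSpace ℝ (Fin d)) c).source) (hd : Disjoint Es Fs)
    {v : TangentSpace (𝓡 d) x} (hv : v ∈ Fs) :
    (J.symm (chartD c x v)).1 = 0 ∧ ‖(J.symm (chartD c x v)).2‖ = ‖v‖ := by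
  set z := J.symm (chartD c x v) with hz
  have h1 : v = chartDInv c x (J (z.1, 0)) + chartDInv c x (J (0, z.2)) := by
    rw [← IsFrame.chartDInv_eq, hz, J.apply_symm_apply, chartDInv_chartD hx]
  have h2 : chartDInv c x (J (z.1, 0)) = 0 := Submodule.disjoint_def.1 hd _ (hJ.fst_mem _) (by
    rw [eq_sub_of_add_eq h1.symm]
    exact Fs.sub_mem hv (hJ.snd_mem _))
  have h3 : z.1 = 0 := norm_eq_zero.1 (by rw [← hJ.norm_fst, h2, norm_zero])
  refine ⟨h3, ?_⟩
  rw [h2, zero_add] at h1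
  rw [← hJ.norm_snd, ← h1]

/-- In frames, a linear map that respects the splittings is block diagonal. -/
theorem IsFrame.block (hJ : IsFrame c x Es Fs J) {c' x' : M}
    {Es' Fs' : Submodule ℝ (TangentSpace (𝓡 d) x')} {J' : (X × Y) ≃L[ℝ] EuclideanSpace ℝ (Fin d)}
    (hJ' : IsFrame c' x' Es' Fs' J')
    (hx' : x' ∈ (chartAt (EuclideanSpace ℝ (Fin d)) c').source) (hd : Disjoint Es' Fs')
    {T : TangentSpace (𝓡 d) x → TangentSpace (𝓡 d) x'} {L : (X × Y) →L[ℝ] (X × Y)}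
    (hL : ∀ z, L z = J'.symm (chartD c' x' (T (chartDInv c x (J z)))))
    (hTE : ∀ v ∈ Es, T v ∈ Es') (hTF : ∀ v ∈ Fs, T v ∈ Fs') {β γ : ℝ} (hβ0 : 0 ≤ β) (hγ0 : 0 < γ)
    (hβ : ∀ v ∈ Es, ‖T v‖ ≤ β * ‖v‖) (hγ : ∀ w ∈ Fs, γ * ‖w‖ ≤ ‖T w‖) :
    (∀ z, ‖(L z).1‖ ≤ β * ‖z‖) ∧
      ∃ D : Y ≃L[ℝ] Y, (∀ z, (L z).2 = D z.2) ∧ ∀ y, γ * ‖D.symm y‖ ≤ ‖y‖ := by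
  have e1 : ∀ a : X, (L (a, 0)).2 = 0 ∧ ‖(L (a, 0)).1‖ ≤ β * ‖a‖ := fun a => by
    have h1 := hJ'.symm_chartD_fst hx' hd (hTE _ (hJ.fst_mem a))
    rw [← hL] at h1
    refine ⟨h1.1, h1.2.trans_le ?_⟩
    rw [← hJ.norm_fst a]
    exact hβ _ (hJ.fst_mem a)
  have e2 : ∀ b : Y, (L (0, b)).1 = 0 ∧ γ * ‖b‖ ≤ ‖(L (0, b)).2‖ := fun b => by
    have h1 := hJ'.symm_chartD_snd hx' hd (hTF _ (hJ.snd_mem b))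
    rw [← hL] at h1
    refine ⟨h1.1, ?_⟩
    rw [h1.2, ← hJ.norm_snd b]
    exact hγ _ (hJ.snd_mem b)
  have e3 : ∀ z, L z = L (z.1, 0) + L (0, z.2) := fun z => by rw [← map_add]; simp
  refine ⟨fun z => ?_, ?_⟩
  · rw [e3, Prod.fst_add, (e2 _).1, add_zero]
    exact (e1 z.1).2.trans (mul_le_mul_of_nonneg_left (norm_fst_le z) hβ0)
  · let D₀ : Y →ₗ[ℝ] Y := LinearMap.snd ℝ X Y ∘ₗ L.toLinearMap ∘ₗ LinearMap.inr ℝ X Y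
    have hD₀ : ∀ y, D₀ y = (L (0, y)).2 := fun y => rfl
    have hinj : Function.Injective D₀ := by
      rw [injective_iff_map_eq_zero]
      intro y hy
      have h1 := (e2 y).2
      rw [← hD₀, hy, norm_zero] at h1
      exact norm_le_zero_iff.1 (nonpos_of_mul_nonpos_right h1 hγ0)
    let D := (LinearEquiv.ofInjectiveEndo D₀ hinj).toContinuousLinearEquiv
    have hD : ∀ y, D y = (L (0, y)).2 := fun y => rfl
    refine ⟨D, fun z => ?_, fun y => ?_⟩
    · rw [e3, Prod.snd_add, (e1 _).1, zero_add, hD]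
    · have h1 := (e2 (D.symm y)).2
      rwa [← hD, D.apply_symm_apply] at h1

end Frames

/-! ### Contraction rates along the orbit of a block point -/

section Rates

variable {d : ℕ} {M : Type*} [MetricSpace M] [CompactSpace M]
  [ChartedSpace (EuclideanSpace ℝ (Fin d)) M] [IsManifold (𝓡 d) ∞ M]
  [RiemannianBundle (fun x : M => TangentSpace (𝓡 d) x)]
  [IsContMDiffRiemannianBundle (𝓡 d) ∞ (EuclideanSpace ℝ (Fin d))
      (fun x : M => TangentSpace (𝓡 d) x)]

/-- A dominated splitting over the invariant set `S`, with explicit constants. -/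
structure AdaptedSplitting (g : M ≃ₘ^1⟮𝓡 d, 𝓡 d⟯ M) (S U : Set M)
    (Ecu Ecs : ∀ x : M, Submodule ℝ (TangentSpace (𝓡 d) x))
    (Ca : ∀ x : M, Set (TangentSpace (𝓡 d) x)) (C : ℝ) (n₀ : ℕ) : Prop where
  mem : ∀ x ∈ S, g x ∈ S
  subset : S ⊆ U
  isCompl : ∀ x ∈ S, IsCompl (Ecu x) (Ecs x)
  map_cu : ∀ x ∈ S, (Ecu x).map (mfderiv (𝓡 d) (𝓡 d) g x).toLinearMap = Ecu (g x)
  map_cs : ∀ x ∈ S, (Ecs x).map (mfderiv (𝓡 d) (𝓡 d) g x).toLinearMap = Ecs (g x)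
  allTime : ∀ x ∈ S, ∀ v ∈ Ecs x, (⟨x, v⟩ : TangentBundle (𝓡 d) M) ∈ allTime g U Ca
  angle : ∀ x ∈ S, ∀ v ∈ Ecs x, ∀ w ∈ Ecu x, ‖v‖ ≤ C * ‖v + w‖ ∧ ‖w‖ ≤ C * ‖v + w‖
  dom : ∀ m ≥ n₀, ∀ x ∈ S, ∀ v ∈ Ecs x, ∀ w ∈ Ecu x,
    19 / 10 * ‖mfderiv (𝓡 d) (𝓡 d) g^[m] x v‖ * ‖w‖ ≤ ‖v‖ * ‖mfderiv (𝓡 d) (𝓡 d) g^[m] x w‖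

variable {g : M ≃ₘ^1⟮𝓡 d, 𝓡 d⟯ M} {S U : Set M}
    {Ecu Ecs : ∀ x : M, Submodule ℝ (TangentSpace (𝓡 d) x)}
    {Ca : ∀ x : M, Set (TangentSpace (𝓡 d) x)} {C : ℝ} {n₀ : ℕ}

theorem iterate_mem_of_map {E : ∀ x : M, Submodule ℝ (TangentSpace (𝓡 d) x)}
    (hS : ∀ x ∈ S, g x ∈ S)
    (hmap : ∀ x ∈ S, (E x).map (mfderiv (𝓡 d) (𝓡 d) g x).toLinearMap = E (g x)) {x : M}
    (hx : x ∈ S) (n : ℕ) {v : TangentSpace (𝓡 d) x} (hv : v ∈ E x) :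
    mfderiv (𝓡 d) (𝓡 d) g^[n] x v ∈ E (g^[n] x) := by
  have h : ∀ p ∈ subSet S E, (tangentCMap g)^[n] p ∈ subSet S E := fun p hp =>
    iterate_mem_of_forall (fun p (hp : p ∈ subSet S E) =>
      (⟨hS _ hp.1, (hmap _ hp.1).le ⟨p.snd, hp.2, rfl⟩⟩ : tangentCMap g p ∈ subSet S E)) hp n
  have h1 := h ⟨x, v⟩ ⟨hx, hv⟩
  rw [tangentCMap_iterate g n x] at h1
  exact h1.2

theorem finrank_iterate_of_map {E : ∀ x : M, Submodule ℝ (TangentSpace (𝓡 d) x)}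
    (hS : ∀ x ∈ S, g x ∈ S)
    (hmap : ∀ x ∈ S, (E x).map (mfderiv (𝓡 d) (𝓡 d) g x).toLinearMap = E (g x)) {x : M}
    (hx : x ∈ S) (n : ℕ) : Module.finrank ℝ (E (g^[n] x)) = Module.finrank ℝ (E x) := by
  induction n with
  | zero => rfl
  | succ n ih =>
    have hy : g^[n] x ∈ S := iterate_mem_of_forall hS hx n
    have hinj : Function.Injective (mfderiv (𝓡 d) (𝓡 d) g (g^[n] x)).toLinearMap := by
      rw [injective_iff_map_eq_zero]
      intro v hv
      exact tangentCMap_snd_ne_zero g (p := ⟨g^[n] x, v⟩) hv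
    have h1 := (Submodule.equivMapOfInjective _ hinj (E (g^[n] x))).finrank_eq
    rw [hmap _ hy] at h1
    rw [Function.iterate_succ_apply', ← h1, ih]

/-- The norm of the restriction of the derivative to a subspace. -/
def restrictNorm (g : M → M) (l : ℕ) (x : M) (E : Submodule ℝ (TangentSpace (𝓡 d) x)) : ℝ :=
  ‖(mfderiv (𝓡 d) (𝓡 d) g^[l] x).comp E.subtypeL‖

theorem norm_le_restrictNorm (g : M → M) (l : ℕ) {x : M}
    {E : Submodule ℝ (TangentSpace (𝓡 d) x)} {v : TangentSpace (𝓡 d) x} (hv : v ∈ E) :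
    ‖mfderiv (𝓡 d) (𝓡 d) g^[l] x v‖ ≤ restrictNorm g l x E * ‖v‖ :=
  ((mfderiv (𝓡 d) (𝓡 d) g^[l] x).comp E.subtypeL).le_opNorm ⟨v, hv⟩

theorem restrictNorm_nonneg (g : M → M) (l : ℕ) (x : M)
    (E : Submodule ℝ (TangentSpace (𝓡 d) x)) : 0 ≤ restrictNorm g l x E := by
  rw [restrictNorm]; exact ContinuousLinearMap.opNorm_nonneg _

/-- Exponentiating the block condition. The extended logarithm is additive on products also when a
factor vanishes, so the sum becomes a single logarithm without case distinction. -/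
theorem prod_restrictNorm_lt {l : ℕ} {x : M} (hx : x ∈ stableBlock g S Ecs l) {n : ℕ} (hn : 1 ≤ n) :
    ∏ j ∈ Finset.range n, restrictNorm g l (g^[l * j] x) (Ecs (g^[l * j] x)) < Real.exp (-n) := by
  have h1 := hx.2 n hn
  have hn' : (0 : ℝ) < n := by exact_mod_cast hn
  have h2 : ∀ m : ℕ, ∑ j ∈ Finset.range m,
      ENNReal.log (normRestrict g l (g^[l * j] x) (Ecs (g^[l * j] x))) =
      ENNReal.log (ENNReal.ofReal (∏ j ∈ Finset.range m,
        restrictNorm g l (g^[l * j] x) (Ecs (g^[l * j] x)))) := by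
    intro m
    induction m with
    | zero => simp
    | succ m ih =>
      rw [Finset.sum_range_succ, Finset.prod_range_succ, ih, ENNReal.ofReal_mul
        (Finset.prod_nonneg fun _ _ => restrictNorm_nonneg _ _ _ _), ENNReal.log_mul_add]
      congr 2
      exact (ofReal_norm _).symm
  rw [h2, EReal.div_lt_iff (by exact_mod_cast hn') (by exact EReal.natCast_ne_top n)] at h1
  have h3 : (-1 : EReal) * (n : EReal) = ENNReal.log (ENNReal.ofReal (Real.exp (-n))) := by
    rw [ENNReal.log_ofReal_of_pos (Real.exp_pos _), Real.log_exp]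
    norm_cast
    simp
  rw [h3, ENNReal.log_lt_log_iff, ENNReal.ofReal_lt_ofReal_iff (Real.exp_pos _)] at h1
  exact h1

theorem norm_mfderiv_iterate_mul_le (hS : ∀ x ∈ S, g x ∈ S)
    (hmap : ∀ x ∈ S, (Ecs x).map (mfderiv (𝓡 d) (𝓡 d) g x).toLinearMap = Ecs (g x)) (l : ℕ) {x : M}
    (hx : x ∈ S) (q : ℕ) {v : TangentSpace (𝓡 d) x} (hv : v ∈ Ecs x) :
    ‖mfderiv (𝓡 d) (𝓡 d) g^[l * q] x v‖ ≤
      (∏ j ∈ Finset.range q, restrictNorm g l (g^[l * j] x) (Ecs (g^[l * j] x))) * ‖v‖ := by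
  have key : ∀ q, ‖((tangentCMap g)^[l * q] ⟨x, v⟩).snd‖ ≤
      (∏ j ∈ Finset.range q, restrictNorm g l (g^[l * j] x) (Ecs (g^[l * j] x))) * ‖v‖ := by
    intro q
    induction q with
    | zero => rw [Finset.prod_range_zero, one_mul]; exact le_rfl
    | succ q ih =>
      have h1 : (tangentCMap g)^[l * (q + 1)] (⟨x, v⟩ : TangentBundle (𝓡 d) M) =
          (tangentCMap g)^[l] ⟨g^[l * q] x, mfderiv (𝓡 d) (𝓡 d) g^[l * q] x v⟩ := by
        rw [← tangentCMap_iterate g (l * q) x v, ← Function.iterate_add_apply]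
        congr 2; ring
      have h2 := norm_le_restrictNorm g l (iterate_mem_of_map hS hmap hx (l * q) hv)
      have h3 := congrArg (fun p : TangentBundle (𝓡 d) M => ‖p.snd‖)
        (tangentCMap_iterate g (l * q) x v)
      have h4 := congrArg (fun p : TangentBundle (𝓡 d) M => ‖p.snd‖)
        (h1.trans (tangentCMap_iterate g l (g^[l * q] x) _))
      refine h4.trans_le (h2.trans ?_)
      rw [Finset.prod_range_succ, mul_comm _ (restrictNorm _ _ _ _), mul_assoc]
      exact mul_le_mul_of_nonneg_left (h3.symm.trans_le ih) (restrictNorm_nonneg _ _ _ _)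
  have h3 := congrArg (fun p : TangentBundle (𝓡 d) M => ‖p.snd‖) (tangentCMap_iterate g (l * q) x v)
  exact h3.symm.trans_le (key q)

/-- The rates of contraction along the orbit of a point of a stable block. -/
theorem AdaptedSplitting.exists_rates (H : AdaptedSplitting g S U Ecu Ecs Ca C n₀) {l q : ℕ}
    (hq : 1 ≤ q) (hN : n₀ ≤ l * q) {c₀ : ℝ} (hc₀ : 0 < c₀) (hc₀1 : c₀ ≤ 1 / 3)
    (hlow : ∀ (x : M) (v : TangentSpace (𝓡 d) x),
      2 * c₀ * ‖v‖ ≤ ‖mfderiv (𝓡 d) (𝓡 d) g^[l * q] x v‖) {x : M}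
    (hx : x ∈ stableBlock g S Ecs l) :
    ∃ b : ℕ → ℝ, (∀ k, c₀ ≤ b k) ∧ (∀ k, weight b k ≤ (1 / 2) ^ k) ∧
      (∀ k, ∀ v ∈ Ecs (g^[l * q * k] x),
        ‖mfderiv (𝓡 d) (𝓡 d) g^[l * q] (g^[l * q * k] x) v‖ ≤ b k * ‖v‖) ∧
      ∀ k, ∀ w ∈ Ecu (g^[l * q * k] x),
        19 / 10 * b k * ‖w‖ ≤ ‖mfderiv (𝓡 d) (𝓡 d) g^[l * q] (g^[l * q * k] x) w‖ := by
  have hS : ∀ n, g^[n] x ∈ S := iterate_mem_of_forall H.mem hx.1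
  set β : ℕ → ℝ := fun k => restrictNorm g (l * q) (g^[l * q * k] x) (Ecs (g^[l * q * k] x)) with hβ
  set a : ℕ → ℝ := fun j => restrictNorm g l (g^[l * j] x) (Ecs (g^[l * j] x)) with ha
  have ha0 : ∀ j, 0 ≤ a j := fun j => restrictNorm_nonneg _ _ _ _
  have hβa : ∀ k, β k ≤ ∏ j ∈ Finset.range q, a (q * k + j) := by
    intro k
    refine ContinuousLinearMap.opNorm_le_bound _ (Finset.prod_nonneg fun j _ => ha0 _) fun v => ?_
    have h1 := norm_mfderiv_iterate_mul_le H.mem H.map_cs l (hS (l * q * k)) q v.2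
    refine h1.trans_eq ?_
    congr 1
    refine Finset.prod_congr rfl fun j _ => ?_
    have e : g^[l * j] (g^[l * q * k] x) = g^[l * (q * k + j)] x := by
      rw [← Function.iterate_add_apply]; congr 2; ring
    rw [e]
  have hprodβ : ∀ k, ∏ i ∈ Finset.range k, β i ≤ ∏ j ∈ Finset.range (q * k), a j := by
    intro k
    induction k with
    | zero => simp
    | succ k ih =>
      rw [Finset.prod_range_succ, mul_add, mul_one, Finset.prod_range_add]
      exact mul_le_mul ih (hβa k) (restrictNorm_nonneg _ _ _ _)
        (Finset.prod_nonneg fun j _ => ha0 _)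
  have hprodβ' : ∀ k : ℕ, ∏ i ∈ Finset.range k, β i ≤ (3 / 8 : ℝ) ^ k := by
    intro k
    rcases Nat.eq_zero_or_pos k with rfl | hk
    · simp
    have h1 := prod_restrictNorm_lt hx (n := q * k) (Nat.mul_pos hq hk)
    have h2 : Real.exp (-((q * k : ℕ) : ℝ)) ≤ Real.exp (-(k : ℝ)) := by
      refine Real.exp_le_exp.2 (neg_le_neg ?_)
      exact_mod_cast Nat.le_mul_of_pos_left k hq
    have h3 : Real.exp (-(k : ℝ)) = (Real.exp (-1)) ^ k := by
      rw [← Real.exp_nat_mul]; simp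
    -- The value 3/8 is what compensates the factor 4/3 in the weights: (4/3)(3/8) = 1/2.
    have h4 : Real.exp (-1) ≤ 3 / 8 := by
      have := Real.exp_one_gt_d9
      rw [Real.exp_neg, inv_le_comm₀ (Real.exp_pos _) (by norm_num)]
      linarith
    refine (hprodβ k).trans (h1.le.trans (h2.trans ?_))
    rw [h3]
    exact pow_le_pow_left₀ (Real.exp_pos _).le h4 k
  have hweight : ∀ b : ℕ → ℝ, ∀ k, ∏ i ∈ Finset.range k, b i ≤ (3 / 8 : ℝ) ^ k →
      weight b k ≤ (1 / 2) ^ k := by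
    intro b k hb
    rw [weight, Finset.prod_mul_distrib, Finset.prod_const, Finset.card_range]
    calc (4 / 3 : ℝ) ^ k * ∏ i ∈ Finset.range k, b i ≤ (4 / 3 : ℝ) ^ k * (3 / 8) ^ k :=
          mul_le_mul_of_nonneg_left hb (by positivity)
      _ = (1 / 2) ^ k := by rw [← mul_pow]; norm_num
  -- The maximum matters only when `Ecs` is zero, where β vanishes and rates c₀ ≤ 1/3 < 3/8 are
  -- harmless. Otherwise the lower bound on Dg^N already gives β k ≥ 2c₀, and the product estimate
  -- for β applies.
  refine ⟨fun k => max (β k) c₀, fun k => le_max_right _ _, fun k => hweight _ k ?_,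
    fun k v hv => ?_, fun k w hw => ?_⟩
  · by_cases hbot : Module.finrank ℝ (Ecs x) = 0
    · have h1 : ∀ i, max (β i) c₀ = c₀ := fun i => max_eq_right (by
        refine (ContinuousLinearMap.opNorm_le_bound _ le_rfl fun v => ?_).trans hc₀.le
        have h2 := finrank_iterate_of_map H.mem H.map_cs hx.1 (l * q * i)
        rw [hbot, Submodule.finrank_eq_zero] at h2
        have h3 : v = 0 := Subtype.ext ((Submodule.mem_bot ℝ).1 (h2.le v.2))
        rw [h3, map_zero, norm_zero, zero_mul])
      simp only [h1, Finset.prod_const, Finset.card_range]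
      exact pow_le_pow_left₀ hc₀.le (hc₀1.trans (by norm_num)) k
    · have h1 : ∀ i, max (β i) c₀ = β i := fun i => max_eq_left (by
        have h2 := finrank_iterate_of_map H.mem H.map_cs hx.1 (l * q * i)
        have h3 : Ecs (g^[l * q * i] x) ≠ ⊥ := fun h => hbot (by rw [← h2, h, finrank_bot])
        obtain ⟨v, hv, hv0⟩ := Submodule.exists_mem_ne_zero_of_ne_bot h3
        have h4 := norm_pos_iff.2 hv0
        have h5 := (hlow _ v).trans (norm_le_restrictNorm g (l * q) hv)
        have h6 := le_of_mul_le_mul_right h5 h4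
        exact (by linarith : c₀ ≤ 2 * c₀).trans h6)
      simp only [h1]
      exact hprodβ' k
  · exact (norm_le_restrictNorm g (l * q) hv).trans
      (mul_le_mul_of_nonneg_right (le_max_left _ _) (norm_nonneg _))
  · rcases eq_or_ne w 0 with rfl | hw0
    · simp
    have hwp := norm_pos_iff.2 hw0
    have h1 : β k ≤ 10 / 19 * ‖mfderiv (𝓡 d) (𝓡 d) g^[l * q] (g^[l * q * k] x) w‖ / ‖w‖ := by
      refine ContinuousLinearMap.opNorm_le_bound _ (by positivity) fun v => ?_
      have h2 := H.dom _ hN _ (hS (l * q * k)) v v.2 w hw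
      change ‖mfderiv (𝓡 d) (𝓡 d) g^[l * q] (g^[l * q * k] x) (v : TangentSpace (𝓡 d) _)‖ ≤ _
      rw [div_mul_eq_mul_div, le_div_iff₀ hwp]
      have e : ‖v‖ = ‖(v : TangentSpace (𝓡 d) (g^[l * q * k] x))‖ := rfl
      rw [e]
      linarith
    rw [le_div_iff₀ hwp] at h1
    have h2 := hlow _ w
    change 19 / 10 * max (β k) c₀ * ‖w‖ ≤ _
    -- For the rate β k this is domination; for the rate c₀ it is the lower bound 2c₀ on Dg^N, since
    -- 19/10 < 2.
    rcases max_choice (β k) c₀ with h | h <;> rw [h] <;> nlinarith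

end Rates

/-- The orbit of `x` under `T`. -/
def orbitSeq {M : Type*} (T : M → M) (x : M) : ℕ → M
  | 0 => x
  | k + 1 => T (orbitSeq T x k)

/-- With `orbitSeq` the point at time k+1 is definitionally the image of the one at time k, so the
tangent maps along the orbit compose without casts; `Nat.iterate` unfolds at the other end. -/
theorem orbitSeq_iterate {M : Type*} (g : M → M) (N : ℕ) (x : M) (k : ℕ) :
    orbitSeq g^[N] x k = g^[N * k] x := by
  induction k with
  | zero => rfl
  | succ k ih => rw [orbitSeq, ih, ← Function.iterate_add_apply, Nat.mul_succ, add_comm]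

/-! ### The stable graph along an orbit, in coordinates -/

section OrbitGraph

variable {d : ℕ} {M : Type*} [MetricSpace M] [CompactSpace M]
  [ChartedSpace (EuclideanSpace ℝ (Fin d)) M] [IsManifold (𝓡 d) ∞ M]
  [RiemannianBundle (fun x : M => TangentSpace (𝓡 d) x)]
  [IsContMDiffRiemannianBundle (𝓡 d) ∞ (EuclideanSpace ℝ (Fin d))
      (fun x : M => TangentSpace (𝓡 d) x)]

namespace ParamAtlas

theorem ctr_source (A : ParamAtlas d M) (x : M) :
    x ∈ (chartAt (EuclideanSpace ℝ (Fin d)) (A.ctr x)).source :=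
  (A.family false _ (A.ctr_mem x)).subset (A.mem_W x)

theorem exists_norm_bound (A : ParamAtlas d M) : ∃ K ≥ 1, ∀ x : M,
    (∀ v : TangentSpace (𝓡 d) x, ‖chartD (A.ctr x) x v‖ ≤ K * ‖v‖) ∧
    ∀ h : EuclideanSpace ℝ (Fin d), ‖chartDInv (A.ctr x) x h‖ ≤ K * ‖h‖ := by
  have h : ∀ᶠ K : ℝ in atTop, ∀ c ∈ A.centers, (∀ x ∈ A.W c, ∀ v : TangentSpace (𝓡 d) x,
      ‖chartD c x v‖ ≤ K * ‖v‖) ∧ ∀ x ∈ A.W c, ∀ h : EuclideanSpace ℝ (Fin d),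
      ‖chartDInv c x h‖ ≤ K * ‖h‖ :=
    (Filter.eventually_all_finset _).2 fun c hc =>
      (A.family false c hc).eventually_norm_chartD_le.and
        (A.family false c hc).eventually_norm_chartDInv_le
  obtain ⟨K, h1, h2⟩ := (h.and (eventually_ge_atTop 1)).exists
  exact ⟨K, h2, fun x => ⟨(h1 _ (A.ctr_mem x)).1 x (A.mem_W x), (h1 _ (A.ctr_mem x)).2 x (A.mem_W x)⟩⟩

/-- At the scale `ρ`, the map `g ^ N` is `η`-close to its linear part in the parametrizations. -/
def GoodScale (A : ParamAtlas d M) (g : M ≃ₘ^1⟮𝓡 d, 𝓡 d⟯ M) (N : ℕ) (η ρ : ℝ) : Prop :=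
  ∀ b, ∀ c ∈ A.centers, ∀ c' ∈ A.centers, ∀ x ∈ A.W c, g^[N] x ∈ A.W c' → ∀ p, ‖p‖ ≤ ρ →
    (extChartAt (𝓡 d) c x, p) ∈ A.O b c ∧
    g^[N] (famPoint c (A.ε b c) x p) ∈ (chartAt (EuclideanSpace ℝ (Fin d)) c').source ∧
    ‖coordDeriv g N c c' (A.ε b c) x p - coordDeriv g N c c' (A.ε b c) x 0‖ ≤ η

theorem eventually_goodScale (A : ParamAtlas d M) (f : M ≃ₘ^1⟮𝓡 d, 𝓡 d⟯ M) (N : ℕ) {η : ℝ}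
    (hη : 0 < η) : ∀ᶠ q : ℝ × (M ≃ₘ^1⟮𝓡 d, 𝓡 d⟯ M) in 𝓝[>] 0 ×ˢ c1Nhds f,
      A.GoodScale q.2 N η q.1 := by
  refine eventually_all.2 fun b => (Filter.eventually_all_finset _).2 fun c hc =>
    (Filter.eventually_all_finset _).2 fun c' hc' => ?_
  exact (A.family b c hc).eventually_coordDeriv_close f N (A.family b c' hc').isCompact
    (A.family b c' hc').subset hη

theorem exists_equicontinuous (A : ParamAtlas d M) {g : M ≃ₘ^1⟮𝓡 d, 𝓡 d⟯ M} {N : ℕ} {η₀ ρ η : ℝ}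
    (hg : A.GoodScale g N η₀ ρ) (hη : 0 < η) :
    ∃ δ > 0, ∀ b, ∀ c ∈ A.centers, ∀ c' ∈ A.centers, ∀ x ∈ A.W c, g^[N] x ∈ A.W c' →
      ∀ p p', ‖p‖ ≤ ρ → ‖p'‖ ≤ ρ → ‖p - p'‖ ≤ δ →
      ‖coordDeriv g N c c' (A.ε b c) x p - coordDeriv g N c c' (A.ε b c) x p'‖ ≤ η := by
  have h : ∀ᶠ δ : ℝ in 𝓝[>] 0, ∀ b, ∀ c ∈ A.centers, ∀ c' ∈ A.centers, ∀ x ∈ A.W c,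
      g^[N] x ∈ A.W c' → ∀ p p', ‖p‖ ≤ ρ → ‖p'‖ ≤ ρ → ‖p - p'‖ ≤ δ →
      ‖coordDeriv g N c c' (A.ε b c) x p - coordDeriv g N c c' (A.ε b c) x p'‖ ≤ η := by
    refine eventually_all.2 fun b => (Filter.eventually_all_finset _).2 fun c hc =>
      (Filter.eventually_all_finset _).2 fun c' hc' => ?_
    exact (A.family b c hc).eventually_equicontinuous g N (A.family b c' hc').isCompact
      (fun x hx hx' p hp => ⟨(hg b c hc c' hc' x hx hx' p hp).1,
        (hg b c hc c' hc' x hx hx' p hp).2.1⟩) hη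
  obtain ⟨δ, h1, h2⟩ := (h.and self_mem_nhdsWithin).exists
  exact ⟨δ, h2, h1⟩

end ParamAtlas

variable {X Y : Type*} [NormedAddCommGroup X] [InnerProductSpace ℝ X] [FiniteDimensional ℝ X]
  [NormedAddCommGroup Y] [InnerProductSpace ℝ Y] [FiniteDimensional ℝ Y]

/-- The type of parametrization at the time `k`: exponential at time `0`, translations later. -/
def startFlag : ℕ → Bool
  | 0 => true
  | _ + 1 => false

open Metric in
-- Read in frames along the orbit, g^N becomes a sequence of maps fixing 0 with block diagonal
-- derivative there and uniformly small nonlinear part, to which the weighted graph theorem applies.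
-- The decay of the weights is the decay of the coordinates p k.
theorem AdaptedSplitting.exists_orbit_graph {g : M ≃ₘ^1⟮𝓡 d, 𝓡 d⟯ M} {S U : Set M}
    {Ecu Ecs : ∀ x : M, Submodule ℝ (TangentSpace (𝓡 d) x)}
    {Ca : ∀ x : M, Set (TangentSpace (𝓡 d) x)} {C : ℝ} {n₀ : ℕ}
    (H : AdaptedSplitting g S U Ecu Ecs Ca C n₀) (A : ParamAtlas d M) {l q : ℕ}
    (hq : 1 ≤ q) (hN : n₀ ≤ l * q) {c₀ c₂ η ρ ρ' K : ℝ} (hc₀ : 0 < c₀) (hc₀1 : c₀ ≤ 1 / 3)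
    (hlow : ∀ (x : M) (v : TangentSpace (𝓡 d) x),
      2 * c₀ * ‖v‖ ≤ ‖mfderiv (𝓡 d) (𝓡 d) g^[l * q] x v‖)
    (hc₂0 : 0 ≤ c₂) (hc₂ : c₂ ≤ 1 / 20) (hC : 0 ≤ C) (hK1 : 1 ≤ K)
    (hK : ∀ x : M, (∀ v : TangentSpace (𝓡 d) x, ‖chartD (A.ctr x) x v‖ ≤ K * ‖v‖) ∧
      ∀ h : EuclideanSpace ℝ (Fin d), ‖chartDInv (A.ctr x) x h‖ ≤ K * ‖h‖)
    (hgood : A.GoodScale g (l * q) η ρ') (hρ : 0 < ρ) (hρ' : 2 * K * ρ ≤ ρ')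
    (hη : C * K * η * (2 * K) ≤ c₀ * c₂) {x : M} (hx : x ∈ stableBlock g S Ecs l)
    (iX : X →ₗ[ℝ] TangentSpace (𝓡 d) x) (iY : Y →ₗ[ℝ] TangentSpace (𝓡 d) x)
    (hX : ∀ a, ‖iX a‖ = ‖a‖) (hY : ∀ b, ‖iY b‖ = ‖b‖) (hXm : ∀ a, iX a ∈ Ecs x)
    (hYm : ∀ b, iY b ∈ Ecu x) (hXd : Module.finrank ℝ X = Module.finrank ℝ (Ecs x))
    (hYd : Module.finrank ℝ Y = Module.finrank ℝ (Ecu x)) :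
    ∃ φ : X → Y, φ 0 = 0 ∧ ContDiffOn ℝ 1 φ (ball 0 (ρ / 5)) ∧ fderiv ℝ φ 0 = 0 ∧
      ∀ v ∈ ball (0 : X) (ρ / 5), ‖fderiv ℝ φ v‖ ≤ 20 * c₂ ∧
        ∃ p : ℕ → EuclideanSpace ℝ (Fin d),
          p 0 = chartD (A.ctr x) x (iX v + iY (φ v)) ∧
          (∀ k, ‖p k‖ ≤ 2 * K * ρ * (1 / 2) ^ k) ∧
          ∀ k, famPoint (A.ctr (orbitSeq g^[l * q] x k)) (A.ε (startFlag k)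
              (A.ctr (orbitSeq g^[l * q] x k))) (orbitSeq g^[l * q] x k) (p k) =
            orbitSeq g^[l * q] (famPoint (A.ctr x) (A.ε true (A.ctr x)) x (p 0)) k := by
  obtain ⟨b, hb1, hb2, hb3, hb4⟩ := H.exists_rates hq hN hc₀ hc₀1 hlow hx
  set N := l * q with hNdef
  set y : ℕ → M := orbitSeq g^[N] x with hy
  have hyit : ∀ k, y k = g^[N * k] x := orbitSeq_iterate g N x
  have hy1 : ∀ k, g^[N] (y k) = y (k + 1) := fun k => rfl
  have hyS : ∀ k, y k ∈ S := fun k => by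
    rw [hyit]; exact iterate_mem_of_forall H.mem hx.1 _
  have hbs : ∀ k, ∀ v ∈ Ecs (y k), ‖mfderiv (𝓡 d) (𝓡 d) g^[N] (y k) v‖ ≤ b k * ‖v‖ := fun k => by
    rw [hyit]; exact hb3 k
  have hbu : ∀ k, ∀ w ∈ Ecu (y k), 19 / 10 * b k * ‖w‖ ≤ ‖mfderiv (𝓡 d) (𝓡 d) g^[N] (y k) w‖ :=
    fun k => by rw [hyit]; exact hb4 k
  have hbp : ∀ k, 0 < b k := fun k => hc₀.trans_le (hb1 k)
  have hK0 : 0 ≤ K := zero_le_one.trans hK1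
  have hdim : Module.finrank ℝ X + Module.finrank ℝ Y = d := by
    rw [hXd, hYd]
    exact finrank_add_finrank (H.isCompl x hx.1)
  -- The model factors X and Y serve all times because the dimensions are constant along the orbit;
  -- only the frame at time 0 is prescribed.
  have hfr : ∀ k, ∃ J : (X × Y) ≃L[ℝ] EuclideanSpace ℝ (Fin d),
      IsFrame (A.ctr (y k)) (y k) (Ecs (y k)) (Ecu (y k)) J ∧
      (k = 0 → ∀ z, J z = chartD (A.ctr x) x (iX z.1 + iY z.2)) := by
    intro k
    cases k with
    | zero =>
      obtain ⟨J, h1, h2⟩ := exists_frame_of_isometries (A.ctr_source x)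
        (H.isCompl x hx.1).disjoint.symm hdim iX iY hX hY hXm hYm
      exact ⟨J, h1, fun _ => h2⟩
    | succ k =>
      obtain ⟨J, h1⟩ := exists_frame (X := X) (Y := Y) (A.ctr_source (y (k + 1)))
        (H.isCompl _ (hyS (k + 1)))
        (by rw [hXd, hyit, finrank_iterate_of_map H.mem H.map_cs hx.1])
        (by rw [hYd, hyit, finrank_iterate_of_map H.mem H.map_cu hx.1])
      exact ⟨J, h1, fun h => absurd h (Nat.succ_ne_zero k)⟩
  choose J hJ hJ0 using hfr
  set c : ℕ → M := fun k => A.ctr (y k) with hc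
  have hcI : ∀ k, c k ∈ A.centers := fun k => A.ctr_mem _
  have hcW : ∀ k, y k ∈ A.W (c k) := fun k => A.mem_W _
  have hcs : ∀ k, y k ∈ (chartAt (EuclideanSpace ℝ (Fin d)) (c k)).source := fun k =>
    A.ctr_source _
  set e : ℕ → EuclideanSpace ℝ (Fin d) × EuclideanSpace ℝ (Fin d) → EuclideanSpace ℝ (Fin d) :=
    fun k => A.ε (startFlag k) (c k) with he
  have hfam : ∀ k, ChartFamily (c k) (A.W (c k)) (e k) (A.O (startFlag k) (c k)) := fun k =>
    A.family _ _ (hcI k)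
  have hgd : ∀ k p, ‖p‖ ≤ ρ' → _ := fun k p hp =>
    hgood (startFlag k) (c k) (hcI k) (c (k + 1)) (hcI (k + 1)) (y k) (hcW k) (hcW (k + 1)) p hp
  have hJle : ∀ k z, ‖J k z‖ ≤ 2 * K * ‖z‖ := fun k z =>
    (hJ k).norm_le (hcs k) hK0 (hK (y k)).1 z
  have hJρ : ∀ k z, ‖z‖ < ρ → ‖J k z‖ ≤ ρ' := fun k z hz =>
    (hJle k z).trans ((mul_le_mul_of_nonneg_left hz.le (by positivity)).trans hρ')
  have hJs : ∀ k h, ‖(J k).symm h‖ ≤ C * K * ‖h‖ := fun k h => by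
    have := (hJ k).norm_le_mul hC (H.angle _ (hyS k)) (hK (y k)).2 ((J k).symm h)
    rwa [(J k).apply_symm_apply] at this
  set G : ℕ → X × Y → X × Y := fun k z => (J (k + 1)).symm
    (extChartAt (𝓡 d) (c (k + 1)) (g^[N] (famPoint (c k) (e k) (y k) (J k z))) -
      extChartAt (𝓡 d) (c (k + 1)) (y (k + 1))) with hG
  set DG : ℕ → X × Y → (X × Y →L[ℝ] X × Y) := fun k z =>
    ((J (k + 1)).symm : EuclideanSpace ℝ (Fin d) →L[ℝ] X × Y).comp
      ((coordDeriv g N (c k) (c (k + 1)) (e k) (y k) (J k z)).comp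
        (J k : X × Y →L[ℝ] EuclideanSpace ℝ (Fin d))) with hDG
  have hDGsub : ∀ k z z' η', ‖coordDeriv g N (c k) (c (k + 1)) (e k) (y k) (J k z) -
      coordDeriv g N (c k) (c (k + 1)) (e k) (y k) (J k z')‖ ≤ η' →
      ‖DG k z - DG k z'‖ ≤ C * K * η' * (2 * K) := by
    intro k z z' η' hη'
    have hη0 : 0 ≤ η' := (norm_nonneg _).trans hη'
    refine ContinuousLinearMap.opNorm_le_bound _ (by positivity) fun h => ?_
    have e1 : (DG k z - DG k z') h = (J (k + 1)).symm
        ((coordDeriv g N (c k) (c (k + 1)) (e k) (y k) (J k z) -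
          coordDeriv g N (c k) (c (k + 1)) (e k) (y k) (J k z')) (J k h)) := by
      simp [hDG]
    rw [e1]
    calc _ ≤ C * K * (η' * (2 * K * ‖h‖)) := (hJs _ _).trans (mul_le_mul_of_nonneg_left
          ((ContinuousLinearMap.le_of_opNorm_le _ hη' _).trans
            (mul_le_mul_of_nonneg_left (hJle k h) hη0)) (by positivity))
      _ = C * K * η' * (2 * K) * ‖h‖ := by ring
  have hblock : ∀ k, (∀ z, ‖(DG k 0 z).1‖ ≤ b k * ‖z‖) ∧
      ∃ D : Y ≃L[ℝ] Y, (∀ z, (DG k 0 z).2 = D z.2) ∧ ∀ w, 19 / 10 * b k * ‖D.symm w‖ ≤ ‖w‖ := by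
    intro k
    refine (hJ k).block (hJ (k + 1)) (hcs (k + 1)) (H.isCompl _ (hyS (k + 1))).disjoint.symm
      (T := fun v => mfderiv (𝓡 d) (𝓡 d) g^[N] (y k) v) (fun z => ?_)
      (fun v hv => iterate_mem_of_map H.mem H.map_cs (hyS k) N hv)
      (fun v hv => iterate_mem_of_map H.mem H.map_cu (hyS k) N hv)
      (hbp k).le (by have := hbp k; positivity) (hbs k) (hbu k)
    have h1 := (hfam k).coordDeriv_zero (c' := c (k + 1)) g N (hcW k) (J k z)
    change (J (k + 1)).symm (coordDeriv g N (c k) (c (k + 1)) (e k) (y k) (J k 0) (J k z)) = _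
    rw [map_zero, h1]
    rfl
  choose hblock1 D hD1 hD2 using hblock
  have hw1 : ∀ k, weight b k ≤ 1 := fun k =>
    (hb2 k).trans (pow_le_one₀ (by norm_num) (by norm_num))
  obtain ⟨φ, z, r1, r2, r3, r4⟩ := exists_weighted_stable_graph (G := G) (DG := DG) (D := D)
    (b := b) hρ hc₀ hc₂0 hc₂ hb1 hw1
    (fun k => by
      simp only [hG, map_zero, (hfam k).famPoint_zero (hcW k), hy1, sub_self])
    (fun k z hz => by
      have h1 := hgd k (J k z) (hJρ k z hz)
      have h2 := (hfam k).hasFDerivAt_coord g N h1.1 h1.2.1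
      have h3 := (h2.comp z (J k).hasFDerivAt).sub_const
        (extChartAt (𝓡 d) (c (k + 1)) (y (k + 1)))
      exact (J (k + 1)).symm.hasFDerivAt.comp z h3)
    (fun η' hη' => by
      -- The added 1 keeps the denominator positive when C = 0.
      have hCK : 0 < C * K * (2 * K) + 1 := by positivity
      obtain ⟨δ, hδ, hδ'⟩ := A.exists_equicontinuous hgood
        (η := η' / (C * K * (2 * K) + 1)) (by positivity)
      refine ⟨δ / (2 * K), by positivity, fun k z z' hz hz' hzz => ?_⟩
      refine (hDGsub k z z' _ (hδ' (startFlag k) (c k) (hcI k) (c (k + 1)) (hcI (k + 1)) (y k)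
        (hcW k) (hcW (k + 1)) _ _ (hJρ k z hz) (hJρ k z' hz') ?_)).trans ?_
      · rw [← map_sub]
        refine (hJle k _).trans ?_
        rw [lt_div_iff₀ (by positivity)] at hzz
        linarith
      · have e1 : C * K * (η' / (C * K * (2 * K) + 1)) * (2 * K) =
            η' * (C * K * (2 * K) / (C * K * (2 * K) + 1)) := by ring
        rw [e1]
        exact mul_le_of_le_one_right hη'.le ((div_le_one hCK).2 (by linarith)))
    hblock1 hD2
    (fun k z hz => by
      refine (hDGsub k z 0 η ?_).trans hη
      rw [map_zero]
      exact (hgd k (J k z) (hJρ k z hz)).2.2)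
    hD1
  refine ⟨φ, r1, r2, r3, fun v hv => ?_⟩
  obtain ⟨s1, s2, s3, s4⟩ := r4 v hv
  refine ⟨s4, fun k => J k (z v k), ?_, fun k => ?_, fun k => ?_⟩
  · change J 0 (z v 0) = _
    rw [hJ0 0 rfl, s1]
  · calc ‖J k (z v k)‖ ≤ 2 * K * ‖z v k‖ := hJle k _
      _ ≤ 2 * K * ((1 / 2) ^ k * ρ) := by
        refine mul_le_mul_of_nonneg_left ((s3 k).le.trans ?_) (by positivity)
        exact mul_le_mul_of_nonneg_right (hb2 k) hρ.le
      _ = 2 * K * ρ * (1 / 2) ^ k := by ring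
  · induction k with
    | zero => rfl
    | succ k ih =>
      have hz : ‖z v k‖ < ρ := (s3 k).trans_le (mul_le_of_le_one_left hρ.le (hw1 k))
      have h1 := hgd k (J k (z v k)) (hJρ k _ hz)
      change famPoint (c (k + 1)) (A.ε false (c (k + 1))) (y (k + 1)) (J (k + 1) (z v (k + 1))) =
        g^[N] (orbitSeq g^[N] _ k)
      rw [← ih, s2]
      change (extChartAt (𝓡 d) (c (k + 1))).symm (A.ε false (c (k + 1))
        (extChartAt (𝓡 d) (c (k + 1)) (y (k + 1)), J (k + 1) ((J (k + 1)).symm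
    (extChartAt (𝓡 d) (c (k + 1)) (g^[N] (famPoint (c k) (e k) (y k) (J k (z v k)))) -
      extChartAt (𝓡 d) (c (k + 1)) (y (k + 1)))))) = _
      -- At positive times the parametrization is a translation, so subtracting the chart value of
      -- the orbit point and adding it back returns the image under g^N exactly.
      rw [A.ε_false, (J (k + 1)).apply_symm_apply, add_sub_cancel,
        (extChartAt (𝓡 d) (c (k + 1))).left_inv (mem_extChartAt_source_iff.2 h1.2.1)]

end OrbitGraph

/-! ### From a graph to an embedded disk tangent to the cones -/

section GraphDisk

variable {d : ℕ} {M : Type*} [MetricSpace M] [CompactSpace M]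
  [ChartedSpace (EuclideanSpace ℝ (Fin d)) M] [IsManifold (𝓡 d) ∞ M]
  [RiemannianBundle (fun x : M => TangentSpace (𝓡 d) x)]
  [IsContMDiffRiemannianBundle (𝓡 d) ∞ (EuclideanSpace ℝ (Fin d))
      (fun x : M => TangentSpace (𝓡 d) x)]
  {c : M} {W : Set M}
  {ε : EuclideanSpace ℝ (Fin d) × EuclideanSpace ℝ (Fin d) → EuclideanSpace ℝ (Fin d)}
  {O : Set (EuclideanSpace ℝ (Fin d) × EuclideanSpace ℝ (Fin d))}

/-- A map that is antilipschitz in a chart is an embedding. -/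
theorem isEmbedding_of_chart {X : Type*} [PseudoMetricSpace X] {S : Set X} {ψ : X → M}
    (hψ : ContinuousOn ψ S) {K : ℝ} {c : M}
    (hsrc : ∀ v ∈ S, ψ v ∈ (chartAt (EuclideanSpace ℝ (Fin d)) c).source)
    (hanti : ∀ v ∈ S, ∀ v' ∈ S,
      dist v v' ≤ K * ‖extChartAt (𝓡 d) c (ψ v) - extChartAt (𝓡 d) c (ψ v')‖)
    (hinj : InjOn ψ S) : IsEmbedding (S.domRestrict ψ) := by
  refine ⟨isInducing_iff_nhds.2 fun v => le_antisymm ?_ ?_, injOn_iff_injective.1 hinj⟩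
  · exact (continuousOn_iff_continuous_domRestrict.1 hψ).continuousAt.le_comap
  · have h1 : Tendsto (fun v' : S => K * ‖extChartAt (𝓡 d) c (ψ v') - extChartAt (𝓡 d) c (ψ v)‖)
        (comap (S.domRestrict ψ) (𝓝 (S.domRestrict ψ v))) (𝓝 0) := by
      have h2 : Tendsto (fun v' : S => extChartAt (𝓡 d) c (ψ v'))
          (comap (S.domRestrict ψ) (𝓝 (S.domRestrict ψ v))) (𝓝 (extChartAt (𝓡 d) c (ψ v))) :=
        (continuousAt_extChartAt' (I := 𝓡 d)
          (mem_extChartAt_source_iff.2 (hsrc v v.2))).tendsto.comp tendsto_comap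
      simpa using ((h2.sub_const (extChartAt (𝓡 d) c (ψ v))).norm).const_mul K
    refine tendsto_id'.1 (tendsto_iff_dist_tendsto_zero.2 (squeeze_zero (fun _ => dist_nonneg)
      (fun v' => hanti v' v'.2 v v.2) h1))

theorem coordDeriv_zero_iterate (g : M ≃ₘ^1⟮𝓡 d, 𝓡 d⟯ M) (x : M)
    (p h : EuclideanSpace ℝ (Fin d)) :
    coordDeriv g 0 c c ε x p h = chartD c (famPoint c ε x p) (famDeriv c ε x p h) :=
  coordDeriv_apply g 0 x p h

/-- With zero iterates, `coordDeriv` is the derivative of the parametrization read in its own chart,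
which is the identity at p = 0. The estimate measures how far exponential coordinates are from
translations. -/
theorem ChartFamily.norm_coordDeriv_sub_le (hF : ChartFamily c W ε O) {x : M} (hx : x ∈ W)
    {g : M ≃ₘ^1⟮𝓡 d, 𝓡 d⟯ M} {p : EuclideanSpace ℝ (Fin d)} {η : ℝ}
    (hη : ‖coordDeriv g 0 c c ε x p - coordDeriv g 0 c c ε x 0‖ ≤ η)
    (h : EuclideanSpace ℝ (Fin d)) : ‖coordDeriv g 0 c c ε x p h - h‖ ≤ η * ‖h‖ := by
  have h1 : coordDeriv g 0 c c ε x 0 h = h := by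
    rw [hF.coordDeriv_zero g 0 hx h]
    change chartD c x (mfderiv (𝓡 d) (𝓡 d) id x (chartDInv c x h)) = h
    rw [mfderiv_id]
    exact chartD_chartDInv (hF.subset hx) h
  have h2 := ContinuousLinearMap.le_of_opNorm_le _ hη h
  rwa [sub_apply, h1] at h2

open Metric in
-- Mean value inequality for the parametrization minus the identity, whose derivative is at most η
-- on the ball.
theorem ChartFamily.norm_extChartAt_famPoint_sub (hF : ChartFamily c W ε O) {x : M} (hx : x ∈ W)
    {g : M ≃ₘ^1⟮𝓡 d, 𝓡 d⟯ M} {ρ η : ℝ}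
    (hgood : ∀ p, ‖p‖ ≤ ρ → (extChartAt (𝓡 d) c x, p) ∈ O ∧
      ‖coordDeriv g 0 c c ε x p - coordDeriv g 0 c c ε x 0‖ ≤ η)
    {p p' : EuclideanSpace ℝ (Fin d)} (hp : ‖p‖ ≤ ρ) (hp' : ‖p'‖ ≤ ρ) :
    ‖extChartAt (𝓡 d) c (famPoint c ε x p) - extChartAt (𝓡 d) c (famPoint c ε x p') - (p - p')‖ ≤
      η * ‖p - p'‖ := by
  have hη : 0 ≤ η := (norm_nonneg _).trans (hgood p hp).2
  have h1 : ∀ q ∈ closedBall (0 : EuclideanSpace ℝ (Fin d)) ρ,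
      HasFDerivWithinAt (fun p => extChartAt (𝓡 d) c (famPoint c ε x p) - p)
        (coordDeriv g 0 c c ε x q - ContinuousLinearMap.id ℝ _) (closedBall 0 ρ) q := by
    intro q hq
    have h2 := hgood q (by simpa using hq)
    have h3 := hF.hasFDerivAt_coord (c' := c) g 0 h2.1 (hF.famPoint_mem_source h2.1)
    exact (h3.sub (hasFDerivAt_id q)).hasFDerivWithinAt
  have h4 := (convex_closedBall (0 : EuclideanSpace ℝ (Fin d)) ρ).norm_image_sub_le_of_norm_hasFDerivWithin_le
    h1 (fun q hq => ContinuousLinearMap.opNorm_le_bound _ hη fun h =>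
      hF.norm_coordDeriv_sub_le hx (hgood q (by simpa using hq)).2 h)
    (show p' ∈ closedBall 0 ρ by simpa using hp') (show p ∈ closedBall 0 ρ by simpa using hp)
  rw [sub_sub_sub_comm]
  exact h4

variable {X Y : Type*} [NormedAddCommGroup X] [InnerProductSpace ℝ X] [FiniteDimensional ℝ X]
  [NormedAddCommGroup Y] [InnerProductSpace ℝ Y] [FiniteDimensional ℝ Y]

open Metric in
-- In the chart, ψ is a graph followed by a map that is 1/2-close to the identity in C^1. The angle
-- bound makes the graph antilipschitz, whence ψ is an embedding and an immersion. Its unit tangent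
-- vectors differ from those of the stable space by less than the margin δ, so they lie in the
-- cones.
theorem ChartFamily.graph_disk (hF : ChartFamily c W ε O) {x : M} (hx : x ∈ W)
    {g : M ≃ₘ^1⟮𝓡 d, 𝓡 d⟯ M} {U : Set M} {Ca : ∀ x : M, Set (TangentSpace (𝓡 d) x)}
    (hCa : IsConeField U Ca) (hxU : x ∈ U) {ρ η r C K κ δ : ℝ} (hη1 : η ≤ 1 / 2)
    (hgood : ∀ p, ‖p‖ ≤ ρ → (extChartAt (𝓡 d) c x, p) ∈ O ∧
      ‖coordDeriv g 0 c c ε x p - coordDeriv g 0 c c ε x 0‖ ≤ η)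
    (hr : 0 < r) (hK0 : 0 ≤ K)
    (hK : ∀ v : TangentSpace (𝓡 d) x, ‖chartD c x v‖ ≤ K * ‖v‖)
    (hK' : ∀ h : EuclideanSpace ℝ (Fin d), ‖chartDInv c x h‖ ≤ K * ‖h‖)
    (iX : X →ₗ[ℝ] TangentSpace (𝓡 d) x) (iY : Y →ₗ[ℝ] TangentSpace (𝓡 d) x)
    (hX : ∀ a, ‖iX a‖ = ‖a‖) (hY : ∀ b, ‖iY b‖ = ‖b‖) (hC : 0 ≤ C)
    (hang : ∀ a b, ‖a‖ ≤ C * ‖iX a + iY b‖)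
    {φ : X → Y} (hφ : ContDiffOn ℝ 1 φ (ball 0 r)) (hφ0 : φ 0 = 0) (hφ1 : fderiv ℝ φ 0 = 0)
    (hφκ : ∀ v ∈ ball (0 : X) r, ‖fderiv ℝ φ v‖ ≤ κ)
    (hφρ : ∀ v ∈ ball (0 : X) r, ‖chartD c x (iX v + iY (φ v))‖ ≤ ρ)
    (hδ1 : 2 * ρ < δ) (hδ2 : η * (K * (1 + κ)) + K * κ < δ)
    (hcone : ∀ a, ‖a‖ = 1 → ∀ y ∈ (chartAt (EuclideanSpace ℝ (Fin d)) c).source,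
      ∀ w : TangentSpace (𝓡 d) y, ‖extChartAt (𝓡 d) c y - extChartAt (𝓡 d) c x‖ < δ →
      ‖chartD c y w - chartD c x (iX a)‖ < δ → (⟨y, w⟩ : TangentBundle (𝓡 d) M) ∈ coneSet U Ca)
    {ψ : X → M} (hψ : ∀ v ∈ ball (0 : X) r,
      ψ v = famPoint c ε x (chartD c x (iX v + iY (φ v)))) :
    ψ 0 = x ∧ ContMDiffOn 𝓘(ℝ, X) (𝓡 d) 1 ψ (ball 0 r) ∧ IsEmbedding ((ball 0 r).domRestrict ψ) ∧
      (∀ v ∈ ball (0 : X) r, Function.Injective (mfderiv 𝓘(ℝ, X) (𝓡 d) ψ v) ∧ ψ v ∈ U ∧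
        Set.range (mfderiv 𝓘(ℝ, X) (𝓡 d) ψ v) ⊆ Ca (ψ v)) ∧
      ∀ w : X, (⟨ψ 0, mfderiv 𝓘(ℝ, X) (𝓡 d) ψ 0 w⟩ : TangentBundle (𝓡 d) M) = ⟨x, iX w⟩ := by
  let LX : X →L[ℝ] EuclideanSpace ℝ (Fin d) := (chartD c x).comp (LinearMap.toContinuousLinearMap iX)
  let LY : Y →L[ℝ] EuclideanSpace ℝ (Fin d) := (chartD c x).comp (LinearMap.toContinuousLinearMap iY)
  set P : X → EuclideanSpace ℝ (Fin d) := fun v => LX v + LY (φ v) with hP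
  have hPe : ∀ v, P v = chartD c x (iX v + iY (φ v)) := fun v =>
    (map_add (chartD c x) (iX v) (iY (φ v))).symm
  let DP : X → (X →L[ℝ] EuclideanSpace ℝ (Fin d)) := fun v => LX + LY.comp (fderiv ℝ φ v)
  have hDPe : ∀ v h, DP v h = chartD c x (iX h + iY (fderiv ℝ φ v h)) :=
    fun v h => (map_add (chartD c x) (iX h) (iY (fderiv ℝ φ v h))).symm
  have hPρ : ∀ v ∈ ball (0 : X) r, ‖P v‖ ≤ ρ := fun v hv => by rw [hPe]; exact hφρ v hv
  have h0 : (0 : X) ∈ ball (0 : X) r := mem_ball_self hr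
  have hP0 : P 0 = 0 := by simp [hP, hφ0]
  have hρ0 : ‖(0 : EuclideanSpace ℝ (Fin d))‖ ≤ ρ := hP0 ▸ hPρ 0 h0
  have hη0 : 0 ≤ η := (norm_nonneg _).trans (hgood 0 hρ0).2
  have hφd : ∀ v ∈ ball (0 : X) r, HasFDerivAt φ (fderiv ℝ φ v) v := fun v hv =>
    ((hφ.differentiableOn one_ne_zero).differentiableAt (isOpen_ball.mem_nhds hv)).hasFDerivAt
  have hPd : ∀ v ∈ ball (0 : X) r, HasFDerivAt P (DP v) v := fun v hv =>
    LX.hasFDerivAt.add (LY.hasFDerivAt.comp v (hφd v hv))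
  have hPc : ContDiffOn ℝ 1 P (ball 0 r) :=
    LX.contDiff.contDiffOn.add (LY.contDiff.comp_contDiffOn hφ)
  have hψP : ∀ v ∈ ball (0 : X) r, ψ v = famPoint c ε x (P v) := fun v hv => by
    rw [hPe]; exact hψ v hv
  have hO : ∀ v ∈ ball (0 : X) r, (extChartAt (𝓡 d) c x, P v) ∈ O := fun v hv =>
    (hgood _ (hPρ v hv)).1
  have hsrc : ∀ v ∈ ball (0 : X) r, ψ v ∈ (chartAt (EuclideanSpace ℝ (Fin d)) c).source :=
    fun v hv => by rw [hψP v hv]; exact hF.famPoint_mem_source (hO v hv)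
  have hchart : ∀ v : TangentSpace (𝓡 d) x, ‖v‖ ≤ K * ‖chartD c x v‖ := fun v => by
    have := hK' (chartD c x v)
    rwa [chartDInv_chartD (hF.subset hx)] at this
  have hψd : ∀ v ∈ ball (0 : X) r, ∀ h : X, (⟨ψ v, mfderiv 𝓘(ℝ, X) (𝓡 d) ψ v h⟩ :
      TangentBundle (𝓡 d) M) = ⟨famPoint c ε x (P v), famDeriv c ε x (P v) (DP v h)⟩ := by
    intro v hv h
    have h1 : HasMFDerivAt 𝓘(ℝ, X) (𝓡 d) (famPoint c ε x ∘ P) v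
        ((famDeriv c ε x (P v)).comp (DP v)) :=
      (hF.hasMFDerivAt_famPoint (hO v hv)).comp v (hPd v hv).hasMFDerivAt
    have h2 : ψ =ᶠ[𝓝 v] famPoint c ε x ∘ P :=
      eventually_of_mem (isOpen_ball.mem_nhds hv) hψP
    have h3 := (h1.congr_of_eventuallyEq h2).mfderiv
    rw [h3]
    have key : ∀ y : M, y = famPoint c ε x (P v) → ∀ w : EuclideanSpace ℝ (Fin d),
        (⟨y, w⟩ : TangentBundle (𝓡 d) M) = ⟨famPoint c ε x (P v), w⟩ := by
      rintro y rfl w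
      rfl
    exact key _ (hψP v hv) _
  have hcd : ∀ v ∈ ball (0 : X) r, ∀ h : X, chartD c (ψ v) (mfderiv 𝓘(ℝ, X) (𝓡 d) ψ v h) =
      coordDeriv g 0 c c ε x (P v) (DP v h) := by
    intro v hv h
    rw [coordDeriv_zero_iterate]
    exact congrArg (fun q : TangentBundle (𝓡 d) M => chartD c q.proj q.snd) (hψd v hv h)
  have hclose : ∀ v ∈ ball (0 : X) r, ∀ h : X,
      ‖chartD c (ψ v) (mfderiv 𝓘(ℝ, X) (𝓡 d) ψ v h) - DP v h‖ ≤ η * ‖DP v h‖ := by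
    intro v hv h
    rw [hcd v hv]
    exact hF.norm_coordDeriv_sub_le hx (hgood _ (hPρ v hv)).2 _
  have hψ0 : ψ 0 = x := by rw [hψP 0 h0, hP0, hF.famPoint_zero hx]
  have hanti : ∀ v ∈ ball (0 : X) r, ∀ v' ∈ ball (0 : X) r,
      dist v v' ≤ C * K * 2 * ‖extChartAt (𝓡 d) c (ψ v) - extChartAt (𝓡 d) c (ψ v')‖ := by
    intro v hv v' hv'
    have h1 := hF.norm_extChartAt_famPoint_sub hx hgood (hPρ v hv) (hPρ v' hv')
    rw [← hψP v hv, ← hψP v' hv'] at h1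
    have h2 : ‖P v - P v'‖ ≤ 2 * ‖extChartAt (𝓡 d) c (ψ v) - extChartAt (𝓡 d) c (ψ v')‖ := by
      have h3 := norm_sub_norm_le (P v - P v')
        (extChartAt (𝓡 d) c (ψ v) - extChartAt (𝓡 d) c (ψ v'))
      rw [norm_sub_rev (P v - P v')] at h3
      have h4 := mul_le_mul_of_nonneg_right hη1 (norm_nonneg (P v - P v'))
      linarith
    have h5 : P v - P v' = chartD c x (iX (v - v') + iY (φ v - φ v')) := by
      rw [hPe, hPe, map_sub iX, map_sub iY, ← add_sub_add_comm]
      exact ((chartD c x).map_sub _ _).symm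
    rw [dist_eq_norm]
    calc ‖v - v'‖ ≤ C * ‖iX (v - v') + iY (φ v - φ v')‖ := hang _ _
      _ ≤ C * (K * ‖P v - P v'‖) := by
        rw [h5]; exact mul_le_mul_of_nonneg_left (hchart _) hC
      _ ≤ C * (K * (2 * ‖extChartAt (𝓡 d) c (ψ v) - extChartAt (𝓡 d) c (ψ v')‖)) := by gcongr
      _ = _ := by ring
  have hsm : ContMDiffOn 𝓘(ℝ, X) (𝓡 d) 1 ψ (ball 0 r) := by
    refine ContMDiffOn.congr (f := famPoint c ε x ∘ P) (fun v hv => ?_) hψP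
    exact (hF.contMDiffAt_famPoint (hO v hv)).comp_contMDiffWithinAt v
      (hPc.contMDiffOn v hv)
  have hunit : ∀ v ∈ ball (0 : X) r, ∀ h : X, ‖h‖ = 1 →
      (⟨ψ v, mfderiv 𝓘(ℝ, X) (𝓡 d) ψ v h⟩ : TangentBundle (𝓡 d) M) ∈ coneSet U Ca := by
    intro v hv h hh
    have hDφ : ‖fderiv ℝ φ v h‖ ≤ κ := by
      simpa [hh] using ContinuousLinearMap.le_of_opNorm_le _ (hφκ v hv) h
    refine hcone h hh _ (hsrc v hv) _ ?_ ?_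
    · have h1 := hF.norm_extChartAt_famPoint_sub hx hgood (hPρ v hv) hρ0
      rw [hF.famPoint_zero hx, ← hψP v hv, sub_zero] at h1
      have h2 := norm_sub_norm_le (extChartAt (𝓡 d) c (ψ v) - extChartAt (𝓡 d) c x) (P v)
      have h3 := hPρ v hv
      have h4 := mul_le_mul_of_nonneg_right hη1 (norm_nonneg (P v))
      linarith [norm_nonneg (P v)]
    -- Two errors are added: the parametrization against the identity, and the slope κ of the graph.
    · have h1 := hclose v hv h
      have h2 : DP v h - chartD c x (iX h) = chartD c x (iY (fderiv ℝ φ v h)) := by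
        rw [hDPe, map_add, add_sub_cancel_left]
      have h3 : ‖chartD c x (iY (fderiv ℝ φ v h))‖ ≤ K * κ :=
        (hK _).trans (by rw [hY]; exact mul_le_mul_of_nonneg_left hDφ hK0)
      have h4 : ‖DP v h‖ ≤ K * (1 + κ) := by
        rw [hDPe]
        refine (hK _).trans (mul_le_mul_of_nonneg_left ((norm_add_le _ _).trans ?_) hK0)
        rw [hX, hY, hh]
        linarith
      calc _ = ‖(chartD c (ψ v) (mfderiv 𝓘(ℝ, X) (𝓡 d) ψ v h) - DP v h) +
            (DP v h - chartD c x (iX h))‖ := by rw [sub_add_sub_cancel]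
        _ ≤ η * (K * (1 + κ)) + K * κ := by
          refine (norm_add_le _ _).trans (add_le_add (h1.trans ?_) (by rw [h2]; exact h3))
          exact mul_le_mul_of_nonneg_left h4 hη0
        _ < δ := hδ2
  have hψU : ∀ v ∈ ball (0 : X) r, ψ v ∈ U := by
    intro v hv
    rcases eq_or_ne v 0 with rfl | hv0
    · rwa [hψ0]
    · exact (hunit v hv (‖v‖⁻¹ • v) (norm_smul_inv_norm hv0)).1
  refine ⟨hψ0, hsm, isEmbedding_of_chart hsm.continuousOn hsrc hanti fun v hv v' hv' he => ?_,
    fun v hv => ⟨?_, hψU v hv, ?_⟩, fun w => ?_⟩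
  · have := hanti v hv v' hv'
    rw [he, sub_self, norm_zero, mul_zero] at this
    exact dist_le_zero.1 this
  · refine (injective_iff_map_eq_zero _).2 fun (h : X) hh => ?_
    have h1 := hclose v hv h
    rw [hh, map_zero, zero_sub, norm_neg] at h1
    have h2 : ‖DP v h‖ ≤ 0 := by
      have h4 := mul_le_mul_of_nonneg_right hη1 (norm_nonneg (DP v h))
      linarith
    have h3 : ‖iX h + iY (fderiv ℝ φ v h)‖ ≤ K * ‖DP v h‖ := by
      rw [hDPe]; exact hchart _
    have h5 := hang h (fderiv ℝ φ v h)
    have h6 : ‖iX h + iY (fderiv ℝ φ v h)‖ ≤ 0 :=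
      h3.trans (mul_nonpos_of_nonneg_of_nonpos hK0 h2)
    have h7 : (h : X) = 0 := norm_le_zero_iff.1 (h5.trans (mul_nonpos_of_nonneg_of_nonpos hC h6))
    exact h7
  · rintro _ ⟨(h : X), rfl⟩
    rcases eq_or_ne h 0 with rfl | hh
    · have h1 : mfderiv 𝓘(ℝ, X) (𝓡 d) ψ v (0 : X) = 0 := (mfderiv 𝓘(ℝ, X) (𝓡 d) ψ v).map_zero
      rw [h1]
      exact hCa.zero_mem _ (hψU v hv)
    · have h1 := hCa.smul_mem _ (hψU v hv) ‖h‖ _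
        (hunit v hv (‖h‖⁻¹ • h) (norm_smul_inv_norm hh)).2
      have h2 : ‖h‖ • mfderiv 𝓘(ℝ, X) (𝓡 d) ψ v (‖h‖⁻¹ • h) = mfderiv 𝓘(ℝ, X) (𝓡 d) ψ v h := by
        have h3 : ‖h‖ • (‖h‖⁻¹ • h) = h := smul_inv_smul₀ (norm_ne_zero_iff.2 hh) h
        have h4 := (mfderiv 𝓘(ℝ, X) (𝓡 d) ψ v).map_smul ‖h‖ (‖h‖⁻¹ • h)
        rw [← h4]
        exact congrArg _ h3
      rw [← h2]
      exact h1
  · rw [hψd 0 h0 w]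
    have h1 : DP 0 w = chartD c x (iX w) := by
      rw [hDPe, hφ1, zero_apply, map_zero, add_zero]
    have h2 := hF.famTangent_zero hx (chartD c x (iX w))
    rw [chartDInv_chartD (hF.subset hx)] at h2
    rw [hP0, h1]
    exact h2

end GraphDisk

/-! ### Stable disks for a single diffeomorphism -/

section StableDisk

variable {d : ℕ} {M : Type*} [MetricSpace M] [CompactSpace M]
  [ChartedSpace (EuclideanSpace ℝ (Fin d)) M] [IsManifold (𝓡 d) ∞ M]
  [RiemannianBundle (fun x : M => TangentSpace (𝓡 d) x)]
  [IsContMDiffRiemannianBundle (𝓡 d) ∞ (EuclideanSpace ℝ (Fin d))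
      (fun x : M => TangentSpace (𝓡 d) x)]
  [IsRiemannianManifold (𝓡 d) M]

namespace ParamAtlas

theorem GoodScale.mem {A : ParamAtlas d M} {g : M ≃ₘ^1⟮𝓡 d, 𝓡 d⟯ M} {N : ℕ} {η ρ : ℝ}
    (h : A.GoodScale g N η ρ) (b : Bool) {c : M} (hc : c ∈ A.centers) {x : M} (hx : x ∈ A.W c)
    {p : EuclideanSpace ℝ (Fin d)} (hp : ‖p‖ ≤ ρ) : (extChartAt (𝓡 d) c x, p) ∈ A.O b c :=
  (h b c hc _ (A.ctr_mem _) x hx (A.mem_W _) p hp).1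

/-- At multiples of N the coordinates halve; in between, the iterates of order below N are uniformly
Lipschitz. This gives the rate (log 2)/N. The Lipschitz constant may depend on g, since the limsup
does not see it. -/
theorem GoodScale.mem_stableSet {A : ParamAtlas d M} {g : M ≃ₘ^1⟮𝓡 d, 𝓡 d⟯ M} {N : ℕ} {η ρ : ℝ}
    (h : A.GoodScale g N η ρ) (hN : 0 < N) {x y : M} {R : ℝ} (hR : R ≤ ρ)
    {flag : ℕ → Bool} {p : ℕ → EuclideanSpace ℝ (Fin d)} (hp : ∀ k, ‖p k‖ ≤ R * (1 / 2) ^ k)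
    (hy : ∀ k, famPoint (A.ctr (orbitSeq g^[N] x k)) (A.ε (flag k) (A.ctr (orbitSeq g^[N] x k)))
      (orbitSeq g^[N] x k) (p k) = orbitSeq g^[N] y k) : y ∈ stableSet g x := by
  have hR0 : 0 ≤ R := by simpa using (norm_nonneg _).trans (hp 0)
  have h1 : ∀ᶠ K : ℝ in atTop, ∀ j ∈ Finset.range N, ∀ b, ∀ c ∈ A.centers, ∀ x ∈ A.W c,
      ∀ p, ‖p‖ ≤ ρ → ∀ v, ‖((tangentCMap g)^[j] (famTangent c (A.ε b c) x p v)).snd‖ ≤ K * ‖v‖ := by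
    refine (Filter.eventually_all_finset _).2 fun j _ => eventually_all.2 fun b =>
      (Filter.eventually_all_finset _).2 fun c hc => ?_
    exact (A.family b c hc).eventually_norm_le g j fun x hx p hp => h.mem b hc hx hp
  obtain ⟨K, hK, hK0⟩ := (h1.and (eventually_ge_atTop 0)).exists
  have hN' : (0 : ℝ) < N := Nat.cast_pos.2 hN
  refine mem_stableSet_of_edist_le (A := K * R * 2) (a := Real.log 2 / N)
    (div_pos (Real.log_pos one_lt_two) hN') fun n => ?_
  set k := n / N
  have hpk : ‖p k‖ ≤ ρ := (hp k).trans
    ((mul_le_of_le_one_right hR0 (pow_le_one₀ (by norm_num) (by norm_num))).trans hR)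
  have h2 := (A.family (flag k) _ (A.ctr_mem (orbitSeq g^[N] x k))).edist_iterate_le g (n % N)
    (A.mem_W _) (fun p hp => h.mem _ (A.ctr_mem _) (A.mem_W _) hp)
    (fun p hp => hK _ (Finset.mem_range.2 (Nat.mod_lt n hN)) (flag k) _ (A.ctr_mem _) _ (A.mem_W _)
      p hp) hpk
  rw [hy k, orbitSeq_iterate, orbitSeq_iterate, ← Function.iterate_add_apply,
    ← Function.iterate_add_apply, Nat.mod_add_div] at h2
  refine h2.trans (ENNReal.ofReal_le_ofReal ?_)
  -- The factor 2 accounts for the incomplete last block: n ≤ N(k+1), not Nk.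
  have h3 : ((1 : ℝ) / 2) ^ k ≤ 2 * Real.exp (-(Real.log 2 / N * n)) := by
    have h4 : (n : ℝ) ≤ N * (k + 1) := by
      exact_mod_cast (Nat.lt_mul_div_succ n hN).le
    have h5 : Real.log 2 / N * n ≤ (k + 1 : ℕ) * Real.log 2 := by
      rw [div_mul_eq_mul_div, div_le_iff₀ hN']
      push_cast
      calc Real.log 2 * n ≤ Real.log 2 * (N * (k + 1)) :=
            mul_le_mul_of_nonneg_left h4 (Real.log_pos one_lt_two).le
        _ = _ := by ring
    have h6 := Real.exp_le_exp.2 (neg_le_neg h5)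
    rw [Real.exp_neg, Real.exp_nat_mul, Real.exp_log two_pos] at h6
    calc ((1 : ℝ) / 2) ^ k = 2 * (2 ^ (k + 1))⁻¹ := by
          rw [one_div, inv_pow, pow_succ, mul_inv]; ring
      _ ≤ _ := mul_le_mul_of_nonneg_left h6 zero_le_two
  calc K * ‖p k‖ ≤ K * (R * (2 * Real.exp (-(Real.log 2 / N * n)))) :=
        mul_le_mul_of_nonneg_left ((hp k).trans (mul_le_mul_of_nonneg_left h3 hR0)) hK0
    _ = _ := by ring

end ParamAtlas

open Metric in
-- With X and Y the summands at x and exponential coordinates at time 0, the graph function φ is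
-- literally the one in the definition of a center-stable disk.
theorem AdaptedSplitting.exists_centerStableDisk {g : M ≃ₘ^1⟮𝓡 d, 𝓡 d⟯ M} {S U : Set M}
    {Ecu Ecs : ∀ x : M, Submodule ℝ (TangentSpace (𝓡 d) x)}
    {Ca : ∀ x : M, Set (TangentSpace (𝓡 d) x)} {C : ℝ} {n₀ : ℕ}
    (H : AdaptedSplitting g S U Ecu Ecs Ca C n₀) (hCa : IsConeField U Ca)
    (A : ParamAtlas d M) {l q : ℕ} (hl : 1 ≤ l)
    (hq : 1 ≤ q) (hN : n₀ ≤ l * q) {c₀ c₂ η η₀ ρ ρ' K δ : ℝ} (hc₀ : 0 < c₀) (hc₀1 : c₀ ≤ 1 / 3)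
    (hlow : ∀ (x : M) (v : TangentSpace (𝓡 d) x),
      2 * c₀ * ‖v‖ ≤ ‖mfderiv (𝓡 d) (𝓡 d) g^[l * q] x v‖)
    (hc₂0 : 0 ≤ c₂) (hc₂ : c₂ ≤ 1 / 20) (hC : 0 ≤ C) (hK1 : 1 ≤ K)
    (hK : ∀ x : M, (∀ v : TangentSpace (𝓡 d) x, ‖chartD (A.ctr x) x v‖ ≤ K * ‖v‖) ∧
      ∀ h : EuclideanSpace ℝ (Fin d), ‖chartDInv (A.ctr x) x h‖ ≤ K * ‖h‖)
    (hgood : A.GoodScale g (l * q) η ρ') (hgood₀ : A.GoodScale g 0 η₀ ρ')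
    (hρ : 0 < ρ) (hρ' : 2 * K * ρ ≤ ρ')
    (hη : C * K * η * (2 * K) ≤ c₀ * c₂) (hη₀ : η₀ ≤ 1 / 2) (hδ1 : 2 * (2 * K * ρ) < δ)
    (hδ2 : η₀ * (K * (1 + 20 * c₂)) + K * (20 * c₂) < δ)
    (hcone : ∀ c ∈ A.centers, ∀ x ∈ A.W c, x ∈ S → ∀ v : TangentSpace (𝓡 d) x,
        (⟨x, v⟩ : TangentBundle (𝓡 d) M) ∈ DomPesin.allTime g U Ca → ‖v‖ = 1 →
        ∀ y ∈ (chartAt (EuclideanSpace ℝ (Fin d)) c).source, ∀ w : TangentSpace (𝓡 d) y,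
        ‖extChartAt (𝓡 d) c y - extChartAt (𝓡 d) c x‖ < δ → ‖chartD c y w - chartD c x v‖ < δ →
        (⟨y, w⟩ : TangentBundle (𝓡 d) M) ∈ coneSet U Ca)
    {x : M} (hx : x ∈ stableBlock g S Ecs l) :
    ∃ D : Set M, IsCenterStableDisk U Ca Ecu Ecs x (ρ / 5) D ∧ D ⊆ stableSet g x := by
  obtain ⟨φ, h1, h2, h3, h4⟩ := H.exists_orbit_graph A hq hN hc₀ hc₀1 hlow hc₂0 hc₂ hC hK1 hK hgood
    hρ hρ' hη hx (Ecs x).subtype (Ecu x).subtype (fun _ => rfl) (fun _ => rfl) (fun a => a.2)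
    (fun b => b.2) rfl rfl
  have hP : ∀ v ∈ ball (0 : Ecs x) (ρ / 5),
      ‖chartD (A.ctr x) x ((Ecs x).subtype v + (Ecu x).subtype (φ v))‖ ≤ 2 * K * ρ := by
    intro v hv
    obtain ⟨-, p, hp0, hp1, -⟩ := h4 v hv
    have := hp1 0
    rwa [hp0, pow_zero, mul_one] at this
  have hψ : ∀ v ∈ ball (0 : Ecs x) (ρ / 5),
      expMap x ((v : TangentSpace (𝓡 d) x) + (φ v : TangentSpace (𝓡 d) x)) =
        famPoint (A.ctr x) (A.ε true (A.ctr x)) x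
          (chartD (A.ctr x) x ((Ecs x).subtype v + (Ecu x).subtype (φ v))) := by
    intro v hv
    rw [← A.exp_eq _ (A.ctr_mem x) x (A.mem_W x) _ (hgood.mem true (A.ctr_mem x) (A.mem_W x)
      ((hP v hv).trans hρ')), chartDInv_chartD (A.ctr_source x)]
    rfl
  obtain ⟨r1, r2, r3, r4, r5⟩ := (A.family true _ (A.ctr_mem x)).graph_disk (A.mem_W x) (g := g)
    hCa (H.subset hx.1) hη₀ (fun p hp => by
      have h5 := hgood₀ true _ (A.ctr_mem x) _ (A.ctr_mem x) x (A.mem_W x) (A.mem_W x) p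
        (hp.trans hρ')
      exact ⟨h5.1, h5.2.2⟩)
    (by positivity : 0 < ρ / 5) (zero_le_one.trans hK1) (hK x).1 (hK x).2
    (Ecs x).subtype (Ecu x).subtype (fun _ => rfl) (fun _ => rfl) hC
    (fun a b => (H.angle x hx.1 a a.2 b b.2).1) h2 h1 h3 (fun v hv => (h4 v hv).1) hP hδ1 hδ2
    (fun a ha => hcone _ (A.ctr_mem x) x (A.mem_W x) hx.1 a (H.allTime x hx.1 a a.2) ha) hψ
  refine ⟨_, ⟨φ, _, fun v => rfl, rfl, h2, h1, r1, r2, r3, r4, congrArg Set.range (funext r5)⟩, ?_⟩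
  rintro _ ⟨v, hv, rfl⟩
  obtain ⟨-, p, hp0, hp1, hp2⟩ := h4 v hv
  refine hgood.mem_stableSet (Nat.mul_pos hl hq) hρ' hp1 (flag := startFlag) fun k => ?_
  beta_reduce
  rw [hψ v hv, ← hp0]
  exact hp2 k

end StableDisk

/-! ### Uniform constants for all nearby diffeomorphisms -/

section StableManifold

variable {d : ℕ} {M : Type*} [MetricSpace M] [CompactSpace M]
  [ChartedSpace (EuclideanSpace ℝ (Fin d)) M] [IsManifold (𝓡 d) ∞ M]
  [RiemannianBundle (fun x : M => TangentSpace (𝓡 d) x)]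
  [IsContMDiffRiemannianBundle (𝓡 d) ∞ (EuclideanSpace ℝ (Fin d))
      (fun x : M => TangentSpace (𝓡 d) x)]

/-- By invariance, the vectors of a splitting inside the cones stay in the cones for all time. The
angle and domination constants therefore come from the cones and are the same for every such
splitting. -/
theorem Adapted.adaptedSplitting {g : M ≃ₘ^1⟮𝓡 d, 𝓡 d⟯ M} {U V S : Set M}
    {Ccs Ccu : ∀ x : M, Set (TangentSpace (𝓡 d) x)} {C : ℝ} {n₀ : ℕ}
    (H : Adapted g U V Ccs Ccu C n₀) (hS : ∀ x ∈ S, g x ∈ S) (hS' : ∀ x ∈ S, g.symm x ∈ S)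
    (hSV : S ⊆ maxInvariant g V) {Ecu Ecs : ∀ x : M, Submodule ℝ (TangentSpace (𝓡 d) x)}
    (hE : IsDominatedSplitting g S Ecu Ecs) (hsub : Subordinate S Ecu Ecs Ccu Ccs) :
    AdaptedSplitting g S U Ecu Ecs Ccs C n₀ := by
  have hSU : S ⊆ U := hSV.trans ((maxInvariant_subset g V).trans H.subset)
  have h1 : ∀ x ∈ S, ∀ v ∈ Ecs x, (⟨x, v⟩ : TangentBundle (𝓡 d) M) ∈ allTime g U Ccs := by
    intro x hx v hv k
    rw [tangentCMap_iterate]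
    have hk : g^[k] x ∈ S := iterate_mem_of_forall hS hx k
    exact ⟨hSU hk, (hsub _ hk).2 (iterate_mem_of_map hS hE.map_cs hx k hv)⟩
  have h2 : ∀ x ∈ S, ∀ v ∈ Ecu x, (⟨x, v⟩ : TangentBundle (𝓡 d) M) ∈ allTime g.symm U Ccu := by
    intro x hx v hv k
    have h3 : ∀ k, (tangentCMap g.symm)^[k] ⟨x, v⟩ ∈ subSet S Ecu := by
      intro k
      induction k with
      | zero => exact ⟨hx, hv⟩
      | succ k ih =>
        rw [Function.iterate_succ_apply']
        exact tangentCMap_symm_mem_subSet hS' hE.map_cu ih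
    exact ⟨hSU (h3 k).1, (hsub _ (h3 k).1).1 (h3 k).2⟩
  refine ⟨hS, hSU, hE.isCompl, hE.map_cu, hE.map_cs, h1,
    fun x hx v hv w hw => H.angle x v w (hSV hx) (h1 x hx v hv) (h2 x hx w hw),
    fun m hm x hx v hv w hw => ?_⟩
  have h3 := H.dom m hm x v w (hSV hx) (h1 x hx v hv) (h2 x hx w hw)
  rw [tangentCMap_iterate, tangentCMap_iterate] at h3
  exact h3

theorem pow_mul_le_norm_iterate {g : M ≃ₘ^1⟮𝓡 d, 𝓡 d⟯ M} {c : ℝ} (hc : 0 ≤ c)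
    (h : ∀ p : TangentBundle (𝓡 d) M, c * ‖p.snd‖ ≤ ‖(tangentCMap g p).snd‖) (n : ℕ)
    (p : TangentBundle (𝓡 d) M) : c ^ n * ‖p.snd‖ ≤ ‖((tangentCMap g)^[n] p).snd‖ := by
  induction n with
  | zero => rw [pow_zero, one_mul]; exact le_rfl
  | succ n ih =>
    rw [Function.iterate_succ_apply']
    refine le_trans ?_ (h _)
    rw [pow_succ', mul_assoc]
    exact mul_le_mul_of_nonneg_left ih hc

variable [IsRiemannianManifold (𝓡 d) M]

/-- The stable disks of the blocks have a uniform size, for all nearby diffeomorphisms. -/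
theorem eventually_exists_centerStableDisk (f : M ≃ₘ^1⟮𝓡 d, 𝓡 d⟯ M) (A : ParamAtlas d M) {U : Set M}
    {Ca : ∀ x : M, Set (TangentSpace (𝓡 d) x)} (hCa : IsConeField U Ca) {C δ : ℝ} (hC : 0 ≤ C)
    (hδ : 0 < δ) {n₀ l : ℕ} (hn₀ : 1 ≤ n₀) (hl : 1 ≤ l) :
    ∃ r : ℝ, 0 < r ∧ ∀ᶠ g : M ≃ₘ^1⟮𝓡 d, 𝓡 d⟯ M in c1Nhds f, ∀ (S : Set M)
      (Ecu Ecs : ∀ x : M, Submodule ℝ (TangentSpace (𝓡 d) x)),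
      AdaptedSplitting g S U Ecu Ecs Ca C n₀ →
      (∀ c ∈ A.centers, ∀ x ∈ A.W c, x ∈ S → ∀ v : TangentSpace (𝓡 d) x,
        (⟨x, v⟩ : TangentBundle (𝓡 d) M) ∈ allTime g U Ca → ‖v‖ = 1 →
        ∀ y ∈ (chartAt (EuclideanSpace ℝ (Fin d)) c).source, ∀ w : TangentSpace (𝓡 d) y,
        ‖extChartAt (𝓡 d) c y - extChartAt (𝓡 d) c x‖ < δ → ‖chartD c y w - chartD c x v‖ < δ →
        (⟨y, w⟩ : TangentBundle (𝓡 d) M) ∈ coneSet U Ca) →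
      ∀ x ∈ stableBlock g S Ecs l, ∃ D : Set M, IsCenterStableDisk U Ca Ecu Ecs x r D ∧
        D ⊆ stableSet g x := by
  obtain ⟨K, hK1, hK⟩ := A.exists_norm_bound
  obtain ⟨a, ha, hag⟩ := eventually_le_norm_tangentCMap f
  have hK0 : 0 < K := zero_lt_one.trans_le hK1
  -- The time step is N = l n₀: a multiple of l, to use the block condition, and at least n₀, to
  -- have domination. Since Dg expands vectors by at least the factor a, 2c₀ bounds the expansion of
  -- Dg^N from below.
  set c₀ := min (a ^ (l * n₀) / 2) (1 / 3) with hc₀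
  have hc₀0 : 0 < c₀ := lt_min (by positivity) (by norm_num)
  set c₂ := min (1 / 20) (δ / (80 * K)) with hc₂
  have hc₂0 : 0 < c₂ := lt_min (by norm_num) (by positivity)
  set η₀ := min (1 / 2) (δ / (8 * K)) with hη₀
  have hη₀0 : 0 < η₀ := lt_min (by norm_num) (by positivity)
  -- In frames an error η in charts is amplified by at most C K · 2K; the result must stay below
  -- c₀c₂.
  set η := c₀ * c₂ / (C * K * (2 * K) + 1) with hη
  have hη0 : 0 < η := by positivity
  -- Currying the product filter fixes one scale first, valid then for all g near f. Zero iterates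
  -- are included to control the exponential coordinates themselves.
  obtain ⟨ρ', hgood, hρ'⟩ := (((A.eventually_goodScale f (l * n₀) hη0).and
    (A.eventually_goodScale f 0 hη₀0)).curry.and self_mem_nhdsWithin).exists
  have hρ'0 : 0 < ρ' := hρ'
  -- Frames enlarge norms by at most 2K, so the coordinates stay within ρ', and the disk stays
  -- within the margin δ of x in the chart.
  set ρ := min (ρ' / (2 * K)) (δ / (8 * K)) with hρ
  have hρ0 : 0 < ρ := lt_min (by positivity) (by positivity)
  refine ⟨ρ / 5, by positivity, ?_⟩
  filter_upwards [hgood, hag] with g hg hga S Ecu Ecs H hcone x hx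
  refine H.exists_centerStableDisk hCa A hl hn₀ (Nat.le_mul_of_pos_left n₀ hl) hc₀0
    (min_le_right _ _) (fun x v => ?_) hc₂0.le (min_le_left _ _) hC hK1 hK hg.1 hg.2 hρ0 ?_ ?_
    (min_le_left _ _) ?_ ?_ hcone hx
  · have h1 := pow_mul_le_norm_iterate ha.le hga (l * n₀) ⟨x, v⟩
    rw [tangentCMap_iterate] at h1
    refine le_trans (mul_le_mul_of_nonneg_right ?_ (norm_nonneg v)) h1
    have := min_le_left (a ^ (l * n₀) / 2) (1 / 3)
    linarith
  · have h1 : ρ ≤ ρ' / (2 * K) := min_le_left _ _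
    rw [le_div_iff₀ (by positivity)] at h1
    linarith
  · have e1 : C * K * η * (2 * K) = c₀ * c₂ * (C * K * (2 * K) / (C * K * (2 * K) + 1)) := by
      rw [hη]; ring
    rw [e1]
    exact mul_le_of_le_one_right (by positivity) ((div_le_one (by positivity)).2 (by linarith))
  · have h1 : ρ ≤ δ / (8 * K) := min_le_right _ _
    rw [le_div_iff₀ (by positivity)] at h1
    linarith
  · have h1 : c₂ ≤ δ / (80 * K) := min_le_right _ _
    have h2 : η₀ ≤ δ / (8 * K) := min_le_right _ _
    have h3 : c₂ ≤ 1 / 20 := min_le_left _ _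
    rw [le_div_iff₀ (by positivity)] at h1 h2
    have h4 : η₀ * (K * (1 + 20 * c₂)) ≤ η₀ * (K * 2) := by
      gcongr
      linarith
    linarith

end StableManifold

end DomPesin
end

/-! ### The theorem -/

open DomPesin

theorem theoremt {d : ℕ} {M : Type*} [MetricSpace M] [CompactSpace M] [ConnectedSpace M]
    [ChartedSpace (EuclideanSpace ℝ (Fin d)) M] [IsManifold (𝓡 d) ∞ M]
    [RiemannianBundle (fun x : M => TangentSpace (𝓡 d) x)]
    [IsContMDiffRiemannianBundle (𝓡 d) ∞ (EuclideanSpace ℝ (Fin d))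
      (fun x : M => TangentSpace (𝓡 d) x)]
    [IsRiemannianManifold (𝓡 d) M]
    -- a `C^1` diffeomorphism with an invariant set and a dominated splitting over it
    (f : M ≃ₘ^1⟮𝓡 d, 𝓡 d⟯ M) (Λ : Set M) (hΛ : f '' Λ = Λ)
    (Ecu Ecs : ∀ x : M, Submodule ℝ (TangentSpace (𝓡 d) x))
    (hE : DomPesin.IsDominatedSplitting f Λ Ecu Ecs)
    -- strictly invariant cone fields around the splitting, over a neighbourhood of the closure
    (U : Set M) (hU : IsOpen U) (hΛU : closure Λ ⊆ U)
    (Ccu Ccs : ∀ x : M, Set (TangentSpace (𝓡 d) x))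
    (hCcu : DomPesin.IsConeField U Ccu) (hCcs : DomPesin.IsConeField U Ccs)
    (hinv : DomPesin.StrictlyInvariant f U Ccu Ccs)
    (hsub : DomPesin.Subordinate Λ Ecu Ecs Ccu Ccs)
    (htrans : DomPesin.ConesTransverse Λ Ecu Ecs Ccu Ccs) :
    ∃ V₀ : Set M, IsOpen V₀ ∧ closure Λ ⊆ V₀ ∧ V₀ ⊆ U ∧
      ∀ V : Set M, IsOpen V → closure Λ ⊆ V → V ⊆ V₀ →
      ∀ l : ℕ, 1 ≤ l → ∃ r : ℝ, 0 < r ∧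
        (∀ x ∈ DomPesin.stableBlock f Λ Ecs l,
          ∃ D : Set M, DomPesin.IsCenterStableDisk U Ccs Ecu Ecs x r D ∧
            D ⊆ DomPesin.stableSet f x) ∧
        ∀ᶠ g : M ≃ₘ^1⟮𝓡 d, 𝓡 d⟯ M in DomPesin.c1Nhds f,
          (∃ Ecu' Ecs' : ∀ x : M, Submodule ℝ (TangentSpace (𝓡 d) x),
            DomPesin.IsDominatedSplitting g (DomPesin.maxInvariant g V) Ecu' Ecs' ∧
            DomPesin.Subordinate (DomPesin.maxInvariant g V) Ecu' Ecs' Ccu Ccs) ∧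
          ∀ Ecu' Ecs' : ∀ x : M, Submodule ℝ (TangentSpace (𝓡 d) x),
            DomPesin.IsDominatedSplitting g (DomPesin.maxInvariant g V) Ecu' Ecs' →
            DomPesin.Subordinate (DomPesin.maxInvariant g V) Ecu' Ecs' Ccu Ccs →
            ∀ x ∈ DomPesin.stableBlock g (DomPesin.maxInvariant g V) Ecs' l,
              ∃ D : Set M, DomPesin.IsCenterStableDisk U Ccs Ecu' Ecs' x r D ∧
                D ⊆ DomPesin.stableSet g x := by

  obtain ⟨n₀, hn₀, H⟩ := exists_coneSplitting hΛ hE hU hΛU hCcu hCcs hinv hsub htrans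
  obtain ⟨C, hC, hev⟩ := H.eventually_exists_isCompl hn₀
  obtain ⟨A⟩ := exists_paramAtlas (d := d) (M := M)
  -- A cone margin in each of the finitely many charts; a common one is then extracted. Neither it
  -- nor the neighbourhood V₀ depends on l.
  have hcl : ∀ c ∈ A.centers, _ := fun c hc => H.exists_mem_coneSet_of_close
    (A.family false c hc).isCompact (A.family false c hc).subset
  choose! δ' hδ'0 hδ' using hcl
  obtain ⟨δ, hδ, hδ0⟩ : ∃ δ : ℝ, (∀ c ∈ A.centers, δ ≤ δ' c) ∧ 0 < δ := by
    have h1 : ∀ᶠ δ : ℝ in 𝓝[>] 0, ∀ c ∈ A.centers, δ ≤ δ' c :=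
      (Filter.eventually_all_finset _).2 fun c hc =>
        Filter.mem_of_superset (Ioc_mem_nhdsGT (hδ'0 c hc)) fun _ h => h.2
    exact (h1.and self_mem_nhdsWithin).exists
  obtain ⟨V₁, hV₁, hΛV₁, hgood⟩ := exists_open_of_eventually_near
    (hev.and ((Filter.eventually_all_finset _).2 hδ'))
  refine ⟨V₁ ∩ U, hV₁.inter hU, subset_inter hΛV₁ hΛU, inter_subset_right, ?_⟩
  intro V hV hΛV hVV l hl
  obtain ⟨r, hr, hdisk⟩ := eventually_exists_centerStableDisk f A hCcs hC hδ0 hn₀ hl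
  -- Stated for every invariant subset S of the maximal invariant set, so that it covers both Λ for
  -- f and the whole maximal invariant set for g, with the same r.
  have key : ∀ᶠ g : M ≃ₘ^1⟮𝓡 d, 𝓡 d⟯ M in c1Nhds f,
      (∃ Ecu' Ecs' : ∀ x : M, Submodule ℝ (TangentSpace (𝓡 d) x),
        IsDominatedSplitting g (maxInvariant g V) Ecu' Ecs' ∧
        Subordinate (maxInvariant g V) Ecu' Ecs' Ccu Ccs) ∧
      ∀ S ⊆ maxInvariant g V, (∀ x ∈ S, g x ∈ S) → (∀ x ∈ S, g.symm x ∈ S) →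
        ∀ Ecu' Ecs' : ∀ x : M, Submodule ℝ (TangentSpace (𝓡 d) x),
        IsDominatedSplitting g S Ecu' Ecs' → Subordinate S Ecu' Ecs' Ccu Ccs →
        ∀ x ∈ stableBlock g S Ecs' l,
          ∃ D : Set M, IsCenterStableDisk U Ccs Ecu' Ecs' x r D ∧ D ⊆ stableSet g x := by
    filter_upwards [hgood, hdisk] with g hg1 hg2
    obtain ⟨⟨h1, h2⟩, h3⟩ := hg1 V (hVV.trans inter_subset_left)
    refine ⟨h1.exists_dominatedSplitting hn₀ h2, fun S hSV hS hS' Ecu' Ecs' hE' hsub' =>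
      hg2 S Ecu' Ecs' (h1.adaptedSplitting hS hS' hSV hE' hsub') ?_⟩
    intro c hc x hx hxS v hv hv1 y hy w hyx hw
    exact h3 c hc x hx (maxInvariant_subset g V (hSV hxS)) v hv hv1 y hy w
      (hyx.trans_le (hδ c hc)) (hw.trans_le (hδ c hc))
  refine ⟨r, hr, ?_, key.mono fun g hg => ⟨hg.1, hg.2 _ subset_rfl
    (fun _ => map_mem_maxInvariant) fun _ => symm_mem_maxInvariant⟩⟩
  -- The diffeomorphism f lies in each of its own neighbourhoods, and Λ, being invariant and
  -- contained in V, lies in the maximal invariant set.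
  have hf := @Filter.Eventually.self_of_nhds _ c1Topology _ _ key
  exact hf.2 Λ (fun x hx n => ⟨hΛV (subset_closure (iterate_mem_of_forall H.mem hx n)),
    hΛV (subset_closure (iterate_mem_of_forall H.mem_symm hx n))⟩) H.mem H.mem_symm Ecu Ecs hE hsub
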